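/- Fix an integer $n\ge 2$. **Marked graphs and the spine.** Let $R_0$ be the rose with one vertex and $n$ edges. A graph here is a finite connected one-dimensional CW complex all of whose vertices have valence at least $3$. A marked graph $(\Gamma,g)$ is a graph $\Gamma$ with a homotopy equivalence $g:R_0\to\Gamma$, where $(\Gamma_1,g_1)$ and $(\Gamma_2,g_2)$ are identified if there is a graph isomorphism $h:\Gamma_1\to\Gamma_2$ with $h\circ g_1\simeq g_2$. Put $(\Gamma_1,g_1)\le(\Gamma_2,g_2)$ if $(\Gamma_1,g_1)$ is obtained from $(\Gamma_2,g_2)$ by collapsing each component of a subforest of $\Gamma_2$ to a point. Let $K_n$ be the simplicial complex whose vertices are the marked graphs and whose simplices are the nonempty finite chains for $\le$ (the spine of Outer space). **Ribbon structures.** A ribbon structure $\mathcal O$ on a graph $\Gamma$ is a cyclic ordering of the half edges at each vertex; $\mathcal O^{op}$ is obtained by reversing all of these cyclic orderings. A boundary cycle of $(\Gamma,\mathcal O)$ is a directed edge cycle in which each directed edge, on arriving at a vertex along a half edge $h$, is followed by the directed edge that leaves along the half edge directly following $h$ in the cyclic ordering. The oriented punctured surface $|\Gamma,\mathcal O|$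 is obtained by gluing a once punctured closed disk to $\Gamma$ along each boundary cycle; it is oriented so that a small positively oriented circle around a vertex meets the half edges there in the cyclic order $\mathcal O$. **Marked surfaces.** A marked surface $(\Sigma,s)$ consists of an oriented surface $\Sigma$, homeomorphic to the closed orientable surface of some genus $g\geq 0$ with $p>0$ points removed, where $2g+p-1=n$, and a homotopy equivalence $s:R_0\to\Sigma$. Write $(\Sigma_1,s_1)\sim_\pm(\Sigma_2,s_2)$ if there is a homeomorphism $h:\Sigma_1\to\Sigma_2$, not necessarily orientation preserving, with $h\circ s_1\simeq s_2$. A ribbon structure $\mathcal O$ on $\Gamma$ draws the marked graph $(\Gamma,g)$ in $(\Sigma,s)$ if there is an orientation preserving homeomorphism $k:|\Gamma,\mathcal O|\to\Sigma$ with $k\circ i\circ g\simeq s$, where $i:\Gamma\hookrightarrow|\Gamma,\mathcal O|$ is the inclusion. The ribbon graph subcomplex $\mathfrak R_{(\Sigma,s)}$ is the subcomplex of $K_n$ spanned by the marked graphs that can be drawn in $(\Sigma,s)$ by some ribbon structure. **Proposition.** Let $(\Sigma_1,s_1)$ and $(\Sigma_2,s_2)$ be marked surfaces. 1. $\mathfrak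 R_{(\Sigma_1,s_1)}=\mathfrak R_{(\Sigma_2,s_2)}$ if and only if $(\Sigma_1,s_1)\sim_\pm(\Sigma_2,s_2)$. 2. The cyclic ordering that a marked surface gives to a rose is determined, up to reversal, by the (non-ribbon) marked graphs in the link of the rose: if $\rho$ is a marked rose (a marked graph with one vertex) drawn in $(\Sigma_1,s_1)$ by $\mathcal O_1$ and in $(\Sigma_2,s_2)$ by $\mathcal O_2$, and the links of $\rho$ in $\mathfrak R_{(\Sigma_1,s_1)}$ and in $\mathfrak R_{(\Sigma_2,s_2)}$ have the same vertices, then $\mathcal O_1=\mathcal O_2$ or $\mathcal O_1=\mathcal O_2^{op}$. -/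

import Mathlib

universe u v

open scoped unitInterval NNReal Topology

noncomputable section

namespace RibbonCover

/-- A continuous map which is a homotopy equivalence. -/
def IsHomotopyEquivalence {X : Type*} {Y : Type*} [TopologicalSpace X] [TopologicalSpace Y]
    (f : C(X, Y)) : Prop :=
  ∃ e : ContinuousMap.HomotopyEquiv X Y, e.toFun = f

/-! ### Graphs and their topological realizations -/

/-- A combinatorial graph (loops and multiple edges allowed), given by its vertices, its half edges,
the involution interchanging the two half edges of an edge, and the vertex to which
a half edge is incident. A half edge `h` also stands for the edge containing it, directed so that
it starts at `root h` and ends at `root (flip h)`. -/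
structure Graph where
  V : Type
  H : Type
  flip : H → H
  flip_flip : ∀ h, flip (flip h) = h
  flip_ne : ∀ h, flip h ≠ h
  root : H → V

namespace Graph

/-- Vertices, together with one unit interval for every directed edge, before gluing. -/
abbrev PreSpace (Γ : Graph) : Type := ((_ : Γ.V) × Unit) ⊕ ((_ : Γ.H) × I)

/-- The point at time `x` on the directed edge `h`, before gluing. -/
abbrev prePt (Γ : Graph) (h : Γ.H) (x : I) : Γ.PreSpace := Sum.inr ⟨h, x⟩

/-- The two directions of an edge run over the same points, and a directed edge starts
at its root. -/
inductive Glue (Γ : Graph) : Γ.PreSpace → Γ.PreSpace → Prop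
  | reverse (h : Γ.H) (x : I) : Glue Γ (Γ.prePt h x) (Γ.prePt (Γ.flip h) (σ x))
  | start (h : Γ.H) : Glue Γ (Γ.prePt h 0) (Sum.inl ⟨Γ.root h, ()⟩)

/-- The one-dimensional CW complex of a graph, with the quotient topology. -/
def Space (Γ : Graph) : Type := Quot Γ.Glue

instance (Γ : Graph) : TopologicalSpace Γ.Space :=
  inferInstanceAs (TopologicalSpace (Quot Γ.Glue))

/-- The point of the realization given by a vertex. -/
def vertexPt (Γ : Graph) (w : Γ.V) : Γ.Space := Quot.mk _ (Sum.inl ⟨w, ()⟩)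

/-- The point of the realization at time `x` on the directed edge `h`. -/
def edgePt (Γ : Graph) (h : Γ.H) (x : I) : Γ.Space := Quot.mk _ (Γ.prePt h x)

theorem edgePt_flip (Γ : Graph) (h : Γ.H) (x : I) :
    Γ.edgePt (Γ.flip h) (σ x) = Γ.edgePt h x := (Quot.sound (Glue.reverse h x)).symm

theorem edgePt_zero (Γ : Graph) (h : Γ.H) : Γ.edgePt h 0 = Γ.vertexPt (Γ.root h) :=
  Quot.sound (Glue.start h)

theorem continuous_edgePt (Γ : Graph) (h : Γ.H) : Continuous (Γ.edgePt h) :=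
  continuous_quot_mk.comp (continuous_inr.comp continuous_sigmaMk)

/-- A continuous map out of the realization, from its values on vertices and directed edges. -/
def lift {Y : Type*} [TopologicalSpace Y] (Γ : Graph) (f : Γ.V → Y) (k : Γ.H → I → Y)
    (hk : ∀ h, Continuous (k h)) (hrev : ∀ h x, k (Γ.flip h) (σ x) = k h x)
    (hstart : ∀ h, k h 0 = f (Γ.root h)) : C(Γ.Space, Y) where
  toFun := Quot.lift (Sum.elim (fun w => f w.1) (fun p => k p.1 p.2)) (by
    rintro _ _ (⟨h, x⟩ | h)
    · exact (hrev h x).symm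
    · exact hstart h)
  continuous_toFun := by
    refine continuous_quot_lift _ (Continuous.sumElim ?_ ?_)
    · exact continuous_sigma fun w => (continuous_const : Continuous fun _ : Unit => f w)
    · exact continuous_sigma fun h => hk h

theorem ext_map {Y : Type*} [TopologicalSpace Y] {Γ : Graph} {a b : C(Γ.Space, Y)}
    (hv : ∀ w, a (Γ.vertexPt w) = b (Γ.vertexPt w))
    (he : ∀ h x, a (Γ.edgePt h x) = b (Γ.edgePt h x)) : a = b := by
  ext p
  induction p using Quot.ind with
  | mk q =>
    rcases q with ⟨w, ⟨⟩⟩ | ⟨h, x⟩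
    · exact hv w
    · exact he h x

/-- Two vertices are joined by an edge. -/
def Joined (Γ : Graph) (a b : Γ.V) : Prop := ∃ h, Γ.root h = a ∧ Γ.root (Γ.flip h) = b

/-- A graph is connected if it has a vertex and any two vertices are joined by an edge path. -/
def Connected (Γ : Graph) : Prop :=
  Nonempty Γ.V ∧ ∀ a b : Γ.V, Relation.ReflTransGen Γ.Joined a b

/-- The valence of a vertex is the number of half edges incident to it. -/
def valence (Γ : Graph) (w : Γ.V) : ℕ := Nat.card {h : Γ.H // Γ.root h = w}

/-- The rose with `n` petals. -/
def rose (n : ℕ) : Graph where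
  V := Unit
  H := Fin n × Bool
  flip h := (h.1, !h.2)
  flip_flip h := by simp
  flip_ne h := by
    rcases h with ⟨i, _ | _⟩ <;> simp
  root _ := ()

/-- Graph isomorphisms. -/
structure Iso (Γ Δ : Graph) where
  onV : Γ.V ≃ Δ.V
  onH : Γ.H ≃ Δ.H
  map_flip : ∀ h, onH (Γ.flip h) = Δ.flip (onH h)
  map_root : ∀ h, onV (Γ.root h) = Δ.root (onH h)

namespace Iso

/-- The continuous map of realizations induced by a graph isomorphism. -/
def map {Γ Δ : Graph} (e : Iso Γ Δ) : C(Γ.Space, Δ.Space) :=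
  Γ.lift (fun w => Δ.vertexPt (e.onV w)) (fun h x => Δ.edgePt (e.onH h) x)
    (fun h => Δ.continuous_edgePt _)
    (fun h x => by rw [e.map_flip, edgePt_flip])
    (fun h => by rw [edgePt_zero, e.map_root])

def refl (Γ : Graph) : Iso Γ Γ := ⟨Equiv.refl _, Equiv.refl _, fun _ => rfl, fun _ => rfl⟩

def symm {Γ Δ : Graph} (e : Iso Γ Δ) : Iso Δ Γ where
  onV := e.onV.symm
  onH := e.onH.symm
  map_flip h := by rw [Equiv.symm_apply_eq, e.map_flip, Equiv.apply_symm_apply]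
  map_root h := by rw [Equiv.symm_apply_eq, e.map_root, Equiv.apply_symm_apply]

def trans {Γ Δ Θ : Graph} (e : Iso Γ Δ) (f : Iso Δ Θ) : Iso Γ Θ where
  onV := e.onV.trans f.onV
  onH := e.onH.trans f.onH
  map_flip h := by simp [e.map_flip, f.map_flip]
  map_root h := by simp [e.map_root, f.map_root]

theorem map_refl (Γ : Graph) : (refl Γ).map = ContinuousMap.id _ :=
  ext_map (fun _ => rfl) (fun _ _ => rfl)

theorem map_trans {Γ Δ Θ : Graph} (e : Iso Γ Δ) (f : Iso Δ Θ) :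
    (e.trans f).map = f.map.comp e.map :=
  ext_map (fun _ => rfl) (fun _ _ => rfl)

theorem symm_map_comp {Γ Δ : Graph} (e : Iso Γ Δ) :
    e.symm.map.comp e.map = ContinuousMap.id _ := by
  refine ext_map (fun w => ?_) (fun h x => ?_)
  · exact congrArg Γ.vertexPt (e.onV.symm_apply_apply w)
  · exact congrArg (fun k => Γ.edgePt k x) (e.onH.symm_apply_apply h)

end Iso

/-! ### Forest collapses -/

/-- A circuit in a set `F` of directed edges: a closed edge path in `F`, of length `k + 1`,
without backtracking (also cyclically). -/
def IsCircuit (Γ : Graph) (F : Set Γ.H) (k : ℕ) (c : Fin (k + 1) → Γ.H) : Prop :=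
  ∀ i, c i ∈ F ∧ Γ.root (Γ.flip (c i)) = Γ.root (c (i + 1)) ∧ c (i + 1) ≠ Γ.flip (c i)

/-- A subforest, given by its edges (both directions): a subgraph without circuits. -/
structure Subforest (Γ : Graph) where
  edges : Set Γ.H
  flip_mem : ∀ h ∈ edges, Γ.flip h ∈ edges
  no_circuit : ∀ k c, ¬ Γ.IsCircuit edges k c

/-- The graph obtained by collapsing every component of a subforest to a point. -/
def collapse (Γ : Graph) (Φ : Γ.Subforest) : Graph where
  V := Quot fun a b : Γ.V => ∃ h ∈ Φ.edges, Γ.root h = a ∧ Γ.root (Γ.flip h) = b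
  H := {h : Γ.H // h ∉ Φ.edges}
  flip h := ⟨Γ.flip h.1, fun hh => h.2 (by simpa [Γ.flip_flip] using Φ.flip_mem _ hh)⟩
  flip_flip h := Subtype.ext (Γ.flip_flip _)
  flip_ne h := fun hh => Γ.flip_ne _ (congrArg Subtype.val hh)
  root h := Quot.mk _ (Γ.root h.1)

open Classical in
/-- The quotient map collapsing every component of a subforest to a point. -/
def collapseMap (Γ : Graph) (Φ : Γ.Subforest) : C(Γ.Space, (Γ.collapse Φ).Space) :=
  Γ.lift (fun w => (Γ.collapse Φ).vertexPt (Quot.mk _ w))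
    (fun h x => if hh : h ∈ Φ.edges then (Γ.collapse Φ).vertexPt (Quot.mk _ (Γ.root h))
      else (Γ.collapse Φ).edgePt ⟨h, hh⟩ x)
    (fun h => by
      by_cases hh : h ∈ Φ.edges
      · simpa [hh] using continuous_const
      · simpa [hh] using (Γ.collapse Φ).continuous_edgePt ⟨h, hh⟩)
    (fun h x => by
      by_cases hh : h ∈ Φ.edges
      · have h2 := Φ.flip_mem h hh
        simp only [hh, h2, dite_true]
        exact congrArg _ (Quot.sound ⟨Γ.flip h, h2, rfl, by rw [Γ.flip_flip]⟩)
      · have h2 : Γ.flip h ∉ Φ.edges := fun h3 => hh (by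
          simpa [Γ.flip_flip] using Φ.flip_mem _ h3)
        simp only [hh, h2, dite_false]
        exact (Γ.collapse Φ).edgePt_flip ⟨h, hh⟩ x)
    (fun h => by
      by_cases hh : h ∈ Φ.edges
      · simp only [hh, dite_true]
      · simp only [hh, dite_false]
        exact (Γ.collapse Φ).edgePt_zero ⟨h, hh⟩)

end Graph

/-! ### Marked graphs and the spine of Outer space -/

/-- A finite connected graph, all of whose vertices have valence at least three, together with
a homotopy equivalence from the standard rose with `n` petals. -/
structure GraphWithMarking (n : ℕ) where
  graph : Graph
  finite_V : Finite graph.V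
  finite_H : Finite graph.H
  connected : graph.Connected
  three_le_valence : ∀ w, 3 ≤ graph.valence w
  marking : C((Graph.rose n).Space, graph.Space)
  marking_equiv : IsHomotopyEquivalence marking

namespace GraphWithMarking

/-- Two marked graphs are equivalent if some graph isomorphism carries one marking to the other,
up to free homotopy. -/
def Equivalent {n : ℕ} (M N : GraphWithMarking n) : Prop :=
  ∃ e : Graph.Iso M.graph N.graph, (e.map.comp M.marking).Homotopic N.marking

instance setoid (n : ℕ) : Setoid (GraphWithMarking n) where
  r := Equivalent
  iseqv :=
    { refl := fun M => ⟨Graph.Iso.refl _, by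
        rw [Graph.Iso.map_refl, ContinuousMap.id_comp]⟩
      symm := by
        rintro M N ⟨e, he⟩
        refine ⟨e.symm, ?_⟩
        have h1 := (ContinuousMap.Homotopic.refl e.symm.map).comp he.symm
        rwa [← ContinuousMap.comp_assoc, Graph.Iso.symm_map_comp, ContinuousMap.id_comp] at h1
      trans := by
        rintro M N P ⟨e, he⟩ ⟨f, hf⟩
        refine ⟨e.trans f, ?_⟩
        rw [Graph.Iso.map_trans, ContinuousMap.comp_assoc]
        exact ((ContinuousMap.Homotopic.refl f.map).comp he).trans hf }

/-- A forest collapse takes `N` to (a marked graph equivalent to) `M`. -/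
def CollapsesTo {n : ℕ} (N M : GraphWithMarking n) : Prop :=
  ∃ (Φ : N.graph.Subforest) (e : Graph.Iso (N.graph.collapse Φ) M.graph),
    ((e.map.comp (N.graph.collapseMap Φ)).comp N.marking).Homotopic M.marking

/-- A marked rose is a marked graph with exactly one vertex. -/
def IsRose {n : ℕ} (M : GraphWithMarking n) : Prop := Nat.card M.graph.V = 1

end GraphWithMarking

/-- Equivalence classes of markings on graphs. -/
def MarkedGraph (n : ℕ) : Type 1 := Quotient (GraphWithMarking.setoid n)

namespace MarkedGraph

/-- The equivalence class of a graph with marking. -/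
def mk {n : ℕ} (M : GraphWithMarking n) : MarkedGraph n := Quotient.mk _ M

/-- The order on marked graphs: `a ≤ b` if a forest collapse takes `b` to `a`. -/
def Le {n : ℕ} (a b : MarkedGraph n) : Prop :=
  ∃ M N : GraphWithMarking n, mk M = a ∧ mk N = b ∧ N.CollapsesTo M

end MarkedGraph

/-- The spine `K_n` of Outer space: the order complex of the poset of marked graphs. -/
def spine (n : ℕ) : AbstractSimplicialComplex (MarkedGraph n) where
  faces := {s | s.Nonempty ∧ IsChain MarkedGraph.Le (s : Set (MarkedGraph n))}
  isRelLowerSet_faces := by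
    intro s hs
    exact ⟨hs.1, fun t hts ht => ⟨ht, hs.2.mono (by exact_mod_cast hts)⟩⟩
  singleton_mem := by
    intro a
    exact ⟨Finset.singleton_nonempty a, by simp [IsChain]⟩

/-- The subcomplex of `K_n` spanned by a set of marked graphs. -/
def spannedSubcomplex {n : ℕ} (A : Set (MarkedGraph n)) :
    PreAbstractSimplicialComplex (MarkedGraph n) where
  faces := {s | s ∈ (spine n).faces ∧ ∀ a ∈ s, a ∈ A}
  isRelLowerSet_faces := by
    intro s hs
    refine ⟨hs.1.1, fun t hts ht => ⟨?_, fun a ha => hs.2 a (hts ha)⟩⟩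
    exact ((spine n).isRelLowerSet_faces hs.1).2 hts ht

/-- The vertices of the link of a vertex in a simplicial complex. -/
def linkVertices {ι : Type*} (K : PreAbstractSimplicialComplex ι) (a : ι) : Set ι :=
  {b | b ≠ a ∧ ∃ s ∈ K.faces, a ∈ s ∧ b ∈ s}

/-! ### Ribbon structures and the punctured surface of a ribbon graph -/

/-- A ribbon structure: a cyclic ordering of the half edges incident to every vertex, given by its
successor permutation, whose cycles are exactly the sets of half edges at the vertices. -/
@[ext]
structure RibbonStructure (Γ : Graph) where
  next : Equiv.Perm Γ.H
  sameCycle_iff : ∀ h k, next.SameCycle h k ↔ Γ.root h = Γ.root k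

namespace RibbonStructure

variable {Γ : Graph} (O : RibbonStructure Γ)

/-- The opposite ribbon structure, with all cyclic orderings reversed. -/
def op : RibbonStructure Γ where
  next := O.next⁻¹
  sameCycle_iff h k := by rw [Equiv.Perm.sameCycle_inv, O.sameCycle_iff]

/-- The directed edge following `h` in a boundary cycle: it starts with the half edge that directly
follows, in the cyclic order, the half edge with which `h` ends. -/
def boundaryNext (h : Γ.H) : Γ.H := O.next (Γ.flip h)

/-- The graph, together with a half-open strip `[0, 1] × [0, ∞)` for every directed edge. -/
abbrev PreSurface (_ : RibbonStructure Γ) : Type := Γ.Space ⊕ ((_ : Γ.H) × (I × ℝ≥0))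

/-- Consecutive strips along a boundary cycle are glued to each other along their sides, which
makes a once punctured closed disk `S¹ × [0, ∞)` out of every boundary cycle; its boundary circle
is glued to the graph along the boundary cycle. -/
inductive Glue : O.PreSurface → O.PreSurface → Prop
  | side (h : Γ.H) (t : ℝ≥0) : Glue (Sum.inr ⟨h, 1, t⟩) (Sum.inr ⟨O.boundaryNext h, 0, t⟩)
  | bottom (h : Γ.H) (x : I) : Glue (Sum.inr ⟨h, x, 0⟩) (Sum.inl (Γ.edgePt h x))

/-- The punctured surface `|Γ, O|`. -/
def Surface : Type := Quot O.Glue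

instance : TopologicalSpace O.Surface := inferInstanceAs (TopologicalSpace (Quot O.Glue))

/-- The inclusion of the graph into the surface. -/
def incl : C(Γ.Space, O.Surface) where
  toFun p := Quot.mk _ (Sum.inl p)
  continuous_toFun := continuous_quot_mk.comp continuous_inl

/-- The strip of the directed edge `h`, parametrized by the part `0 ≤ Re z ≤ 1`, `Im z ≤ 0` of the
complex plane (and extended to the whole plane by a retraction, which is never used below).
The directed edge `h` is the segment from `0` to `1`, and the strip lies to its right. -/
def strip (h : Γ.H) (z : ℂ) : O.Surface :=
  Quot.mk _ (Sum.inr ⟨h, Set.projIcc 0 1 zero_le_one z.re, (-z.im).toNNReal⟩)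

end RibbonStructure

/-! ### Orientations -/

/-- A map between plane regions preserves orientation at `p` if small positively oriented circles
around `p` are mapped to curves of winding number one around the image of `p`; here `L` is
a continuous logarithm along the image curve. -/
def PreservesOrientationAt (f : ℂ → ℂ) (p : ℂ) : Prop :=
  ∀ᶠ r : ℝ in 𝓝[>] 0, ∃ L : ℝ → ℂ, Continuous L ∧
    (∀ t : ℝ, Complex.exp (L t) = f (p + r * Complex.exp (t * Complex.I)) - f p) ∧
    L (2 * Real.pi) - L 0 = 2 * Real.pi * Complex.I

/-- An atlas of charts to the plane is an oriented atlas if all changes of charts preserve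
the orientation of the plane. -/
def IsOrientedAtlas (S : Type*) [TopologicalSpace S] [ChartedSpace ℂ S] : Prop :=
  ∀ e ∈ atlas ℂ S, ∀ e' ∈ atlas ℂ S, ∀ p ∈ (e.symm.trans e').source,
    PreservesOrientationAt (fun z => e' (e.symm z)) p

/-- A homeomorphism from `|Γ, O|` to an oriented surface preserves orientation. Here `|Γ, O|` has
the orientation for which the strips are positively parametrized: travelling along a boundary
cycle, the punctured disk glued to it lies on the right, so that a small positively oriented
circle around a vertex meets the half edges in the cyclic order `O`. -/
def RibbonStructure.OrientationPreserving {Γ : Graph} (O : RibbonStructure Γ) {S : Type*}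
    [TopologicalSpace S] [ChartedSpace ℂ S] (k : O.Surface ≃ₜ S) : Prop :=
  ∀ (h : Γ.H) (z : ℂ), 0 < z.re → z.re < 1 → z.im < 0 →
    ∀ e ∈ atlas ℂ S, k (O.strip h z) ∈ e.source →
      PreservesOrientationAt (fun y => e (k (O.strip h y))) z

/-! ### Punctured surfaces and marked surfaces -/

/-- The point at time `x` on the `k`-th of the `m` sides of the unit disk, regarded as an `m`-gon
by dividing the unit circle into `m` equal arcs. -/
def polygonSide (m k : ℕ) (x : I) : ℂ :=
  Complex.exp (2 * Real.pi * Complex.I * ((k + (x : ℝ)) / m : ℝ))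

/-- The side pairing of the `4g`-gon according to the boundary word
`a₁ b₁ a₁⁻¹ b₁⁻¹ ⋯ a_g b_g a_g⁻¹ b_g⁻¹`. -/
inductive SidePairing (g : ℕ) : Metric.closedBall (0 : ℂ) 1 → Metric.closedBall (0 : ℂ) 1 → Prop
  | a (p q : Metric.closedBall (0 : ℂ) 1) (j : ℕ) (hj : j < g) (x : I)
      (hp : (p : ℂ) = polygonSide (4 * g) (4 * j) x)
      (hq : (q : ℂ) = polygonSide (4 * g) (4 * j + 2) (σ x)) : SidePairing g p q
  | b (p q : Metric.closedBall (0 : ℂ) 1) (j : ℕ) (hj : j < g) (x : I)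
      (hp : (p : ℂ) = polygonSide (4 * g) (4 * j + 1) x)
      (hq : (q : ℂ) = polygonSide (4 * g) (4 * j + 3) (σ x)) : SidePairing g p q

/-- The closed orientable surface of genus `g`: the sphere for `g = 0`, and the `4g`-gon with sides
identified in pairs for `g ≥ 1`. -/
def ClosedSurface : ℕ → Type
  | 0 => Metric.sphere (0 : EuclideanSpace ℝ (Fin 3)) 1
  | g + 1 => Quot (SidePairing (g + 1))

instance : (g : ℕ) → TopologicalSpace (ClosedSurface g)
  | 0 => inferInstanceAs (TopologicalSpace (Metric.sphere (0 : EuclideanSpace ℝ (Fin 3)) 1))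
  | g + 1 => inferInstanceAs (TopologicalSpace (Quot (SidePairing (g + 1))))

/-- A surface of type `Σ_g^s`: a space homeomorphic to the closed orientable surface of genus `g`
with `s` points removed. -/
def IsOfType (g s : ℕ) (S : Type*) [TopologicalSpace S] : Prop :=
  ∃ P : Set (ClosedSurface g), P.Finite ∧ P.ncard = s ∧ Nonempty (S ≃ₜ (Pᶜ : Set (ClosedSurface g)))

/-- An oriented punctured surface, of type `Σ_g^s` with `s > 0` and `2g + s - 1 = n`, together with
a homotopy equivalence from the standard rose with `n` petals. -/
structure MarkedSurface (n : ℕ) where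
  carrier : Type u
  [topology : TopologicalSpace carrier]
  [charts : ChartedSpace ℂ carrier]
  oriented : IsOrientedAtlas carrier
  type : ∃ g s : ℕ, 0 < s ∧ 2 * g + s = n + 1 ∧ IsOfType g s carrier
  marking : C((Graph.rose n).Space, carrier)
  marking_equiv : IsHomotopyEquivalence marking

attribute [instance] MarkedSurface.topology MarkedSurface.charts

namespace MarkedSurface

variable {n : ℕ}

/-- The relation `∼±`: there is a homeomorphism, not necessarily orientation preserving, that
carries one marking to the other up to homotopy. -/
def UnorientedEquivalent (S : MarkedSurface.{u} n) (T : MarkedSurface.{v} n) : Prop :=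
  ∃ k : S.carrier ≃ₜ T.carrier,
    ((k : C(S.carrier, T.carrier)).comp S.marking).Homotopic T.marking

/-- The ribbon structure `O` draws the marked graph `M` in `S`: the marked surface `|M, O|`
is equivalent to `S` through an orientation preserving homeomorphism. -/
def DrawnBy (S : MarkedSurface.{u} n) (M : GraphWithMarking n) (O : RibbonStructure M.graph) :
    Prop :=
  ∃ k : O.Surface ≃ₜ S.carrier, O.OrientationPreserving k ∧
    ((k : C(O.Surface, S.carrier)).comp (O.incl.comp M.marking)).Homotopic S.marking

/-- The marked graphs that can be drawn in `S`. -/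
def drawable (S : MarkedSurface.{u} n) : Set (MarkedGraph n) :=
  {a | ∃ (M : GraphWithMarking n) (O : RibbonStructure M.graph),
    MarkedGraph.mk M = a ∧ S.DrawnBy M O}

/-- The ribbon graph complex of `S`: the subcomplex of `K_n` spanned by the marked graphs that can
be drawn in `S`. -/
def ribbonComplex (S : MarkedSurface.{u} n) : PreAbstractSimplicialComplex (MarkedGraph n) :=
  spannedSubcomplex S.drawable

end MarkedSurface

end RibbonCover

end

/-!
The proof goes through the cyclic orderings of marked roses and compares them by means of the
graphs in their links.

*Orientations.* The surface of a ribbon graph is connected and glued from strips, so a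
homeomorphism from it to an oriented surface has the same local degree `1` or `-1` on all of them
(`RibbonStructure.orientationPreserving_or`). After a reflection, which replaces a ribbon structure
by the opposite one, it preserves the orientation. Hence a marked graph is drawable in a marked
surface as soon as there is any homeomorphism compatible with the markings
(`MarkedSurface.mem_drawable`), and unoriented equivalent surfaces have the same complex.

*Blow-ups.* Let `a` be a half edge of a rose with cyclic ordering `O₁`. Pulling `a` and its
successor `O₁.next a` away from the vertex along a new edge gives a ribbon graph with two vertices
and with a homeomorphic surface (`RibbonStructure.blowUpHomeo`). So the blown up marked graph lies
in the link of the rose, in every marked surface in which `O₁` draws the rose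
(`GraphWithMarking.blowUp_mem_drawable`).

*Boundary cycles.* Suppose that this blown up graph is also drawable, by some ribbon structure
`O'`, in a marked surface in which `O₂` draws the rose. The surfaces of `O'` and `O₂` are then
homeomorphic. A curve parallel to a boundary cycle of `O'`, far away from the graph, is mapped into
a punctured disk of the surface of `O₂`, so that it is homotopic there to a power of a boundary
cycle of `O₂`. Both boundary cycles are read off as words in a free group, by lifting them to a
covering of the rose with the free group as deck group. The words are conjugate, and they are
cyclically reduced because the vertices have valence at least three. Two letters that are adjacent
in one word are therefore adjacent, up to inversion, in the other one (`pair_of_isConj`,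
`boundaryNext_of_homeomorph`). Applied to the boundary cycles through the new vertex, which has
valence three, this shows that `a` and `O₁.next a` are neighbours in `O₂`
(`GraphWithMarking.next_of_blowUp_mem_drawable`). Two cyclic orderings with the same neighbours
agree up to reversal (`RibbonStructure.eq_or_eq_op`). This shows that the link determines the
cyclic ordering up to reversal (`GraphWithMarking.eq_or_eq_op_of_link`).

*Existence of a rose.* Every marked surface is homeomorphic to the surface of a ribbon rose
(`MarkedSurface.exists_ribbon`), and a homotopy inverse of the inclusion of the rose turns the
marking of the surface into a marking of the rose. The twice punctured sphere is the surface of the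
rose with one petal. A once punctured surface of positive genus is a polygon with glued sides and
without its corners; it is the surface of the rose whose petals are dual to the pairs of sides. If
an edge of a ribbon graph is doubled, then a new punctured disk appears between the two copies, and
filling in its puncture gives back the old surface (`RibbonStructure.isOpenEmbedding_fill`). As
points of a connected surface can be moved to any position, this removes further points one by one
(`IsConnectedSurface.isRibbonComplement`). If two marked surfaces have the same complex, then a
rose drawn in the first one is drawn in the second one, with the same cyclic ordering up to
reversal by the result on links. The two surfaces are therefore homeomorphic compatibly with the
markings (`unorientedEquivalent_of_drawable_eq`).
-/

open scoped unitInterval NNReal Topology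

noncomputable section

namespace RibbonCover

/-! ### Homotopy equivalences -/

theorem IsHomotopyEquivalence.comp {X Y Z : Type*} [TopologicalSpace X] [TopologicalSpace Y]
    [TopologicalSpace Z] {g : C(Y, Z)} {f : C(X, Y)} (hg : IsHomotopyEquivalence g)
    (hf : IsHomotopyEquivalence f) : IsHomotopyEquivalence (g.comp f) := by
  obtain ⟨e, rfl⟩ := hf
  obtain ⟨e', rfl⟩ := hg
  exact ⟨e.trans e', rfl⟩

theorem isHomotopyEquivalence_homeomorph {X Y : Type*} [TopologicalSpace X] [TopologicalSpace Y]
    (k : X ≃ₜ Y) : IsHomotopyEquivalence (k : C(X, Y)) := ⟨k.toHomotopyEquiv, rfl⟩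

/-- Homotopy equivalences may be cancelled on the right. -/
theorem IsHomotopyEquivalence.homotopic_of_comp {X Y Z : Type*} [TopologicalSpace X]
    [TopologicalSpace Y] [TopologicalSpace Z] {m : C(X, Y)} (hm : IsHomotopyEquivalence m)
    {f g : C(Y, Z)} (h : (f.comp m).Homotopic (g.comp m)) : f.Homotopic g := by
  obtain ⟨e, rfl⟩ := hm
  have h1 := h.comp (ContinuousMap.Homotopic.refl e.invFun)
  rw [ContinuousMap.comp_assoc, ContinuousMap.comp_assoc] at h1
  have hf := (ContinuousMap.Homotopic.refl f).comp e.right_inv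
  have hg := (ContinuousMap.Homotopic.refl g).comp e.right_inv
  rw [ContinuousMap.comp_id] at hf hg
  exact (hf.symm.trans h1).trans hg

/-- A homotopy may be given as a continuous map into the path space of the target. -/
theorem homotopic_of_pathMap {X Y : Type*} [TopologicalSpace X] [TopologicalSpace Y]
    (F : C(X, C(I, Y))) {f g : C(X, Y)} (hf : ∀ x, F x 0 = f x) (hg : ∀ x, F x 1 = g x) :
    f.Homotopic g :=
  ⟨{ toFun := fun p => F p.2 p.1
     continuous_toFun := by fun_prop
     map_zero_left := hf
     map_one_left := hg }⟩

theorem projIcc_one_sub (x : ℝ) :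
    (Set.projIcc 0 1 zero_le_one (1 - x) : I) = σ (Set.projIcc 0 1 zero_le_one x) := by
  apply Subtype.ext
  rw [unitInterval.coe_symm_eq, Set.coe_projIcc, Set.coe_projIcc]
  rcases le_total x 0 with h | h
  · rw [min_eq_left (by linarith), min_eq_right (by linarith), max_eq_left h]; simp
  · rcases le_total x 1 with h' | h'
    · rw [min_eq_right (by linarith), min_eq_right (by linarith), max_eq_right (by linarith),
        max_eq_right h]
    · rw [min_eq_right (by linarith), min_eq_left (by linarith), max_eq_left (by linarith)]; simp

/-! ### Maps out of the realization of a graph -/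

namespace Graph

variable {Γ : Graph}

theorem flip_injective : Function.Injective Γ.flip :=
  Function.LeftInverse.injective Γ.flip_flip

theorem edgePt_one (h : Γ.H) : Γ.edgePt h 1 = Γ.vertexPt (Γ.root (Γ.flip h)) := by
  rw [← edgePt_zero, ← Γ.edgePt_flip h 1, unitInterval.symm_one]

theorem space_cases (p : Γ.Space) : (∃ w, p = Γ.vertexPt w) ∨ ∃ h x, p = Γ.edgePt h x := by
  induction p using Quot.ind with
  | mk q =>
    rcases q with ⟨w, ⟨⟩⟩ | ⟨h, x⟩
    · exact Or.inl ⟨w, rfl⟩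
    · exact Or.inr ⟨h, x, rfl⟩

theorem exists_edgePt (hΓ : Function.Surjective Γ.root) (p : Γ.Space) :
    ∃ h x, p = Γ.edgePt h x := by
  rcases Γ.space_cases p with ⟨w, rfl⟩ | h
  · obtain ⟨h, rfl⟩ := hΓ w
    exact ⟨h, 0, (Γ.edgePt_zero h).symm⟩
  · exact h

/-- The realization carries the final topology with respect to its edges. -/
theorem isOpen_space_iff {U : Set Γ.Space} : IsOpen U ↔ ∀ h, IsOpen (Γ.edgePt h ⁻¹' U) := by
  refine ⟨fun hU h => hU.preimage (Γ.continuous_edgePt h), fun hU => ?_⟩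
  change IsOpen (Quot.mk Γ.Glue ⁻¹' U)
  rw [isOpen_sum_iff, isOpen_sigma_iff, isOpen_sigma_iff]
  exact ⟨fun w => isOpen_discrete _, hU⟩

theorem compactSpace_space [Finite Γ.V] [Finite Γ.H] : CompactSpace Γ.Space :=
  inferInstanceAs (CompactSpace (Quot Γ.Glue))

/-- Changing the parametrization of the edges does not change the homotopy class of a map. -/
theorem homotopic_of_reparam {Y : Type*} [TopologicalSpace Y] (hΓ : Function.Surjective Γ.root)
    (g : C(Γ.Space, Y)) (f : C(Γ.Space, Y)) (s : Γ.H → I → I) (hs : ∀ h, Continuous (s h))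
    (hs0 : ∀ h, s h 0 = 0) (hrev : ∀ h x, s (Γ.flip h) (σ x) = σ (s h x))
    (hf : ∀ h x, f (Γ.edgePt h x) = g (Γ.edgePt h (s h x))) : f.Homotopic g := by
  have hc : ∀ h, Continuous fun p : I × I =>
      g (Γ.edgePt h (Set.projIcc 0 1 zero_le_one
        ((1 - (p.2 : ℝ)) * s h p.1 + (p.2 : ℝ) * p.1))) := fun h => by
    have := hs h
    exact g.continuous.comp ((Γ.continuous_edgePt h).comp (continuous_projIcc.comp (by fun_prop)))
  refine homotopic_of_pathMap (Γ.lift (fun w => ContinuousMap.const I (g (Γ.vertexPt w)))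
    (fun h x => ⟨fun t => g (Γ.edgePt h (Set.projIcc 0 1 zero_le_one
      ((1 - (t : ℝ)) * s h x + (t : ℝ) * x))),
          (hc h).comp (by fun_prop : Continuous fun t : I => (x, t))⟩)
    (fun h => ContinuousMap.continuous_of_continuous_uncurry _ (hc h)) ?_ ?_) ?_ ?_
  · intro h x
    ext t
    simp only [ContinuousMap.coe_mk]
    rw [← Γ.edgePt_flip h]
    congr 2
    rw [hrev, ← projIcc_one_sub]
    congr 1
    rw [unitInterval.coe_symm_eq, unitInterval.coe_symm_eq]
    ring
  · intro h
    ext t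
    have : (Set.projIcc 0 1 zero_le_one ((1 - (t : ℝ)) * ((s h 0 : I) : ℝ) +
        (t : ℝ) * ((0 : I) : ℝ)) : I)
        = 0 := by
      rw [hs0]; simp
    change g (Γ.edgePt h (Set.projIcc 0 1 zero_le_one _)) = g (Γ.vertexPt (Γ.root h))
    rw [this, edgePt_zero]
  · intro p
    obtain ⟨h, x, rfl⟩ := exists_edgePt hΓ p
    rw [hf]
    change g (Γ.edgePt h (Set.projIcc 0 1 zero_le_one _)) = _
    simp
  · intro p
    obtain ⟨h, x, rfl⟩ := exists_edgePt hΓ p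
    change g (Γ.edgePt h (Set.projIcc 0 1 zero_le_one _)) = _
    simp

end Graph

/-! ### Maps out of the surface of a ribbon graph -/

namespace RibbonStructure

variable {Γ : Graph} (O : RibbonStructure Γ)

/-- The point `(x, t)` of the strip of the directed edge `h`. -/
def stripPt (h : Γ.H) (x : I) (t : ℝ≥0) : O.Surface := Quot.mk _ (Sum.inr ⟨h, x, t⟩)

theorem stripPt_one (h : Γ.H) (t : ℝ≥0) :
    O.stripPt h 1 t = O.stripPt (O.boundaryNext h) 0 t := Quot.sound (Glue.side h t)

theorem stripPt_bottom (h : Γ.H) (x : I) : O.stripPt h x 0 = O.incl (Γ.edgePt h x) :=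
  Quot.sound (Glue.bottom h x)

theorem continuous_stripPt (h : Γ.H) : Continuous fun p : I × ℝ≥0 => O.stripPt h p.1 p.2 :=
  continuous_quot_mk.comp (continuous_inr.comp
    (@continuous_sigmaMk _ (fun _ : Γ.H => I × ℝ≥0) _ h))

theorem surface_cases (p : O.Surface) : (∃ q, p = O.incl q) ∨ ∃ h x t, p = O.stripPt h x t := by
  induction p using Quot.ind with
  | mk q =>
    rcases q with q | ⟨h, x, t⟩
    · exact Or.inl ⟨q, rfl⟩
    · exact Or.inr ⟨h, x, t, rfl⟩

theorem exists_stripPt (hΓ : Function.Surjective Γ.root) (p : O.Surface) :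
    ∃ h x t, p = O.stripPt h x t := by
  rcases O.surface_cases p with ⟨q, rfl⟩ | h
  · obtain ⟨h, x, rfl⟩ := Graph.exists_edgePt hΓ q
    exact ⟨h, x, 0, (O.stripPt_bottom h x).symm⟩
  · exact h

variable {O} in
/-- The surface carries the final topology with respect to its strips. -/
theorem isOpen_surface_iff {U : Set O.Surface} :
    IsOpen U ↔ ∀ h, IsOpen ((fun p : I × ℝ≥0 => O.stripPt h p.1 p.2) ⁻¹' U) := by
  refine ⟨fun hU h => hU.preimage (O.continuous_stripPt h), fun hU => ?_⟩
  change IsOpen (Quot.mk O.Glue ⁻¹' U)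
  rw [isOpen_sum_iff, isOpen_sigma_iff]
  refine ⟨Graph.isOpen_space_iff.2 fun h => ?_, hU⟩
  have := (hU h).preimage (by fun_prop : Continuous fun x : I => (x, (0 : ℝ≥0)))
  convert this using 1
  ext x
  exact iff_of_eq (congrArg (· ∈ U) (O.stripPt_bottom h x).symm)

variable {O} in
theorem continuous_surface_iff {Y : Type*} [TopologicalSpace Y] {f : O.Surface → Y} :
    Continuous f ↔ ∀ h, Continuous fun p : I × ℝ≥0 => f (O.stripPt h p.1 p.2) := by
  refine ⟨fun hf h => hf.comp (O.continuous_stripPt h), fun hf => ⟨fun U hU => ?_⟩⟩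
  exact isOpen_surface_iff.2 fun h => hU.preimage (hf h)

/-- The function on the surface with given values on the graph and on the strips. -/
def desc {Y : Type*} (f : Γ.Space → Y) (k : Γ.H → I → ℝ≥0 → Y)
    (side : ∀ h t, k h 1 t = k (O.boundaryNext h) 0 t)
    (bottom : ∀ h x, k h x 0 = f (Γ.edgePt h x)) : O.Surface → Y :=
  Quot.lift (Sum.elim f fun p => k p.1 p.2.1 p.2.2) (by
    rintro _ _ (⟨h, t⟩ | ⟨h, x⟩)
    · exact side h t
    · exact bottom h x)

theorem desc_stripPt {Y : Type*} (f : Γ.Space → Y) (k : Γ.H → I → ℝ≥0 → Y) (side bottom)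
    (h : Γ.H) (x : I) (t : ℝ≥0) : O.desc f k side bottom (O.stripPt h x t) = k h x t := rfl

theorem root_next (h : Γ.H) : Γ.root (O.next h) = Γ.root h :=
  (O.sameCycle_iff _ _).1 (Equiv.Perm.sameCycle_apply_left.2 (Equiv.Perm.SameCycle.refl _ _))

theorem root_boundaryNext (h : Γ.H) : Γ.root (O.boundaryNext h) = Γ.root (Γ.flip h) :=
  O.root_next _

/-- A function of half edges that is constant along the cyclic orders only depends on the
vertex. -/
theorem eq_of_root_eq {Y : Type*} {f : Γ.H → Y} (hf : ∀ h, f (O.next h) = f h) {h k : Γ.H}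
    (hk : Γ.root h = Γ.root k) : f h = f k := by
  obtain ⟨i, rfl⟩ := (O.sameCycle_iff h k).2 hk
  have hp : ∀ (n : ℕ) (h : Γ.H), f ((O.next ^ n) h) = f h := fun n => by
    induction n with
    | zero => intro h; rfl
    | succ n ih => intro h; rw [pow_succ', Equiv.Perm.mul_apply, hf, ih]
  obtain ⟨n, rfl | rfl⟩ := i.eq_nat_or_neg
  · exact (hp n h).symm
  · rw [zpow_neg, zpow_natCast, ← hp n ((O.next ^ n)⁻¹ h)]
    simp

/-- The function on the surface with given values on the strips. -/
def stripDesc {Y : Type*} (hΓ : Function.Surjective Γ.root) (k : Γ.H → I → ℝ≥0 → Y)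
    (side : ∀ h t, k h 1 t = k (O.boundaryNext h) 0 t)
    (bottom : ∀ h x, k (Γ.flip h) (σ x) 0 = k h x 0) : O.Surface → Y :=
  O.desc (Quot.lift (Sum.elim (fun w => k (Function.surjInv hΓ w.1) 0 0) fun p => k p.1 p.2 0) (by
    rintro _ _ (⟨h, x⟩ | h)
    · exact (bottom h x).symm
    · refine O.eq_of_root_eq (f := fun h => k h 0 0) (fun h => ?_) (Function.surjInv_eq hΓ _).symm
      have h1 := side (Γ.flip h) 0
      have h2 := bottom h 0
      rw [unitInterval.symm_zero] at h2
      rw [h2, boundaryNext, Γ.flip_flip] at h1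
      exact h1.symm)) k side (fun h x => rfl)

theorem stripDesc_stripPt {Y : Type*} (hΓ : Function.Surjective Γ.root) (k : Γ.H → I → ℝ≥0 → Y)
    (side bottom) (h : Γ.H) (x : I) (t : ℝ≥0) :
    O.stripDesc hΓ k side bottom (O.stripPt h x t) = k h x t := rfl

/-- The retraction of the surface onto the graph. -/
def retr : C(O.Surface, Γ.Space) where
  toFun := O.desc id (fun h x _ => Γ.edgePt h x)
    (fun h _ => by rw [Γ.edgePt_one, Γ.edgePt_zero, root_boundaryNext]) (fun _ _ => rfl)
  continuous_toFun := continuous_surface_iff.2 fun h =>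
    (Γ.continuous_edgePt h).comp continuous_fst

theorem retr_comp_incl : O.retr.comp O.incl = ContinuousMap.id _ := rfl

theorem incl_comp_retr : (O.incl.comp O.retr).Homotopic (ContinuousMap.id _) := by
  have hc : ∀ h, Continuous fun p : (I × ℝ≥0) × I =>
      O.stripPt h p.1.1 (p.1.2 * (p.2 : ℝ).toNNReal) := fun h =>
    (O.continuous_stripPt h).comp
      (f := fun p : (I × ℝ≥0) × I => (p.1.1, p.1.2 * (p.2 : ℝ).toNNReal)) (by fun_prop)
  refine homotopic_of_pathMap (X := O.Surface) (Y := O.Surface) ⟨O.desc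
    (fun q => ContinuousMap.const I (O.incl q))
    (fun h x t => ⟨fun s => O.stripPt h x (t * (s : ℝ).toNNReal),
      (hc h).comp (by fun_prop : Continuous fun s : I => ((x, t), s))⟩) ?_ ?_, ?_⟩ ?_ ?_
  · intro h t
    ext s
    exact O.stripPt_one h _
  · intro h x
    ext s
    change O.stripPt h x (0 * _) = O.incl _
    rw [zero_mul, stripPt_bottom]
  · exact continuous_surface_iff.2 fun h => ContinuousMap.continuous_of_continuous_uncurry _ (hc h)
  · intro p
    rcases O.surface_cases p with ⟨q, rfl⟩ | ⟨h, x, t, rfl⟩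
    · rfl
    · change O.stripPt h x (t * ((0 : I) : ℝ).toNNReal) = O.incl (Γ.edgePt h x)
      rw [← stripPt_bottom]; simp
  · intro p
    rcases O.surface_cases p with ⟨q, rfl⟩ | ⟨h, x, t, rfl⟩
    · rfl
    · change O.stripPt h x (t * ((1 : I) : ℝ).toNNReal) = O.stripPt h x t
      simp

theorem isHomotopyEquivalence_incl : IsHomotopyEquivalence O.incl :=
  ⟨⟨O.incl, O.retr, by rw [retr_comp_incl], O.incl_comp_retr⟩, rfl⟩

theorem isHomotopyEquivalence_retr : IsHomotopyEquivalence O.retr :=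
  ⟨⟨O.retr, O.incl, O.incl_comp_retr, by rw [retr_comp_incl]⟩, rfl⟩

/-- The height of a point above the graph. -/
def height : O.Surface → ℝ≥0 := O.desc (fun _ => 0) (fun _ _ t => t) (fun _ _ => rfl) fun _ _ => rfl

theorem continuous_height : Continuous O.height := continuous_surface_iff.2 fun _ => continuous_snd

theorem height_stripPt (h : Γ.H) (x : I) (t : ℝ≥0) : O.height (O.stripPt h x t) = t := rfl

/-! ### Real coordinates on strips and bands -/

/-- The strip of `h` in real coordinates, which are clamped to `0 ≤ x ≤ 1` and `0 ≤ t`. -/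
def stp (h : Γ.H) (x t : ℝ) : O.Surface := O.stripPt h (Set.projIcc 0 1 zero_le_one x) t.toNNReal

theorem continuous_stp (h : Γ.H) : Continuous fun p : ℝ × ℝ => O.stp h p.1 p.2 :=
  (O.continuous_stripPt h).comp
    (f := fun p : ℝ × ℝ => (Set.projIcc 0 1 zero_le_one p.1, p.2.toNNReal))
    ((continuous_projIcc.comp continuous_fst).prodMk (continuous_real_toNNReal.comp continuous_snd))

theorem stripPt_eq_stp (h : Γ.H) (x : I) (t : ℝ≥0) : O.stripPt h x t = O.stp h x t := by
  simp [stp]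

theorem stp_one (h : Γ.H) (t : ℝ) : O.stp h 1 t = O.stp (O.boundaryNext h) 0 t := by
  have := O.stripPt_one h t.toNNReal
  simpa [stp] using this

theorem stp_flip {h : Γ.H} {x t : ℝ} (ht : t ≤ 0) :
    O.stp (Γ.flip h) (1 - x) t = O.stp h x t := by
  rw [stp, stp, Real.toNNReal_of_nonpos ht, stripPt_bottom, stripPt_bottom, projIcc_one_sub,
    Γ.edgePt_flip]

/-- The band around the half edge `h`: it consists of half of the strip of `h`, where `y ≤ 0`,
and half of the strip of the reversed edge, where `0 ≤ y`; the coordinate `x` is the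
distance from the root of `h`. -/
def band (h : Γ.H) (x y : ℝ) : O.Surface :=
  if y ≤ 0 then O.stp h x (-y) else O.stp (Γ.flip h) (1 - x) y

variable {O}

theorem band_of_nonpos {h : Γ.H} {x y : ℝ} (hy : y ≤ 0) : O.band h x y = O.stp h x (-y) :=
  if_pos hy

theorem band_of_nonneg {h : Γ.H} {x y : ℝ} (hy : 0 ≤ y) :
    O.band h x y = O.stp (Γ.flip h) (1 - x) y := by
  rcases hy.eq_or_lt with rfl | hy
  · rw [band_of_nonpos le_rfl, neg_zero, stp_flip _ le_rfl]
  · exact if_neg (not_le.2 hy)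

variable (O)

theorem continuous_band (h : Γ.H) : Continuous fun p : ℝ × ℝ => O.band h p.1 p.2 := by
  refine Continuous.if_le ?_ ?_ continuous_snd continuous_const ?_
  · exact (O.continuous_stp h).comp (continuous_fst.prodMk continuous_snd.neg)
  · exact (O.continuous_stp _).comp ((continuous_const.sub continuous_fst).prodMk continuous_snd)
  · intro p hp
    rw [hp, neg_zero, stp_flip _ le_rfl]

theorem band_flip (h : Γ.H) (y : ℝ) : O.band (Γ.flip h) (1 / 2) (-y) = O.band h (1 / 2) y := by
  rcases le_total y 0 with hy | hy
  · rw [band_of_nonpos hy, band_of_nonneg (by linarith), Γ.flip_flip]; norm_num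
  · rw [band_of_nonneg hy, band_of_nonpos (by linarith)]; norm_num

theorem band_next (h : Γ.H) {y : ℝ} (hy : 0 ≤ y) : O.band (O.next h) 0 (-y) = O.band h 0 y := by
  rw [band_of_nonneg hy, band_of_nonpos (by linarith), neg_neg, sub_zero, stp_one, boundaryNext,
    Γ.flip_flip]

/-- The function on the surface with given values on the bands. -/
def bandDesc {Y : Type*} (hΓ : Function.Surjective Γ.root) (k : Γ.H → ℝ → ℝ → Y)
    (outer : ∀ h y, k (Γ.flip h) (1 / 2) (-y) = k h (1 / 2) y)
    (inner : ∀ h y, 0 ≤ y → k (O.next h) 0 (-y) = k h 0 y) : O.Surface → Y :=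
  O.stripDesc hΓ
    (fun h x t => if (x : ℝ) ≤ 1 / 2 then k h x (-t) else k (Γ.flip h) (1 - x) t)
    (fun h t => by
      rw [if_neg (by norm_num), if_pos (by norm_num), boundaryNext]
      simpa using (inner (Γ.flip h) t t.2).symm)
    (fun h x => by
      rw [unitInterval.coe_symm_eq]
      have := outer h 0
      rw [neg_zero] at this
      rcases lt_trichotomy (x : ℝ) (1 / 2) with hx | hx | hx
      · rw [if_neg (by linarith), if_pos hx.le, Γ.flip_flip]; simp
      · rw [if_pos (by linarith), if_pos hx.le, hx]; norm_num at this ⊢; exact this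
      · rw [if_pos (by linarith), if_neg (by linarith)]; simp)

variable {O}

/-- The prescribed values are taken on the half of the band where `x ≤ 1 / 2`; the other half
belongs
to the band of the reversed half edge. -/
theorem bandDesc_band {Y : Type*} {hΓ : Function.Surjective Γ.root} {k : Γ.H → ℝ → ℝ → Y}
    {outer inner} (h : Γ.H) {x y : ℝ} (hx : x ∈ Set.Icc (0 : ℝ) (1 / 2)) :
    O.bandDesc hΓ k outer inner (O.band h x y) = k h x y := by
  rcases le_total y 0 with hy | hy
  · rw [band_of_nonpos hy, stp, bandDesc, stripDesc_stripPt,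
      Set.projIcc_of_mem _ ⟨hx.1, by linarith [hx.2]⟩, if_pos hx.2,
      Real.coe_toNNReal _ (by linarith), neg_neg]
  · rw [band_of_nonneg hy, stp, bandDesc, stripDesc_stripPt,
      Set.projIcc_of_mem _ ⟨by linarith [hx.2], by linarith [hx.1]⟩, Real.coe_toNNReal _ hy]
    rcases hx.2.eq_or_lt with rfl | h2
    · rw [if_pos (by norm_num), ← outer]
      congr 1; norm_num
    · rw [if_neg (by simp only [not_le]; linarith), Γ.flip_flip]
      congr 1; simp

theorem continuous_bandDesc {Y : Type*} [TopologicalSpace Y] {hΓ : Function.Surjective Γ.root}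
    {k : Γ.H → ℝ → ℝ → Y} {outer inner}
    (hk : ∀ h, ContinuousOn (fun p : ℝ × ℝ => k h p.1 p.2) (Set.Icc 0 (1 / 2) ×ˢ Set.univ)) :
    Continuous (O.bandDesc hΓ k outer inner) := by
  refine continuous_surface_iff.2 fun h => ?_
  have h1 : Continuous fun p : I × ℝ≥0 => k h (min p.1 (1 / 2)) (-p.2) :=
    (hk h).comp_continuous (f := fun p : I × ℝ≥0 => (min (p.1 : ℝ) (1 / 2), -(p.2 : ℝ)))
      (by fun_prop) fun p => ⟨⟨le_min p.1.2.1 (by norm_num), min_le_right _ _⟩, trivial⟩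
  have h2 : Continuous fun p : I × ℝ≥0 => k (Γ.flip h) (min (1 - p.1) (1 / 2)) p.2 :=
    (hk _).comp_continuous (f := fun p : I × ℝ≥0 => (min (1 - (p.1 : ℝ)) (1 / 2), (p.2 : ℝ)))
      (by fun_prop) fun p =>
      ⟨⟨le_min (by linarith [p.1.2.2]) (by norm_num), min_le_right _ _⟩, trivial⟩
  have h3 := Continuous.if_le h1 h2 (f := fun p : I × ℝ≥0 => (p.1 : ℝ)) (g := fun _ => 1 / 2)
    (by fun_prop) (by fun_prop) (fun p hp => by
      simp only [hp]
      rw [min_self, min_eq_right (by norm_num), ← outer, neg_neg])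
  convert h3 using 2 with p
  change (if (p.1 : ℝ) ≤ 1 / 2 then _ else _) = _
  split_ifs with hx
  · rw [min_eq_left hx]
  · rw [min_eq_left (by linarith)]

theorem exists_band (hΓ : Function.Surjective Γ.root) (p : O.Surface) :
    ∃ h x y, x ∈ Set.Icc (0 : ℝ) (1 / 2) ∧ p = O.band h x y := by
  obtain ⟨h, x, t, rfl⟩ := O.exists_stripPt hΓ p
  rw [stripPt_eq_stp]
  rcases le_total (x : ℝ) (1 / 2) with hx | hx
  · exact ⟨h, x, -t, ⟨x.2.1, hx⟩, by rw [band_of_nonpos (by simp), neg_neg]⟩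
  · refine ⟨Γ.flip h, 1 - x, t, ⟨by linarith [x.2.2], by linarith⟩, ?_⟩
    rw [band_of_nonneg (NNReal.coe_nonneg t), Γ.flip_flip, sub_sub_cancel]

theorem retr_stp (h : Γ.H) (x t : ℝ) :
    O.retr (O.stp h x t) = Γ.edgePt h (Set.projIcc 0 1 zero_le_one x) := rfl

theorem retr_band (h : Γ.H) (x y : ℝ) :
    O.retr (O.band h x y) = Γ.edgePt h (Set.projIcc 0 1 zero_le_one x) := by
  rcases le_total y 0 with hy | hy
  · rw [band_of_nonpos hy, retr_stp]
  · rw [band_of_nonneg hy, retr_stp, projIcc_one_sub, Γ.edgePt_flip]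

variable (O)

/-- Reversing all cyclic orders reflects the surface. -/
def reflectFun : O.op.Surface → O.Surface :=
  O.op.desc O.incl (fun h x t => O.stripPt (Γ.flip h) (σ x) t)
    (fun h t => by
      rw [unitInterval.symm_one, unitInterval.symm_zero, stripPt_one]
      congr 1
      simp [boundaryNext, op, Γ.flip_flip])
    (fun h x => by rw [stripPt_bottom, Γ.edgePt_flip])

theorem continuous_reflectFun : Continuous O.reflectFun :=
  continuous_surface_iff.2 fun h => (O.continuous_stripPt (Γ.flip h)).comp
    (f := fun p : I × ℝ≥0 => (σ p.1, p.2)) (by fun_prop)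

/-- The reflection homeomorphism between the surfaces of opposite ribbon structures. -/
def reflect : O.op.Surface ≃ₜ O.Surface where
  toFun := O.reflectFun
  invFun := O.desc O.op.incl (fun h x t => O.op.stripPt (Γ.flip h) (σ x) t)
    (fun h t => by
      rw [unitInterval.symm_one, unitInterval.symm_zero, stripPt_one]
      congr 1
      simp [boundaryNext, op, Γ.flip_flip])
    (fun h x => by rw [stripPt_bottom, Γ.edgePt_flip])
  left_inv p := by
    rcases O.op.surface_cases p with ⟨q, rfl⟩ | ⟨h, x, t, rfl⟩
    · rfl
    · change O.op.stripPt (Γ.flip (Γ.flip h)) (σ (σ x)) t = O.op.stripPt h x t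
      rw [Γ.flip_flip, unitInterval.symm_symm]
  right_inv p := by
    rcases O.surface_cases p with ⟨q, rfl⟩ | ⟨h, x, t, rfl⟩
    · rfl
    · change O.stripPt (Γ.flip (Γ.flip h)) (σ (σ x)) t = O.stripPt h x t
      rw [Γ.flip_flip, unitInterval.symm_symm]
  continuous_toFun := O.continuous_reflectFun
  continuous_invFun := continuous_surface_iff.2 fun h => (O.op.continuous_stripPt (Γ.flip h)).comp
    (f := fun p : I × ℝ≥0 => (σ p.1, p.2)) (by fun_prop)

theorem reflect_stripPt (h : Γ.H) (x : I) (t : ℝ≥0) :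
    O.reflect (O.op.stripPt h x t) = O.stripPt (Γ.flip h) (σ x) t := rfl

end RibbonStructure

/-! ### Winding numbers of maps between plane regions -/

/-- A continuous nonvanishing function on a convex open set has a continuous logarithm. -/
theorem exists_continuousOn_log {E : Type*} [NormedAddCommGroup E] [NormedSpace ℝ E] {C : Set E}
    (hC : Convex ℝ C) (hCo : IsOpen C) {f : E → ℂ} (hf : ContinuousOn f C)
    (h0 : ∀ x ∈ C, f x ≠ 0) : ∃ L : E → ℂ, ContinuousOn L C ∧ ∀ x ∈ C, Complex.exp (L x) = f x := by
  classical
  rcases C.eq_empty_or_nonempty with rfl | ⟨a, ha⟩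
  · exact ⟨0, by simp, by simp⟩
  have := hC.contractibleSpace ⟨a, ha⟩
  have := hCo.locallyPathConnectedSpace
  obtain ⟨L, ⟨-, hL⟩, -⟩ := Complex.isCoveringMapOn_exp.existsUnique_continuousMap_lifts
    (⟨C.domRestrict f, hf.domRestrict⟩ : C(C, ℂ)) (a₀ := ⟨a, ha⟩)
    (e₀ := Complex.log (f a)) (Complex.exp_log (h0 a ha)) (fun x => h0 x x.2)
  refine ⟨fun x => if hx : x ∈ C then L ⟨x, hx⟩ else 0, ?_, fun x hx => ?_⟩
  · rw [continuousOn_iff_continuous_domRestrict]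
    convert L.continuous using 1
    ext x
    simp [Set.domRestrict]
  · simpa [hx] using congrFun hL ⟨x, hx⟩

/-- A continuous function with `exp g = 1` on a connected space is a constant multiple of `2πi`. -/
theorem exists_int_of_exp_eq_one {X : Type*} [TopologicalSpace X] [PreconnectedSpace X]
    {g : X → ℂ} (hg : Continuous g) (h : ∀ x, Complex.exp (g x) = 1) :
    ∃ n : ℤ, ∀ x, g x = n * (2 * Real.pi * Complex.I) := by
  choose n hn using fun x => Complex.exp_eq_one_iff.1 (h x)
  have hc : Continuous n := by
    rw [Int.isClosedEmbedding_coe_real.isInducing.continuous_iff]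
    have : (fun x => (n x : ℝ)) = fun x => (g x).im / (2 * Real.pi) := by
      ext x
      rw [hn x, eq_div_iff (by positivity)]
      simp
    change Continuous fun x => (n x : ℝ)
    rw [this]
    exact (Complex.continuous_im.comp hg).div_const _
  rcases isEmpty_or_nonempty X with hX | ⟨⟨a⟩⟩
  · exact ⟨0, fun x => (hX.false x).elim⟩
  · exact ⟨n a, fun x => by rw [hn x, PreconnectedSpace.constant inferInstance hc]⟩

/-- The images of small positively oriented circles around `p` have winding number `d` around
the image of `p`. -/
def HasDegree (f : ℂ → ℂ) (p : ℂ) (d : ℤ) : Prop :=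
  ∀ᶠ r : ℝ in 𝓝[>] 0, ∃ L : ℝ → ℂ, Continuous L ∧
    (∀ t : ℝ, Complex.exp (L t) = f (p + r * Complex.exp (t * Complex.I)) - f p) ∧
    L (2 * Real.pi) - L 0 = d * (2 * Real.pi * Complex.I)

theorem preservesOrientationAt_iff {f : ℂ → ℂ} {p : ℂ} :
    PreservesOrientationAt f p ↔ HasDegree f p 1 := by
  simp [PreservesOrientationAt, HasDegree]

namespace HasDegree

theorem eventually_circle {P : ℂ → Prop} {p : ℂ} (h : ∀ᶠ z in 𝓝 p, P z) :
    ∀ᶠ r : ℝ in 𝓝[>] 0, ∀ t : ℝ, P (p + r * Complex.exp (t * Complex.I)) := by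
  obtain ⟨ε, hε, hP⟩ := Metric.eventually_nhds_iff.1 h
  filter_upwards [Ioo_mem_nhdsGT hε] with r hr t
  refine hP ?_
  rw [dist_eq_norm, add_sub_cancel_left, norm_mul, Complex.norm_exp_ofReal_mul_I, mul_one,
    Complex.norm_real, Real.norm_of_nonneg hr.1.le]
  exact hr.2

theorem congr {f g : ℂ → ℂ} {p : ℂ} {d : ℤ} (hf : HasDegree f p d) (h : f =ᶠ[𝓝 p] g) :
    HasDegree g p d := by
  filter_upwards [hf, eventually_circle h] with r ⟨L, hL, hL1, hL2⟩ hr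
  exact ⟨L, hL, fun t => by rw [hL1, hr t, h.self_of_nhds], hL2⟩

theorem unique {f : ℂ → ℂ} {p : ℂ} {d d' : ℤ} (h : HasDegree f p d) (h' : HasDegree f p d') :
    d = d' := by
  obtain ⟨r, ⟨L, hL, hL1, hL2⟩, L', hL', hL1', hL2'⟩ := (h.and h').exists
  obtain ⟨n, hn⟩ := exists_int_of_exp_eq_one (g := fun t => L t - L' t) (hL.sub hL') (fun t => by
    rw [Complex.exp_sub, hL1, ← hL1', div_self (Complex.exp_ne_zero _)])
  have h2 := (hn (2 * Real.pi)).trans (hn 0).symm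
  have h3 : (d : ℂ) * (2 * Real.pi * Complex.I) = d' * (2 * Real.pi * Complex.I) := by
    rw [← hL2, ← hL2']; linear_combination h2
  exact_mod_cast mul_right_cancel₀ Complex.two_pi_I_ne_zero h3

theorem of_log {f : ℂ → ℂ} {p c : ℂ} {d : ℤ}
    (hf : ∀ z, f (p + z) - f p = Complex.exp c * z ∧ d = 1 ∨
      f (p + z) - f p = Complex.exp c * (starRingEnd ℂ) z ∧ d = -1) : HasDegree f p d := by
  filter_upwards [self_mem_nhdsWithin] with r hr
  have hr : (0 : ℝ) < r := hr
  refine ⟨fun t => c + Real.log r + d * (t * Complex.I), by fun_prop, fun t => ?_, by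
    push_cast; ring⟩
  rw [Complex.exp_add, Complex.exp_add, ← Complex.ofReal_exp, Real.exp_log hr]
  rcases hf (r * Complex.exp (t * Complex.I)) with ⟨h, rfl⟩ | ⟨h, rfl⟩
  · rw [h]; push_cast; rw [one_mul]; ring
  · rw [h, map_mul, ← Complex.exp_conj, map_mul, Complex.conj_ofReal, Complex.conj_I,
      Complex.conj_ofReal]
    push_cast
    rw [mul_neg, neg_one_mul]; ring

theorem id (p : ℂ) : HasDegree (fun z => z) p 1 :=
  of_log (c := 0) fun z => Or.inl ⟨by simp, rfl⟩

theorem sub_const (p c : ℂ) : HasDegree (fun z => z - c) p 1 :=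
  of_log (c := 0) fun z => Or.inl ⟨by simp, rfl⟩

theorem const_sub (p c : ℂ) : HasDegree (fun z => c - z) p 1 :=
  of_log (c := Real.pi * Complex.I) fun z => Or.inl ⟨by rw [Complex.exp_pi_mul_I]; ring, rfl⟩

theorem const_sub_conj (p c : ℂ) : HasDegree (fun z => c - (starRingEnd ℂ) z) p (-1) :=
  of_log (c := Real.pi * Complex.I) fun z =>
    Or.inr ⟨by rw [Complex.exp_pi_mul_I, map_add]; ring, rfl⟩

/-- The parameters `(q, r, θ)` of the points at angle `θ` on the circles with centre `q` and
radius `r` in a disk; the angle is not reduced modulo `2π`, which makes this a convex set. -/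
def circles (p : ℂ) (R : ℝ) : Set (ℂ × ℝ × ℝ) := {x | dist x.1 p + x.2.1 < R ∧ 0 < x.2.1}

theorem convex_circles (p : ℂ) (R : ℝ) : Convex ℝ (circles p R) := by
  have h1 : ConvexOn ℝ Set.univ fun x : ℂ × ℝ × ℝ => dist x.1 p + x.2.1 := by
    refine ConvexOn.add ?_ ?_
    · exact (convexOn_univ_dist p).comp_linearMap (LinearMap.fst ℝ ℂ (ℝ × ℝ))
    · exact ((LinearMap.fst ℝ ℝ ℝ).comp (LinearMap.snd ℝ ℂ (ℝ × ℝ))).convexOn convex_univ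
  have h2 : ConcaveOn ℝ Set.univ fun x : ℂ × ℝ × ℝ => x.2.1 :=
    ((LinearMap.fst ℝ ℝ ℝ).comp (LinearMap.snd ℝ ℂ (ℝ × ℝ))).concaveOn convex_univ
  have := (h1.convex_lt R).inter (h2.convex_gt 0)
  simpa [circles, Set.ext_iff, Set.ofPred_and] using this

theorem isOpen_circles (p : ℂ) (R : ℝ) : IsOpen (circles p R) :=
  (isOpen_lt (f := fun x : ℂ × ℝ × ℝ => dist x.1 p + x.2.1) (by fun_prop) continuous_const).inter
    (isOpen_lt (g := fun x : ℂ × ℝ × ℝ => x.2.1) continuous_const (by fun_prop))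

/-- An injective continuous map on a disk has a logarithm of `f (q + r exp (i θ)) - f q`
depending continuously on the circle, and hence a degree that is the same at all points. -/
theorem exists_log {f : ℂ → ℂ} {p : ℂ} {R : ℝ} (hf : ContinuousOn f (Metric.ball p R))
    (hi : Set.InjOn f (Metric.ball p R)) : ∃ (d : ℤ) (L : ℂ × ℝ × ℝ → ℂ),
      ContinuousOn L (circles p R) ∧
      (∀ x ∈ circles p R, Complex.exp (L x) =
        f (x.1 + x.2.1 * Complex.exp (x.2.2 * Complex.I)) - f x.1) ∧
      (∀ x ∈ circles p R, ∀ m : ℤ, L (x.1, x.2.1, x.2.2 + m * (2 * Real.pi)) =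
        L x + m * (d * (2 * Real.pi * Complex.I))) ∧
      ∀ q ∈ Metric.ball p R, HasDegree f q d := by
  have hm1 : ∀ x ∈ circles p R, x.1 ∈ Metric.ball p R := fun x hx => by
    rw [Metric.mem_ball]; linarith [hx.1, hx.2]
  have hm2 : ∀ x ∈ circles p R,
      x.1 + x.2.1 * Complex.exp (x.2.2 * Complex.I) ∈ Metric.ball p R := fun x hx => by
    have h1 : dist (x.1 + x.2.1 * Complex.exp (x.2.2 * Complex.I)) x.1 = x.2.1 := by
      rw [dist_eq_norm, add_sub_cancel_left, norm_mul, Complex.norm_exp_ofReal_mul_I, mul_one,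
        Complex.norm_real, Real.norm_of_nonneg hx.2.le]
    rw [Metric.mem_ball]
    have := dist_triangle (x.1 + x.2.1 * Complex.exp (x.2.2 * Complex.I)) x.1 p
    linarith [hx.1]
  -- the parameter space is convex, so that there is a logarithm on all circles at once
  obtain ⟨L, hL, hL1⟩ := exists_continuousOn_log (convex_circles p R) (isOpen_circles p R)
    (f := fun x => f (x.1 + x.2.1 * Complex.exp (x.2.2 * Complex.I)) - f x.1)
    ((hf.comp (by fun_prop) hm2).sub (hf.comp (by fun_prop) hm1)) (fun x hx h0 => by
      have := hi (hm2 x hx) (hm1 x hx) (sub_eq_zero.1 h0)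
      simp [hx.2.ne'] at this)
  have hper : ∀ x ∈ circles p R, (x.1, x.2.1, x.2.2 + 2 * Real.pi) ∈ circles p R :=
    fun x hx => hx
  have : PreconnectedSpace (circles p R) :=
    isPreconnected_iff_preconnectedSpace.1 (convex_circles p R).isPreconnected
  -- the increment of the logarithm along a full circle does not depend on the circle
  obtain ⟨d, hd⟩ := exists_int_of_exp_eq_one (X := circles p R)
    (g := fun x : circles p R => L (x.1.1, x.1.2.1, x.1.2.2 + 2 * Real.pi) - L x)
    ((hL.comp_continuous (f := fun x : circles p R => (x.1.1, x.1.2.1, x.1.2.2 + 2 * Real.pi))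
      (by fun_prop) fun x => hper x.1 x.2).sub
      (hL.comp_continuous continuous_subtype_val fun x : circles p R => x.2)) (fun x => by
      rw [Complex.exp_sub, hL1 _ (hper x x.2), hL1 _ x.2]
      have : Complex.exp (((x.1.2.2 + 2 * Real.pi : ℝ) : ℂ) * Complex.I)
          = Complex.exp (x.1.2.2 * Complex.I) := by
        push_cast
        rw [add_mul, Complex.exp_add, Complex.exp_two_pi_mul_I, mul_one]
      simp only [this]
      rw [← hL1 _ x.2, div_self (Complex.exp_ne_zero _)])
  have hstep : ∀ x ∈ circles p R, L (x.1, x.2.1, x.2.2 + 2 * Real.pi) =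
      L x + d * (2 * Real.pi * Complex.I) := fun x hx => by
    linear_combination hd ⟨x, hx⟩
  refine ⟨d, L, hL, hL1, fun x hx m => ?_, fun q hq => ?_⟩
  swap
  · have hq' : 0 < R - dist q p := by rw [Metric.mem_ball] at hq; linarith
    filter_upwards [Ioo_mem_nhdsGT hq'] with r hr
    have hm : ∀ t : ℝ, ((q, r, t) : ℂ × ℝ × ℝ) ∈ circles p R := fun t =>
      ⟨by have := hr.2; simp only; linarith, hr.1⟩
    refine ⟨fun t => L (q, r, t), hL.comp_continuous (by fun_prop) hm, fun t => hL1 _ (hm t), ?_⟩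
    have := hstep _ (hm 0)
    rw [zero_add] at this
    simp only [this, add_sub_cancel_left]
  induction m with
  | zero => simp
  | succ m ih =>
    have := hstep (x.1, x.2.1, x.2.2 + (m : ℤ) * (2 * Real.pi)) hx
    rw [ih] at this
    convert this using 1
    · simp only [Int.cast_add, Int.cast_one]
      congr 3; ring
    · push_cast; ring
  | pred m ih =>
    have := hstep (x.1, x.2.1, x.2.2 + (-m - 1 : ℤ) * (2 * Real.pi)) hx
    have h2 : x.2.2 + (-m - 1 : ℤ) * (2 * Real.pi) + 2 * Real.pi
        = x.2.2 + (-m : ℤ) * (2 * Real.pi) := by push_cast; ring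
    simp only [h2] at this
    rw [ih] at this
    push_cast at this ⊢
    linear_combination -this

/-- Degrees multiply under composition. -/
theorem comp {f : ℂ → ℂ} {p : ℂ} {d d' : ℤ} (hf : HasDegree f p d) (hfc : ContinuousAt f p)
    {g : OpenPartialHomeomorph ℂ ℂ} (hp : f p ∈ g.source) (hg : HasDegree g (f p) d') :
    HasDegree (fun z => g (f z)) p (d * d') := by
  obtain ⟨R, hR, hRs⟩ := Metric.isOpen_iff.1 g.open_source _ hp
  obtain ⟨d₁, L, hL, hL1, hL2, hd₁⟩ := exists_log (g.continuousOn.mono hRs) (g.injOn.mono hRs)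
  obtain rfl := (hd₁ _ (Metric.mem_ball_self hR)).unique hg
  filter_upwards [hf, eventually_circle (hfc.eventually (Metric.ball_mem_nhds _ hR))] with
    r ⟨M, hM, hM1, hM2⟩ hr
  have hm : ∀ t : ℝ, ((f p, Real.exp (M t).re, (M t).im) : ℂ × ℝ × ℝ) ∈ circles (f p) R :=
    fun t => by
      refine ⟨?_, Real.exp_pos _⟩
      have := hr t
      rw [dist_eq_norm, ← hM1, Complex.norm_exp] at this
      simpa using this
  -- the image curve has polar coordinates `exp (M t).re` and `(M t).im` around `f p`
  refine ⟨fun t => L (f p, Real.exp (M t).re, (M t).im), hL.comp_continuous (by fun_prop) hm,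
    fun t => ?_, ?_⟩
  · rw [hL1 _ (hm t)]
    have : ((Real.exp (M t).re : ℝ) : ℂ) * Complex.exp ((M t).im * Complex.I)
        = f (p + r * Complex.exp (t * Complex.I)) - f p := by
      rw [← hM1 t, Complex.ofReal_exp, ← Complex.exp_add, Complex.re_add_im]
    simp only [this, add_sub_cancel]
  · have h1 : M (2 * Real.pi) = M 0 + d * (2 * Real.pi * Complex.I) := by
      linear_combination hM2
    have hre : (M (2 * Real.pi)).re = (M 0).re := by rw [h1]; simp
    have him : (M (2 * Real.pi)).im = (M 0).im + d * (2 * Real.pi) := by rw [h1]; simp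
    have := hL2 _ (hm 0) d
    simp only at this ⊢
    rw [hre, him, this]
    push_cast; ring

/-- A homeomorphism between plane regions has locally constant degree `1` or `-1`. -/
theorem exists_sign (φ : OpenPartialHomeomorph ℂ ℂ) {p : ℂ} (hp : p ∈ φ.source) :
    ∃ d : ℤ, (d = 1 ∨ d = -1) ∧ ∀ᶠ q in 𝓝 p, HasDegree φ q d := by
  obtain ⟨R, hR, hRs⟩ := Metric.isOpen_iff.1 φ.open_source _ hp
  obtain ⟨d, -, -, -, -, hd⟩ := exists_log (φ.continuousOn.mono hRs) (φ.injOn.mono hRs)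
  obtain ⟨R', hR', hRs'⟩ := Metric.isOpen_iff.1 φ.open_target _ (φ.map_source hp)
  obtain ⟨d', -, -, -, -, hd'⟩ := exists_log (φ.symm.continuousOn.mono hRs')
      (φ.symm.injOn.mono hRs')
  refine ⟨d, ?_, Filter.eventually_of_mem (Metric.ball_mem_nhds p hR) hd⟩
  have h := (hd p (Metric.mem_ball_self hR)).comp (φ.continuousAt hp) (g := φ.symm)
    (φ.map_source hp) (hd' _ (Metric.mem_ball_self hR'))
  have h1 : d * d' = 1 := (h.congr (φ.eventually_left_inverse hp)).unique (HasDegree.id p)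
  exact Int.isUnit_iff.1 (IsUnit.of_mul_eq_one _ h1)

end HasDegree

/-! ### Local degrees of maps from the plane to an oriented surface -/

section LocalDegree

variable {S : Type*} [TopologicalSpace S] [ChartedSpace ℂ S]

/-- A map from a plane region to a surface has degree `d` at `z`, in all charts. -/
def HasLocalDegree (f : ℂ → S) (z : ℂ) (d : ℤ) : Prop :=
  ∀ e ∈ atlas ℂ S, f z ∈ e.source → HasDegree (fun y => e (f y)) z d

theorem HasLocalDegree.unique {f : ℂ → S} {z : ℂ} {d d' : ℤ} (h : HasLocalDegree f z d)
    (h' : HasLocalDegree f z d') : d = d' :=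
  (h _ (chart_mem_atlas ℂ (f z)) (mem_chart_source ℂ (f z))).unique
    (h' _ (chart_mem_atlas ℂ (f z)) (mem_chart_source ℂ (f z)))

theorem HasLocalDegree.congr {f g : ℂ → S} {z : ℂ} {d : ℤ} (h : HasLocalDegree f z d)
    (hfg : f =ᶠ[𝓝 z] g) : HasLocalDegree g z d := fun e he hz =>
  (h e he (by rwa [hfg.self_of_nhds])).congr (hfg.fun_comp e)

theorem HasLocalDegree.comp {f : OpenPartialHomeomorph ℂ S} {T : ℂ → ℂ} {z : ℂ} {d d' : ℤ}
    (hz : T z ∈ f.source) (hf : HasLocalDegree f (T z) d) (hT : HasDegree T z d')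
    (hTc : ContinuousAt T z) : HasLocalDegree (fun y => f (T y)) z (d' * d) := fun e he hz' =>
  hT.comp hTc (g := f.trans e) (by simp [hz, hz']) (hf e he hz')

/-- An open embedding of a connected plane region into an oriented surface either preserves or
reverses the orientation. -/
theorem exists_hasLocalDegree (hS : IsOrientedAtlas S) (f : OpenPartialHomeomorph ℂ S)
    (hf : IsPreconnected f.source) :
    ∃ d : ℤ, (d = 1 ∨ d = -1) ∧ ∀ z ∈ f.source, HasLocalDegree f z d := by
  have hloc : ∀ z ∈ f.source, ∃ d : ℤ, (d = 1 ∨ d = -1) ∧ ∀ᶠ q in 𝓝 z, HasLocalDegree f q d := by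
    intro z hz
    set e₀ := chartAt ℂ (f z)
    have hz' : z ∈ (f.trans e₀).source := by simp [hz, e₀]
    obtain ⟨d, hd, hq⟩ := HasDegree.exists_sign (f.trans e₀) hz'
    refine ⟨d, hd, ?_⟩
    filter_upwards [hq, (f.trans e₀).open_source.mem_nhds hz'] with q hq hqs e he hqe
    have hq1 : q ∈ f.source ∧ f q ∈ e₀.source := by simpa using hqs
    have hq2 : e₀ (f q) ∈ (e₀.symm.trans e).source := by
      simp [hq1.2, hqe]
    have h1 := preservesOrientationAt_iff.1 (hS e₀ (chart_mem_atlas ℂ _) e he _ hq2)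
    have h2 := hq.comp ((f.trans e₀).continuousAt hqs) (g := e₀.symm.trans e) hq2 h1
    rw [mul_one] at h2
    refine h2.congr ?_
    filter_upwards [(f.trans e₀).open_source.mem_nhds hqs] with y hy
    have hy1 : y ∈ f.source ∧ f y ∈ e₀.source := by simpa using hy
    simp [hy1.2]
  have hopen : ∀ d : ℤ, IsOpen {z | ∀ᶠ q in 𝓝 z, HasLocalDegree f q d} := fun d =>
    isOpen_iff_mem_nhds.2 fun z hz => Filter.Eventually.eventually_nhds hz
  have hdisj : Disjoint {z | ∀ᶠ q in 𝓝 z, HasLocalDegree f q 1}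
      {z | ∀ᶠ q in 𝓝 z, HasLocalDegree f q (-1)} := by
    rw [Set.disjoint_left]
    intro z h1 h2
    exact absurd (h1.self_of_nhds.unique h2.self_of_nhds) (by norm_num)
  have hcov : f.source ⊆ {z | ∀ᶠ q in 𝓝 z, HasLocalDegree f q 1} ∪
      {z | ∀ᶠ q in 𝓝 z, HasLocalDegree f q (-1)} := by
    intro z hz
    obtain ⟨d, rfl | rfl, hd⟩ := hloc z hz
    · exact Or.inl hd
    · exact Or.inr hd
  rcases hf.subset_or_subset (hopen 1) (hopen (-1)) hdisj hcov with h | h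
  · exact ⟨1, Or.inl rfl, fun z hz => (h hz).self_of_nhds⟩
  · exact ⟨-1, Or.inr rfl, fun z hz => (h hz).self_of_nhds⟩

end LocalDegree

/-! ### Charts of the surface of a ribbon graph -/

/-- An open embedding of a plane region `U`, from a bump function `b` supported on its image and
the product `c` of `b` with the inverse map. -/
def chartOfBump {X : Type*} [TopologicalSpace X] (f : ℂ → X) (U : Set ℂ) (b : X → ℝ) (c : X → ℂ)
    (hU : IsOpen U) (hf : ContinuousOn f U) (hb : Continuous b) (hc : Continuous c)
    (h1 : ∀ z ∈ U, 0 < b (f z) ∧ c (f z) = b (f z) * z) (h2 : ∀ p, 0 < b p → ∃ z ∈ U, f z = p) :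
    OpenPartialHomeomorph ℂ X where
  toFun := f
  invFun p := c p / b p
  source := U
  target := {p | 0 < b p}
  map_source' z hz := (h1 z hz).1
  map_target' p hp := by
    obtain ⟨z, hz, rfl⟩ := h2 p hp
    rwa [(h1 z hz).2, mul_div_cancel_left₀ _ (Complex.ofReal_ne_zero.2 (h1 z hz).1.ne')]
  left_inv' z hz := by
    rw [(h1 z hz).2, mul_div_cancel_left₀ _ (Complex.ofReal_ne_zero.2 (h1 z hz).1.ne')]
  right_inv' p hp := by
    obtain ⟨z, hz, rfl⟩ := h2 p hp
    rw [(h1 z hz).2, mul_div_cancel_left₀ _ (Complex.ofReal_ne_zero.2 (h1 z hz).1.ne')]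
  open_source := hU
  open_target := isOpen_lt continuous_const hb
  continuousOn_toFun := hf
  continuousOn_invFun := hc.continuousOn.div (Complex.continuous_ofReal.comp hb).continuousOn
    fun p hp => Complex.ofReal_ne_zero.2 (ne_of_gt hp)

namespace RibbonStructure

variable {Γ : Graph} (O : RibbonStructure Γ)

theorem coe_projIcc_unit {x : ℝ} (hx : x ∈ Set.Icc (0 : ℝ) 1) :
    ((Set.projIcc 0 1 zero_le_one x : I) : ℝ) = x := by rw [Set.projIcc_of_mem _ hx]

theorem strip_eq_stp (h : Γ.H) (z : ℂ) : O.strip h z = O.stp h z.re (-z.im) := rfl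

section Charts

open Classical

variable (hΓ : Function.Surjective Γ.root)

/-- A bump function on the union of the two strips along an edge. -/
def edgeBump (h : Γ.H) : O.Surface → ℝ :=
  O.stripDesc hΓ (fun k x _ => if k = h ∨ k = Γ.flip h then (x : ℝ) * (1 - x) else 0)
    (fun k t => by simp) (fun k x => by
      have : (Γ.flip k = h ∨ Γ.flip k = Γ.flip h) ↔ (k = h ∨ k = Γ.flip h) := by
        rw [Γ.flip_injective.eq_iff, or_comm]
        exact or_congr_right ⟨fun e => by rw [← e, Γ.flip_flip], fun e => by rw [e, Γ.flip_flip]⟩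
      simp only [this, unitInterval.coe_symm_eq]
      split_ifs <;> ring)

/-- The plane coordinate on the union of the two strips along an edge, multiplied by the bump
function. -/
def edgeCoord (h : Γ.H) : O.Surface → ℂ :=
  O.stripDesc hΓ (fun k x t =>
      if k = h then ((x : ℝ) * (1 - x) : ℝ) * ((x : ℝ) - (t : ℝ) * Complex.I : ℂ) else
      if k = Γ.flip h then ((x : ℝ) * (1 - x) : ℝ) * ((1 - x : ℝ) + (t : ℝ) * Complex.I : ℂ) else 0)
    (fun k t => by simp) (fun k x => by
      have h1 : (Γ.flip k = h) ↔ (k = Γ.flip h) :=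
        ⟨fun e => by rw [← e, Γ.flip_flip], fun e => by rw [e, Γ.flip_flip]⟩
      have h2 : (Γ.flip k = Γ.flip h) ↔ k = h := Γ.flip_injective.eq_iff
      have h3 := Γ.flip_ne h
      simp only [h1, h2, unitInterval.coe_symm_eq]
      by_cases e : k = Γ.flip h
      · subst e; simp only [h3, if_true, if_false]; push_cast; ring
      · by_cases e' : k = h
        · subst e'; simp only [h3.symm, if_true, if_false]; push_cast; ring
        · simp [e, e'])

theorem edgeBump_stp (h k : Γ.H) {x t : ℝ} (hx : x ∈ Set.Icc (0 : ℝ) 1) :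
    O.edgeBump hΓ h (O.stp k x t) = if k = h ∨ k = Γ.flip h then x * (1 - x) else 0 := by
  change (if k = h ∨ k = Γ.flip h then ((Set.projIcc 0 1 zero_le_one x : I) : ℝ) *
    (1 - ((Set.projIcc 0 1 zero_le_one x : I) : ℝ)) else 0) = _
  rw [coe_projIcc_unit hx]

theorem edgeCoord_stp (h k : Γ.H) {x t : ℝ} (hx : x ∈ Set.Icc (0 : ℝ) 1) (ht : 0 ≤ t) :
    O.edgeCoord hΓ h (O.stp k x t) =
      if k = h then (x * (1 - x) : ℝ) * (x - t * Complex.I : ℂ) else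
      if k = Γ.flip h then (x * (1 - x) : ℝ) * ((1 - x : ℝ) + t * Complex.I : ℂ) else 0 := by
  have h1 := coe_projIcc_unit hx
  have h2 := Real.coe_toNNReal _ ht
  simp only [edgeCoord, stp, stripDesc_stripPt, h1, h2]

theorem continuous_edgeBump (h : Γ.H) : Continuous (O.edgeBump hΓ h) :=
  continuous_surface_iff.2 fun k => by
    change Continuous fun p : I × ℝ≥0 => if k = h ∨ k = Γ.flip h then (p.1 : ℝ) * (1 - p.1) else 0
    split_ifs <;> fun_prop

theorem continuous_edgeCoord (h : Γ.H) : Continuous (O.edgeCoord hΓ h) :=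
  continuous_surface_iff.2 fun k => by
    change Continuous fun p : I × ℝ≥0 => if k = h
      then ((p.1 : ℝ) * (1 - p.1) : ℝ) * ((p.1 : ℝ) - (p.2 : ℝ) * Complex.I : ℂ) else
      if k = Γ.flip h then
        ((p.1 : ℝ) * (1 - p.1) : ℝ) * ((1 - p.1 : ℝ) + (p.2 : ℝ) * Complex.I : ℂ) else 0
    split_ifs <;> fun_prop

/-- The union of the two strips along the edge `h`, as the image of the region `0 < Re z < 1` of
the plane. -/
def edgeChart (h : Γ.H) : OpenPartialHomeomorph ℂ O.Surface :=
  chartOfBump (fun z => O.band h z.re z.im) {z | 0 < z.re ∧ z.re < 1} (O.edgeBump hΓ h)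
    (O.edgeCoord hΓ h)
    ((isOpen_lt continuous_const Complex.continuous_re).inter
      (isOpen_lt Complex.continuous_re continuous_const))
    ((O.continuous_band h).comp
      (f := fun z : ℂ => (z.re, z.im)) (by fun_prop)).continuousOn
    (O.continuous_edgeBump hΓ h)
    (O.continuous_edgeCoord hΓ h)
    (fun z hz => by
      rcases le_total z.im 0 with hy | hy
      · rw [band_of_nonpos hy, edgeBump_stp _ _ _ _ ⟨hz.1.le, hz.2.le⟩,
          edgeCoord_stp _ _ _ _ ⟨hz.1.le, hz.2.le⟩ (neg_nonneg.2 hy), if_pos (Or.inl rfl),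
          if_pos rfl]
        refine ⟨mul_pos hz.1 (sub_pos.2 hz.2), ?_⟩
        congr 1
        apply Complex.ext <;> simp
      · have hx : 1 - z.re ∈ Set.Icc (0 : ℝ) 1 := ⟨sub_nonneg.2 hz.2.le, by simpa using hz.1.le⟩
        rw [band_of_nonneg hy, edgeBump_stp _ _ _ _ hx, edgeCoord_stp _ _ _ _ hx hy,
          if_pos (Or.inr rfl), if_neg (Γ.flip_ne h), if_pos rfl]
        refine ⟨mul_pos (sub_pos.2 hz.2) (by simpa using hz.1), ?_⟩
        congr 1
        apply Complex.ext <;> simp)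
    (fun p hp => by
      obtain ⟨k, x, t, rfl⟩ := O.exists_stripPt hΓ p
      simp only [edgeBump, stripDesc_stripPt] at hp
      split_ifs at hp with hk
      · have hx0 : 0 < (x : ℝ) := lt_of_le_of_ne x.2.1 fun e => by simp [← e] at hp
        have hx1 : (x : ℝ) < 1 := lt_of_le_of_ne x.2.2 fun e => by simp [e] at hp
        rcases hk with rfl | rfl
        · refine ⟨⟨x, -t⟩, ⟨hx0, hx1⟩, ?_⟩
          rw [band_of_nonpos (by simp), neg_neg, stripPt_eq_stp]
        · refine ⟨⟨1 - x, t⟩, ⟨sub_pos.2 hx1, by simpa using hx0⟩, ?_⟩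
          rw [band_of_nonneg (NNReal.coe_nonneg t), sub_sub_cancel, stripPt_eq_stp]
      · exact absurd hp (lt_irrefl _))

/-- A bump function around the common side of the strips of `h` and its successor. -/
def sideBump (h : Γ.H) : O.Surface → ℝ :=
  O.desc (fun _ => 0) (fun k x t => (if k = h then max ((x : ℝ) - 1 / 2) 0 * t else 0) +
      if k = O.boundaryNext h then max (1 / 2 - (x : ℝ)) 0 * t else 0)
    (fun k t => by
      have : (O.boundaryNext k = O.boundaryNext h) ↔ k = h := by
        simp [boundaryNext, Γ.flip_injective.eq_iff]
      simp only [this]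
      norm_num) (fun k x => by simp)

/-- The plane coordinate around the common side of the strips of `h` and its successor,
multiplied by the bump function. -/
def sideCoord (h : Γ.H) : O.Surface → ℂ :=
  O.desc (fun _ => 0) (fun k x t =>
      (if k = h then (max ((x : ℝ) - 1 / 2) 0 * t : ℝ) * ((x : ℝ) - (t : ℝ) * Complex.I : ℂ)
        else 0) +
      if k = O.boundaryNext h then
        (max (1 / 2 - (x : ℝ)) 0 * t : ℝ) * ((x + 1 : ℝ) - (t : ℝ) * Complex.I : ℂ) else 0)
    (fun k t => by
      have : (O.boundaryNext k = O.boundaryNext h) ↔ k = h := by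
        simp [boundaryNext, Γ.flip_injective.eq_iff]
      simp only [this]
      norm_num) (fun k x => by simp)

theorem sideBump_stp (h k : Γ.H) {x t : ℝ} (hx : x ∈ Set.Icc (0 : ℝ) 1) (ht : 0 ≤ t) :
    O.sideBump h (O.stp k x t) = (if k = h then max (x - 1 / 2) 0 * t else 0) +
      if k = O.boundaryNext h then max (1 / 2 - x) 0 * t else 0 := by
  have h1 := coe_projIcc_unit hx
  have h2 := Real.coe_toNNReal _ ht
  simp only [sideBump, stp, desc_stripPt, h1, h2]

theorem sideCoord_stp (h k : Γ.H) {x t : ℝ} (hx : x ∈ Set.Icc (0 : ℝ) 1) (ht : 0 ≤ t) :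
    O.sideCoord h (O.stp k x t) =
      (if k = h then (max (x - 1 / 2) 0 * t : ℝ) * (x - t * Complex.I : ℂ) else 0) +
      if k = O.boundaryNext h then
        (max (1 / 2 - x) 0 * t : ℝ) * ((x + 1 : ℝ) - t * Complex.I : ℂ) else 0 := by
  have h1 := coe_projIcc_unit hx
  have h2 := Real.coe_toNNReal _ ht
  simp only [sideCoord, stp, desc_stripPt, h1, h2]

theorem continuous_sideBump (h : Γ.H) : Continuous (O.sideBump h) :=
  continuous_surface_iff.2 fun k => by
    change Continuous fun p : I × ℝ≥0 => (if k = h then max ((p.1 : ℝ) - 1 / 2) 0 *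
        (p.2 : ℝ) else 0) +
      if k = O.boundaryNext h then max (1 / 2 - (p.1 : ℝ)) 0 * (p.2 : ℝ) else 0
    split_ifs <;> fun_prop

theorem continuous_sideCoord (h : Γ.H) : Continuous (O.sideCoord h) :=
  continuous_surface_iff.2 fun k => by
    change Continuous fun p : I × ℝ≥0 => (if k = h then
        (max ((p.1 : ℝ) - 1 / 2) 0 * p.2 : ℝ) * ((p.1 : ℝ) - (p.2 : ℝ) * Complex.I : ℂ) else 0) +
      if k = O.boundaryNext h then
        (max (1 / 2 - (p.1 : ℝ)) 0 * p.2 : ℝ) * ((p.1 + 1 : ℝ) - (p.2 : ℝ) * Complex.I : ℂ) else 0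
    split_ifs <;> fun_prop

/-- A neighbourhood of the common side of the strips of `h` and its successor, as the image of
the region `1 / 2 < Re z < 3 / 2`, `Im z < 0` of the plane. -/
def sideChart (h : Γ.H) : OpenPartialHomeomorph ℂ O.Surface :=
  chartOfBump (fun z => if z.re ≤ 1 then O.stp h z.re (-z.im) else
      O.stp (O.boundaryNext h) (z.re - 1) (-z.im))
    {z | 1 / 2 < z.re ∧ z.re < 3 / 2 ∧ z.im < 0} (O.sideBump h) (O.sideCoord h)
    ((isOpen_lt continuous_const Complex.continuous_re).inter
      ((isOpen_lt Complex.continuous_re continuous_const).inter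
        (isOpen_lt Complex.continuous_im continuous_const)))
    (Continuous.if_le
      ((O.continuous_stp _).comp (f := fun z : ℂ => (z.re, -z.im)) (by fun_prop))
      ((O.continuous_stp _).comp (f := fun z : ℂ => (z.re - 1, -z.im)) (by fun_prop))
      Complex.continuous_re continuous_const (fun z hz => by
        change O.stp h z.re _ = O.stp _ (z.re - 1) _
        rw [hz, sub_self, stp_one])).continuousOn
    (O.continuous_sideBump h)
    (O.continuous_sideCoord h)
    (fun z ⟨hz1, hz2, hz3⟩ => by
      have e3 : z = z.re - (-z.im : ℝ) * Complex.I := by apply Complex.ext <;> simp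
      have ht : 0 ≤ -z.im := by linarith
      by_cases hx : z.re ≤ 1
      · have hx' : z.re ∈ Set.Icc (0 : ℝ) 1 := ⟨by linarith, hx⟩
        have e1 : max (z.re - 1 / 2) 0 = z.re - 1 / 2 := max_eq_left (by linarith)
        have e2 : max (1 / 2 - z.re) 0 = 0 := max_eq_right (by linarith)
        rw [if_pos hx, sideBump_stp _ _ _ hx' ht, sideCoord_stp _ _ _ hx' ht, e1, e2, if_pos rfl,
          if_pos rfl]
        refine ⟨by simpa using mul_pos (sub_pos.2 hz1) (neg_pos.2 hz3), ?_⟩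
        rw [← e3]
        simp
      · push Not at hx
        have hx' : z.re - 1 ∈ Set.Icc (0 : ℝ) 1 := ⟨by linarith, by linarith⟩
        have e1 : max (z.re - 1 - 1 / 2) 0 = 0 := max_eq_right (by linarith)
        have e2 : max (1 / 2 - (z.re - 1)) 0 = 1 / 2 - (z.re - 1) := max_eq_left (by linarith)
        rw [if_neg (not_le.2 hx), sideBump_stp _ _ _ hx' ht, sideCoord_stp _ _ _ hx' ht, e1, e2,
          if_pos (c := O.boundaryNext h = O.boundaryNext h) rfl,
          if_pos (c := O.boundaryNext h = O.boundaryNext h) rfl, sub_add_cancel, ← e3]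
        refine ⟨?_, by simp⟩
        have := mul_pos (a := 1 / 2 - (z.re - 1)) (by linarith) (neg_pos.2 hz3)
        simpa using this)
    (fun p hp => by
      rcases O.surface_cases p with ⟨q, rfl⟩ | ⟨k, x, t, rfl⟩
      · exact absurd hp (lt_irrefl _)
      · change 0 < (if k = h then max ((x : ℝ) - 1 / 2) 0 * (t : ℝ) else 0) +
          (if k = O.boundaryNext h then max (1 / 2 - (x : ℝ)) 0 * (t : ℝ) else 0) at hp
        have ht : 0 < (t : ℝ) := lt_of_le_of_ne t.2 fun e => by simp [← e] at hp
        have hm1 : ∀ a : ℝ, 0 < max a 0 * t → 0 < a := fun a ha => by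
          by_contra hn
          rw [max_eq_right (not_lt.1 hn), zero_mul] at ha
          exact lt_irrefl _ ha
        have hm2 : ∀ a : ℝ, 0 ≤ max a 0 * (t : ℝ) := fun a => by positivity
        by_cases hx : (1 : ℝ) / 2 < x
        · have : max (1 / 2 - (x : ℝ)) 0 = 0 := max_eq_right (by linarith)
          rw [this] at hp
          have hk : k = h := by
            by_contra hk
            simp [hk] at hp
          subst hk
          refine ⟨⟨x, -t⟩, ⟨hx, by have := x.2.2; simp only; linarith, by simpa using ht⟩, ?_⟩
          rw [if_pos x.2.2, neg_neg, stripPt_eq_stp]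
        · have : max ((x : ℝ) - 1 / 2) 0 = 0 := max_eq_right (by linarith)
          rw [this] at hp
          have hk : k = O.boundaryNext h := by
            by_contra hk
            simp [hk] at hp
          subst hk
          have hx2 : (x : ℝ) < 1 / 2 := by
            have := hm1 (1 / 2 - x) (by simpa using hp)
            linarith
          refine ⟨⟨x + 1, -t⟩, ⟨by have := x.2.1; simp only; linarith, by simp only; linarith,
            by simpa using ht⟩, ?_⟩
          simp only
          split_ifs with hx1
          · have : (x : ℝ) = 0 := le_antisymm (by linarith) x.2.1
            rw [this, zero_add, stp_one, neg_neg, stripPt_eq_stp, this]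
          · rw [add_sub_cancel_right, neg_neg, stripPt_eq_stp])

theorem sideChart_apply (h : Γ.H) (z : ℂ) : O.sideChart h z = if z.re ≤ 1 then
    O.stp h z.re (-z.im) else O.stp (O.boundaryNext h) (z.re - 1) (-z.im) := rfl

end Charts

/-- A function of half edges that is constant along the cyclic orders and along edges is constant
if the graph is connected. -/
theorem eq_of_connected {Y : Type*} (hc : Γ.Connected) {f : Γ.H → Y}
    (hf : ∀ h, f (O.next h) = f h) (hf' : ∀ h, f (Γ.flip h) = f h) (h k : Γ.H) : f h = f k := by
  have : ∀ a b, Relation.ReflTransGen Γ.Joined a b → ∀ h k, Γ.root h = a → Γ.root k = b →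
      f h = f k := by
    intro a b hab
    induction hab with
    | refl => exact fun h k e e' => O.eq_of_root_eq hf (e.trans e'.symm)
    | tail _ hbc ih =>
      obtain ⟨l, hl1, hl2⟩ := hbc
      exact fun h k e e' => (ih h l e hl1).trans
        ((hf' l).symm.trans (O.eq_of_root_eq hf (hl2.trans e'.symm)))
  exact this _ _ (hc.2 _ _) h k rfl rfl

section Orientation

variable {S : Type*} [TopologicalSpace S] [ChartedSpace ℂ S]

/-- All strips are mapped with the same local degree: the chart around an edge compares its two
strips, and the chart around a side compares consecutive strips of a boundary cycle. -/
theorem exists_orientation (hΓ : Function.Surjective Γ.root) (hc : Γ.Connected)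
    (hS : IsOrientedAtlas S) (k : O.Surface ≃ₜ S) :
    ∃ d : ℤ, (d = 1 ∨ d = -1) ∧ ∀ (h : Γ.H) (z : ℂ), 0 < z.re → z.re < 1 → z.im < 0 →
      HasLocalDegree (fun y => k (O.strip h y)) z d := by
  have hconv : Convex ℝ {z : ℂ | 0 < z.re ∧ z.re < 1} :=
    (convex_halfSpace_re_gt 0).inter (convex_halfSpace_re_lt 1)
  have hconv' : Convex ℝ {z : ℂ | 1 / 2 < z.re ∧ z.re < 3 / 2 ∧ z.im < 0} :=
    (convex_halfSpace_re_gt _).inter ((convex_halfSpace_re_lt _).inter (convex_halfSpace_im_lt 0))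
  have hE := fun h => exists_hasLocalDegree hS
    ((O.edgeChart hΓ h).transHomeomorph k) hconv.isPreconnected
  have hD := fun h => exists_hasLocalDegree hS
    ((O.sideChart h).transHomeomorph k) hconv'.isPreconnected
  choose ε hε1 hε using hE
  choose δ hδ1 hδ using hD
  have hopen : ∀ z : ℂ, z.im < 0 → ∀ᶠ y : ℂ in 𝓝 z, y.im < 0 := fun z hz =>
    (isOpen_lt Complex.continuous_im continuous_const).mem_nhds hz
  have hstrip : ∀ (h : Γ.H) (z : ℂ), 0 < z.re → z.re < 1 → z.im < 0 →
      HasLocalDegree (fun y => k (O.strip h y)) z (ε h) := fun h z h0 h1 h2 => by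
    refine (hε h z ⟨h0, h1⟩).congr ?_
    filter_upwards [hopen z h2] with y hy
    change k (O.band h y.re y.im) = _
    rw [band_of_nonpos hy.le, strip_eq_stp]
  have hflip : ∀ h, ε (Γ.flip h) = ε h := fun h => by
    set z : ℂ := ⟨1 / 2, -1⟩
    have hz : z ∈ {z : ℂ | 0 < z.re ∧ z.re < 1} := by simp [z]; norm_num
    have hz' : (1 : ℂ) - z ∈ {z : ℂ | 0 < z.re ∧ z.re < 1} := by simp [z]; norm_num
    have h1 := (hε (Γ.flip h) _ hz').comp (T := fun z => 1 - z) hz' (HasDegree.const_sub z 1)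
      (by fun_prop)
    rw [one_mul] at h1
    refine (h1.congr (g := (O.edgeChart hΓ h).transHomeomorph k) ?_).unique (hε h z hz)
    filter_upwards [hopen z (by simp [z])] with y hy
    change k (O.band (Γ.flip h) (1 - y).re (1 - y).im) = k (O.band h y.re y.im)
    rw [band_of_nonneg (by simpa using hy.le), band_of_nonpos hy.le, Γ.flip_flip]
    simp
  have hside : ∀ h, δ h = ε h := fun h => by
    set z : ℂ := ⟨3 / 4, -1⟩
    refine ((hδ h z ?_).congr ?_).unique (hstrip h z ?_ ?_ ?_)
    · change (1 : ℝ) / 2 < 3 / 4 ∧ (3 : ℝ) / 4 < 3 / 2 ∧ (-1 : ℝ) < 0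
      norm_num
    · have : ∀ᶠ y : ℂ in 𝓝 z, y.re < 1 :=
        (isOpen_lt Complex.continuous_re continuous_const).mem_nhds (by simp [z]; norm_num)
      filter_upwards [this] with y hy
      change k (O.sideChart h y) = _
      rw [sideChart_apply, if_pos hy.le, strip_eq_stp]
    all_goals norm_num [z]
  have hside' : ∀ h, δ h = ε (O.boundaryNext h) := fun h => by
    set z : ℂ := ⟨5 / 4, -1⟩
    have hz' : z - 1 ∈ {z : ℂ | 0 < z.re ∧ z.re < 1} := by simp [z]; norm_num
    have h1 := (hε (O.boundaryNext h) _ hz').comp (T := fun z => z - 1) hz'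
      (HasDegree.sub_const z 1) (by fun_prop)
    rw [one_mul] at h1
    refine ((hδ h z ?_).congr ?_).unique h1
    · change (1 : ℝ) / 2 < 5 / 4 ∧ (5 : ℝ) / 4 < 3 / 2 ∧ (-1 : ℝ) < 0
      norm_num
    · have : ∀ᶠ y : ℂ in 𝓝 z, 1 < y.re :=
        (isOpen_lt continuous_const Complex.continuous_re).mem_nhds (by simp [z]; norm_num)
      filter_upwards [this, hopen z (by simp [z])] with y hy hy'
      change k (O.sideChart h y) = k (O.band _ (y - 1).re (y - 1).im)
      rw [sideChart_apply, if_neg (not_le.2 hy), band_of_nonpos (by simpa using hy'.le)]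
      simp
  have hnext : ∀ h, ε (O.next h) = ε h := fun h => by
    have := (hside' (Γ.flip h)).symm.trans (hside (Γ.flip h))
    rwa [boundaryNext, Γ.flip_flip, hflip] at this
  rcases isEmpty_or_nonempty Γ.H with hH | ⟨⟨h₀⟩⟩
  · exact ⟨1, Or.inl rfl, fun h => (hH.false h).elim⟩
  · exact ⟨ε h₀, hε1 h₀, fun h => O.eq_of_connected hc hnext hflip h h₀ ▸ hstrip h⟩

/-- A homeomorphism from the surface of a ribbon graph to an oriented surface preserves
orientation for the ribbon structure or for its opposite. -/
theorem orientationPreserving_or (hΓ : Function.Surjective Γ.root) (hc : Γ.Connected)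
    (hS : IsOrientedAtlas S) (k : O.Surface ≃ₜ S) :
    O.OrientationPreserving k ∨ O.op.OrientationPreserving (O.reflect.trans k) := by
  obtain ⟨d, rfl | rfl, hd⟩ := O.exists_orientation hΓ hc hS k
  · exact Or.inl fun h z h0 h1 h2 e he hz => preservesOrientationAt_iff.2 (hd h z h0 h1 h2 e he hz)
  · refine Or.inr fun h z h0 h1 h2 e he hz => preservesOrientationAt_iff.2 ?_
    have heq : ∀ y, (O.reflect.trans k) (O.op.strip h y) =
        k (O.strip (Γ.flip h) (1 - (starRingEnd ℂ) y)) := fun y => by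
      change k (O.reflect (O.op.stripPt h _ _)) = _
      rw [reflect_stripPt, ← projIcc_one_sub, strip_eq_stp]
      simp [stp]
    set w := 1 - (starRingEnd ℂ) z with hw
    have hw' : w ∈ ((O.edgeChart hΓ (Γ.flip h)).transHomeomorph k).source := by
      change 0 < w.re ∧ w.re < 1
      simp [hw, h0, h1]
    have hloc : HasLocalDegree ((O.edgeChart hΓ (Γ.flip h)).transHomeomorph k) w (-1) := by
      refine (hd (Γ.flip h) w
          (by simp [hw, h1]) (by simp [hw, h0]) (by simpa [hw] using h2)).congr ?_
      have : ∀ᶠ y : ℂ in 𝓝 w, y.im < 0 :=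
        (isOpen_lt Complex.continuous_im continuous_const).mem_nhds
          (by simpa [hw] using h2)
      filter_upwards [this] with y hy
      change _ = k (O.band _ y.re y.im)
      rw [band_of_nonpos hy.le, strip_eq_stp]
    have h3 := hloc.comp (T := fun z => 1 - (starRingEnd ℂ) z) hw' (HasDegree.const_sub_conj z 1)
      (by fun_prop)
    have h4 : HasLocalDegree (fun y => (O.reflect.trans k) (O.op.strip h y)) z 1 := by
      refine h3.congr ?_
      have : ∀ᶠ y : ℂ in 𝓝 z, y.im < 0 :=
        (isOpen_lt Complex.continuous_im continuous_const).mem_nhds h2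
      filter_upwards [this] with y hy
      rw [heq, strip_eq_stp]
      change k (O.band _ _ _) = _
      rw [band_of_nonpos (by simpa using hy.le)]
    exact h4 e he hz

end Orientation

end RibbonStructure

namespace MarkedSurface

variable {n : ℕ}

/-- Since a ribbon structure may be reversed, a marked graph can be drawn in a marked surface as
soon as there is any homeomorphism compatible with the markings. -/
theorem mem_drawable (S : MarkedSurface.{u} n) (M : GraphWithMarking n)
    (O : RibbonStructure M.graph) (k : O.Surface ≃ₜ S.carrier)
    (hk : ((k : C(O.Surface, S.carrier)).comp (O.incl.comp M.marking)).Homotopic S.marking) :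
    MarkedGraph.mk M ∈ S.drawable := by
  have hΓ : Function.Surjective M.graph.root := fun w => by
    have h3 := M.three_le_valence w
    have : Nat.card {h : M.graph.H // M.graph.root h = w} ≠ 0 := by
      change M.graph.valence w ≠ 0; omega
    obtain ⟨⟨h⟩⟩ := (Nat.card_ne_zero.1 this).1
    exact ⟨h, by assumption⟩
  rcases O.orientationPreserving_or hΓ M.connected S.oriented k with h | h
  · exact ⟨M, O, rfl, k, h, hk⟩
  · exact ⟨M, O.op, rfl, O.reflect.trans k, h, hk⟩

end MarkedSurface

/-! ### Coverings of graphs and holonomy -/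

namespace Graph

variable {Γ : Graph}

section Bump

open Classical

variable (Γ)

/-- A bump function on the open star of a vertex. -/
def starBump (v : Γ.V) : C(Γ.Space, ℝ) :=
  Γ.lift (fun w => if w = v then 1 / 2 else 0)
    (fun k x => (if Γ.root k = v then max (1 / 2 - (x : ℝ)) 0 else 0) +
      if Γ.root (Γ.flip k) = v then max ((x : ℝ) - 1 / 2) 0 else 0)
    (fun k => by split_ifs <;> fun_prop)
    (fun k x => by
      rw [Γ.flip_flip, unitInterval.coe_symm_eq, add_comm,
        show 1 / 2 - (1 - (x : ℝ)) = x - 1 / 2 by ring,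
        show 1 - (x : ℝ) - 1 / 2 = 1 / 2 - x by ring])
    (fun k => by norm_num)

/-- A bump function on an open edge. -/
def openEdgeBump (h : Γ.H) : C(Γ.Space, ℝ) :=
  Γ.lift (fun _ => 0) (fun k x => if k = h ∨ k = Γ.flip h then (x : ℝ) * (1 - x) else 0)
    (fun k => by split_ifs <;> fun_prop)
    (fun k x => by
      have : (Γ.flip k = h ∨ Γ.flip k = Γ.flip h) ↔ (k = h ∨ k = Γ.flip h) := by
        rw [Γ.flip_injective.eq_iff, or_comm]
        exact or_congr_right ⟨fun e => by rw [← e, Γ.flip_flip], fun e => by rw [e, Γ.flip_flip]⟩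
      simp only [this, unitInterval.coe_symm_eq]
      split_ifs <;> ring)
    (fun k => by simp)

variable {Γ}

theorem starBump_vertexPt (v w : Γ.V) :
    Γ.starBump v (Γ.vertexPt w) = if w = v then 1 / 2 else 0 := rfl

theorem starBump_edgePt (v : Γ.V) (k : Γ.H) (x : I) : Γ.starBump v (Γ.edgePt k x) =
    (if Γ.root k = v then max (1 / 2 - (x : ℝ)) 0 else 0) +
      if Γ.root (Γ.flip k) = v then max ((x : ℝ) - 1 / 2) 0 else 0 := rfl

theorem openEdgeBump_edgePt (h k : Γ.H) (x : I) : Γ.openEdgeBump h (Γ.edgePt k x) =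
    if k = h ∨ k = Γ.flip h then (x : ℝ) * (1 - x) else 0 := rfl

theorem starBump_pos_unique {v w : Γ.V} {p : Γ.Space} (hv : 0 < Γ.starBump v p)
    (hw : 0 < Γ.starBump w p) : v = w := by
  rcases space_cases p with ⟨u, rfl⟩ | ⟨k, x, rfl⟩
  · rw [starBump_vertexPt] at hv hw
    split_ifs at hv hw with h1 h2
    · exact h1.symm.trans h2
    all_goals norm_num at *
  · rw [starBump_edgePt] at hv hw
    rcases le_total (x : ℝ) (1 / 2) with hx | hx
    · have e : max ((x : ℝ) - 1 / 2) 0 = 0 := max_eq_right (by linarith)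
      rw [e, ite_self, add_zero] at hv hw
      split_ifs at hv hw with h1 h2
      · exact h1.symm.trans h2
      all_goals norm_num at *
    · have e : max (1 / 2 - (x : ℝ)) 0 = 0 := max_eq_right (by linarith)
      rw [e, ite_self, zero_add] at hv hw
      split_ifs at hv hw with h1 h2
      · exact h1.symm.trans h2
      all_goals norm_num at *

theorem openEdgeBump_pos {h k : Γ.H} {p : Γ.Space} (hh : 0 < Γ.openEdgeBump h p)
    (hk : 0 < Γ.openEdgeBump k p) : h = k ∨ h = Γ.flip k := by
  rcases space_cases p with ⟨u, rfl⟩ | ⟨l, x, rfl⟩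
  · exact absurd hh (lt_irrefl _)
  · rw [openEdgeBump_edgePt] at hh hk
    split_ifs at hh hk with h1 h2
    · rcases h1 with rfl | rfl <;> rcases h2 with h2 | h2
      · exact Or.inl h2
      · exact Or.inr h2
      · exact Or.inr (by rw [← h2, Γ.flip_flip])
      · exact Or.inl (Γ.flip_injective h2)
    all_goals norm_num at *

theorem starBump_map {Δ : Graph} (e : Iso Γ Δ) (v : Γ.V) (p : Γ.Space) :
    Δ.starBump (e.onV v) (e.map p) = Γ.starBump v p := by
  rcases space_cases p with ⟨u, rfl⟩ | ⟨k, x, rfl⟩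
  · change (if e.onV u = e.onV v then (1 / 2 : ℝ) else 0) = if u = v then 1 / 2 else 0
    rw [e.onV.injective.eq_iff]
  · change (if Δ.root (e.onH k) = e.onV v then max (1 / 2 - (x : ℝ)) 0 else 0) +
      (if Δ.root (Δ.flip (e.onH k)) = e.onV v then max ((x : ℝ) - 1 / 2) 0 else 0) =
      (if Γ.root k = v then max (1 / 2 - (x : ℝ)) 0 else 0) +
      (if Γ.root (Γ.flip k) = v then max ((x : ℝ) - 1 / 2) 0 else 0)
    rw [← e.map_flip, ← e.map_root, ← e.map_root, e.onV.injective.eq_iff, e.onV.injective.eq_iff]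

theorem openEdgeBump_map {Δ : Graph} (e : Iso Γ Δ) (h : Γ.H) (p : Γ.Space) :
    Δ.openEdgeBump (e.onH h) (e.map p) = Γ.openEdgeBump h p := by
  rcases space_cases p with ⟨u, rfl⟩ | ⟨k, x, rfl⟩
  · rfl
  · change (if e.onH k = e.onH h ∨ e.onH k = Δ.flip (e.onH h) then (x : ℝ) * (1 - x) else 0) =
      if k = h ∨ k = Γ.flip h then (x : ℝ) * (1 - x) else 0
    rw [← e.map_flip, e.onH.injective.eq_iff, e.onH.injective.eq_iff]

theorem exists_bump_pos (p : Γ.Space) :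
    (∃ v, 0 < Γ.starBump v p) ∨ ∃ h, 0 < Γ.openEdgeBump h p := by
  have hvert : ∀ v, 0 < Γ.starBump v (Γ.vertexPt v) := fun v => by
    rw [starBump_vertexPt, if_pos rfl]; norm_num
  rcases space_cases p with ⟨u, rfl⟩ | ⟨k, y, rfl⟩
  · exact Or.inl ⟨u, hvert u⟩
  by_cases hy0 : y = 0
  · rw [hy0, edgePt_zero]; exact Or.inl ⟨_, hvert _⟩
  by_cases hy1 : y = 1
  · rw [hy1, edgePt_one]; exact Or.inl ⟨_, hvert _⟩
  refine Or.inr ⟨k, ?_⟩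
  rw [openEdgeBump_edgePt, if_pos (Or.inl rfl)]
  exact mul_pos (unitInterval.pos_iff_ne_zero.2 hy0)
    (sub_pos.2 (unitInterval.lt_one_iff_ne_one.2 hy1))

end Bump

section Cover

variable {G : Type} [Group G]

/-- The covering graph with deck group `G` determined by a labelling of the directed edges by
elements of `G`. -/
def cover (Γ : Graph) (φ : Γ.H → G) (hφ : ∀ h, φ (Γ.flip h) = (φ h)⁻¹) : Graph where
  V := G × Γ.V
  H := G × Γ.H
  flip h := (h.1 * φ h.2, Γ.flip h.2)
  flip_flip h := by simp [hφ, Γ.flip_flip]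
  flip_ne h e := Γ.flip_ne h.2 (congrArg Prod.snd e)
  root h := (h.1, Γ.root h.2)

variable (φ : Γ.H → G) (hφ : ∀ h, φ (Γ.flip h) = (φ h)⁻¹)

/-- Deck transformations of the covering graph. -/
def deck (g : G) : Iso (Γ.cover φ hφ) (Γ.cover φ hφ) where
  onV := (Equiv.mulLeft g).prodCongr (Equiv.refl _)
  onH := (Equiv.mulLeft g).prodCongr (Equiv.refl _)
  map_flip _ := Prod.ext (mul_assoc _ _ _).symm rfl
  map_root _ := rfl

instance coverAction : MulAction G (Γ.cover φ hφ).Space where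
  smul g p := (deck φ hφ g).map p
  one_smul p := by
    rcases space_cases p with ⟨w, rfl⟩ | ⟨h, x, rfl⟩
    · exact congrArg (Γ.cover φ hφ).vertexPt (Prod.ext (one_mul _) rfl)
    · exact congrArg ((Γ.cover φ hφ).edgePt · x) (Prod.ext (one_mul _) rfl)
  mul_smul a b p := by
    rcases space_cases p with ⟨w, rfl⟩ | ⟨h, x, rfl⟩
    · exact congrArg (Γ.cover φ hφ).vertexPt (Prod.ext (mul_assoc _ _ _) rfl)
    · exact congrArg ((Γ.cover φ hφ).edgePt · x) (Prod.ext (mul_assoc _ _ _) rfl)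

/-- The covering projection. -/
def coverProj : C((Γ.cover φ hφ).Space, Γ.Space) :=
  (Γ.cover φ hφ).lift (fun w => Γ.vertexPt w.2) (fun h x => Γ.edgePt h.2 x)
    (fun h => Γ.continuous_edgePt h.2) (fun h x => Γ.edgePt_flip h.2 x)
    (fun h => Γ.edgePt_zero h.2)

theorem coverProj_surjective : Function.Surjective (coverProj φ hφ) := fun p => by
  rcases space_cases p with ⟨w, rfl⟩ | ⟨h, x, rfl⟩
  · exact ⟨(Γ.cover φ hφ).vertexPt (1, w), rfl⟩
  · exact ⟨(Γ.cover φ hφ).edgePt (1, h) x, rfl⟩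

theorem coverProj_smul (g : G) (p : (Γ.cover φ hφ).Space) :
    coverProj φ hφ (g • p) = coverProj φ hφ p := by
  rcases space_cases p with ⟨w, rfl⟩ | ⟨h, x, rfl⟩ <;> rfl

/-- The orbit above a point of the base. -/
def fiberOrbit : Γ.Space → MulAction.orbitRel.Quotient G (Γ.cover φ hφ).Space :=
  Quot.lift (Sum.elim (fun w => Quotient.mk _ ((Γ.cover φ hφ).vertexPt (1, w.1)))
    (fun p => Quotient.mk _ ((Γ.cover φ hφ).edgePt (1, p.1) p.2))) (by
    rintro _ _ (⟨h, x⟩ | h)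
    · refine Quotient.sound ⟨φ h, ?_⟩
      change (Γ.cover φ hφ).edgePt (φ h * 1, Γ.flip h) (σ x) = _
      rw [← (Γ.cover φ hφ).edgePt_flip (1, h) x, mul_one]
      change _ = (Γ.cover φ hφ).edgePt (1 * φ h, Γ.flip h) (σ x)
      rw [one_mul]
    · change Quotient.mk _ ((Γ.cover φ hφ).edgePt (1, h) 0) =
        Quotient.mk _ ((Γ.cover φ hφ).vertexPt (1, Γ.root h))
      exact congrArg (Quotient.mk _) ((Γ.cover φ hφ).edgePt_zero (1, h)))

theorem fiberOrbit_coverProj (p : (Γ.cover φ hφ).Space) :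
    fiberOrbit φ hφ (coverProj φ hφ p) = Quotient.mk _ p := by
  rcases space_cases p with ⟨⟨g, w⟩, rfl⟩ | ⟨⟨g, h⟩, x, rfl⟩
  · refine Quotient.sound ⟨g⁻¹, ?_⟩
    change (Γ.cover φ hφ).vertexPt (g⁻¹ * g, w) = _
    rw [inv_mul_cancel]
  · refine Quotient.sound ⟨g⁻¹, ?_⟩
    change (Γ.cover φ hφ).edgePt (g⁻¹ * g, h) x = _
    rw [inv_mul_cancel]

/-- The covering graph is the quotient covering for the action of the deck group; evenly covered
neighbourhoods are open stars of vertices and open edges, which the bump functions cut out. -/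
theorem isQuotientCoveringMap_coverProj : IsQuotientCoveringMap (coverProj φ hφ) G where
  surjective := coverProj_surjective φ hφ
  eq_coinduced := TopologicalSpace.ext <| funext fun U => propext <| by
    change IsOpen U ↔ IsOpen (coverProj φ hφ ⁻¹' U)
    refine ⟨fun hU => hU.preimage (coverProj φ hφ).continuous, fun hU => ?_⟩
    refine isOpen_space_iff.2 fun h => ?_
    exact hU.preimage ((Γ.cover φ hφ).continuous_edgePt (1, h))
  continuous_const_smul g := (deck φ hφ g).map.continuous
  apply_eq_iff_mem_orbit {e₁ e₂} := by
    refine ⟨fun h => ?_, ?_⟩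
    · have := congrArg (fiberOrbit φ hφ) h
      rw [fiberOrbit_coverProj, fiberOrbit_coverProj] at this
      exact Quotient.exact this
    · rintro ⟨g, rfl⟩
      exact coverProj_smul φ hφ g e₂
  disjoint e := by
    rcases exists_bump_pos e with ⟨v, hv⟩ | ⟨h, hh⟩
    · refine ⟨{p | 0 < (Γ.cover φ hφ).starBump v p}, (isOpen_lt continuous_const
        ((Γ.cover φ hφ).starBump v).continuous).mem_nhds hv, ?_⟩
      rintro g ⟨_, ⟨p, hp, rfl⟩, hgp⟩
      have h1 := starBump_pos_unique hgp (hp.trans_eq (starBump_map (deck φ hφ g) v p).symm)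
      exact mul_eq_right.1 (congrArg Prod.fst h1).symm
    · refine ⟨{p | 0 < (Γ.cover φ hφ).openEdgeBump h p}, (isOpen_lt continuous_const
        ((Γ.cover φ hφ).openEdgeBump h).continuous).mem_nhds hh, ?_⟩
      rintro g ⟨_, ⟨p, hp, rfl⟩, hgp⟩
      rcases openEdgeBump_pos hgp (hp.trans_eq (openEdgeBump_map (deck φ hφ g) h p).symm)
        with h1 | h1
      · exact mul_eq_right.1 (congrArg Prod.fst h1).symm
      · exact absurd (congrArg Prod.snd h1).symm (Γ.flip_ne h.2)

end Cover

end Graph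

/-- If two periodic lines are homotopic through periodic lines, the deck transformations by which
their lifts to a covering are translated are conjugate. -/
theorem isConj_of_periodic {E B G : Type*} [TopologicalSpace E] [TopologicalSpace B] [Group G]
    [MulAction G E] {p : E → B} (hp : IsQuotientCoveringMap p G) (N : ℝ) (F : C(I × ℝ, B))
    (hF : ∀ s u, F (s, u + N) = F (s, u)) {l₀ l₁ : ℝ → E} (hl₀ : Continuous l₀)
    (hl₁ : Continuous l₁) (h₀ : ∀ u, F (0, u) = p (l₀ u)) (h₁ : ∀ u, F (1, u) = p (l₁ u)) {x y : G}
    (hx : ∀ u, l₀ (u + N) = x • l₀ u) (hy : ∀ u, l₁ (u + N) = y • l₁ u) : IsConj x y := by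
  have hcov := hp.isCoveringMap
  have := hp.toContinuousConstSMul
  have := hp.isCancelSMul
  set L := hcov.liftHomotopy F ⟨l₀, hl₀⟩ h₀ with hL
  have hLF : ∀ q, p (L q) = F q := congrFun (hcov.liftHomotopy_lifts F ⟨l₀, hl₀⟩ h₀)
  have hL0 : ∀ u, L (0, u) = l₀ u := hcov.liftHomotopy_zero F ⟨l₀, hl₀⟩ h₀
  have hper : (fun q : I × ℝ => L (q.1, q.2 + N)) = fun q => x • L q := by
    refine hcov.eq_of_comp_eq (by fun_prop) (L.continuous.const_smul x) ?_ (0, 0) ?_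
    · ext q
      simp only [Function.comp_apply, hp.map_smul, hLF, hF]
    · simp only [hL0, hx]
  obtain ⟨g, hg⟩ := hp.apply_eq_iff_mem_orbit.1 (show p (l₁ 0) = p (L (1, 0)) by rw [hLF, h₁])
  have hl : l₁ = fun u => g • L (1, u) := by
    refine hcov.eq_of_comp_eq hl₁ (Continuous.const_smul (by fun_prop) g) ?_ 0 hg.symm
    ext u
    simp only [Function.comp_apply, hp.map_smul, hLF, h₁]
  have h3 : y • l₁ 0 = g • x • L (1, 0) := by
    rw [← hy, hl]
    exact congrArg (g • ·) (congrFun hper (1, 0))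
  rw [hl] at h3
  simp only [smul_smul] at h3
  have h4 := IsCancelSMul.right_cancel _ _ _ h3
  exact isConj_iff.2 ⟨g, by rw [← h4, mul_inv_cancel_right]⟩

/-! ### Lines made of edges -/

/-- The concatenation of a two-sided infinite sequence of paths. -/
def line {Y : Type*} (γ : ℤ → I → Y) (u : ℝ) : Y :=
  γ ⌊u⌋ (Set.projIcc 0 1 zero_le_one (u - ⌊u⌋))

/-- Adjacent formulas for the concatenation agree, so that it is given by its `i`-th path also at
the
right end of the `i`-th interval. -/
theorem line_eq {Y : Type*} {γ : ℤ → I → Y} (hγ : ∀ i, γ i 1 = γ (i + 1) 0) (i : ℤ) {u : ℝ}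
    (hu : u ∈ Set.Icc (i : ℝ) (i + 1)) :
    line γ u = γ i (Set.projIcc 0 1 zero_le_one (u - i)) := by
  rcases hu.2.eq_or_lt with h | h
  · have : ⌊u⌋ = i + 1 := by rw [h]; exact_mod_cast Int.floor_intCast (i + 1)
    rw [line, this, h]
    simp [hγ]
  · have : ⌊u⌋ = i := Int.floor_eq_iff.2 ⟨hu.1, h⟩
    rw [line, this]

theorem continuous_line {Y : Type*} [TopologicalSpace Y] {γ : ℤ → I → Y}
    (hγ : ∀ i, γ i 1 = γ (i + 1) 0) (hc : ∀ i, Continuous (γ i)) : Continuous (line γ) := by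
  rw [continuous_iff_continuousAt]
  intro u
  set n := ⌊u⌋ with hn
  have h1 : Continuous fun v : ℝ => if v ≤ n
      then γ (n - 1) (Set.projIcc 0 1 zero_le_one (v - (n - 1 : ℤ)))
      else γ n (Set.projIcc 0 1 zero_le_one (v - n)) := by
    refine Continuous.if_le ((hc _).comp (continuous_projIcc.comp (by fun_prop)))
      ((hc _).comp (continuous_projIcc.comp (by fun_prop))) continuous_id continuous_const ?_
    rintro v rfl
    have := hγ (n - 1)
    rw [sub_add_cancel] at this
    simp [this]
  refine h1.continuousAt.congr ?_
  have h2 := Int.floor_le u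
  have h3 := Int.lt_floor_add_one u
  filter_upwards [Ioo_mem_nhds (show (n : ℝ) - 1 < u by linarith) (show u < n + 1 from h3)] with
      v hv
  split_ifs with h
  · rw [line_eq hγ (n - 1) ⟨by push_cast; linarith [hv.1], by push_cast; linarith⟩]
  · rw [line_eq hγ n ⟨by linarith, hv.2.le⟩]

theorem line_add_int {Y : Type*} (γ : ℤ → I → Y) (u : ℝ) (j : ℤ) :
    line γ (u + j) = line (fun i => γ (i + j)) u := by
  simp [line]

/-! ### Words in a free group -/

section Words

variable {α : Type}

open Classical in
/-- Multiplication on the left by a word of length `ℓ` changes at most the first `ℓ` letters of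
a reduced word. -/
theorem toWord_mk_mul_append (L : List (α × Bool)) {z : FreeGroup α} {A B : List (α × Bool)}
    (hz : z.toWord = A ++ B) (hA : L.length ≤ A.length) :
    ∃ A', (FreeGroup.mk L * z).toWord = A' ++ B := by
  suffices h : ∃ A', A.length ≤ A'.length + L.length ∧ (FreeGroup.mk L * z).toWord = A' ++ B from
    let ⟨A', h⟩ := h; ⟨A', h.2⟩
  induction L with
  | nil => exact ⟨A, le_rfl, by rw [← FreeGroup.one_eq_mk, one_mul, hz]⟩
  | cons a L ih =>
    obtain ⟨A', hl, hA'⟩ := ih (by simp at hA; omega)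
    have h1 : FreeGroup.mk (a :: L) * z = FreeGroup.mk [a] * (FreeGroup.mk L * z) := by
      rw [← mul_assoc, FreeGroup.mul_mk]; rfl
    have h2 : (FreeGroup.mk (a :: L) * z).toWord = FreeGroup.reduce (a :: (A' ++ B)) := by
      rw [h1, ← FreeGroup.mk_toWord (x := FreeGroup.mk L * z), FreeGroup.mul_mk,
        FreeGroup.toWord_mk, hA']
      rfl
    have h3 : FreeGroup.reduce (A' ++ B) = A' ++ B := by
      rw [← hA', FreeGroup.reduce_toWord]
    rw [h2, FreeGroup.reduce.cons, h3]
    rcases A' with _ | ⟨b, A'⟩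
    · simp at hA hl; omega
    · simp only [List.cons_append]
      split_ifs with h
      · exact ⟨A', by simp at hl ⊢; omega, rfl⟩
      · exact ⟨a :: b :: A', by simp at hl ⊢; omega, rfl⟩

open Classical in
theorem toWord_mul_inv_append (g : FreeGroup α) {z : FreeGroup α} {B C : List (α × Bool)}
    (hz : z.toWord = B ++ C) (hC : g.toWord.length ≤ C.length) :
    ∃ C', (z * g⁻¹).toWord = B ++ C' := by
  obtain ⟨A', h⟩ := toWord_mk_mul_append g.toWord (z := z⁻¹) (A := FreeGroup.invRev C)
    (B := FreeGroup.invRev B) (by rw [FreeGroup.toWord_inv, hz]; simp [FreeGroup.invRev])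
    (by simpa using hC)
  refine ⟨FreeGroup.invRev A', ?_⟩
  rw [FreeGroup.mk_toWord] at h
  rw [show z * g⁻¹ = (g * z⁻¹)⁻¹ by group, FreeGroup.toWord_inv, h]
  simp [FreeGroup.invRev, Function.comp_def]

open Classical in
/-- Conjugation only changes the ends of a reduced word. -/
theorem infix_toWord_conj (g : FreeGroup α) {z : FreeGroup α} {A B C : List (α × Bool)}
    (hz : z.toWord = A ++ B ++ C) (hA : g.toWord.length ≤ A.length)
    (hC : g.toWord.length ≤ C.length) : B <:+: (g * z * g⁻¹).toWord := by
  obtain ⟨A', h⟩ := toWord_mk_mul_append g.toWord (z := z) (A := A) (B := B ++ C)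
    (by rw [hz, List.append_assoc]) hA
  rw [FreeGroup.mk_toWord, ← List.append_assoc] at h
  obtain ⟨C', h'⟩ := toWord_mul_inv_append g h hC
  exact ⟨A', C', h'.symm⟩

/-- The word read off along an orbit of `b`, where the letters of `a` are `w a`. -/
def orbitWord {A : Type} (b : A → A) (w : A → List (α × Bool)) : ℕ → A → List (α × Bool)
  | 0, _ => []
  | m + 1, a => w a ++ orbitWord b w m (b a)

theorem orbitWord_add {A : Type} (b : A → A) (w : A → List (α × Bool)) (m n : ℕ) (a : A) :
    orbitWord b w (m + n) a = orbitWord b w m a ++ orbitWord b w n (b^[m] a) := by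
  induction m generalizing a with
  | zero => simp [orbitWord]
  | succ m ih => rw [Nat.add_right_comm]; simp [orbitWord, ih]

/-- The letters of a directed edge and of its reverse are inverse to each other. -/
theorem orbitWord_pair {A : Type} (b : A → A) (l : A → α × Bool) (m : ℕ) (a : A) {u v : α × Bool}
    (h : [u, v] <:+: orbitWord b (fun a => [l a]) m a) : ∃ c, u = l c ∧ v = l (b c) := by
  induction m generalizing a with
  | zero => simp [orbitWord] at h
  | succ m ih =>
    rw [orbitWord, List.singleton_append, List.infix_cons_iff] at h
    rcases h with h | h
    · rw [List.cons_prefix_cons] at h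
      rcases m with _ | m
      · simp [orbitWord] at h
      · simp [orbitWord, List.cons_prefix_cons] at h
        exact ⟨a, h⟩
    · exact ih _ h

end Words

section Skew

variable {G A : Type} [Group G]

/-- The permutation `(g, a) ↦ (g * w a, b a)`. -/
def skew (b : Equiv.Perm A) (w : A → G) : Equiv.Perm (G × A) where
  toFun p := (p.1 * w p.2, b p.2)
  invFun p := (p.1 * (w (b.symm p.2))⁻¹, b.symm p.2)
  left_inv p := by simp
  right_inv p := by simp

variable (b : Equiv.Perm A) (w : A → G)

theorem skew_apply (p : G × A) : skew b w p = (p.1 * w p.2, b p.2) := rfl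

theorem skew_zpow_snd (i : ℤ) (p : G × A) : ((skew b w ^ i) p).2 = (b ^ i) p.2 := by
  induction i using Int.induction_on generalizing p with
  | zero => rfl
  | succ n ih => rw [zpow_add_one, zpow_add_one, Equiv.Perm.mul_apply, ih]; rfl
  | pred n ih => rw [zpow_sub_one, zpow_sub_one, Equiv.Perm.mul_apply, ih]; rfl

theorem skew_zpow_mul (i : ℤ) (c g : G) (a : A) :
    (skew b w ^ i) (c * g, a) = (c * ((skew b w ^ i) (g, a)).1, (b ^ i) a) := by
  have h : Commute (skew b w) ((Equiv.mulLeft c).prodCongr (Equiv.refl A)) :=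
    Equiv.ext fun p => Prod.ext (mul_assoc _ _ _) rfl
  have h2 := Equiv.congr_fun (h.zpow_left i).eq (g, a)
  exact h2.trans (Prod.ext rfl (skew_zpow_snd b w i (g, a)))

theorem skew_pow {α : Type} (w : A → List (α × Bool)) (m : ℕ) (g : FreeGroup α) (a : A) :
    (skew b (fun a => FreeGroup.mk (w a)) ^ m) (g, a) =
      (g * FreeGroup.mk (orbitWord b w m a), b^[m] a) := by
  induction m generalizing g a with
  | zero => simp [orbitWord, ← FreeGroup.one_eq_mk]
  | succ m ih => rw [pow_succ, Equiv.Perm.mul_apply, skew_apply, ih, mul_assoc,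
      FreeGroup.mul_mk]; rfl

end Skew

namespace Graph

variable {Γ : Graph}

open Classical in
/-- The letter of a directed edge, in the free group on all directed edges: out of the
two directions of an edge only one is used as a generator. -/
def letter (h : Γ.H) : Γ.H × Bool :=
  if WellOrderingRel h (Γ.flip h) then (h, true) else (Γ.flip h, false)

theorem letter_flip (h : Γ.H) : Γ.letter (Γ.flip h) = ((Γ.letter h).1, !(Γ.letter h).2) := by
  rcases trichotomous_of (WellOrderingRel (α := Γ.H)) h (Γ.flip h) with h1 | h1 | h1
  · have h2 := asymm_of (WellOrderingRel (α := Γ.H)) h1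
    rw [letter, letter, Γ.flip_flip, if_pos h1, if_neg h2]; rfl
  · exact absurd h1.symm (Γ.flip_ne h)
  · have h2 := asymm_of (WellOrderingRel (α := Γ.H)) h1
    rw [letter, letter, Γ.flip_flip, if_pos h1, if_neg h2]; rfl

theorem letter_injective : Function.Injective Γ.letter := by
  intro h k e
  rw [letter, letter] at e
  split_ifs at e with h1 h2 h2
  · exact congrArg Prod.fst e
  · exact absurd (congrArg Prod.snd e) (by simp)
  · exact absurd (congrArg Prod.snd e) (by simp)
  · exact Γ.flip_injective (congrArg Prod.fst e)

/-- The letters of an edge or of a constant path. -/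
def letters (l : Option Γ.H) : List (Γ.H × Bool) := l.elim [] fun k => [Γ.letter k]

/-- The generator of a directed edge. -/
def gen (h : Γ.H) : FreeGroup Γ.H := FreeGroup.mk [Γ.letter h]

theorem gen_flip (h : Γ.H) : Γ.gen (Γ.flip h) = (Γ.gen h)⁻¹ := by
  rw [gen, gen, FreeGroup.inv_mk, letter_flip]; rfl

theorem letter_reduced {p q : Γ.H} (h : q ≠ Γ.flip p) (h1 : (Γ.letter p).1 = (Γ.letter q).1) :
    (Γ.letter p).2 = (Γ.letter q).2 := by
  by_contra h2
  refine h (letter_injective ?_)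
  rw [letter_flip, h1]
  refine Prod.ext rfl ?_
  change (Γ.letter q).2 = !(Γ.letter p).2
  cases hp : (Γ.letter p).2 <;> cases hq : (Γ.letter q).2 <;> simp_all

/-- A word read off along an orbit is reduced, if no letter is followed by its inverse, and empty
letters are isolated. -/
theorem isReduced_orbitWord {A : Type} (b : A → A) (l : A → Option Γ.H)
    (h1 : ∀ a p q, l a = some p → l (b a) = some q → q ≠ Γ.flip p)
    (h2 : ∀ a p, l a = some p → l (b a) = none →
      l (b (b a)) ≠ none ∧ ∀ q, l (b (b a)) = some q → q ≠ Γ.flip p) (m : ℕ) (a : A) :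
    FreeGroup.IsReduced (orbitWord b (fun a => letters (l a)) m a) := by
  suffices h : ∀ a, FreeGroup.IsReduced (orbitWord b (fun a => letters (l a)) m a) ∧
      ∀ c p, l c = some p → (b c = a ∨ (l (b c) = none ∧ b (b c) = a)) →
      FreeGroup.IsReduced (Γ.letter p :: orbitWord b (fun a => letters (l a)) m a) from (h a).1
  clear a
  induction m with
  | zero => exact fun a => ⟨FreeGroup.IsReduced.nil, fun _ _ _ _ => FreeGroup.IsReduced.singleton⟩
  | succ m ih =>
    intro a
    rcases hla : l a with _ | q
    · have e : orbitWord b (fun a => letters (l a)) (m + 1) a =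
        orbitWord b (fun a => letters (l a)) m (b a) := by simp [orbitWord, hla, letters]
      rw [e]
      refine ⟨(ih _).1, fun c p hc hca => (ih _).2 c p hc ?_⟩
      rcases hca with rfl | ⟨h3, rfl⟩
      · exact Or.inr ⟨hla, rfl⟩
      · exact absurd hla (h2 c p hc h3).1
    · have e : orbitWord b (fun a => letters (l a)) (m + 1) a =
        Γ.letter q :: orbitWord b (fun a => letters (l a)) m (b a) := by
          simp [orbitWord, hla, letters]
      rw [e]
      have h3 := (ih (b a)).2 a q hla (Or.inl rfl)
      refine ⟨h3, fun c p hc hca => FreeGroup.isReduced_cons_cons.2 ⟨letter_reduced ?_, h3⟩⟩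
      rcases hca with rfl | ⟨h4, rfl⟩
      · exact h1 c p q hc hla
      · exact (h2 c p hc h4).2 q hla

/-! ### Lifts of edge paths to coverings -/

section EdgePath

variable {A : Type} (b : Equiv.Perm A) (l : A → Option Γ.H) (w₀ : Γ.V)

/-- The image of a labelled unit interval: an edge or a vertex. -/
def labelPt (w₀ : Γ.V) (l : Option Γ.H) (x : I) : Γ.Space :=
  l.elim (Γ.vertexPt w₀) fun k => Γ.edgePt k x

/-- A lift of a labelled unit interval to the Cayley graph. -/
def liftPt (w₀ : Γ.V) (g : FreeGroup Γ.H) (l : Option Γ.H) (x : I) :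
    (Γ.cover gen gen_flip).Space :=
  l.elim ((Γ.cover gen gen_flip).vertexPt (g, w₀)) fun k =>
    (Γ.cover gen gen_flip).edgePt (g, k) x

theorem coverProj_liftPt (g : FreeGroup Γ.H) (l : Option Γ.H) (x : I) :
    coverProj gen gen_flip (liftPt w₀ g l x) = labelPt w₀ l x := by cases l <;> rfl

theorem smul_liftPt (c g : FreeGroup Γ.H) (l : Option Γ.H) (x : I) :
    c • liftPt w₀ g l x = liftPt w₀ (c * g) l x := by cases l <;> rfl

/-- The holonomy along a labelled orbit. -/
def hol : Equiv.Perm (FreeGroup Γ.H × A) := skew b fun a => FreeGroup.mk (letters (l a))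

/-- The lift to the Cayley graph of the edge path along a labelled orbit. -/
def liftLine (a : A) : ℝ → (Γ.cover gen gen_flip).Space :=
  line fun i x => liftPt w₀ ((hol b l ^ i) (1, a)).1 (l ((b ^ i) a)) x

theorem coverProj_liftLine (a : A) (u : ℝ) : coverProj gen gen_flip (liftLine b l w₀ a u) =
    line (fun i x => labelPt w₀ (l ((b ^ i) a)) x) u := coverProj_liftPt w₀ _ _ _

theorem continuous_liftLine [Subsingleton Γ.V] (a : A) : Continuous (liftLine b l w₀ a) := by
  refine continuous_line (fun i => ?_) fun i => ?_
  · have h0 : ∀ g l, liftPt w₀ g l 0 = (Γ.cover gen gen_flip).vertexPt (g, w₀) := fun g l => by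
      cases l with
      | none => rfl
      | some k =>
        refine ((Γ.cover gen gen_flip).edgePt_zero _).trans ?_
        exact congrArg (Γ.cover gen gen_flip).vertexPt (Prod.ext rfl (Subsingleton.elim _ _))
    have h1 : ∀ g l, liftPt w₀ g l 1 =
        (Γ.cover gen gen_flip).vertexPt (g * FreeGroup.mk (letters l), w₀) := fun g l => by
      cases l with
      | none => rw [letters, Option.elim_none, ← FreeGroup.one_eq_mk, mul_one]; rfl
      | some k =>
        refine (edgePt_one _).trans ?_
        exact congrArg (Γ.cover gen gen_flip).vertexPt (Prod.ext rfl (Subsingleton.elim _ _))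
    have h2 : (hol b l ^ (i + 1)) (1, a) = hol b l ((hol b l ^ i) (1, a)) := by
      rw [add_comm, zpow_one_add]; rfl
    have h3 := skew_zpow_snd b (fun a => FreeGroup.mk (letters (l a))) i (1, a)
    rw [h0, h1, h2, hol, skew_apply]
    rw [hol] at *
    rw [h3]
  · cases l ((b ^ i) a) with
    | none => exact continuous_const
    | some k => exact (Γ.cover gen gen_flip).continuous_edgePt _

/-- Going around a closed orbit translates the lift by the holonomy. -/
theorem liftLine_add (a : A) (j : ℤ) (hj : (b ^ j) a = a) (u : ℝ) :
    liftLine b l w₀ a (u + j) = ((hol b l ^ j) (1, a)).1 • liftLine b l w₀ a u := by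
  rw [liftLine, line_add_int]
  change liftPt _ _ _ _ = _ • liftPt _ _ _ _
  rw [smul_liftPt, zpow_add, Equiv.Perm.mul_apply, zpow_add, Equiv.Perm.mul_apply, hj]
  congr 1
  have h3 : ((hol b l ^ j) (1, a)).2 = a :=
    (skew_zpow_snd b (fun a => FreeGroup.mk (letters (l a))) j (1, a)).trans hj
  have h4 := skew_zpow_mul b (fun a => FreeGroup.mk (letters (l a))) ⌊u⌋
      ((hol b l ^ j) (1, a)).1 1 a
  rw [mul_one] at h4
  have h5 : (hol b l ^ j) (1, a) = (((hol b l ^ j) (1, a)).1, a) := Prod.ext rfl h3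
  rw [h5]
  exact congrArg Prod.fst h4

end EdgePath

end Graph

/-! ### The universal covering of the punctured disks -/

namespace RibbonStructure

variable {Γ : Graph} (O : RibbonStructure Γ)

/-- The map sending a directed edge to the next one in its boundary cycle, as a permutation. -/
def bnPerm : Equiv.Perm Γ.H := (Function.Involutive.toPerm Γ.flip Γ.flip_flip).trans O.next

/-- The union of the punctured disks glued to the graph. -/
abbrev Punctured : Type := {p : O.Surface // 0 < O.height p}

/-- The line at height `t` that follows the boundary cycle of `h`. -/
def bline (h : Γ.H) (u : ℝ) (t : ℝ≥0) : O.Surface :=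
  line (fun i x => O.stripPt ((O.bnPerm ^ i) h) x t) u

theorem bline_eq (h : Γ.H) (x : I) (t : ℝ≥0) : O.bline h x t = O.stripPt h x t := by
  rw [bline, line_eq (i := 0) _ (by simp)]
  · simp
  · intro i
    rw [stripPt_one, add_comm, zpow_one_add]; rfl

theorem continuous_bline (h : Γ.H) : Continuous fun p : ℝ × ℝ≥0 => O.bline h p.1 p.2 := by
  let γ : ℤ → I → C(ℝ≥0, O.Surface) := fun i =>
    (ContinuousMap.mk _ (O.continuous_stripPt ((O.bnPerm ^ i) h))).curry
  have hγ : Continuous (line γ) := continuous_line (fun i => by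
    ext t
    change O.stripPt _ 1 t = O.stripPt _ 0 t
    rw [stripPt_one, add_comm, zpow_one_add]; rfl) fun i => ContinuousMap.continuous _
  exact ContinuousMap.continuous_uncurry_of_continuous ⟨line γ, hγ⟩

theorem bline_add (h : Γ.H) (u : ℝ) (j : ℤ) (t : ℝ≥0) :
    O.bline h (u + j) t = O.bline ((O.bnPerm ^ j) h) u t := by
  simp only [bline, line_add_int, zpow_add, Equiv.Perm.mul_apply]

theorem height_bline (h : Γ.H) (u : ℝ) (t : ℝ≥0) : O.height (O.bline h u t) = t := rfl

theorem retr_bline (h : Γ.H) (u : ℝ) (t : ℝ≥0) :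
    O.retr (O.bline h u t) = line (fun i x => Γ.edgePt ((O.bnPerm ^ i) h) x) u := rfl

theorem mem_range_incl {p : O.Surface} (hp : ¬ 0 < O.height p) : p ∈ Set.range O.incl := by
  rcases O.surface_cases p with ⟨q, rfl⟩ | ⟨h, x, t, rfl⟩
  · exact ⟨q, rfl⟩
  · rw [height_stripPt, pos_iff_ne_zero, not_not] at hp
    rw [hp, stripPt_bottom]
    exact ⟨_, rfl⟩

open Classical in
/-- The coordinates of a point of the punctured disks, with `0 ≤ x < 1`. -/
def cut : O.Surface → Option (Γ.H × I × ℝ≥0) :=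
  O.desc (fun _ => none) (fun h x t => if t = 0 then none else
      if x = 1 then some (O.boundaryNext h, 0, t) else some (h, x, t))
    (fun h t => by simp) (fun h x => by simp)

theorem cut_stripPt {h : Γ.H} {x : I} {t : ℝ≥0} (ht : 0 < t) (hx : x < 1) :
    O.cut (O.stripPt h x t) = some (h, x, t) := by
  rw [cut, desc_stripPt, if_neg ht.ne', if_neg hx.ne]

/-- The universal covering of the punctured disks. -/
def Strips (_ : RibbonStructure Γ) : Type := (_ : Γ.H) × (ℝ × Set.Ioi (0 : ℝ≥0))

instance : TopologicalSpace O.Strips :=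
  inferInstanceAs (TopologicalSpace ((_ : Γ.H) × (ℝ × Set.Ioi (0 : ℝ≥0))))

/-- The point with coordinate `(u, t)` of the strip belonging to `h`. -/
def stripsPt (h : Γ.H) (u : ℝ) (t : Set.Ioi (0 : ℝ≥0)) : O.Strips := ⟨h, u, t⟩

instance : AddAction ℤ O.Strips where
  vadd j e := O.stripsPt ((O.bnPerm ^ (-j)) e.1) (e.2.1 + j) e.2.2
  zero_vadd e := by
    change O.stripsPt ((O.bnPerm ^ (-(0 : ℤ))) e.1) (e.2.1 + ((0 : ℤ) : ℝ)) e.2.2 = e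
    simp only [neg_zero, zpow_zero, Equiv.Perm.one_apply, Int.cast_zero, add_zero]
    rfl
  add_vadd i j e := by
    change O.stripsPt ((O.bnPerm ^ (-(i + j))) e.1) (e.2.1 + ((i + j : ℤ) : ℝ)) e.2.2 =
      O.stripsPt ((O.bnPerm ^ (-i)) ((O.bnPerm ^ (-j)) e.1)) (e.2.1 + j + i) e.2.2
    rw [← Equiv.Perm.mul_apply, ← zpow_add, neg_add]
    push_cast
    rw [add_assoc, add_comm (j : ℝ)]

theorem vadd_strips (j : ℤ) (h : Γ.H) (u : ℝ) (t : Set.Ioi (0 : ℝ≥0)) :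
    j +ᵥ O.stripsPt h u t = O.stripsPt ((O.bnPerm ^ (-j)) h) (u + j) t := rfl

/-- The covering of the punctured disks. -/
def stripsProj (e : O.Strips) : O.Punctured := ⟨O.bline e.1 e.2.1 e.2.2, e.2.2.2⟩

theorem stripsProj_vadd (j : ℤ) (e : O.Strips) : O.stripsProj (j +ᵥ e) = O.stripsProj e := by
  obtain ⟨h, u, t⟩ := e
  refine Subtype.ext ?_
  change O.bline ((O.bnPerm ^ (-j)) h) (u + j) t = O.bline h u t
  rw [bline_add, ← Equiv.Perm.mul_apply, ← zpow_add, add_neg_cancel]; rfl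

theorem exists_vadd_strips (e : O.Strips) : ∃ (j : ℤ) (h : Γ.H) (x : I) (t : Set.Ioi (0 : ℝ≥0)),
    x < 1 ∧ e = j +ᵥ O.stripsPt h x t := by
  obtain ⟨h, u, t⟩ := e
  refine ⟨⌊u⌋, (O.bnPerm ^ ⌊u⌋) h, ⟨Int.fract u, Int.fract_nonneg u, (Int.fract_lt_one u).le⟩, t,
    Int.fract_lt_one u, ?_⟩
  rw [vadd_strips, ← Equiv.Perm.mul_apply, ← zpow_add, neg_add_cancel]
  change (⟨h, u, t⟩ : (_ : Γ.H) × (ℝ × Set.Ioi (0 : ℝ≥0))) = ⟨h, Int.fract u + ⌊u⌋, t⟩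
  rw [Int.fract_add_floor]

theorem continuous_stripsProj : Continuous O.stripsProj :=
  continuous_sigma fun h => ((O.continuous_bline h).comp
    (f := fun e : ℝ × Set.Ioi (0 : ℝ≥0) => (e.1, (e.2 : ℝ≥0))) (by fun_prop)).subtype_mk _

/-- Above each boundary cycle the covering is `ℝ → ℝ / Nℤ`, with `N` the length of the cycle, times
the
identity of the height coordinate. The action of `ℤ` on all strips at once, which also permutes the
indices, treats all boundary cycles uniformly. -/
theorem isAddQuotientCoveringMap_stripsProj : IsAddQuotientCoveringMap O.stripsProj ℤ where
  surjective p := by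
    obtain ⟨p, hp⟩ := p
    rcases O.surface_cases p with ⟨q, rfl⟩ | ⟨h, x, t, rfl⟩
    · exact absurd hp (lt_irrefl _)
    · exact ⟨⟨h, x, t, hp⟩, Subtype.ext (O.bline_eq h x t)⟩
  eq_coinduced := TopologicalSpace.ext <| funext fun U => propext <| by
    change IsOpen U ↔ IsOpen (O.stripsProj ⁻¹' U)
    refine ⟨fun hU => hU.preimage O.continuous_stripsProj, fun hU => ?_⟩
    have hpos : IsOpen {p : O.Surface | 0 < O.height p} :=
      isOpen_lt continuous_const O.continuous_height
    rw [hpos.isOpenEmbedding_subtypeVal.isOpen_iff_image_isOpen, isOpen_surface_iff]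
    intro h
    have hemb : Topology.IsOpenEmbedding fun p : I × Set.Ioi (0 : ℝ≥0) => (p.1, (p.2 : ℝ≥0)) :=
      Topology.IsOpenEmbedding.id.prodMap isOpen_Ioi.isOpenEmbedding_subtypeVal
    have h1 : Continuous fun p : I × Set.Ioi (0 : ℝ≥0) => O.stripsPt h p.1 p.2 :=
      (@continuous_sigmaMk _ (fun _ : Γ.H => ℝ × Set.Ioi (0 : ℝ≥0)) _ h).comp
        (f := fun p : I × Set.Ioi (0 : ℝ≥0) => ((p.1 : ℝ), p.2)) (by fun_prop)
    convert hemb.isOpenMap _ (hU.preimage h1) using 1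
    ext ⟨x, t⟩
    constructor
    · rintro ⟨⟨p, hp⟩, hpU, hpe⟩
      have hpe : p = O.stripPt h x t := hpe
      subst hpe
      refine ⟨(x, ⟨t, hp⟩), ?_, rfl⟩
      have e : O.stripsProj (O.stripsPt h x ⟨t, hp⟩) = ⟨O.stripPt h x t, hp⟩ :=
          Subtype.ext (O.bline_eq h x t)
      change O.stripsProj (O.stripsPt h x ⟨t, hp⟩) ∈ U
      rwa [e]
    · rintro ⟨⟨x', t', ht'⟩, hpU, hpe⟩
      obtain ⟨rfl, rfl⟩ := Prod.mk.inj hpe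
      exact ⟨_, hpU, O.bline_eq h _ _⟩
  continuous_const_vadd j := continuous_sigma fun h =>
    (@continuous_sigmaMk _ (fun _ : Γ.H => ℝ × Set.Ioi (0 : ℝ≥0)) _ ((O.bnPerm ^ (-j)) h)).comp
      (f := fun e : ℝ × Set.Ioi (0 : ℝ≥0) => (e.1 + (j : ℝ), e.2)) (by fun_prop)
  apply_eq_iff_mem_orbit {e e'} := by
    refine ⟨fun hee => ?_, ?_⟩
    · obtain ⟨i, h, x, t, hx, rfl⟩ := O.exists_vadd_strips e
      obtain ⟨i', h', x', t', hx', rfl⟩ := O.exists_vadd_strips e'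
      rw [stripsProj_vadd, stripsProj_vadd] at hee
      have h1 := congrArg (fun p : O.Punctured => O.cut p.1) hee
      change O.cut (O.bline h x t) = O.cut (O.bline h' x' t') at h1
      rw [bline_eq, bline_eq, cut_stripPt _ t.2 hx, cut_stripPt _ t'.2 hx'] at h1
      simp only [Option.some.injEq, Prod.mk.injEq] at h1
      obtain ⟨rfl, rfl, h2⟩ := h1
      obtain rfl := Subtype.ext h2
      exact ⟨i - i', by change (i - i') +ᵥ (i' +ᵥ _) = _; rw [vadd_vadd, sub_add_cancel]⟩
    · rintro ⟨j, rfl⟩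
      exact O.stripsProj_vadd j e'
  disjoint e := by
    obtain ⟨h, u, t⟩ := e
    have hc : Continuous fun e : O.Strips => e.2.1 := continuous_sigma fun _ => continuous_fst
    refine ⟨{e | e.2.1 ∈ Set.Ioo (u - 1 / 2) (u + 1 / 2)}, (isOpen_Ioo.preimage hc).mem_nhds
      ⟨by change u - 1 / 2 < u; linarith, by change u < u + 1 / 2; linarith⟩, ?_⟩
    rintro j ⟨_, ⟨⟨k, v, s⟩, hv, rfl⟩, hv'⟩
    have h1 : v ∈ Set.Ioo (u - 1 / 2) (u + 1 / 2) := hv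
    have h2 : v + j ∈ Set.Ioo (u - 1 / 2) (u + 1 / 2) := hv'
    have h3 : (j : ℝ) < 1 := by linarith [h1.1, h2.2]
    have h4 : (-1 : ℝ) < j := by linarith [h1.2, h2.1]
    have h5 : j < 1 := by exact_mod_cast h3
    have h6 : -1 < j := by exact_mod_cast h4
    omega

/-- A periodic line in the punctured disks follows a boundary cycle. -/
theorem exists_lift_strips (B : ℝ → O.Surface) (hB : Continuous B) (hpos : ∀ u, 0 < O.height (B u))
    (N : ℝ) (hN : ∀ u, B (u + N) = B u) :
    ∃ (k : Γ.H) (θ : ℝ → ℝ) (j : ℤ), Continuous θ ∧ (∀ u, O.retr (B u) =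
      line (fun i x => Γ.edgePt ((O.bnPerm ^ i) k) x) (θ u)) ∧ (∀ u, θ (u + N) = θ u + j) ∧
      (O.bnPerm ^ j) k = k := by
  have hq := O.isAddQuotientCoveringMap_stripsProj
  have := hq.toContinuousConstVAdd
  obtain ⟨e₀, he₀⟩ := hq.surjective ⟨B 0, hpos 0⟩
  obtain ⟨F, ⟨-, hF⟩, -⟩ := hq.isCoveringMap.existsUnique_continuousMap_lifts
    ⟨fun u => (⟨B u, hpos u⟩ : O.Punctured), hB.subtype_mk _⟩ 0 e₀ he₀
  have hF' : ∀ u, O.stripsProj (F u) = ⟨B u, hpos u⟩ := congrFun hF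
  obtain ⟨j, hj⟩ := hq.apply_eq_iff_mem_orbit.1
    (show O.stripsProj (F (0 + N)) = O.stripsProj (F 0) by
      rw [hF', hF']; exact Subtype.ext (hN 0))
  have hper : (fun u => F (u + N)) = fun u => j +ᵥ F u := by
    refine hq.isCoveringMap.eq_of_comp_eq (by fun_prop) (F.continuous.const_vadd j) ?_ 0 hj.symm
    ext u
    simp only [Function.comp_apply, stripsProj_vadd, hF', hN]
  -- a path stays in one component of the disjoint union of the strips
  have hconst : ∀ u, (F u).1 = (F 0).1 := fun u => by
    have h1 := Sigma.isConnected_iff.1 (isConnected_range F.continuous)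
    obtain ⟨k, T, -, hT⟩ := h1
    have h2 : ∀ u, (F u).1 = k := fun u => by
      obtain ⟨x, -, hx⟩ := hT.subset ⟨u, rfl⟩
      rw [← hx]
    rw [h2, h2]
  have hc : Continuous fun e : O.Strips => e.2.1 := continuous_sigma fun _ => continuous_fst
  refine ⟨(F 0).1, fun u => (F u).2.1, j, hc.comp F.continuous, fun u => ?_, fun u => ?_, ?_⟩
  · have h1 : B u = O.bline (F u).1 (F u).2.1 (F u).2.2 := (congrArg Subtype.val (hF' u)).symm
    rw [h1, retr_bline, hconst]
  · have h1 := congrArg (fun e : O.Strips => e.2.1) (congrFun hper u)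
    exact h1
  · have h1 := congrArg Sigma.fst (congrFun hper 0)
    have h2 : (F (0 + N)).1 = (O.bnPerm ^ (-j)) (F 0).1 := h1
    rw [hconst] at h2
    conv_lhs => rw [h2]
    rw [← Equiv.Perm.mul_apply, ← zpow_add, add_neg_cancel]; rfl

end RibbonStructure

/-! ### Homeomorphisms of ribbon graph surfaces respect boundary cycles -/

theorem iterate_mul_eq {A : Type} {b : A → A} {a : A} {N : ℕ} (h : b^[N] a = a) (M : ℕ) :
    b^[M * N] a = a := by
  rw [mul_comm, Function.iterate_mul]
  exact Function.iterate_fixed h M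

theorem mk_orbitWord_pow {A α : Type} {b : A → A} (w : A → List (α × Bool)) {a : A} {N : ℕ}
    (h : b^[N] a = a) (M : ℕ) :
    FreeGroup.mk (orbitWord b w N a) ^ M = FreeGroup.mk (orbitWord b w (M * N) a) := by
  induction M with
  | zero => simp [orbitWord, FreeGroup.one_eq_mk]
  | succ M ih => rw [pow_succ, ih, Nat.succ_mul, orbitWord_add, iterate_mul_eq h, FreeGroup.mul_mk]

theorem le_length_orbitWord {A α : Type} {b : A → A} (w : A → List (α × Bool)) {a : A} {N : ℕ}
    (h : b^[N] a = a) (hpos : orbitWord b w N a ≠ []) (M : ℕ) :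
    M ≤ (orbitWord b w (M * N) a).length := by
  induction M with
  | zero => exact Nat.zero_le _
  | succ M ih =>
    rw [Nat.succ_mul, orbitWord_add, iterate_mul_eq h, List.length_append]
    exact Nat.add_le_add ih (List.length_pos_iff.2 hpos)

namespace Graph

open Classical in
/-- If a reduced periodic word is conjugate to the word of a period of an orbit, or to its inverse,
every pair of successive letters of the former occurs in the latter, possibly inverted. -/
theorem pair_of_isConj {Γ : Graph} {A : Type} {b : A → A} {l : A → Option Γ.H} {a : A} {N : ℕ}
    (hb : b^[N + 2] a = a)
    (hred : ∀ m, FreeGroup.IsReduced (orbitWord b (fun a => letters (l a)) m a))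
    {b' : Γ.H → Γ.H} {k : Γ.H} {m : ℕ} (hb' : b'^[m] k = k)
    (hred' : ∀ m, FreeGroup.IsReduced (orbitWord b' (fun a => [Γ.letter a]) m k))
        {y : FreeGroup Γ.H}
    (hy : y = FreeGroup.mk (orbitWord b' (fun a => [Γ.letter a]) m k) ∨
      y = (FreeGroup.mk (orbitWord b' (fun a => [Γ.letter a]) m k))⁻¹)
    (hconj : IsConj (FreeGroup.mk (orbitWord b (fun a => letters (l a)) (N + 2) a)) y)
    {p q : Γ.H} (hp : l a = some p) (hq : l (b a) = some q) :
    q = b' p ∨ Γ.flip p = b' (Γ.flip q) := by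
  obtain ⟨g, hg⟩ := isConj_iff.1 hconj
  set W := orbitWord b (fun a => letters (l a)) with hW
  set c := g.toWord.length
  -- in a high power, the letters of `p` and `q` are too far from the ends to be changed by
  -- a conjugation
  obtain ⟨R, hR⟩ : ∃ R, W (N + 2) a = [Γ.letter p, Γ.letter q] ++ R :=
    ⟨W N (b (b a)), by simp [hW, orbitWord, hp, hq, letters]⟩
  have hne : W (N + 2) a ≠ [] := by rw [hR]; simp
  have h1 : (FreeGroup.mk (W (N + 2) a) ^ (c + 1 + c)).toWord =
      W (c * (N + 2)) a ++ [Γ.letter p, Γ.letter q] ++ (R ++ W (c * (N + 2)) a) := by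
    rw [mk_orbitWord_pow _ hb, FreeGroup.toWord_mk, (hred _).reduce_eq, add_mul, add_mul, one_mul,
      hW, orbitWord_add, orbitWord_add, Function.iterate_add_apply, hb, iterate_mul_eq hb, ← hW, hR]
    simp
  have h2 := infix_toWord_conj g h1 (le_length_orbitWord _ hb hne c) (by
    rw [List.length_append]
    exact (le_length_orbitWord _ hb hne c).trans (Nat.le_add_left _ _))
  rw [← conj_pow, hg] at h2
  rcases hy with rfl | rfl
  · rw [mk_orbitWord_pow _ hb', FreeGroup.toWord_mk, (hred' _).reduce_eq] at h2
    obtain ⟨d, e1, e2⟩ := orbitWord_pair _ _ _ _ h2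
    rw [← letter_injective e1] at e2
    exact Or.inl (letter_injective e2)
  · rw [inv_pow, FreeGroup.toWord_inv, mk_orbitWord_pow _ hb', FreeGroup.toWord_mk,
      (hred' _).reduce_eq] at h2
    obtain ⟨S, T, h3⟩ := h2
    have h4 := congrArg FreeGroup.invRev h3
    rw [FreeGroup.invRev_invRev] at h4
    have h5 : [Γ.letter (Γ.flip q), Γ.letter (Γ.flip p)] <:+:
        orbitWord b' (fun a => [Γ.letter a]) ((c + 1 + c) * m) k := by
      refine ⟨FreeGroup.invRev T, FreeGroup.invRev S, ?_⟩
      rw [← h4]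
      simp [FreeGroup.invRev, letter_flip]
    obtain ⟨d, e1, e2⟩ := orbitWord_pair _ _ _ _ h5
    rw [← letter_injective e1] at e2
    exact Or.inr (letter_injective e2)

end Graph

open RibbonCover.Graph in
/-- Let `h` be a homeomorphism between the surfaces of ribbon graphs, the second one with one
vertex, which up to homotopy is given by a map `f` of graphs that takes every edge to an edge or
a point. Then two edges which are in succession in the image of a boundary cycle of the first graph
are also in succession in a boundary cycle of the second, in one of the two directions. -/
theorem boundaryNext_of_homeomorph {Γ₁ Γ₂ : Graph} [Finite Γ₁.H] [Finite Γ₂.V] [Finite Γ₂.H]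
    [Subsingleton Γ₂.V] (w₀ : Γ₂.V) (O₁ : RibbonStructure Γ₁) (O₂ : RibbonStructure Γ₂)
    (h : O₁.Surface ≃ₜ O₂.Surface) (f : C(Γ₁.Space, Γ₂.Space)) (l : Γ₁.H → Option Γ₂.H)
    (hfl : ∀ a x, f (Γ₁.edgePt a x) = labelPt w₀ (l a) x)
    (hf : (O₂.retr.comp ((h : C(O₁.Surface, O₂.Surface)).comp O₁.incl)).Homotopic f)
    (hO₂ : ∀ k, O₂.next k ≠ k)
    (h1 : ∀ a p q, l a = some p → l (O₁.boundaryNext a) = some q → q ≠ Γ₂.flip p)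
    (h2 : ∀ a p, l a = some p → l (O₁.boundaryNext a) = none →
      l (O₁.boundaryNext (O₁.boundaryNext a)) ≠ none ∧
        ∀ q, l (O₁.boundaryNext (O₁.boundaryNext a)) = some q → q ≠ Γ₂.flip p)
    {a : Γ₁.H} {p q : Γ₂.H} (hp : l a = some p) (hq : l (O₁.boundaryNext a) = some q) :
    q = O₂.boundaryNext p ∨ Γ₂.flip p = O₂.boundaryNext (Γ₂.flip q) := by
  have := compactSpace_space (Γ := Γ₂)
  -- a boundary curve far away from the graph misses the preimage of the second graph
  obtain ⟨T, hT⟩ : ∃ T, ∀ x, O₁.height (h.symm (O₂.incl x)) ≤ T := by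
    obtain ⟨T, hT⟩ := (isCompact_range (O₁.continuous_height.comp
      (h.symm.continuous.comp O₂.incl.continuous))).bddAbove
    exact ⟨T, fun x => hT ⟨x, rfl⟩⟩
  set t₀ := T + 1
  have hBc : Continuous fun u : ℝ => O₁.bline a u t₀ :=
    (O₁.continuous_bline a).comp (f := fun u : ℝ => (u, t₀)) (by fun_prop)
  have hpos : ∀ u, 0 < O₂.height (h (O₁.bline a u t₀)) := fun u => by
    by_contra hu
    obtain ⟨x, hx⟩ := O₂.mem_range_incl hu
    have h3 := hT x
    rw [hx, h.symm_apply_apply, O₁.height_bline] at h3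
    exact absurd h3 (not_le.2 (lt_add_one T))
  -- a period of at least two, so that one period contains both letters
  obtain ⟨N, hN⟩ : ∃ N : ℕ, O₁.bnPerm ^ (N + 2) = 1 := by
    have : Nonempty Γ₁.H := ⟨a⟩
    have h3 := orderOf_pos O₁.bnPerm
    refine ⟨2 * orderOf O₁.bnPerm - 2, ?_⟩
    rw [Nat.sub_add_cancel (by omega), mul_comm, pow_mul, pow_orderOf_eq_one, one_pow]
  have hNa : (O₁.bnPerm ^ ((N + 2 : ℕ) : ℤ)) a = a := by rw [zpow_natCast, hN]; rfl
  have hBper : ∀ u, O₁.bline a (u + (N + 2 : ℕ)) t₀ = O₁.bline a u t₀ := fun u => by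
    have h3 := O₁.bline_add a u ((N + 2 : ℕ) : ℤ) t₀
    rw [hNa] at h3
    exact_mod_cast h3
  obtain ⟨k, θ, j, hθ, hret, hθN, hk⟩ := O₂.exists_lift_strips _ (h.continuous.comp hBc) hpos
    ((N + 2 : ℕ) : ℝ) (fun u => congrArg h (hBper u))
  have hhom : (f.comp O₁.retr).Homotopic (O₂.retr.comp (h : C(O₁.Surface, O₂.Surface))) := by
    have h3 := hf.comp (ContinuousMap.Homotopic.refl O₁.retr)
    refine h3.symm.trans ?_
    rw [ContinuousMap.comp_assoc, ContinuousMap.comp_assoc, ← ContinuousMap.comp_assoc]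
    exact (ContinuousMap.Homotopic.refl _).comp O₁.incl_comp_retr
  obtain ⟨H⟩ := hhom
  -- the image of the boundary curve in the second graph is homotopic to its edge path under `f`,
  -- and it runs along a boundary cycle of the second graph
  have hconj := isConj_of_periodic (isQuotientCoveringMap_coverProj (Γ := Γ₂) gen gen_flip)
    ((N + 2 : ℕ) : ℝ) (H.toContinuousMap.comp ⟨fun q : I × ℝ => (q.1, O₁.bline a q.2 t₀),
      continuous_fst.prodMk (hBc.comp continuous_snd)⟩)
    (fun s u => congrArg (fun z => H (s, z)) (hBper u))
    (l₀ := liftLine O₁.bnPerm l w₀ a) (l₁ := fun u => liftLine O₂.bnPerm some w₀ k (θ u))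
    (continuous_liftLine _ _ _ _) ((continuous_liftLine _ _ _ _).comp hθ)
    (fun u => (H.apply_zero _).trans (by
      rw [coverProj_liftLine, ContinuousMap.comp_apply, RibbonStructure.retr_bline]
      exact hfl _ _))
    (fun u => (H.apply_one _).trans (by
      rw [coverProj_liftLine]
      exact hret u))
    (fun u => by exact_mod_cast liftLine_add O₁.bnPerm l w₀ a ((N + 2 : ℕ) : ℤ) hNa u)
    (fun u => by rw [hθN, liftLine_add _ _ _ _ _ hk])
  rw [hol, skew_pow, one_mul] at hconj
  have hred' : ∀ m, FreeGroup.IsReduced (orbitWord O₂.bnPerm (fun a => [Γ₂.letter a]) m k) :=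
    fun m => isReduced_orbitWord O₂.bnPerm some (fun a p q e1 e2 => by
      obtain rfl := Option.some.inj e1
      obtain rfl := Option.some.inj e2
      exact hO₂ _) (fun a p _ e => absurd e (by simp)) m k
  have hNa' : O₁.bnPerm^[N + 2] a = a := by
    rw [← Equiv.Perm.coe_pow, hN]; rfl
  obtain ⟨m, rfl | rfl⟩ := j.eq_nat_or_neg
  · rw [zpow_natCast] at hk
    rw [zpow_natCast, hol, skew_pow, one_mul] at hconj
    exact pair_of_isConj hNa' (isReduced_orbitWord _ _ h1 h2 · a)
      (by rw [← Equiv.Perm.coe_pow]; exact hk) hred' (Or.inl rfl) hconj hp hq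
  · have hk' : O₂.bnPerm^[m] k = k := by
      rw [← Equiv.Perm.coe_pow]
      rw [zpow_neg, Equiv.Perm.inv_eq_iff_eq, zpow_natCast] at hk
      exact hk.symm
    refine pair_of_isConj hNa' (isReduced_orbitWord _ _ h1 h2 · a) hk' hred' (Or.inr ?_) hconj hp hq
    have h3 : ((hol O₂.bnPerm some ^ (-(m : ℤ))) (1, k)).2 = k :=
      (skew_zpow_snd O₂.bnPerm _ (-(m : ℤ)) ((1 : FreeGroup Γ₂.H), k)).trans hk
    have h4 : (hol O₂.bnPerm some ^ m) ((hol O₂.bnPerm some ^ (-(m : ℤ))) (1, k)) = (1, k) := by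
      rw [zpow_neg, zpow_natCast, ← Equiv.Perm.mul_apply, mul_inv_cancel]; rfl
    rw [show (hol O₂.bnPerm some ^ (-(m : ℤ))) (1, k) =
      (((hol O₂.bnPerm some ^ (-(m : ℤ))) (1, k)).1, k) from Prod.ext rfl h3] at h4
    have h5 := (skew_pow O₂.bnPerm (fun a => letters (some a)) m _ k).symm.trans h4
    exact eq_inv_of_mul_eq_one_left (congrArg Prod.fst h5)

/-! ### Blowing up a vertex of a ribbon graph -/

namespace RibbonStructure

/-- The truncation of `-y` to the unit interval. -/
def clampNeg (y : ℝ) : ℝ := max 0 (min 1 (-y))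

theorem continuous_clampNeg : Continuous clampNeg := by unfold clampNeg; fun_prop

theorem clampNeg_nonneg (y : ℝ) : 0 ≤ clampNeg y := le_max_left _ _

theorem clampNeg_le_one (y : ℝ) : clampNeg y ≤ 1 := max_le zero_le_one (min_le_left _ _)

/-- First coordinate of the plane homeomorphism that takes the L-shaped region
`[-1, 0] × (-∞, 0] ∪ [0, 1 / 2] × ℝ` to the band `[0, 1 / 2] × ℝ`. It is the identity where
`x = 1 / 2`, and an isometry between the left boundaries of the regions. -/
def warpX (x y : ℝ) : ℝ := (x + clampNeg (y + min x 0)) / (1 + 2 * clampNeg (y + min x 0))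

/-- Second coordinate of the plane homeomorphism that takes the L-shaped region to the band. -/
def warpY (x y : ℝ) : ℝ := y + min x 0 + 1 - 2 * warpX x y

/-- First coordinate of the inverse homeomorphism, from the band to the L-shaped region. -/
def unwarpX (x y : ℝ) : ℝ :=
  x * (1 + 2 * clampNeg (y - (1 - 2 * x))) - clampNeg (y - (1 - 2 * x))

/-- Second coordinate of the inverse homeomorphism, from the band to the L-shaped region. -/
def unwarpY (x y : ℝ) : ℝ := y - (1 - 2 * x) - min (unwarpX x y) 0

theorem continuous_warpX : Continuous fun p : ℝ × ℝ => warpX p.1 p.2 := by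
  have h := continuous_clampNeg
  unfold warpX
  refine Continuous.div (by fun_prop) (by fun_prop) fun p => ?_
  have := clampNeg_nonneg (p.2 + min p.1 0)
  positivity

theorem continuous_warpY : Continuous fun p : ℝ × ℝ => warpY p.1 p.2 := by
  have h := continuous_warpX
  unfold warpY
  fun_prop

theorem continuous_unwarpX : Continuous fun p : ℝ × ℝ => unwarpX p.1 p.2 := by
  have h := continuous_clampNeg
  unfold unwarpX
  fun_prop

theorem continuous_unwarpY : Continuous fun p : ℝ × ℝ => unwarpY p.1 p.2 := by
  have h := continuous_unwarpX
  unfold unwarpY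
  fun_prop

theorem shift_warp (x y : ℝ) : warpY x y - (1 - 2 * warpX x y) = y + min x 0 := by
  unfold warpY; ring

theorem unwarpX_warp (x y : ℝ) : unwarpX (warpX x y) (warpY x y) = x := by
  rw [unwarpX, shift_warp, warpX]
  have := clampNeg_nonneg (y + min x 0)
  rw [div_mul_cancel₀ _ (by positivity)]
  ring

theorem unwarpY_warp (x y : ℝ) : unwarpY (warpX x y) (warpY x y) = y := by
  rw [unwarpY, shift_warp, unwarpX_warp]; ring

theorem shift_unwarp (x y : ℝ) : unwarpY x y + min (unwarpX x y) 0 = y - (1 - 2 * x) := by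
  unfold unwarpY; ring

theorem warpX_unwarp (x y : ℝ) : warpX (unwarpX x y) (unwarpY x y) = x := by
  rw [warpX, shift_unwarp, unwarpX]
  have := clampNeg_nonneg (y - (1 - 2 * x))
  rw [sub_add_cancel, mul_div_cancel_right₀ _ (by positivity)]

theorem warpY_unwarp (x y : ℝ) : warpY (unwarpX x y) (unwarpY x y) = y := by
  rw [warpY, shift_unwarp, warpX_unwarp]; ring

theorem le_clampNeg {x y : ℝ} (h1 : -1 ≤ x) (h2 : x ≤ 0 → y ≤ 0) :
    -x ≤ clampNeg (y + min x 0) := by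
  rcases le_total x 0 with h | h
  · rw [min_eq_left h]
    exact le_max_of_le_right (le_min (by linarith) (by linarith [h2 h]))
  · exact le_trans (by linarith) (clampNeg_nonneg _)

theorem warpX_mem {x y : ℝ} (h1 : -1 ≤ x) (h2 : x < 0 → y ≤ 0) (h3 : x ≤ 1 / 2) :
    warpX x y ∈ Set.Icc (0 : ℝ) (1 / 2) := by
  have hr := clampNeg_nonneg (y + min x 0)
  have hx : -x ≤ clampNeg (y + min x 0) := by
    rcases lt_or_ge x 0 with h | h
    · exact le_clampNeg h1 fun _ => h2 h
    · linarith
  refine ⟨div_nonneg (by linarith) (by linarith), ?_⟩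
  rw [warpX, div_le_iff₀ (by linarith)]
  linarith

/-- The coordinate change maps the two pieces of the L-shaped region onto the band. -/
theorem exists_warp {x : ℝ} (hx : x ∈ Set.Icc (0 : ℝ) (1 / 2)) (y : ℝ) :
    ∃ x' y', x = warpX x' y' ∧ y = warpY x' y' ∧
      (x' ∈ Set.Icc (0 : ℝ) (1 / 2) ∨ x' ∈ Set.Icc (-1 : ℝ) 0 ∧ y' ≤ 0) := by
  refine ⟨unwarpX x y, unwarpY x y, (warpX_unwarp x y).symm, (warpY_unwarp x y).symm, ?_⟩
  have hr0 := clampNeg_nonneg (y - (1 - 2 * x))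
  have hr1 := clampNeg_le_one (y - (1 - 2 * x))
  have e : unwarpX x y = x * (1 + 2 * clampNeg (y - (1 - 2 * x))) -
      clampNeg (y - (1 - 2 * x)) := rfl
  have h1 : 0 ≤ x * (1 + 2 * clampNeg (y - (1 - 2 * x))) := mul_nonneg hx.1 (by linarith)
  have h2 : x * (1 + 2 * clampNeg (y - (1 - 2 * x))) ≤
    1 / 2 * (1 + 2 * clampNeg (y - (1 - 2 * x))) := mul_le_mul_of_nonneg_right hx.2 (by linarith)
  rcases le_or_gt 0 (unwarpX x y) with h | h
  · exact Or.inl ⟨h, by linarith⟩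
  · refine Or.inr ⟨⟨by linarith, h.le⟩, ?_⟩
    rw [unwarpY, min_eq_left h.le]
    have h3 : 0 < clampNeg (y - (1 - 2 * x)) := by linarith
    have h4 : clampNeg (y - (1 - 2 * x)) ≤ -(y - (1 - 2 * x)) := by
      rcases lt_max_iff.1 h3 with h5 | h5
      · exact absurd h5 (lt_irrefl _)
      · rw [clampNeg, max_eq_right h5.le]; exact min_le_right _ _
    linarith

theorem warpX_half (y : ℝ) : warpX (1 / 2) y = 1 / 2 := by
  rw [warpX, div_eq_iff]
  · ring
  · have := clampNeg_nonneg (y + min (1 / 2) 0)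
    positivity

theorem warpY_half (y : ℝ) : warpY (1 / 2) y = y := by
  rw [warpY, warpX_half]; norm_num

theorem warpX_left {y : ℝ} (hy : y ≤ 0) : warpX (-1) y = 0 := by
  have h : clampNeg (y + min (-1) 0) = 1 := by
    rw [min_eq_left (by norm_num), clampNeg, min_eq_left (by linarith), max_eq_right zero_le_one]
  rw [warpX, h]; norm_num

theorem warpY_left {y : ℝ} (hy : y ≤ 0) : warpY (-1) y = y := by
  rw [warpY, warpX_left hy]; norm_num

theorem warpX_bottom {x : ℝ} (hx : x ∈ Set.Icc (-1 : ℝ) 0) : warpX x 0 = 0 := by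
  have h : clampNeg (0 + min x 0) = -x := by
    rw [min_eq_left hx.2, clampNeg, zero_add, min_eq_right (by linarith [hx.1]),
      max_eq_right (by linarith [hx.2])]
  rw [warpX, h]; norm_num

theorem warpY_bottom {x : ℝ} (hx : x ∈ Set.Icc (-1 : ℝ) 0) : warpY x 0 = x + 1 := by
  rw [warpY, warpX_bottom hx, min_eq_left hx.2]; ring

theorem warpX_top {y : ℝ} (hy : 0 ≤ y) : warpX 0 y = 0 := by
  have h : clampNeg (y + min 0 0) = 0 := by
    rw [min_self, clampNeg, min_eq_right (by linarith), max_eq_left (by linarith)]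
  rw [warpX, h]; norm_num

theorem warpY_top {y : ℝ} (hy : 0 ≤ y) : warpY 0 y = y + 1 := by
  rw [warpY, warpX_top hy, min_self]; ring

/-- The map of the band that corresponds to the map of the L-shaped region given by `S` on
the part `[-1, 0] × (-∞, 0]` and by `T` on the part `[0, 1 / 2] × ℝ`. -/
def lShape {Y : Type*} (S T : ℝ → ℝ → Y) (x y : ℝ) : Y :=
  -- the coordinate `x` is clamped, to make this continuous outside of the band as well
  if unwarpX (max x 0) y ≤ min 0 (-(y - (1 - 2 * max x 0))) then
    S (unwarpX (max x 0) y) (unwarpY (max x 0) y) else T (unwarpX (max x 0) y) (unwarpY (max x 0) y)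

theorem continuous_lShape {Y : Type*} [TopologicalSpace Y] {S T : ℝ → ℝ → Y}
    (hS : Continuous fun p : ℝ × ℝ => S p.1 p.2) (hT : Continuous fun p : ℝ × ℝ => T p.1 p.2)
    (hST : ∀ y ≤ 0, S 0 y = T 0 y) : Continuous fun p : ℝ × ℝ => lShape S T p.1 p.2 := by
  have hm : Continuous fun p : ℝ × ℝ => (max p.1 0, p.2) := by fun_prop
  have h1 := continuous_unwarpX.comp hm
  have h2 := continuous_unwarpY.comp hm
  refine Continuous.if_le (hS.comp (h1.prodMk h2)) (hT.comp (h1.prodMk h2)) h1 (by fun_prop) ?_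
  intro p hp
  have hx : (0 : ℝ) ≤ max p.1 0 := le_max_right _ _
  change S (unwarpX (max p.1 0) p.2) (unwarpY (max p.1 0) p.2) =
    T (unwarpX (max p.1 0) p.2) (unwarpY (max p.1 0) p.2)
  change unwarpX (max p.1 0) p.2 = _ at hp
  generalize max p.1 0 = x at hx hp
  generalize p.2 = y at hp
  rcases lt_or_ge 0 (y - (1 - 2 * x)) with h | h
  · have h3 : clampNeg (y - (1 - 2 * x)) = 0 := by
      rw [clampNeg, min_eq_right (by linarith), max_eq_left (by linarith)]
    rw [unwarpX, h3, min_eq_right (by linarith)] at hp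
    linarith
  · rw [min_eq_left (by linarith)] at hp
    have h4 : unwarpY x y ≤ 0 := by rw [unwarpY, hp, min_self]; linarith
    rw [hp]
    exact hST _ h4

theorem lShape_warp_of_nonneg {Y : Type*} {S T : ℝ → ℝ → Y} (hST : ∀ y ≤ 0, S 0 y = T 0 y)
    {x y : ℝ} (hx : x ∈ Set.Icc (0 : ℝ) (1 / 2)) : lShape S T (warpX x y) (warpY x y) = T x y := by
  rw [lShape, max_eq_left (warpX_mem (by linarith [hx.1]) (fun h => absurd hx.1 (not_le.2 h))
    hx.2).1, shift_warp, unwarpX_warp, unwarpY_warp, min_eq_right hx.1, add_zero]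
  split_ifs with h
  · obtain rfl : x = 0 := le_antisymm (h.trans (min_le_left _ _)) hx.1
    exact hST y (by linarith [h.trans (min_le_right _ _)])
  · rfl

theorem lShape_warp_of_nonpos {Y : Type*} {S T : ℝ → ℝ → Y} {x y : ℝ}
    (hx : x ∈ Set.Icc (-1 : ℝ) 0) (hy : y ≤ 0) :
    lShape S T (warpX x y) (warpY x y) = S x y := by
  rw [lShape, max_eq_left (warpX_mem hx.1 (fun _ => hy) (by linarith [hx.2])).1, shift_warp,
    unwarpX_warp, unwarpY_warp, min_eq_left hx.2, if_pos]
  exact le_min hx.2 (by linarith [hx.2])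

end RibbonStructure

theorem apply_zpow_eq {A Y : Type*} {f : Equiv.Perm A} {r : A → Y} (h : ∀ x, r (f x) = r x) (i : ℤ)
    (x : A) : r ((f ^ i) x) = r x := by
  induction i using Int.induction_on generalizing x with
  | zero => rfl
  | succ n ih => rw [zpow_add_one, Equiv.Perm.mul_apply, ih, h]
  | pred n ih =>
    rw [zpow_sub_one, Equiv.Perm.mul_apply, ih, ← h, ← Equiv.Perm.mul_apply, mul_inv_cancel]; rfl

namespace Graph

open Classical in
/-- The vertex of a half edge after moving the half edges `a` and `b` to a new vertex `true`. -/
def blowUpRoot {H : Type} (a b : H) : H ⊕ Bool → Bool :=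
  Sum.elim (fun h => decide (h = a ∨ h = b)) id

theorem blowUpRoot_eq_true {H : Type} {a b h : H} :
    blowUpRoot a b (Sum.inl h) = true ↔ h = a ∨ h = b := by simp [blowUpRoot]

theorem blowUpRoot_eq_false {H : Type} {a b h : H} :
    blowUpRoot a b (Sum.inl h) = false ↔ ¬ (h = a ∨ h = b) := by simp [blowUpRoot]

/-- The graph obtained from a graph with one vertex by moving the half edges `a` and `b` to a new
vertex `true`, which is joined to the old vertex `false` by a new edge. The half edge of the
new edge at the vertex `c` is `Sum.inr c`. -/
def blowUp (Γ : Graph) (a b : Γ.H) : Graph where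
  V := Bool
  H := Γ.H ⊕ Bool
  flip := Sum.map Γ.flip not
  flip_flip h := by rcases h with h | c <;> simp [Γ.flip_flip]
  flip_ne h := by rcases h with h | c <;> simp [Γ.flip_ne]
  root := blowUpRoot a b

end Graph

namespace RibbonStructure

variable {Γ : Graph} (O : RibbonStructure Γ) {a : Γ.H}

open Classical in
/-- The successor of a half edge after moving `a` and its successor to a new vertex. -/
def blowUpNext (a : Γ.H) : Γ.H ⊕ Bool → Γ.H ⊕ Bool
  | Sum.inl h => if h = O.next a then Sum.inr true else if O.next h = a then Sum.inr false
      else Sum.inl (O.next h)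
  | Sum.inr true => Sum.inl a
  | Sum.inr false => Sum.inl (O.next (O.next a))

open Classical in
/-- The predecessor of a half edge after moving `a` and its successor to a new vertex. -/
def blowUpPrev (a : Γ.H) : Γ.H ⊕ Bool → Γ.H ⊕ Bool
  | Sum.inl h => if h = a then Sum.inr true else if h = O.next (O.next a) then Sum.inr false
      else Sum.inl (O.next.symm h)
  | Sum.inr true => Sum.inl (O.next a)
  | Sum.inr false => Sum.inl (O.next.symm a)

/-- The permutation of half edges after moving `a` and its successor to a new vertex. -/
def blowUpPerm (ha : O.next (O.next a) ≠ a) : Equiv.Perm (Γ.H ⊕ Bool) where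
  toFun := O.blowUpNext a
  invFun := O.blowUpPrev a
  left_inv x := by
    rcases x with h | _ | _
    · by_cases h1 : h = O.next a
      · simp [blowUpNext, blowUpPrev, h1]
      · by_cases h2 : O.next h = a
        · simp [blowUpNext, blowUpPrev, h1, h2, Equiv.symm_apply_eq]
        · simp [blowUpNext, blowUpPrev, h1, h2]
    · simp [blowUpNext, blowUpPrev, ha]
    · simp [blowUpNext, blowUpPrev]
  right_inv x := by
    rcases x with h | _ | _
    · by_cases h1 : h = a
      · simp [blowUpNext, blowUpPrev, h1]
      · by_cases h2 : h = O.next (O.next a)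
        · simp [blowUpNext, blowUpPrev, h2, ha]
        · simp [blowUpNext, blowUpPrev, h1, h2, Equiv.symm_apply_eq]
    · have : O.next.symm a ≠ O.next a := fun e => ha (by rw [← e, Equiv.apply_symm_apply])
      simp [blowUpNext, blowUpPrev, this]
    · simp [blowUpNext, blowUpPrev]

theorem next_ne (ha : O.next (O.next a) ≠ a) : O.next a ≠ a := fun e => ha (by rw [e, e])

/-- The ribbon structure of the blown up graph. -/
def blowUp [Finite Γ.H] [Subsingleton Γ.V] (ha : O.next (O.next a) ≠ a) :
    RibbonStructure (Γ.blowUp a (O.next a)) where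
  next := O.blowUpPerm ha
  sameCycle_iff := by
    have hroot : ∀ x, Graph.blowUpRoot a (O.next a) (O.blowUpPerm ha x) =
        Graph.blowUpRoot a (O.next a) x := by
      have hne := O.next_ne ha
      rintro (h | _ | _)
      · change Graph.blowUpRoot a (O.next a) (O.blowUpNext a (Sum.inl h)) = _
        rw [blowUpNext]
        split_ifs with h1 h2
        · exact (Graph.blowUpRoot_eq_true.2 (Or.inr h1)).symm
        · have : h ≠ a := fun e => hne (by rw [← e, h2, e])
          exact (Graph.blowUpRoot_eq_false.2 (by simp [h1, this])).symm
        · simp [Graph.blowUpRoot, h1, h2]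
      · exact Graph.blowUpRoot_eq_false.2 (by simp [ha, hne])
      · exact Graph.blowUpRoot_eq_true.2 (Or.inl rfl)
    have hstep : ∀ x y, O.blowUpNext a x = y → (O.blowUpPerm ha).SameCycle x y := by
      rintro x _ rfl
      exact ⟨1, rfl⟩
    have htrue : (O.blowUpPerm ha).SameCycle (Sum.inl a) (Sum.inr true) :=
      (hstep (Sum.inr true) (Sum.inl a) rfl).symm
    have htrue' : (O.blowUpPerm ha).SameCycle (Sum.inl (O.next a)) (Sum.inr true) :=
      hstep _ _ (by simp [blowUpNext])
    have hfalse : ∀ h, h = a ∨ h = O.next a ∨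
        (O.blowUpPerm ha).SameCycle (Sum.inl h) (Sum.inr false) := by
      have h1 : ∀ h, (h = a ∨ h = O.next a ∨
          (O.blowUpPerm ha).SameCycle (Sum.inl h) (Sum.inr false)) → (O.next h = a ∨
          O.next h = O.next a ∨
          (O.blowUpPerm ha).SameCycle (Sum.inl (O.next h)) (Sum.inr false)) := by
        rintro h (rfl | rfl | hh)
        · exact Or.inr (Or.inl rfl)
        · exact Or.inr (Or.inr (hstep (Sum.inr false) _ rfl).symm)
        · by_cases e1 : O.next h = a
          · exact Or.inl e1
          by_cases e2 : h = O.next a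
          · rw [e2]; exact Or.inr (Or.inr (hstep (Sum.inr false) _ rfl).symm)
          · exact Or.inr (Or.inr ((hstep _ _ (by simp [blowUpNext, e1, e2])).symm.trans hh))
      intro h
      obtain ⟨i, -, rfl⟩ := ((O.sameCycle_iff a h).2 (Subsingleton.elim _ _)).exists_pow_eq'
      induction i with
      | zero => exact Or.inl rfl
      | succ i ih => rw [pow_succ']; exact h1 _ ih
    have hcyc : ∀ x, (O.blowUpPerm ha).SameCycle x (Sum.inr (Graph.blowUpRoot a (O.next a) x)) := by
      rintro (h | c)
      · by_cases h1 : h = a ∨ h = O.next a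
        · rw [Graph.blowUpRoot_eq_true.2 h1]
          rcases h1 with rfl | rfl
          · exact htrue
          · exact htrue'
        · rw [Graph.blowUpRoot_eq_false.2 h1]
          rw [not_or] at h1
          exact ((hfalse h).resolve_left h1.1).resolve_left h1.2
      · exact Equiv.Perm.SameCycle.refl _ _
    intro x y
    refine ⟨?_, fun e => (hcyc x).trans ?_⟩
    · rintro ⟨i, rfl⟩
      exact (apply_zpow_eq hroot i x).symm
    · change Graph.blowUpRoot a (O.next a) x = Graph.blowUpRoot a (O.next a) y at e
      rw [e]
      exact (hcyc y).symm

end RibbonStructure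

/-! ### The homeomorphism of surfaces for a blow-up -/

namespace RibbonStructure

variable {Γ : Graph} (O : RibbonStructure Γ) {a : Γ.H}

theorem root_surjective_blowUp (b : Γ.H) : Function.Surjective (Γ.blowUp a b).root := fun c =>
  ⟨Sum.inr c, rfl⟩

theorem root_surjective_of_subsingleton [Subsingleton Γ.V] (a : Γ.H) :
    Function.Surjective Γ.root := fun _ => ⟨a, Subsingleton.elim _ _⟩

/-- A half edge of the original graph, as a half edge of the blown up graph. -/
def old (a h : Γ.H) : (Γ.blowUp a (O.next a)).H := Sum.inl h

/-- A half edge of the new edge of the blown up graph. -/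
def new (a : Γ.H) (c : Bool) : (Γ.blowUp a (O.next a)).H := Sum.inr c

theorem flip_new (a : Γ.H) (c : Bool) :
    (Γ.blowUp a (O.next a)).flip (O.new a c) = O.new a (!c) := rfl

/-- The band of `a` in terms of the coordinates of the L-shaped region. -/
def warpBand (a : Γ.H) (x y : ℝ) : O.Surface := O.band a (warpX x y) (warpY x y)

/-- The band of the successor of `a` in terms of the coordinates of the L-shaped region. -/
def warpBandNext (a : Γ.H) (x y : ℝ) : O.Surface := O.band (O.next a) (warpX x y) (-warpY x y)

theorem continuous_warpBand (a : Γ.H) : Continuous fun p : ℝ × ℝ => O.warpBand a p.1 p.2 :=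
  (O.continuous_band a).comp (continuous_warpX.prodMk continuous_warpY)

theorem continuous_warpBandNext (a : Γ.H) : Continuous fun p : ℝ × ℝ => O.warpBandNext a p.1 p.2 :=
  (O.continuous_band _).comp (continuous_warpX.prodMk continuous_warpY.neg)

theorem warpBand_bottom (a : Γ.H) {x : ℝ} (hx : x ∈ Set.Icc (-1 : ℝ) 0) :
    O.warpBand a x 0 = O.warpBandNext a x 0 := by
  rw [warpBand, warpBandNext, warpX_bottom hx, warpY_bottom hx, band_next _ _ (by linarith [hx.1])]

theorem warpBand_top (a : Γ.H) {y : ℝ} (hy : 0 ≤ y) :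
    O.warpBand a 0 y = O.warpBandNext a 0 y := by
  rw [warpBand, warpBandNext, warpX_top hy, warpY_top hy, band_next _ _ (by linarith)]

open Classical in
/-- The map from the bands of the blown up graph to the surface of the original graph. -/
def blowDownBand (a : Γ.H) : Γ.H ⊕ Bool → ℝ → ℝ → O.Surface
  | Sum.inl h, x, y => if h = a then O.warpBand a x y else
      if h = O.next a then O.warpBandNext a x (-y) else O.band h x y
  | Sum.inr false, x, y => if y ≤ 0 then O.warpBand a (x - 1) y else O.warpBandNext a (x - 1) (-y)
  | Sum.inr true, x, y => if y ≤ 0 then O.warpBandNext a (-x) y else O.warpBand a (-x) (-y)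

theorem blowDownBand_half (h : Γ.H) (y : ℝ) :
    O.blowDownBand a (Sum.inl h) (1 / 2) y = O.band h (1 / 2) y := by
  rw [blowDownBand]
  split_ifs with h1 h2
  · rw [warpBand, warpX_half, warpY_half, h1]
  · rw [warpBandNext, warpX_half, warpY_half, h2, neg_neg]
  · rfl

theorem blowDownBand_false_of_nonpos {x y : ℝ} (hy : y ≤ 0) :
    O.blowDownBand a (Sum.inr false) x y = O.warpBand a (x - 1) y := if_pos hy

theorem blowDownBand_true_of_nonpos {x y : ℝ} (hy : y ≤ 0) :
    O.blowDownBand a (Sum.inr true) x y = O.warpBandNext a (-x) y := if_pos hy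

theorem blowDownBand_false {x y : ℝ} (hx : x ∈ Set.Icc (0 : ℝ) 1) (hy : 0 ≤ y) :
    O.blowDownBand a (Sum.inr false) x y = O.warpBandNext a (x - 1) (-y) := by
  rw [blowDownBand]
  split_ifs with h
  · obtain rfl := le_antisymm h hy
    rw [neg_zero, warpBand_bottom _ _ ⟨by linarith [hx.1], by linarith [hx.2]⟩]
  · rfl

theorem blowDownBand_true {x y : ℝ} (hx : x ∈ Set.Icc (0 : ℝ) 1) (hy : 0 ≤ y) :
    O.blowDownBand a (Sum.inr true) x y = O.warpBand a (-x) (-y) := by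
  rw [blowDownBand]
  split_ifs with h
  · obtain rfl := le_antisymm h hy
    rw [neg_zero, warpBand_bottom _ _ ⟨by linarith [hx.2], by linarith [hx.1]⟩]
  · rfl

theorem warpBand_left (a : Γ.H) {y : ℝ} (hy : y ≤ 0) : O.warpBand a (-1) y = O.band a 0 y := by
  rw [warpBand, warpX_left hy, warpY_left hy]

theorem warpBandNext_left (a : Γ.H) {y : ℝ} (hy : y ≤ 0) :
    O.warpBandNext a (-1) y = O.band (O.next a) 0 (-y) := by
  rw [warpBandNext, warpX_left hy, warpY_left hy]

section

variable [Finite Γ.H] [Subsingleton Γ.V] (ha : O.next (O.next a) ≠ a)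

theorem blowUp_next_old_next : (O.blowUp ha).next (O.old a (O.next a)) = O.new a true := if_pos rfl

theorem blowUp_next_old_of_next_eq {h : Γ.H} (h1 : h ≠ O.next a) (h2 : O.next h = a) :
    (O.blowUp ha).next (O.old a h) = O.new a false := (if_neg h1).trans (if_pos h2)

theorem blowUp_next_old {h : Γ.H} (h1 : h ≠ O.next a) (h2 : O.next h ≠ a) :
    (O.blowUp ha).next (O.old a h) = O.old a (O.next h) := (if_neg h1).trans (if_neg h2)

/-- The map of surfaces for a blow-up, from the blown up graph to the original one. -/
def blowDown : (O.blowUp ha).Surface → O.Surface :=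
  (O.blowUp ha).bandDesc (root_surjective_blowUp _) (O.blowDownBand a)
    (by
      rintro (h | _ | _) y
      · change O.blowDownBand a (Sum.inl (Γ.flip h)) _ _ = _
        rw [blowDownBand_half, blowDownBand_half, band_flip]
      · change O.blowDownBand a (Sum.inr true) _ _ = _
        rcases le_total 0 y with hy | hy
        · rw [blowDownBand_false _ ⟨by norm_num, by norm_num⟩ hy,
            blowDownBand_true_of_nonpos _ (by linarith)]
          norm_num
        · rw [blowDownBand_true _ ⟨by norm_num, by norm_num⟩ (by linarith),
            blowDownBand_false_of_nonpos _ hy]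
          norm_num
      · change O.blowDownBand a (Sum.inr false) _ _ = _
        rcases le_total 0 y with hy | hy
        · rw [blowDownBand_true _ ⟨by norm_num, by norm_num⟩ hy,
            blowDownBand_false_of_nonpos _ (by linarith)]
          norm_num
        · rw [blowDownBand_false _ ⟨by norm_num, by norm_num⟩ (by linarith),
            blowDownBand_true_of_nonpos _ hy]
          norm_num)
    (by
      intro x y hy
      have hy' : -y ≤ 0 := by linarith
      have hne := O.next_ne ha
      change O.blowDownBand a (O.blowUpNext a x) 0 (-y) = _
      rcases x with h | _ | _
      · rw [blowUpNext]
        split_ifs with h1 h2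
        · rw [blowDownBand_true_of_nonpos _ hy', blowDownBand, if_neg (h1 ▸ hne), if_pos h1,
              neg_zero]
        · have h3 : h ≠ a := fun e => hne (by rw [← e, h2, e])
          rw [blowDownBand_false_of_nonpos _ hy', blowDownBand, if_neg h3, if_neg h1, zero_sub,
            warpBand_left _ _ hy', ← h2, band_next _ _ hy]
        · by_cases h3 : h = a
          · rw [blowDownBand, if_neg h2, if_pos (by rw [h3]), neg_neg, blowDownBand, if_pos h3,
              warpBand_top _ _ hy]
          · have h4 : O.next h ≠ O.next a := fun e => h3 (O.next.injective e)
            rw [blowDownBand, if_neg h2, if_neg h4, blowDownBand, if_neg h3, if_neg h1,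
              band_next _ _ hy]
      · have h1 : O.next (O.next a) ≠ O.next a := fun e => hne (O.next.injective e)
        rw [blowUpNext, blowDownBand_false _ ⟨le_rfl, zero_le_one⟩ hy, blowDownBand, if_neg ha,
          if_neg h1, zero_sub, warpBandNext_left _ _ hy', neg_neg, band_next _ _ hy]
      · rw [blowUpNext, blowDownBand_true _ ⟨le_rfl, zero_le_one⟩ hy, blowDownBand, if_pos rfl,
          neg_zero])

theorem blowDown_band_inl (h : Γ.H) {x y : ℝ} (hx : x ∈ Set.Icc (0 : ℝ) (1 / 2)) :
    O.blowDown ha ((O.blowUp ha).band (O.old a h) x y) = O.blowDownBand a (Sum.inl h) x y :=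
  bandDesc_band (O := O.blowUp ha) (O.old a h) hx

theorem blowDown_stp_false {x y : ℝ} (hx : x ∈ Set.Icc (-1 : ℝ) 0) (hy : y ≤ 0) :
    O.blowDown ha ((O.blowUp ha).stp (O.new a false) (x + 1) (-y)) = O.warpBand a x y := by
  rcases le_total x (-1 / 2) with h | h
  · have h1 : x + 1 ∈ Set.Icc (0 : ℝ) (1 / 2) := ⟨by linarith [hx.1], by linarith⟩
    rw [← band_of_nonpos hy]
    refine (bandDesc_band (O := O.blowUp ha) (O.new a false) h1).trans ?_
    change O.blowDownBand a (Sum.inr false) _ _ = _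
    rw [blowDownBand_false_of_nonpos _ hy, add_sub_cancel_right]
  · have h1 : -x ∈ Set.Icc (0 : ℝ) (1 / 2) := ⟨by linarith [hx.2], by linarith⟩
    have h2 := band_of_nonneg (O := O.blowUp ha) (h := O.new a true) (x := -x) (y := -y)
      (by linarith)
    rw [sub_neg_eq_add, add_comm] at h2
    refine (congrArg (O.blowDown ha) h2.symm).trans
      ((bandDesc_band (O := O.blowUp ha) (O.new a true) h1).trans ?_)
    change O.blowDownBand a (Sum.inr true) _ _ = _
    rw [blowDownBand_true _ ⟨h1.1, by linarith [h1.2]⟩ (by linarith), neg_neg, neg_neg]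

theorem blowDown_stp_true {x y : ℝ} (hx : x ∈ Set.Icc (-1 : ℝ) 0) (hy : y ≤ 0) :
    O.blowDown ha ((O.blowUp ha).stp (O.new a true) (-x) (-y)) = O.warpBandNext a x y := by
  rcases le_total x (-1 / 2) with h | h
  · have h1 : x + 1 ∈ Set.Icc (0 : ℝ) (1 / 2) := ⟨by linarith [hx.1], by linarith⟩
    have h2 := band_of_nonneg (O := O.blowUp ha) (h := O.new a false) (x := x + 1) (y := -y)
      (by linarith)
    rw [sub_add_cancel_right] at h2
    refine (congrArg (O.blowDown ha) h2.symm).trans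
      ((bandDesc_band (O := O.blowUp ha) (O.new a false) h1).trans ?_)
    change O.blowDownBand a (Sum.inr false) _ _ = _
    rw [blowDownBand_false _ ⟨h1.1, by linarith [h1.2]⟩ (by linarith),
      neg_neg, add_sub_cancel_right]
  · have h1 : -x ∈ Set.Icc (0 : ℝ) (1 / 2) := ⟨by linarith [hx.2], by linarith⟩
    rw [← band_of_nonpos hy]
    refine (bandDesc_band (O := O.blowUp ha) (O.new a true) h1).trans ?_
    change O.blowDownBand a (Sum.inr true) _ _ = _
    rw [blowDownBand_true_of_nonpos _ hy, neg_neg]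

theorem continuous_blowDown : Continuous (O.blowDown ha) := by
  have hA := O.continuous_warpBand a
  have hB := O.continuous_warpBandNext a
  refine continuous_bandDesc ?_
  rintro (h | _ | _)
  · refine Continuous.continuousOn ?_
    simp only [blowDownBand]
    split_ifs
    · exact hA
    · exact hB.comp (f := fun p : ℝ × ℝ => (p.1, -p.2)) (by fun_prop)
    · exact O.continuous_band h
  · refine ContinuousOn.congr (f := fun p : ℝ × ℝ => if p.2 ≤ 0 then
      O.warpBand a (max (min (p.1 - 1) 0) (-1)) p.2
      else O.warpBandNext a (max (min (p.1 - 1) 0) (-1)) (-p.2)) (Continuous.continuousOn ?_)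
      fun p hp => ?_
    · refine Continuous.if_le (hA.comp
        (f := fun p : ℝ × ℝ => (max (min (p.1 - 1) 0) (-1), p.2)) (by fun_prop)) (hB.comp
        (f := fun p : ℝ × ℝ => (max (min (p.1 - 1) 0) (-1), -p.2)) (by fun_prop))
        continuous_snd continuous_const fun p hp => ?_
      rw [hp, neg_zero, warpBand_bottom]
      exact ⟨le_max_right _ _, max_le (min_le_right _ _) (by norm_num)⟩
    · have h1 := hp.1.1
      have h2 := hp.1.2
      beta_reduce
      rw [blowDownBand, min_eq_left (by linarith), max_eq_left (by linarith)]
  · refine ContinuousOn.congr (f := fun p : ℝ × ℝ => if p.2 ≤ 0 then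
      O.warpBandNext a (max (min (-p.1) 0) (-1)) p.2
      else O.warpBand a (max (min (-p.1) 0) (-1)) (-p.2)) (Continuous.continuousOn ?_)
      fun p hp => ?_
    · refine Continuous.if_le (hB.comp
        (f := fun p : ℝ × ℝ => (max (min (-p.1) 0) (-1), p.2)) (by fun_prop)) (hA.comp
        (f := fun p : ℝ × ℝ => (max (min (-p.1) 0) (-1), -p.2)) (by fun_prop))
        continuous_snd continuous_const fun p hp => ?_
      rw [hp, neg_zero, warpBand_bottom]
      exact ⟨le_max_right _ _, max_le (min_le_right _ _) (by norm_num)⟩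
    · have h1 := hp.1.1
      have h2 := hp.1.2
      beta_reduce
      rw [blowDownBand, min_eq_left (by linarith), max_eq_left (by linarith)]

/-- The map of the band of `a` to the surface of the blown up graph. -/
def blowUpBand (x y : ℝ) : (O.blowUp ha).Surface :=
  lShape (fun x y => (O.blowUp ha).stp (O.new a false) (x + 1) (-y))
    (fun x y => (O.blowUp ha).band (O.old a a) x y) x y

/-- The map of the band of the successor of `a` to the surface of the blown up graph. -/
def blowUpBandNext (x y : ℝ) : (O.blowUp ha).Surface :=
  lShape (fun x y => (O.blowUp ha).stp (O.new a true) (-x) (-y))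
    (fun x y => (O.blowUp ha).band (O.old a (O.next a)) x (-y)) x (-y)

theorem blowUp_agree {y : ℝ} (hy : y ≤ 0) : (O.blowUp ha).stp (O.new a false) (0 + 1) (-y) =
    (O.blowUp ha).band (O.old a a) 0 y := by
  rw [zero_add, stp_one, band_of_nonpos hy]
  rfl

theorem blowUp_agree_next {y : ℝ} (hy : y ≤ 0) :
    (O.blowUp ha).stp (O.new a true) (-0) (-y) =
      (O.blowUp ha).band (O.old a (O.next a)) 0 (-y) := by
  rw [band_of_nonneg (by linarith), sub_zero, stp_one, neg_zero]
  rw [boundaryNext, Graph.flip_flip, blowUp_next_old_next]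

theorem blowUpBand_warp {x y : ℝ} (hx : x ∈ Set.Icc (0 : ℝ) (1 / 2)) :
    O.blowUpBand ha (warpX x y) (warpY x y) = (O.blowUp ha).band (O.old a a) x y :=
  lShape_warp_of_nonneg (fun _ => O.blowUp_agree ha) hx

theorem blowUpBand_warp_of_nonpos {x y : ℝ} (hx : x ∈ Set.Icc (-1 : ℝ) 0) (hy : y ≤ 0) :
    O.blowUpBand ha (warpX x y) (warpY x y) = (O.blowUp ha).stp (O.new a false) (x + 1) (-y) :=
  lShape_warp_of_nonpos hx hy

theorem blowUpBandNext_warp {x y : ℝ} (hx : x ∈ Set.Icc (0 : ℝ) (1 / 2)) :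
    O.blowUpBandNext ha (warpX x y) (-warpY x y) =
      (O.blowUp ha).band (O.old a (O.next a)) x (-y) := by
  rw [blowUpBandNext, neg_neg]
  exact lShape_warp_of_nonneg (fun _ => O.blowUp_agree_next ha) hx

theorem blowUpBandNext_warp_of_nonpos {x y : ℝ} (hx : x ∈ Set.Icc (-1 : ℝ) 0) (hy : y ≤ 0) :
    O.blowUpBandNext ha (warpX x y) (-warpY x y) =
      (O.blowUp ha).stp (O.new a true) (-x) (-y) := by
  rw [blowUpBandNext, neg_neg]
  exact lShape_warp_of_nonpos hx hy

open Classical in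
/-- The map from the bands of the original graph to the surface of the blown up graph. -/
def blowUpBands (h : Γ.H) (x y : ℝ) : (O.blowUp ha).Surface :=
  if h = a then O.blowUpBand ha x y else if h = O.next a then O.blowUpBandNext ha x y
    else (O.blowUp ha).band (O.old a h) x y

theorem blowUpBands_half (h : Γ.H) (y : ℝ) :
    O.blowUpBands ha h (1 / 2) y = (O.blowUp ha).band (O.old a h) (1 / 2) y := by
  have hm : (1 / 2 : ℝ) ∈ Set.Icc (0 : ℝ) (1 / 2) := ⟨by norm_num, le_rfl⟩
  rw [blowUpBands]
  split_ifs with h1 h2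
  · have := O.blowUpBand_warp ha (y := y) hm
    rw [warpX_half, warpY_half] at this
    subst h1
    exact this
  · have := O.blowUpBandNext_warp ha (y := -y) hm
    rw [warpX_half, warpY_half, neg_neg] at this
    subst h2
    exact this
  · rfl

/-- The map of surfaces for a blow-up, from the original graph to the blown up one. -/
def blowUpMap : O.Surface → (O.blowUp ha).Surface :=
  O.bandDesc (root_surjective_of_subsingleton a) (O.blowUpBands ha)
    (by
      intro h y
      rw [blowUpBands_half, blowUpBands_half]
      exact (O.blowUp ha).band_flip (O.old a h) y)
    (by
      intro h y hy
      have hy' : -y ≤ 0 := by linarith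
      have hne := O.next_ne ha
      have hleft : (-1 : ℝ) ∈ Set.Icc (-1 : ℝ) 0 := ⟨le_rfl, by norm_num⟩
      have h0 : (0 : ℝ) ∈ Set.Icc (0 : ℝ) (1 / 2) := ⟨le_rfl, by norm_num⟩
      rw [blowUpBands, blowUpBands]
      by_cases h1 : h = a
      · rw [if_neg (by rw [h1]; exact hne), if_pos (by rw [h1]), if_pos h1]
        rcases le_total 1 y with hy1 | hy1
        · have e1 := O.blowUpBand_warp ha (y := y - 1) h0
          have e2 := O.blowUpBandNext_warp ha (y := y - 1) h0
          rw [warpX_top (by linarith), warpY_top (by linarith), sub_add_cancel] at e1 e2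
          rw [e1, e2]
          have e3 := (O.blowUp ha).band_next (O.old a a) (y := y - 1) (by linarith)
          rw [← e3, blowUp_next_old _ _ hne.symm hne]
        · have hm : y - 1 ∈ Set.Icc (-1 : ℝ) 0 := ⟨by linarith, by linarith⟩
          have e1 := O.blowUpBand_warp_of_nonpos ha hm le_rfl
          have e2 := O.blowUpBandNext_warp_of_nonpos ha hm le_rfl
          rw [warpX_bottom hm, warpY_bottom hm, sub_add_cancel, neg_zero] at e1 e2
          rw [e1, e2, ← (O.blowUp ha).stp_flip le_rfl, neg_sub, flip_new, sub_sub_cancel,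
            Bool.not_true]
      by_cases h2 : h = O.next a
      · have e1 := O.blowUpBandNext_warp_of_nonpos ha hleft hy'
        rw [warpX_left hy', warpY_left hy', neg_neg, neg_neg, stp_one] at e1
        have h3 : O.next h ≠ O.next a := fun e => h1 (O.next.injective e)
        rw [if_neg (by rw [h2]; exact ha), if_neg h3, if_neg h1, if_pos h2, e1,
          band_of_nonpos hy', neg_neg, h2]
        rfl
      · rw [if_neg h1, if_neg h2, ← (O.blowUp ha).band_next (O.old a h) hy]
        by_cases h3 : O.next h = a
        · have e1 := O.blowUpBand_warp_of_nonpos ha hleft hy'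
          rw [warpX_left hy', warpY_left hy', neg_neg, neg_add_cancel] at e1
          rw [if_pos h3, blowUp_next_old_of_next_eq _ _ h2 h3, e1, band_of_nonpos hy', neg_neg]
        · have h4 : O.next h ≠ O.next a := fun e => h1 (O.next.injective e)
          rw [if_neg h3, if_neg h4, blowUp_next_old _ _ h2 h3])

theorem blowUpMap_band (h : Γ.H) {x y : ℝ} (hx : x ∈ Set.Icc (0 : ℝ) (1 / 2)) :
    O.blowUpMap ha (O.band h x y) = O.blowUpBands ha h x y :=
  bandDesc_band h hx

theorem continuous_blowUpMap : Continuous (O.blowUpMap ha) := by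
  refine continuous_bandDesc fun h => Continuous.continuousOn ?_
  simp only [blowUpBands]
  split_ifs
  · exact continuous_lShape (((O.blowUp ha).continuous_stp _).comp
      (f := fun p : ℝ × ℝ => (p.1 + 1, -p.2)) (by fun_prop)) ((O.blowUp ha).continuous_band _)
      (fun _ => O.blowUp_agree ha)
  · exact (continuous_lShape (((O.blowUp ha).continuous_stp _).comp
      (f := fun p : ℝ × ℝ => (-p.1, -p.2)) (by fun_prop)) (((O.blowUp ha).continuous_band _).comp
      (f := fun p : ℝ × ℝ => (p.1, -p.2)) (by fun_prop))
      (fun _ => O.blowUp_agree_next ha)).comp (f := fun p : ℝ × ℝ => (p.1, -p.2)) (by fun_prop)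
  · exact (O.blowUp ha).continuous_band _

theorem blowUpMap_warpBand {x y : ℝ} (hx : x ∈ Set.Icc (0 : ℝ) (1 / 2)) :
    O.blowUpMap ha (O.warpBand a x y) = (O.blowUp ha).band (O.old a a) x y := by
  rw [warpBand, blowUpMap_band _ _ _ (warpX_mem (by linarith [hx.1])
    (fun h => absurd hx.1 (not_le.2 h)) hx.2), blowUpBands, if_pos rfl, blowUpBand_warp _ _ hx]

theorem blowUpMap_warpBandNext {x y : ℝ} (hx : x ∈ Set.Icc (0 : ℝ) (1 / 2)) :
    O.blowUpMap ha (O.warpBandNext a x y) = (O.blowUp ha).band (O.old a (O.next a)) x (-y) := by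
  rw [warpBandNext, blowUpMap_band _ _ _ (warpX_mem (by linarith [hx.1])
    (fun h => absurd hx.1 (not_le.2 h)) hx.2), blowUpBands, if_neg (O.next_ne ha), if_pos rfl,
    blowUpBandNext_warp _ _ hx]

theorem blowUpMap_warpBand_of_nonpos {x y : ℝ} (hx : x ∈ Set.Icc (-1 : ℝ) 0) (hy : y ≤ 0) :
    O.blowUpMap ha (O.warpBand a x y) = (O.blowUp ha).stp (O.new a false) (x + 1) (-y) := by
  rw [warpBand, blowUpMap_band _ _ _ (warpX_mem hx.1 (fun _ => hy) (by linarith [hx.2])),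
    blowUpBands, if_pos rfl, blowUpBand_warp_of_nonpos _ _ hx hy]

theorem blowUpMap_warpBandNext_of_nonpos {x y : ℝ} (hx : x ∈ Set.Icc (-1 : ℝ) 0) (hy : y ≤ 0) :
    O.blowUpMap ha (O.warpBandNext a x y) = (O.blowUp ha).stp (O.new a true) (-x) (-y) := by
  rw [warpBandNext, blowUpMap_band _ _ _ (warpX_mem hx.1 (fun _ => hy) (by linarith [hx.2])),
    blowUpBands, if_neg (O.next_ne ha), if_pos rfl, blowUpBandNext_warp_of_nonpos _ _ hx hy]

/-- Moving two successive half edges to a new vertex does not change the surface. -/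
def blowUpHomeo : O.Surface ≃ₜ (O.blowUp ha).Surface where
  toFun := O.blowUpMap ha
  invFun := O.blowDown ha
  continuous_toFun := O.continuous_blowUpMap ha
  continuous_invFun := O.continuous_blowDown ha
  left_inv p := by
    obtain ⟨h, x, y, hx, rfl⟩ := O.exists_band (root_surjective_of_subsingleton a) p
    by_cases h1 : h = a
    · obtain ⟨x', y', rfl, rfl, hx' | ⟨hx', hy'⟩⟩ := exists_warp hx y
      · rw [h1]
        change O.blowDown ha (O.blowUpMap ha (O.warpBand a x' y')) = O.warpBand a x' y'
        rw [blowUpMap_warpBand _ _ hx', blowDown_band_inl _ _ _ hx', blowDownBand, if_pos rfl]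
      · rw [h1]
        change O.blowDown ha (O.blowUpMap ha (O.warpBand a x' y')) = O.warpBand a x' y'
        rw [blowUpMap_warpBand_of_nonpos _ _ hx' hy', blowDown_stp_false _ _ hx' hy']
    by_cases h2 : h = O.next a
    · obtain ⟨x', y', rfl, hy, hx' | ⟨hx', hy'⟩⟩ := exists_warp hx (-y)
      · rw [h2, show y = -warpY x' y' by rw [← hy, neg_neg]]
        change O.blowDown ha (O.blowUpMap ha (O.warpBandNext a x' y')) = O.warpBandNext a x' y'
        rw [blowUpMap_warpBandNext _ _ hx', blowDown_band_inl _ _ _ hx', blowDownBand,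
          if_neg (O.next_ne ha), if_pos rfl, neg_neg]
      · rw [h2, show y = -warpY x' y' by rw [← hy, neg_neg]]
        change O.blowDown ha (O.blowUpMap ha (O.warpBandNext a x' y')) = O.warpBandNext a x' y'
        rw [blowUpMap_warpBandNext_of_nonpos _ _ hx' hy', blowDown_stp_true _ _ hx' hy']
    · rw [blowUpMap_band _ _ _ hx, blowUpBands, if_neg h1, if_neg h2, blowDown_band_inl _ _ _ hx,
        blowDownBand, if_neg h1, if_neg h2]
  right_inv p := by
    obtain ⟨h | c, x, y, hx, rfl⟩ := (O.blowUp ha).exists_band (root_surjective_blowUp _) p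
    · change O.blowUpMap ha (O.blowDown ha ((O.blowUp ha).band (O.old a h) x y)) =
        (O.blowUp ha).band (O.old a h) x y
      rw [blowDown_band_inl _ _ _ hx, blowDownBand]
      split_ifs with h1 h2
      · rw [blowUpMap_warpBand _ _ hx, h1]
      · rw [blowUpMap_warpBandNext _ _ hx, h2, neg_neg]
      · rw [blowUpMap_band _ _ _ hx, blowUpBands, if_neg h1, if_neg h2]
    · have hcase : ∀ (c : Bool) (x t : ℝ), x ∈ Set.Icc (0 : ℝ) 1 → 0 ≤ t →
          O.blowUpMap ha (O.blowDown ha ((O.blowUp ha).stp (O.new a c) x t)) =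
            (O.blowUp ha).stp (O.new a c) x t := by
        intro c x t hx ht
        cases c
        · have hm : x - 1 ∈ Set.Icc (-1 : ℝ) 0 := ⟨by linarith [hx.1], by linarith [hx.2]⟩
          have e1 := O.blowDown_stp_false ha hm (y := -t) (by linarith)
          have e2 := O.blowUpMap_warpBand_of_nonpos ha hm (y := -t) (by linarith)
          rw [sub_add_cancel, neg_neg] at e1 e2
          rw [e1, e2]
        · have hm : -x ∈ Set.Icc (-1 : ℝ) 0 := ⟨by linarith [hx.2], by linarith [hx.1]⟩
          have e1 := O.blowDown_stp_true ha hm (y := -t) (by linarith)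
          have e2 := O.blowUpMap_warpBandNext_of_nonpos ha hm (y := -t) (by linarith)
          rw [neg_neg, neg_neg] at e1 e2
          rw [e1, e2]
      change O.blowUpMap ha (O.blowDown ha ((O.blowUp ha).band (O.new a c) x y)) =
        (O.blowUp ha).band (O.new a c) x y
      rcases le_total y 0 with hy | hy
      · rw [band_of_nonpos hy]
        exact hcase c x (-y) ⟨hx.1, by linarith [hx.2]⟩ (by linarith)
      · rw [band_of_nonneg hy]
        exact hcase (!c) (1 - x) y ⟨by linarith [hx.2], by linarith [hx.1]⟩ hy

end

end RibbonStructure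

/-! ### The marked graph of a blow-up -/

namespace RibbonStructure

theorem next_next_ne {Γ : Graph} (O : RibbonStructure Γ) {k : Γ.H}
    (h : 3 ≤ Γ.valence (Γ.root k)) : O.next (O.next k) ≠ k := by
  intro e
  have hsub : {h | Γ.root h = Γ.root k} ⊆ {k, O.next k} := by
    intro h hh
    obtain ⟨i, rfl⟩ := (O.sameCycle_iff k h).2 (Eq.symm hh)
    have hr : ∀ x, (O.next x = k ∨ O.next x = O.next k) = (x = k ∨ x = O.next k) := fun x => by
      refine propext ⟨?_, ?_⟩
      · rintro (h1 | h1)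
        · rw [← e] at h1
          exact Or.inr (O.next.injective h1)
        · exact Or.inl (O.next.injective h1)
      · rintro (rfl | rfl)
        · exact Or.inr rfl
        · exact Or.inl e
    have h2 := apply_zpow_eq (f := O.next) (r := fun x => x = k ∨ x = O.next k) hr i k
    exact cast h2.symm (Or.inl rfl)
  have h1 : Γ.valence (Γ.root k) = Set.ncard {h | Γ.root h = Γ.root k} := rfl
  have h2 := Set.ncard_le_ncard hsub (Set.toFinite _)
  have h3 := Set.ncard_insert_le k {O.next k}
  rw [Set.ncard_singleton] at h3
  omega

end RibbonStructure

namespace Graph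

variable {Γ : Graph}

theorem collapseMap_edgePt_of_mem (Φ : Γ.Subforest) {h : Γ.H} (hh : h ∈ Φ.edges) (x : I) :
    Γ.collapseMap Φ (Γ.edgePt h x) = (Γ.collapse Φ).vertexPt (Quot.mk _ (Γ.root h)) := dif_pos hh

theorem collapseMap_edgePt_of_notMem (Φ : Γ.Subforest) {h : Γ.H} (hh : h ∉ Φ.edges) (x : I) :
    Γ.collapseMap Φ (Γ.edgePt h x) = (Γ.collapse Φ).edgePt ⟨h, hh⟩ x := dif_neg hh

/-- The new edge of a blow-up. -/
def blowUpForest (Γ : Graph) (a b : Γ.H) : (Γ.blowUp a b).Subforest where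
  edges := {x | ∃ c : Bool, x = Sum.inr c}
  flip_mem := by
    rintro _ ⟨c, rfl⟩
    exact ⟨!c, rfl⟩
  no_circuit := by
    intro k c hc
    obtain ⟨⟨x, hx⟩, h1, h2⟩ := hc 0
    obtain ⟨⟨y, hy⟩, -⟩ := hc (0 + 1)
    rw [hx, hy] at h1 h2
    have h3 : (!x) = y := h1
    exact h2 (by rw [← h3]; rfl)

/-- The labels of the directed edges of a blow-up with respect to the collapse of the new edge. -/
def blowUpLabel (Γ : Graph) (a b : Γ.H) : (Γ.blowUp a b).H → Option Γ.H :=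
  Sum.elim some fun _ => none

/-- Collapsing the new edge of a blow-up gives back the original graph. -/
def blowUpCollapseIso [Subsingleton Γ.V] (a b : Γ.H) :
    Iso ((Γ.blowUp a b).collapse (Γ.blowUpForest a b)) Γ where
  onV :=
    { toFun := fun _ => Γ.root a
      invFun := fun _ => Quot.mk _ false
      left_inv := by
        rintro ⟨_ | _⟩
        · rfl
        · exact Quot.sound ⟨Sum.inr false, ⟨false, rfl⟩, rfl, rfl⟩
      right_inv := fun _ => Subsingleton.elim _ _ }
  onH :=
    { toFun := fun x => Sum.elim (fun h => h) (fun _ => a) x.1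
      invFun := fun h => ⟨Sum.inl h, fun ⟨_, hc⟩ => Sum.inl_ne_inr hc⟩
      left_inv := by
        rintro ⟨h | c, hx⟩
        · rfl
        · exact absurd ⟨c, rfl⟩ hx
      right_inv := fun _ => rfl }
  map_flip := by
    rintro ⟨h | c, hx⟩
    · rfl
    · exact absurd ⟨c, rfl⟩ hx
  map_root _ := Subsingleton.elim _ _

/-- The collapse of the new edge of a blow-up. -/
def blowUpCollapse [Subsingleton Γ.V] (a b : Γ.H) : C((Γ.blowUp a b).Space, Γ.Space) :=
  (blowUpCollapseIso a b).map.comp ((Γ.blowUp a b).collapseMap (Γ.blowUpForest a b))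

theorem blowUpCollapse_edgePt [Subsingleton Γ.V] (a b : Γ.H) (h : (Γ.blowUp a b).H) (x : I) :
    blowUpCollapse a b ((Γ.blowUp a b).edgePt h x) =
      labelPt (Γ.root a) (Γ.blowUpLabel a b h) x := by
  rcases h with h | c
  · exact congrArg (blowUpCollapseIso a b).map
      (collapseMap_edgePt_of_notMem (Γ.blowUpForest a b) (h := Sum.inl h)
        (fun ⟨_, hc⟩ => Sum.inl_ne_inr hc) x)
  · exact congrArg (blowUpCollapseIso a b).map
      (collapseMap_edgePt_of_mem (Γ.blowUpForest a b) (h := Sum.inr c) ⟨c, rfl⟩ x)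

end Graph

namespace RibbonStructure

variable {Γ : Graph} (O : RibbonStructure Γ) {a : Γ.H}

theorem incl_edgePt (h : Γ.H) {x : I} : O.incl (Γ.edgePt h x) = O.band h x 0 := by
  rw [band_of_nonpos le_rfl, neg_zero, ← stripPt_bottom, stripPt_eq_stp]
  rfl

open Classical in
/-- The reparametrization of the first half of an edge under blow-up and collapse. -/
def halfReparam (a h : Γ.H) (x : ℝ) : I :=
  Set.projIcc 0 1 zero_le_one (if h = a ∨ h = O.next a then unwarpX (max x 0) 0 else x)

theorem continuous_halfReparam (h : Γ.H) : Continuous (O.halfReparam a h) := by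
  unfold halfReparam
  refine continuous_projIcc.comp ?_
  split_ifs
  · exact continuous_unwarpX.comp (f := fun x : ℝ => (max x 0, (0 : ℝ))) (by fun_prop)
  · exact continuous_id

theorem halfReparam_half (h : Γ.H) : (O.halfReparam a h (1 / 2) : ℝ) = 1 / 2 := by
  have h1 : unwarpX (max (1 / 2) 0) 0 = 1 / 2 := by
    rw [max_eq_left (by norm_num), unwarpX]; ring
  rw [halfReparam, h1, ite_self, coe_projIcc_unit (by norm_num)]

theorem halfReparam_zero (h : Γ.H) : O.halfReparam a h 0 = 0 := by
  have h1 : unwarpX (max 0 0) 0 ≤ 0 := by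
    rw [max_self, unwarpX, zero_mul, zero_sub, neg_nonpos]
    exact clampNeg_nonneg _
  rw [halfReparam]
  split_ifs
  · exact Set.projIcc_of_le_left _ h1
  · exact Set.projIcc_left _

section

variable [Finite Γ.H] [Subsingleton Γ.V] (ha : O.next (O.next a) ≠ a)

theorem collapse_retr_new (c : Bool) (x y : ℝ) :
    Graph.blowUpCollapse a (O.next a) ((O.blowUp ha).retr ((O.blowUp ha).stp (O.new a c) x y)) =
      Γ.vertexPt (Γ.root a) :=
  Graph.blowUpCollapse_edgePt a (O.next a) (O.new a c) _

theorem collapse_retr_old (h : Γ.H) (x y : ℝ) :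
    Graph.blowUpCollapse a (O.next a) ((O.blowUp ha).retr ((O.blowUp ha).band (O.old a h) x y)) =
      Γ.edgePt h (Set.projIcc 0 1 zero_le_one x) := by
  rw [retr_band]
  exact Graph.blowUpCollapse_edgePt a (O.next a) (O.old a h) _

/-- After the collapse of the new edge, the part of a band that was moved to the new edge is
constant,
and the rest runs through the old edge. -/
theorem collapse_blowUpBands (h : Γ.H) (x : ℝ) :
    Graph.blowUpCollapse a (O.next a) ((O.blowUp ha).retr (O.blowUpBands ha h x 0)) =
      Γ.edgePt h (O.halfReparam a h x) := by
  have hS : ∀ (k : Γ.H) (z : ℝ), z ≤ 0 →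
      Γ.vertexPt (Γ.root a) = Γ.edgePt k (Set.projIcc 0 1 zero_le_one z) := fun k z hz => by
    rw [Set.projIcc_of_le_left _ hz]
    refine Eq.trans ?_ (Γ.edgePt_zero k).symm
    rw [Subsingleton.elim (Γ.root a) (Γ.root k)]
  rw [blowUpBands, halfReparam]
  split_ifs with h1 h2 h2 h3 h3
  · subst h1
    rw [blowUpBand, lShape]
    split_ifs with h3
    · rw [collapse_retr_new]
      exact hS _ _ (h3.trans (min_le_left _ _))
    · rw [collapse_retr_old]
  · exact absurd (Or.inl h1) h2
  · rw [blowUpBandNext, lShape, neg_zero, h2]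
    split_ifs with h4
    · rw [collapse_retr_new]
      exact hS _ _ (h4.trans (min_le_left _ _))
    · rw [collapse_retr_old]
  · exact absurd (Or.inr h2) h3
  · exact absurd h3 (by rw [not_or]; exact ⟨h1, h2⟩)
  · rw [collapse_retr_old]

/-- The inclusion of the graph into the surface, followed by the projection to the blown up graph
and the collapse, only changes the parametrization of the edges. -/
theorem collapse_blowUpHomeo_homotopic :
    ((Graph.blowUpCollapse a (O.next a)).comp ((O.blowUp ha).retr.comp
      ((O.blowUpHomeo ha : C(O.Surface, (O.blowUp ha).Surface)).comp O.incl))).Homotopic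
      (ContinuousMap.id _) := by
  let s : Γ.H → I → I := fun h x => if (x : ℝ) ≤ 1 / 2 then O.halfReparam a h x else
    σ (O.halfReparam a (Γ.flip h) (1 - x))
  have hhalf : ∀ h : Γ.H, O.halfReparam a h (1 / 2) = σ (O.halfReparam a (Γ.flip h) (1 / 2)) :=
    fun h => Subtype.ext (by
      rw [unitInterval.coe_symm_eq, halfReparam_half, halfReparam_half]; norm_num)
  have hs_low : ∀ h (x : I), (x : ℝ) ≤ 1 / 2 → s h x = O.halfReparam a h x :=
    fun h x hx => if_pos hx
  have hs_high : ∀ h (x : I), ¬ (x : ℝ) ≤ 1 / 2 →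
      s h x = σ (O.halfReparam a (Γ.flip h) (1 - x)) := fun h x hx => if_neg hx
  have hrev : ∀ h x, s (Γ.flip h) (σ x) = σ (s h x) := fun h x => by
    rcases lt_trichotomy (x : ℝ) (1 / 2) with hx | hx | hx
    · rw [hs_high _ (σ x) (by rw [unitInterval.coe_symm_eq]; linarith), hs_low h x hx.le,
        Γ.flip_flip, unitInterval.coe_symm_eq, sub_sub_cancel]
    · rw [hs_low _ (σ x) (by rw [unitInterval.coe_symm_eq]; linarith), hs_low h x hx.le, hx,
        unitInterval.coe_symm_eq, hx, hhalf h, unitInterval.symm_symm]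
      norm_num
    · rw [hs_low _ (σ x) (by rw [unitInterval.coe_symm_eq]; linarith),
        hs_high h x (by linarith), unitInterval.symm_symm, unitInterval.coe_symm_eq]
  have hlow : ∀ (h : Γ.H) (x : I), (x : ℝ) ≤ 1 / 2 → Graph.blowUpCollapse a (O.next a)
      ((O.blowUp ha).retr (O.blowUpHomeo ha (O.incl (Γ.edgePt h x)))) = Γ.edgePt h (s h x) :=
    fun h x hx => by
      have h1 : O.blowUpHomeo ha (O.incl (Γ.edgePt h x)) = O.blowUpBands ha h x 0 := by
        rw [incl_edgePt]
        exact O.blowUpMap_band ha h ⟨x.2.1, hx⟩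
      rw [h1, collapse_blowUpBands]
      simp only [s, if_pos hx]
  refine Graph.homotopic_of_reparam (root_surjective_of_subsingleton a) _ _ s (fun h => ?_)
    (fun h => ?_) hrev (fun h x => ?_)
  · refine Continuous.if_le ((O.continuous_halfReparam h).comp continuous_subtype_val)
      (unitInterval.continuous_symm.comp ((O.continuous_halfReparam _).comp (by fun_prop)))
      continuous_subtype_val continuous_const fun x hx => ?_
    rw [hx, hhalf]
    norm_num
  · simp only [s]
    rw [if_pos (by norm_num)]
    exact O.halfReparam_zero h
  · change Graph.blowUpCollapse a (O.next a)
      ((O.blowUp ha).retr (O.blowUpHomeo ha (O.incl (Γ.edgePt h x)))) = Γ.edgePt h (s h x)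
    rcases le_total (x : ℝ) (1 / 2) with hx | hx
    · exact hlow h x hx
    · rw [← Γ.edgePt_flip h x, hlow _ _ (by rw [unitInterval.coe_symm_eq]; linarith), hrev,
        Γ.edgePt_flip]

end

end RibbonStructure

namespace GraphWithMarking

variable {n : ℕ} (ρ : GraphWithMarking n)

theorem three_le_ncard_blowUpRoot {H : Type} [Finite H] {a b : H} (hab : a ≠ b)
    (h4 : 4 ≤ Nat.card H) (c : Bool) :
        3 ≤ Nat.card {x : H ⊕ Bool // Graph.blowUpRoot a b x = c} := by
  change 3 ≤ Set.ncard {x : H ⊕ Bool | Graph.blowUpRoot a b x = c}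
  cases c
  · have h1 : insert (Sum.inr false) (Sum.inl '' ({a, b}ᶜ : Set H)) ⊆
        {x : H ⊕ Bool | Graph.blowUpRoot a b x = false} := by
      rintro _ (rfl | ⟨h, hh, rfl⟩)
      · rfl
      · exact Graph.blowUpRoot_eq_false.2 hh
    refine le_trans ?_ (Set.ncard_le_ncard h1 (Set.toFinite _))
    rw [Set.ncard_insert_of_notMem (by simp) (Set.toFinite _),
      Set.ncard_image_of_injective _ Sum.inl_injective, Set.ncard_compl, Set.ncard_pair hab]
    omega
  · have h1 : ({Sum.inr true, Sum.inl a, Sum.inl b} : Set (H ⊕ Bool)) ⊆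
        {x : H ⊕ Bool | Graph.blowUpRoot a b x = true} := by
      rintro _ (rfl | rfl | rfl)
      · rfl
      · exact Graph.blowUpRoot_eq_true.2 (Or.inl rfl)
      · exact Graph.blowUpRoot_eq_true.2 (Or.inr rfl)
    refine le_trans ?_ (Set.ncard_le_ncard h1 (Set.toFinite _))
    rw [Set.ncard_insert_of_notMem (by simp) (Set.toFinite _), Set.ncard_pair (by simpa using hab)]

/-- The marked graph obtained by moving a half edge and its successor to a new vertex. -/
def blowUp [Finite ρ.graph.H] [Subsingleton ρ.graph.V] (h4 : 4 ≤ Nat.card ρ.graph.H)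
    (O : RibbonStructure ρ.graph) {a : ρ.graph.H} (ha : O.next (O.next a) ≠ a) :
    GraphWithMarking n where
  graph := ρ.graph.blowUp a (O.next a)
  finite_V := inferInstanceAs (Finite Bool)
  finite_H := inferInstanceAs (Finite (ρ.graph.H ⊕ Bool))
  connected := by
    refine ⟨⟨false⟩, fun c d => ?_⟩
    change Bool at c d
    by_cases h : c = d
    · subst h
      exact Relation.ReflTransGen.refl
    · refine Relation.ReflTransGen.single ⟨Sum.inr c, rfl, ?_⟩
      change (!c) = d
      revert h; cases c <;> cases d <;> simp
  three_le_valence := three_le_ncard_blowUpRoot (O.next_ne ha).symm h4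
  marking := ((O.blowUp ha).retr.comp ((O.blowUpHomeo ha : C(O.Surface, (O.blowUp ha).Surface)).comp
    O.incl)).comp ρ.marking
  marking_equiv := ((O.blowUp ha).isHomotopyEquivalence_retr.comp
    ((isHomotopyEquivalence_homeomorph _).comp O.isHomotopyEquivalence_incl)).comp ρ.marking_equiv

section

variable {ρ} [Finite ρ.graph.H] [Subsingleton ρ.graph.V] (h4 : 4 ≤ Nat.card ρ.graph.H)
  (O : RibbonStructure ρ.graph) {a : ρ.graph.H} (ha : O.next (O.next a) ≠ a)

theorem collapse_blowUp_marking : ((Graph.blowUpCollapse a (O.next a)).comp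
    (ρ.blowUp h4 O ha).marking).Homotopic ρ.marking :=
  (O.collapse_blowUpHomeo_homotopic ha).comp (ContinuousMap.Homotopic.refl ρ.marking)

theorem blowUp_collapsesTo : (ρ.blowUp h4 O ha).CollapsesTo ρ :=
  ⟨ρ.graph.blowUpForest a (O.next a), Graph.blowUpCollapseIso a (O.next a),
    collapse_blowUp_marking h4 O ha⟩

theorem mk_blowUp_ne : MarkedGraph.mk (ρ.blowUp h4 O ha) ≠ MarkedGraph.mk ρ := by
  intro h
  obtain ⟨e, -⟩ : (ρ.blowUp h4 O ha).Equivalent ρ := Quotient.exact h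
  have h1 : false = true := e.onV.injective (Subsingleton.elim _ _)
  exact Bool.false_ne_true h1

/-- A blow-up is drawn in the same marked surfaces. -/
theorem blowUp_mem_drawable (S : MarkedSurface.{u} n) (k : O.Surface ≃ₜ S.carrier)
    (hk : ((k : C(O.Surface, S.carrier)).comp (O.incl.comp ρ.marking)).Homotopic S.marking) :
    MarkedGraph.mk (ρ.blowUp h4 O ha) ∈ S.drawable := by
  refine S.mem_drawable (ρ.blowUp h4 O ha) (O.blowUp ha) ((O.blowUpHomeo ha).symm.trans k) ?_
  refine ContinuousMap.Homotopic.trans ?_ hk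
  have h1 := ((O.blowUp ha).incl_comp_retr).comp (ContinuousMap.Homotopic.refl
    ((O.blowUpHomeo ha : C(O.Surface, (O.blowUp ha).Surface)).comp (O.incl.comp ρ.marking)))
  have h2 := (ContinuousMap.Homotopic.refl
    ((((O.blowUpHomeo ha).symm.trans k : (O.blowUp ha).Surface ≃ₜ S.carrier)) :
      C((O.blowUp ha).Surface, S.carrier))).comp h1
  have h3 : (((O.blowUpHomeo ha).symm.trans k : (O.blowUp ha).Surface ≃ₜ S.carrier) :
      C((O.blowUp ha).Surface, S.carrier)).comp ((ContinuousMap.id _).comp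
      ((O.blowUpHomeo ha : C(O.Surface, (O.blowUp ha).Surface)).comp (O.incl.comp ρ.marking))) =
      (k : C(O.Surface, S.carrier)).comp (O.incl.comp ρ.marking) := by
    ext x
    exact congrArg k ((O.blowUpHomeo ha).symm_apply_apply (O.incl (ρ.marking x)))
  rw [h3] at h2
  exact h2

end

end GraphWithMarking

namespace MarkedSurface

variable {n : ℕ}

theorem mem_drawable_of_mem_link (S : MarkedSurface.{u} n) {a b : MarkedGraph n}
    (h : b ∈ linkVertices S.ribbonComplex a) : b ∈ S.drawable := by
  obtain ⟨-, s, hs, -, hb⟩ := h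
  exact hs.2 b hb

theorem mem_link (S : MarkedSurface.{u} n) {M N : GraphWithMarking n}
    (hM : MarkedGraph.mk M ∈ S.drawable) (hN : MarkedGraph.mk N ∈ S.drawable)
    (hne : MarkedGraph.mk N ≠ MarkedGraph.mk M) (h : N.CollapsesTo M) :
    MarkedGraph.mk N ∈ linkVertices S.ribbonComplex (MarkedGraph.mk M) := by
  classical
  refine ⟨hne, {MarkedGraph.mk M, MarkedGraph.mk N}, ⟨⟨by simp, ?_⟩, ?_⟩, by simp, by simp⟩
  · rw [Finset.coe_pair]
    exact IsChain.pair (show MarkedGraph.Le _ _ from ⟨M, N, rfl, rfl, h⟩)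
  · intro a ha
    rcases Finset.mem_insert.1 ha with rfl | ha
    · exact hM
    · rw [Finset.mem_singleton.1 ha]; exact hN

theorem mem_drawable_iff (S : MarkedSurface.{u} n) (a : MarkedGraph n) :
    a ∈ S.drawable ↔ {a} ∈ S.ribbonComplex.faces := by
  refine ⟨fun h => ⟨(spine n).singleton_mem a, fun b hb => ?_⟩, fun h => h.2 a (by simp)⟩
  rwa [Finset.mem_singleton.1 hb]

end MarkedSurface

/-! ### The cyclic ordering of a rose and its blow-ups -/

namespace RibbonStructure

section

variable {Γ Γ' : Graph} {a b : Γ.H} (O' : RibbonStructure Γ') (e : Graph.Iso Γ' (Γ.blowUp a b))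

theorem onV_root_next (x : Γ'.H) :
    Graph.blowUpRoot a b (e.onH (O'.next x)) = Graph.blowUpRoot a b (e.onH x) := by
  refine (e.map_root (O'.next x)).symm.trans (Eq.trans ?_ (e.map_root x))
  rw [O'.root_next]

variable {O'}

/-- In a boundary cycle of the blown up graph, two consecutive old edges are not inverse to each
other. -/
theorem label_ne_flip (hO' : ∀ x, O'.next (O'.next x) ≠ x) {x : Γ'.H} {p q : Γ.H}
    (hp : Γ.blowUpLabel a b (e.onH x) = some p)
    (hq : Γ.blowUpLabel a b (e.onH (O'.boundaryNext x)) = some q) : q ≠ Γ.flip p := by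
  rintro rfl
  refine O'.next_ne (hO' (Γ'.flip x)) (e.onH.injective ?_)
  rw [e.map_flip]
  rcases h1 : e.onH x with y | c
  · rw [h1] at hp
    obtain rfl : y = p := Option.some.inj hp
    rcases h2 : e.onH (O'.boundaryNext x) with z | c
    · rw [h2] at hq
      obtain rfl : z = Γ.flip y := Option.some.inj hq
      exact h2
    · rw [h2] at hq
      exact absurd hq (Option.some_ne_none _).symm
  · rw [h1] at hp
    exact absurd hp (Option.some_ne_none _).symm

theorem label_eq_some {x : Γ'.H} {p : Γ.H} (hp : Γ.blowUpLabel a b (e.onH x) = some p) :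
    e.onH x = Sum.inl p := by
  rcases h1 : e.onH x with y | c
  · rw [h1] at hp
    exact congrArg Sum.inl (Option.some.inj hp)
  · rw [h1] at hp
    exact absurd hp (Option.some_ne_none _).symm

theorem label_eq_none {x : Γ'.H} (hp : Γ.blowUpLabel a b (e.onH x) = none) :
    ∃ c, e.onH x = Sum.inr c := by
  rcases h1 : e.onH x with y | c
  · rw [h1] at hp
    exact absurd hp (Option.some_ne_none _)
  · exact ⟨c, rfl⟩

/-- In a boundary cycle of the blown up graph, the new edge is followed by an old edge, which is not
the inverse of the old edge before the new edge. -/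
theorem label_ne_of_none (hO' : ∀ x, O'.next (O'.next x) ≠ x) {x : Γ'.H} {p : Γ.H}
    (hp : Γ.blowUpLabel a b (e.onH x) = some p)
    (hn : Γ.blowUpLabel a b (e.onH (O'.boundaryNext x)) = none) :
    Γ.blowUpLabel a b (e.onH (O'.boundaryNext (O'.boundaryNext x))) ≠ none ∧
      ∀ q, Γ.blowUpLabel a b (e.onH (O'.boundaryNext (O'.boundaryNext x))) = some q →
        q ≠ Γ.flip p := by
  obtain ⟨c, hc⟩ := label_eq_none e hn
  have hflip : e.onH (Γ'.flip (O'.boundaryNext x)) = Sum.inr !c := by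
    rw [e.map_flip, hc]; rfl
  -- the boundary cycle leaves the new edge at the vertex at its end
  have hroot : Graph.blowUpRoot a b (e.onH (O'.boundaryNext (O'.boundaryNext x))) = !c := by
    refine (onV_root_next O' e _).trans ?_
    rw [hflip]; rfl
  constructor
  · intro h
    obtain ⟨d, hd⟩ := label_eq_none e h
    rw [hd] at hroot
    obtain rfl : d = !c := hroot
    exact O'.next_ne (hO' (Γ'.flip (O'.boundaryNext x))) (e.onH.injective (hd.trans hflip.symm))
  · rintro _ hq rfl
    have h1 := label_eq_some e hq
    have h2 : Graph.blowUpRoot a b (e.onH (O'.boundaryNext x)) =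
        Graph.blowUpRoot a b (e.onH (Γ'.flip x)) := onV_root_next O' e _
    have h3 : e.onH (Γ'.flip x) = Sum.inl (Γ.flip p) := by
      rw [e.map_flip, label_eq_some e hp]; rfl
    rw [h3, ← h1, hroot, hc] at h2
    exact absurd h2 (by cases c <;> simp [Graph.blowUpRoot])

/-- At the new vertex of a blow-up, which has valence three, one of the two old half edges is
followed by the other one. -/
theorem next_at_new_vertex (hO' : ∀ x, O'.next (O'.next x) ≠ x) :
    ∃ x y, e.onH x = Sum.inl a ∧ e.onH y = Sum.inl b ∧ (O'.next x = y ∨ O'.next y = x) := by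
  obtain ⟨x, hx⟩ := e.onH.surjective (Sum.inl a)
  obtain ⟨y, hy⟩ := e.onH.surjective (Sum.inl b)
  obtain ⟨z, hz⟩ := e.onH.surjective (Sum.inr true)
  have hcases : ∀ w, Graph.blowUpRoot a b (e.onH w) = true →
      O'.next w = x ∨ O'.next w = y ∨ O'.next w = z := fun w hw => by
    have h1 := (onV_root_next O' e w).trans hw
    rcases h2 : e.onH (O'.next w) with v | c
    · rw [h2] at h1
      rcases Graph.blowUpRoot_eq_true.1 h1 with rfl | rfl
      · exact Or.inl (e.onH.injective (h2.trans hx.symm))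
      · exact Or.inr (Or.inl (e.onH.injective (h2.trans hy.symm)))
    · rw [h2] at h1
      obtain rfl : c = true := h1
      exact Or.inr (Or.inr (e.onH.injective (h2.trans hz.symm)))
  have hne := fun x => O'.next_ne (hO' x)
  refine ⟨x, y, hx, hy, ?_⟩
  rcases hcases x (by rw [hx]; exact Graph.blowUpRoot_eq_true.2 (Or.inl rfl)) with h | h | h
  · exact absurd h (hne _)
  · exact Or.inl h
  have hzy : O'.next z = y := by
    rcases hcases z (by rw [hz]; rfl) with h1 | h1 | h1
    · exact absurd (by rw [h, h1]) (hO' x)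
    · exact h1
    · exact absurd h1 (hne _)
  rcases hcases y (by rw [hy]; exact Graph.blowUpRoot_eq_true.2 (Or.inr rfl)) with h1 | h1 | h1
  · exact Or.inr h1
  · exact absurd h1 (hne _)
  · exact absurd (by rw [hzy, h1]) (hO' z)

end

section

variable {Γ : Graph} {O₁ O₂ : RibbonStructure Γ}

/-- Two cyclic orderings with the same adjacent pairs agree up to reversal. -/
theorem eq_or_eq_op [Subsingleton Γ.V] (h1 : ∀ a, O₁.next (O₁.next a) ≠ a)
    (h : ∀ a, O₁.next a = O₂.next a ∨ a = O₂.next (O₁.next a)) : O₁ = O₂ ∨ O₁ = O₂.op := by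
  by_cases hall : ∀ a, a = O₂.next (O₁.next a)
  · refine Or.inr (RibbonStructure.ext (Equiv.ext fun a => ?_))
    exact (Equiv.Perm.inv_eq_iff_eq.2 (hall a)).symm
  push Not at hall
  obtain ⟨a, ha⟩ := hall
  have ha' : O₁.next a = O₂.next a := (h a).resolve_right ha
  -- agreement of the successors propagates along the cycle, in both directions
  have hstep : ∀ x, (O₁.next (O₁.next x) = O₂.next (O₁.next x)) = (O₁.next x = O₂.next x) := by
    refine fun x => propext ⟨fun hx => (h x).resolve_right fun e => h1 x (hx.trans e.symm),
      fun hx => (h (O₁.next x)).resolve_right fun e => ?_⟩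
    rw [hx] at e
    exact h1 x ((O₂.next.injective (hx ▸ e)).symm)
  refine Or.inl (RibbonStructure.ext (Equiv.ext fun b => ?_))
  obtain ⟨i, rfl⟩ := (O₁.sameCycle_iff a b).2 (Subsingleton.elim _ _)
  exact cast (apply_zpow_eq (r := fun x => O₁.next x = O₂.next x) hstep i a).symm ha'

end

end RibbonStructure

namespace GraphWithMarking

variable {n : ℕ}

theorem next_next_ne (M : GraphWithMarking n) (O : RibbonStructure M.graph) (x : M.graph.H) :
    O.next (O.next x) ≠ x :=
  haveI := M.finite_H
  O.next_next_ne (M.three_le_valence _)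

theorem four_le_card (M : GraphWithMarking n) [Subsingleton M.graph.V] :
    4 ≤ Nat.card M.graph.H := by
  have := M.finite_H
  obtain ⟨w⟩ := M.connected.1
  have h3 := M.three_le_valence w
  have h1 : M.graph.valence w = Nat.card M.graph.H :=
    Nat.card_congr (Equiv.subtypeUnivEquiv fun _ => Subsingleton.elim _ _)
  -- the number of half edges is even, since `flip` is an involution without fixed points
  have h2 : Even (Nat.card M.graph.H) := by
    classical
    have := Fintype.ofFinite M.graph.H
    rw [Nat.card_eq_fintype_card, ← ZMod.natCast_eq_zero_iff_even, ← Finset.card_univ,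
      Finset.cast_card]
    exact Finset.sum_involution (fun h _ => M.graph.flip h) (fun _ _ => by decide)
      (fun h _ _ => M.graph.flip_ne h) (fun _ _ => Finset.mem_univ _)
      (fun h _ => M.graph.flip_flip h)
  rw [Nat.even_iff] at h2
  omega

/-- If the blow-up of a rose `ρ` along consecutive half edges `a` and `b` of one cyclic ordering
can be drawn in a marked surface, then `a` and `b` are also neighbours in the cyclic ordering
which that surface gives to `ρ`. -/
theorem next_of_blowUp_mem_drawable (ρ : GraphWithMarking n) [Finite ρ.graph.H]
    [Subsingleton ρ.graph.V] (h4 : 4 ≤ Nat.card ρ.graph.H) (O₁ O₂ : RibbonStructure ρ.graph)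
    {a : ρ.graph.H} (ha : O₁.next (O₁.next a) ≠ a) (S : MarkedSurface.{u} n)
    (k : O₂.Surface ≃ₜ S.carrier)
    (hk : ((k : C(O₂.Surface, S.carrier)).comp (O₂.incl.comp ρ.marking)).Homotopic S.marking)
    (hd : MarkedGraph.mk (ρ.blowUp h4 O₁ ha) ∈ S.drawable) :
    O₁.next a = O₂.next a ∨ a = O₂.next (O₁.next a) := by
  have := ρ.finite_V
  obtain ⟨M, O', hM, k', -, hk'⟩ := hd
  obtain ⟨e, he⟩ : M.Equivalent (ρ.blowUp h4 O₁ ha) := Quotient.exact hM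
  have := M.finite_H
  let f : C(M.graph.Space, ρ.graph.Space) := (Graph.blowUpCollapse a (O₁.next a)).comp e.map
  have hf1 : (f.comp M.marking).Homotopic ρ.marking :=
    ((ContinuousMap.Homotopic.refl (Graph.blowUpCollapse a (O₁.next a))).comp he).trans
      (collapse_blowUp_marking h4 O₁ ha)
  have hf2 : ((O₂.retr.comp ((k'.trans k.symm : C(O'.Surface, O₂.Surface)).comp O'.incl)).comp
      M.marking).Homotopic ρ.marking := by
    have h1 := (ContinuousMap.Homotopic.refl
      (O₂.retr.comp (k.symm : C(S.carrier, O₂.Surface)))).comp (hk'.trans hk.symm)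
    refine Eq.mp ?_ h1
    congr 1
    ext x
    change O₂.retr (k.symm (k (O₂.incl (ρ.marking x)))) = ρ.marking x
    rw [k.symm_apply_apply]
    rfl
  have hf := M.marking_equiv.homotopic_of_comp (hf2.trans hf1.symm)
  have hO' := M.next_next_ne O'
  have key : ∀ {x : M.graph.H} {p q : ρ.graph.H},
      ρ.graph.blowUpLabel a (O₁.next a) (e.onH x) = some p →
      ρ.graph.blowUpLabel a (O₁.next a) (e.onH (O'.boundaryNext x)) = some q →
      q = O₂.boundaryNext p ∨ ρ.graph.flip p = O₂.boundaryNext (ρ.graph.flip q) :=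
    boundaryNext_of_homeomorph (ρ.graph.root a) O' O₂ (k'.trans k.symm) f
      (fun x => ρ.graph.blowUpLabel a (O₁.next a) (e.onH x))
      (fun x t => Graph.blowUpCollapse_edgePt a (O₁.next a) (e.onH x) t) hf
      (fun x => O₂.next_ne (ρ.next_next_ne O₂ x))
      (fun x p q => RibbonStructure.label_ne_flip e hO')
      (fun x p => RibbonStructure.label_ne_of_none e hO')
  -- half edges in succession at a vertex give edges in succession in a boundary cycle
  have hpair : ∀ (x y : M.graph.H) (p q : ρ.graph.H), e.onH x = Sum.inl p → e.onH y = Sum.inl q →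
      O'.next x = y → q = O₂.next p ∨ p = O₂.next q := fun x y p q hx hy hxy => by
    have h1 := key (x := M.graph.flip x) (p := ρ.graph.flip p) (q := q)
      (by rw [e.map_flip, hx]; rfl)
      (by rw [RibbonStructure.boundaryNext, M.graph.flip_flip, hxy, hy]; rfl)
    rwa [RibbonStructure.boundaryNext, RibbonStructure.boundaryNext, ρ.graph.flip_flip,
      ρ.graph.flip_flip] at h1
  obtain ⟨x, y, hx, hy, h | h⟩ := RibbonStructure.next_at_new_vertex e hO'
  · exact hpair _ _ _ _ hx hy h
  · exact (hpair _ _ _ _ hy hx h).symm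

/-- The cyclic ordering which a marked surface gives to a rose is determined up to reversal by the
link of the rose. -/
theorem eq_or_eq_op_of_link (ρ : GraphWithMarking n) [Subsingleton ρ.graph.V]
    (O₁ O₂ : RibbonStructure ρ.graph) (S₁ : MarkedSurface.{u} n) (S₂ : MarkedSurface.{v} n)
    (k₁ : O₁.Surface ≃ₜ S₁.carrier) (hk₁ : ((k₁ : C(O₁.Surface, S₁.carrier)).comp
      (O₁.incl.comp ρ.marking)).Homotopic S₁.marking)
    (k₂ : O₂.Surface ≃ₜ S₂.carrier) (hk₂ : ((k₂ : C(O₂.Surface, S₂.carrier)).comp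
      (O₂.incl.comp ρ.marking)).Homotopic S₂.marking)
    (hl : linkVertices S₁.ribbonComplex (MarkedGraph.mk ρ) ⊆
      linkVertices S₂.ribbonComplex (MarkedGraph.mk ρ)) : O₁ = O₂ ∨ O₁ = O₂.op := by
  have := ρ.finite_H
  refine RibbonStructure.eq_or_eq_op (ρ.next_next_ne O₁) fun a => ?_
  have ha := ρ.next_next_ne O₁ a
  refine ρ.next_of_blowUp_mem_drawable ρ.four_le_card O₁ O₂ ha S₂ k₂ hk₂
    (S₂.mem_drawable_of_mem_link (hl (S₁.mem_link (S₁.mem_drawable ρ O₁ k₁ hk₁) ?_ ?_ ?_)))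
  · exact blowUp_mem_drawable ρ.four_le_card O₁ ha S₁ k₁ hk₁
  · exact mk_blowUp_ne ρ.four_le_card O₁ ha
  · exact blowUp_collapsesTo ρ.four_le_card O₁ ha

end GraphWithMarking

/-! ### Ribbon graph complexes and equivalence of marked surfaces -/

namespace RibbonStructure

variable {Γ Δ : Graph}

/-- The map of surfaces induced by an isomorphism of ribbon graphs. -/
def isoMap (O : RibbonStructure Γ) (P : RibbonStructure Δ) (e : Graph.Iso Γ Δ)
    (he : ∀ h, e.onH (O.next h) = P.next (e.onH h)) : C(O.Surface, P.Surface) where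
  toFun := O.desc (fun p => P.incl (e.map p)) (fun h x t => P.stripPt (e.onH h) x t)
    (fun h t => by rw [stripPt_one, boundaryNext, boundaryNext, he, e.map_flip])
    fun h x => P.stripPt_bottom (e.onH h) x
  continuous_toFun := continuous_surface_iff.2 fun h => P.continuous_stripPt (e.onH h)

theorem isoMap_isoMap_symm (O : RibbonStructure Γ) (P : RibbonStructure Δ) (e : Graph.Iso Γ Δ)
    (he he') (p : O.Surface) : P.isoMap O e.symm he' (O.isoMap P e he p) = p := by
  rcases O.surface_cases p with ⟨q, rfl⟩ | ⟨h, x, t, rfl⟩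
  · exact congrArg O.incl (ContinuousMap.congr_fun e.symm_map_comp q)
  · exact congrArg (fun h => O.stripPt h x t) (e.onH.symm_apply_apply h)

/-- The homeomorphism of surfaces induced by an isomorphism of ribbon graphs. -/
def isoHomeo (O : RibbonStructure Γ) (P : RibbonStructure Δ) (e : Graph.Iso Γ Δ)
    (he : ∀ h, e.onH (O.next h) = P.next (e.onH h)) : O.Surface ≃ₜ P.Surface :=
  have he' : ∀ h, e.symm.onH (P.next h) = O.next (e.symm.onH h) := fun h => by
    change e.onH.symm _ = O.next (e.onH.symm h)
    rw [Equiv.symm_apply_eq, he, Equiv.apply_symm_apply]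
  { toFun := O.isoMap P e he
    invFun := P.isoMap O e.symm he'
    left_inv := O.isoMap_isoMap_symm P e he he'
    right_inv := P.isoMap_isoMap_symm O e.symm he' he
    continuous_toFun := (O.isoMap P e he).continuous
    continuous_invFun := (P.isoMap O e.symm he').continuous }

/-- The ribbon structure carried over by an isomorphism of graphs. -/
def transport (O : RibbonStructure Γ) (e : Graph.Iso Γ Δ) : RibbonStructure Δ where
  next := e.onH.permCongr O.next
  sameCycle_iff h k := by
    obtain ⟨h, rfl⟩ := e.onH.surjective h
    obtain ⟨k, rfl⟩ := e.onH.surjective k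
    rw [← e.map_root, ← e.map_root, e.onV.injective.eq_iff, ← O.sameCycle_iff]
    refine exists_congr fun i => ?_
    have h1 : (e.onH.permCongr O.next) ^ i = e.onH.permCongr (O.next ^ i) :=
      (map_zpow e.onH.permCongrHom O.next i).symm
    rw [h1, Equiv.permCongr_apply, e.onH.symm_apply_apply, e.onH.injective.eq_iff]

theorem transport_next (O : RibbonStructure Γ) (e : Graph.Iso Γ Δ) (h : Γ.H) :
    e.onH (O.next h) = (O.transport e).next (e.onH h) := by
  change _ = e.onH.permCongr O.next (e.onH h)
  rw [Equiv.permCongr_apply, e.onH.symm_apply_apply]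

end RibbonStructure

namespace MarkedSurface

variable {n : ℕ}

theorem UnorientedEquivalent.symm {S : MarkedSurface.{u} n} {T : MarkedSurface.{v} n}
    (h : S.UnorientedEquivalent T) : T.UnorientedEquivalent S := by
  obtain ⟨k, hk⟩ := h
  refine ⟨k.symm, ?_⟩
  have h1 := (ContinuousMap.Homotopic.refl (k.symm : C(T.carrier, S.carrier))).comp hk.symm
  refine Eq.mp ?_ h1
  congr 1
  ext x
  exact k.symm_apply_apply _

theorem UnorientedEquivalent.drawable_subset {S : MarkedSurface.{u} n} {T : MarkedSurface.{v} n}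
    (h : S.UnorientedEquivalent T) : S.drawable ⊆ T.drawable := by
  rintro _ ⟨M, O, rfl, k, -, hk⟩
  obtain ⟨j, hj⟩ := h
  exact T.mem_drawable M O (k.trans j)
    (((ContinuousMap.Homotopic.refl (j : C(S.carrier, T.carrier))).comp hk).trans hj)

theorem unorientedEquivalent_of_homeomorph {S : MarkedSurface.{u} n} {T : MarkedSurface.{v} n}
    {X Y : Type*} [TopologicalSpace X] [TopologicalSpace Y] {f : C(Y, X)}
    {m : C((Graph.rose n).Space, Y)} (k : X ≃ₜ S.carrier) (j : X ≃ₜ T.carrier)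
    (hk : ((k : C(X, S.carrier)).comp (f.comp m)).Homotopic S.marking)
    (hj : ((j : C(X, T.carrier)).comp (f.comp m)).Homotopic T.marking) :
    S.UnorientedEquivalent T := by
  refine ⟨k.symm.trans j, ContinuousMap.Homotopic.trans ?_ hj⟩
  have h1 := (ContinuousMap.Homotopic.refl
    (k.symm.trans j : C(S.carrier, T.carrier))).comp hk.symm
  refine Eq.mp ?_ h1
  congr 1
  ext x
  exact congrArg j (k.symm_apply_apply _)

theorem ribbonComplex_eq_iff {S : MarkedSurface.{u} n} {T : MarkedSurface.{v} n} :
    S.ribbonComplex = T.ribbonComplex ↔ S.drawable = T.drawable := by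
  refine ⟨fun h => Set.ext fun a => ?_, fun h => by rw [ribbonComplex, h, ribbonComplex]⟩
  rw [mem_drawable_iff, mem_drawable_iff, h]

/-- A marked surface which is homeomorphic to the surface of a ribbon graph with one vertex gets
a marked rose from it. -/
theorem exists_rose_of_homeomorph (S : MarkedSurface.{u} n) (hn : 2 ≤ n) {Γ : Graph}
    (O : RibbonStructure Γ) (hV : Nat.card Γ.V = 1) (hH : Nat.card Γ.H = 2 * n)
    (k : O.Surface ≃ₜ S.carrier) :
    ∃ (ρ : GraphWithMarking n) (P : RibbonStructure ρ.graph) (j : P.Surface ≃ₜ S.carrier),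
      ρ.IsRose ∧ ((j : C(P.Surface, S.carrier)).comp (P.incl.comp ρ.marking)).Homotopic
        S.marking := by
  obtain ⟨hs, ⟨w⟩⟩ := Nat.card_eq_one_iff_unique.1 hV
  refine ⟨{ graph := Γ
            finite_V := Finite.of_subsingleton
            finite_H := Nat.finite_of_card_ne_zero (by omega)
            connected := ⟨⟨w⟩, fun a b => by
              obtain rfl := Subsingleton.elim a b
              exact Relation.ReflTransGen.refl⟩
            three_le_valence := fun v => by
              have h1 : Γ.valence v = Nat.card Γ.H :=
                Nat.card_congr (Equiv.subtypeUnivEquiv fun _ => Subsingleton.elim _ _)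
              omega
            marking := (O.retr.comp (k.symm : C(S.carrier, O.Surface))).comp S.marking
            marking_equiv := (O.isHomotopyEquivalence_retr.comp
              (isHomotopyEquivalence_homeomorph _)).comp S.marking_equiv }, O, k, hV, ?_⟩
  have h1 := ((ContinuousMap.Homotopic.refl (k : C(O.Surface, S.carrier))).comp
    O.incl_comp_retr).comp (ContinuousMap.Homotopic.refl
      ((k.symm : C(S.carrier, O.Surface)).comp S.marking))
  refine Eq.mp ?_ h1
  congr 1
  ext x
  exact k.apply_symm_apply _

end MarkedSurface

/-- The drawable marked graphs determine the marked surface up to reflection: a rose drawn in `S` is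
drawn in `T` as well, and since its links agree, the two cyclic orderings agree up to reversal, so
that both surfaces are homeomorphic to the same ribbon graph surface. -/
theorem unorientedEquivalent_of_drawable_eq {n : ℕ} {S : MarkedSurface.{u} n}
    {T : MarkedSurface.{v} n} (ρ : GraphWithMarking n) (hρ : ρ.IsRose)
    (O : RibbonStructure ρ.graph) (k : O.Surface ≃ₜ S.carrier)
    (hk : ((k : C(O.Surface, S.carrier)).comp (O.incl.comp ρ.marking)).Homotopic S.marking)
    (h : S.drawable = T.drawable) : S.UnorientedEquivalent T := by
  have := (Nat.card_eq_one_iff_unique.1 hρ).1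
  have hS := S.mem_drawable ρ O k hk
  rw [h] at hS
  obtain ⟨M, O', hM, k', -, hk'⟩ := hS
  obtain ⟨e, he⟩ : M.Equivalent ρ := Quotient.exact hM
  let P := O'.transport e
  let f := O'.isoHomeo P e (O'.transport_next e)
  have hP : (((f.symm.trans k' : P.Surface ≃ₜ T.carrier) : C(P.Surface, T.carrier)).comp
      (P.incl.comp ρ.marking)).Homotopic T.marking := by
    refine ContinuousMap.Homotopic.trans ?_ hk'
    have h1 := (ContinuousMap.Homotopic.refl
      (((f.symm.trans k' : P.Surface ≃ₜ T.carrier) : C(P.Surface, T.carrier)).comp P.incl)).comp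
        he.symm
    refine Eq.mp ?_ h1
    congr 1
    ext x
    exact congrArg k' (f.symm_apply_apply (O'.incl (M.marking x)))
  have hl : linkVertices S.ribbonComplex (MarkedGraph.mk ρ) ⊆
      linkVertices T.ribbonComplex (MarkedGraph.mk ρ) := by
    rw [MarkedSurface.ribbonComplex_eq_iff.2 h]
  rcases ρ.eq_or_eq_op_of_link O P S T k hk _ hP hl with h1 | h1
  · subst h1
    exact MarkedSurface.unorientedEquivalent_of_homeomorph k _ hk hP
  · subst h1
    exact MarkedSurface.unorientedEquivalent_of_homeomorph k (P.reflect.trans (f.symm.trans k'))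
      hk hP

/-! ### Moving points in surfaces -/

/-- A homeomorphism of the plane which moves a point inside a disk and is supported in the disk. -/
theorem exists_homeomorph_complex (p b : ℂ) {r : ℝ} (hb : ‖b - p‖ < r) :
    ∃ η : ℂ ≃ₜ ℂ, η p = b ∧ ∀ z, z ∉ Metric.closedBall p r → η z = z := by
  have hr : 0 < r := (norm_nonneg _).trans_lt hb
  let f : ℂ → ℂ := fun z => z + (max 0 (1 - ‖z - p‖ / r)) • (b - p)
  -- `f` differs from the identity by a map with Lipschitz constant `‖b - p‖ / r < 1`
  have hf : ApproximatesLinearOn f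
      ((ContinuousLinearEquiv.refl ℝ ℂ : ℂ ≃L[ℝ] ℂ) : ℂ →L[ℝ] ℂ) Set.univ
      (‖b - p‖ / r).toNNReal := by
    intro x _ y _
    have h1 : f x - f y - ((ContinuousLinearEquiv.refl ℝ ℂ : ℂ ≃L[ℝ] ℂ) : ℂ →L[ℝ] ℂ) (x - y) =
        (max 0 (1 - ‖x - p‖ / r) - max 0 (1 - ‖y - p‖ / r)) • (b - p) := by
      rw [sub_smul]
      simp only [f, ContinuousLinearEquiv.coe_coe, ContinuousLinearEquiv.refl_apply]
      ring
    have h2 : |max 0 (1 - ‖x - p‖ / r) - max 0 (1 - ‖y - p‖ / r)| ≤ ‖x - y‖ / r := by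
      rw [max_comm 0, max_comm 0]
      refine (abs_max_sub_max_le_abs _ _ _).trans ?_
      rw [show 1 - ‖x - p‖ / r - (1 - ‖y - p‖ / r) = (‖y - p‖ - ‖x - p‖) / r by ring, abs_div,
        abs_of_pos hr, norm_sub_rev x y]
      gcongr
      refine (abs_norm_sub_norm_le _ _).trans (le_of_eq ?_)
      congr 1; ring
    rw [h1, norm_smul, Real.norm_eq_abs]
    calc _ ≤ ‖x - y‖ / r * ‖b - p‖ := by gcongr
      _ = _ := by rw [Real.coe_toNNReal _ (by positivity)]; ring
  refine ⟨hf.toHomeomorph _ (Or.inr ?_), ?_, fun z hz => ?_⟩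
  · have h1 : ‖((ContinuousLinearEquiv.refl ℝ ℂ).symm : ℂ →L[ℝ] ℂ)‖₊ = 1 := by
      rw [ContinuousLinearEquiv.refl_symm]
      exact Subtype.ext ContinuousLinearMap.norm_id
    rw [h1, inv_one]
    exact Real.toNNReal_lt_one.2 ((div_lt_one hr).2 hb)
  · change f p = b
    simp [f]
  · change f z = z
    rw [Metric.mem_closedBall, dist_eq_norm, not_le] at hz
    have h1 : 1 - ‖z - p‖ / r ≤ 0 := sub_nonpos.2 ((one_le_div hr).2 hz.le)
    simp only [f, max_eq_left h1, zero_smul, add_zero]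

section

variable {X : Type*} [TopologicalSpace X]

open Classical in
/-- A self-map of a chart domain, extended by the identity. -/
def extendChart (φ : OpenPartialHomeomorph X ℂ) (η : ℂ → ℂ) (x : X) : X :=
  if x ∈ φ.source then φ.symm (η (φ x)) else x

variable {φ : OpenPartialHomeomorph X ℂ} {K : Set ℂ}

theorem extendChart_eq_self {η : ℂ → ℂ} (hη : ∀ z, z ∉ K → η z = z) {x : X}
    (hx : x ∉ φ.symm '' K) : extendChart φ η x = x := by
  rw [extendChart]
  split_ifs with h
  · rw [hη _ fun h1 => hx ⟨φ x, h1, φ.left_inv h⟩, φ.left_inv h]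
  · rfl

theorem continuous_extendChart [T2Space X] (hK : IsCompact K) (hKt : K ⊆ φ.target) {η : ℂ ≃ₜ ℂ}
    (hη : ∀ z, z ∉ K → η z = z) (ht : ∀ z ∈ φ.target, η z ∈ φ.target) :
    Continuous (extendChart φ η) := by
  refine continuous_iff_continuousAt.2 fun x => ?_
  by_cases hx : x ∈ φ.source
  · have h0 : ContinuousAt (fun y => η (φ y)) x :=
      ContinuousAt.comp (g := η) η.continuous.continuousAt (φ.continuousAt hx)
    have h1 : ContinuousAt (fun y => φ.symm (η (φ y))) x :=
      ContinuousAt.comp (g := φ.symm) (φ.continuousAt_symm (ht _ (φ.map_source hx))) h0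
    refine h1.congr ?_
    filter_upwards [φ.open_source.mem_nhds hx] with y hy
    exact (if_pos hy).symm
  · have h1 : IsClosed (φ.symm '' K) := (hK.image_of_continuousOn
      (φ.continuousOn_symm.mono hKt)).isClosed
    refine continuousAt_id.congr ?_
    filter_upwards [h1.isOpen_compl.mem_nhds (fun ⟨z, hz, e⟩ =>
      hx (e ▸ φ.map_target (hKt hz)) : x ∉ φ.symm '' K)] with y hy
    exact (extendChart_eq_self hη hy).symm

theorem extendChart_extendChart {η η' : ℂ → ℂ} (h : ∀ z, η' (η z) = z)
    (ht : ∀ z ∈ φ.target, η z ∈ φ.target) (x : X) :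
    extendChart φ η' (extendChart φ η x) = x := by
  by_cases hx : x ∈ φ.source
  · have h1 := ht _ (φ.map_source hx)
    have h2 : extendChart φ η x = φ.symm (η (φ x)) := if_pos hx
    rw [h2, extendChart, if_pos (φ.map_target h1), φ.right_inv h1, h, φ.left_inv hx]
  · have h2 : ∀ η, extendChart φ η x = x := fun η => if_neg hx
    rw [h2, h2]

/-- Homeomorphisms of the plane with compact support in the target of a chart act on the whole
space. -/
theorem exists_homeomorph_extendChart [T2Space X] (hK : IsCompact K) (hKt : K ⊆ φ.target)
    (η : ℂ ≃ₜ ℂ) (hη : ∀ z, z ∉ K → η z = z) : ∃ h : X ≃ₜ X, ∀ x, h x = extendChart φ η x := by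
  have hη' : ∀ z, z ∉ K → η.symm z = z := fun z hz => by
    rw [Homeomorph.symm_apply_eq, hη z hz]
  have key : ∀ η : ℂ ≃ₜ ℂ, (∀ z, z ∉ K → η z = z) → ∀ z ∈ φ.target, η z ∈ φ.target := by
    intro η hη z hz
    by_cases h1 : η z ∈ K
    · exact hKt h1
    · rwa [η.injective (hη _ h1)]
  exact ⟨{ toFun := extendChart φ η
           invFun := extendChart φ η.symm
           left_inv := extendChart_extendChart η.symm_apply_apply (key η hη)
           right_inv := extendChart_extendChart η.apply_symm_apply (key η.symm hη')
           continuous_toFun := continuous_extendChart hK hKt hη (key η hη)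
           continuous_invFun := continuous_extendChart hK hKt hη' (key η.symm hη') },
    fun _ => rfl⟩

/-- Every point can be moved to all nearby points by homeomorphisms supported in a chart. -/
theorem eventually_exists_homeomorph [T2Space X] (φ : OpenPartialHomeomorph X ℂ) {x : X}
    (hx : x ∈ φ.source) :
    ∀ᶠ y in 𝓝 x, ∃ h : X ≃ₜ X, h x = y ∧ ∀ z, z ∉ φ.source → h z = z := by
  obtain ⟨r, hr, hrt⟩ := Metric.nhds_basis_closedBall.mem_iff.1
    (φ.open_target.mem_nhds (φ.map_source hx))
  filter_upwards [φ.open_source.mem_nhds hx, (φ.continuousAt hx).eventually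
    (Metric.ball_mem_nhds _ hr)] with y hy hyr
  obtain ⟨η, h1, h2⟩ := exists_homeomorph_complex (φ x) (φ y) (by rwa [← dist_eq_norm])
  obtain ⟨h, hh⟩ := exists_homeomorph_extendChart (isCompact_closedBall _ _) hrt η h2
  refine ⟨h, ?_, fun z hz => ?_⟩
  · rw [hh, extendChart, if_pos hx, h1, φ.left_inv hy]
  · rw [hh, extendChart, if_neg hz]

end

/-- A connected topological surface, in the sense in which it is used here: the complement of
a finite set is always connected. -/
structure IsConnectedSurface (X : Type*) [TopologicalSpace X] : Prop where
  t2 : T2Space X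
  exists_chart : ∀ x : X, ∃ φ : OpenPartialHomeomorph X ℂ, x ∈ φ.source
  isPreconnected_compl : ∀ F : Set X, F.Finite → IsPreconnected Fᶜ

section

variable {X Y : Type*} [TopologicalSpace X] [TopologicalSpace Y]

theorem exists_chart_of_isOpenEmbedding {j : X → Y} (hj : Topology.IsOpenEmbedding j) {x : X}
    (h : ∃ φ : OpenPartialHomeomorph Y ℂ, j x ∈ φ.source) :
    ∃ φ : OpenPartialHomeomorph X ℂ, x ∈ φ.source := by
  obtain ⟨φ, hφ⟩ := h
  have : Nonempty X := ⟨x⟩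
  exact ⟨(hj.toOpenPartialHomeomorph j).trans φ, by simpa using hφ⟩

theorem exists_chart_image {j : X → Y} (hj : Topology.IsOpenEmbedding j) {x : X}
    (h : ∃ φ : OpenPartialHomeomorph X ℂ, x ∈ φ.source) :
    ∃ φ : OpenPartialHomeomorph Y ℂ, j x ∈ φ.source := by
  obtain ⟨φ, hφ⟩ := h
  have : Nonempty X := ⟨x⟩
  refine ⟨(hj.toOpenPartialHomeomorph j).symm.trans φ, ?_⟩
  have h1 := (hj.toOpenPartialHomeomorph j).left_inv (x := x) (by simp)
  rw [Topology.IsOpenEmbedding.toOpenPartialHomeomorph_apply] at h1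
  simp [h1, hφ]

theorem isConnectedSurface_of_isOpenEmbedding {j : X → Y} (hj : Topology.IsOpenEmbedding j)
    (hr : (Set.range j)ᶜ.Finite) (ht : T2Space Y)
    (hc : ∀ x, ∃ φ : OpenPartialHomeomorph Y ℂ, j x ∈ φ.source)
    (hp : ∀ F : Set Y, F.Finite → IsPreconnected Fᶜ) : IsConnectedSurface X where
  t2 := hj.isEmbedding.t2Space
  exists_chart x := exists_chart_of_isOpenEmbedding hj (hc x)
  isPreconnected_compl F hF := by
    have h1 := hp (j '' F ∪ (Set.range j)ᶜ) ((hF.image j).union hr)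
    rw [← hj.isInducing.isPreconnected_image]
    convert h1 using 1
    rw [Set.compl_union, compl_compl, Set.image_compl_eq_range_sdiff_image hj.injective,
      Set.sdiff_eq, Set.inter_comm]

theorem IsConnectedSurface.of_isOpenEmbedding {j : X → Y} (hj : Topology.IsOpenEmbedding j)
    (hr : (Set.range j)ᶜ.Finite) (hY : IsConnectedSurface Y) : IsConnectedSurface X :=
  isConnectedSurface_of_isOpenEmbedding hj hr hY.t2 (fun x => hY.exists_chart (j x))
    hY.isPreconnected_compl

/-- Surfaces are homogeneous, even relative to a finite set. -/
theorem IsConnectedSurface.exists_homeomorph (hX : IsConnectedSurface X) {F : Set X} (hF : F.Finite)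
    {x y : X}
    (hx : x ∉ F) (hy : y ∉ F) : ∃ h : X ≃ₜ X, h x = y ∧ ∀ z ∈ F, h z = z := by
  have := hX.t2
  let orbit : X → Set X := fun a => {b | ∃ h : X ≃ₜ X, h a = b ∧ ∀ z ∈ F, h z = z}
  have hopen : ∀ a, IsOpen (orbit a ∩ Fᶜ) := fun a => by
    refine isOpen_iff_mem_nhds.2 fun b ⟨⟨h, hb, hF'⟩, hbF⟩ => ?_
    obtain ⟨φ, hφ⟩ := hX.exists_chart b
    have h1 := eventually_exists_homeomorph
      (φ.restrOpen Fᶜ hF.isClosed.isOpen_compl) (x := b) ⟨hφ, hbF⟩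
    filter_upwards [h1, hF.isClosed.isOpen_compl.mem_nhds hbF] with c ⟨h', hc, hF''⟩ hcF
    refine ⟨⟨h.trans h', ?_, fun z hz => ?_⟩, hcF⟩
    · rw [Homeomorph.trans_apply, hb, hc]
    · rw [Homeomorph.trans_apply, hF' z hz, hF'' z fun h2 => h2.2 hz]
  by_contra hxy
  -- the orbit of `x` and the union of the other orbits would separate the complement of `F`
  obtain ⟨z, hz, hz1, hz2⟩ := hX.isPreconnected_compl F hF (orbit x ∩ Fᶜ)
    (⋃ a ∈ {a | a ∉ orbit x}, orbit a ∩ Fᶜ) (hopen x)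
    (isOpen_biUnion fun a _ => hopen a)
    (fun b hb => by
      by_cases h : b ∈ orbit x
      · exact Or.inl ⟨h, hb⟩
      · exact Or.inr (Set.mem_biUnion h ⟨⟨Homeomorph.refl X, rfl, fun _ _ => rfl⟩, hb⟩))
    ⟨x, hx, ⟨Homeomorph.refl X, rfl, fun _ _ => rfl⟩, hx⟩
    ⟨y, hy, Set.mem_biUnion (x := y) hxy ⟨⟨Homeomorph.refl X, rfl, fun _ _ => rfl⟩, hy⟩⟩
  obtain ⟨a, ha, ⟨h, hh, hF'⟩, -⟩ := Set.mem_iUnion₂.1 hz2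
  obtain ⟨⟨h', hh', hF''⟩, -⟩ := hz1
  refine ha ⟨h'.trans h.symm, ?_, fun w hw => ?_⟩
  · rw [Homeomorph.trans_apply, hh', ← hh, h.symm_apply_apply]
  · rw [Homeomorph.trans_apply, hF'' w hw, Homeomorph.symm_apply_eq, hF' w hw]

/-- A dense injective image of the plane remains connected and dense when finitely many points are
removed. -/
theorem isPreconnected_compl_of_dense {m : ℂ → X} (hm : Continuous m) (hinj : Function.Injective m)
    (hd : DenseRange m) {F : Set X} (hF : F.Finite) : IsPreconnected Fᶜ := by
  have h1 : (m ⁻¹' F).Countable := (hF.preimage hinj.injOn).countable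
  have h2 := (h1.isConnected_compl_of_one_lt_rank (E := ℂ)
    (by rw [Complex.rank_real_complex]; exact Nat.one_lt_ofNat)).isPreconnected
  have h3 := (h2.image m hm.continuousOn)
  refine h3.subset_closure ?_ fun x _ => ?_
  · rintro _ ⟨z, hz, rfl⟩
    exact hz
  · exact hd.dense_image hm (h1.dense_compl ℝ) x

end

/-! ### Separation and compactness properties of the surface of a ribbon graph -/

namespace RibbonStructure

variable {Γ : Graph} (O : RibbonStructure Γ)

theorem exists_bump_pos (hΓ : Function.Surjective Γ.root) (p : O.Surface) :
    (∃ w, p = O.incl (Γ.vertexPt w)) ∨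
    (∃ h, 0 < O.edgeBump hΓ h p) ∨ ∃ h, 0 < O.sideBump h p := by
  obtain ⟨h, x, t, rfl⟩ := O.exists_stripPt hΓ p
  by_cases hx : 0 < (x : ℝ) ∧ (x : ℝ) < 1
  · refine Or.inr (Or.inl ⟨h, ?_⟩)
    rw [stripPt_eq_stp, edgeBump_stp _ _ _ _ ⟨hx.1.le, hx.2.le⟩, if_pos (Or.inl rfl)]
    exact mul_pos hx.1 (sub_pos.2 hx.2)
  obtain ⟨k, hk⟩ : ∃ k, O.stripPt h x t = O.stripPt k 1 t := by
    by_cases h0 : 0 < (x : ℝ)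
    · have : x = 1 := Subtype.ext (le_antisymm x.2.2 (not_lt.1 fun h1 => hx ⟨h0, h1⟩))
      exact ⟨h, by rw [this]⟩
    · have : x = 0 := Subtype.ext (le_antisymm (not_lt.1 h0) x.2.1)
      refine ⟨Γ.flip (O.next.symm h), ?_⟩
      rw [stripPt_one, boundaryNext, Γ.flip_flip, Equiv.apply_symm_apply, this]
  rw [hk]
  rcases eq_or_lt_of_le (zero_le (a := t)) with ht | ht
  · left
    rw [← ht, stripPt_bottom, Γ.edgePt_one]
    exact ⟨_, rfl⟩
  · refine Or.inr (Or.inr ⟨k, ?_⟩)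
    have ht' : (0 : ℝ) < t := ht
    rw [stripPt_eq_stp, sideBump_stp _ _ _ ⟨by norm_num, by norm_num⟩ ht'.le, if_pos rfl]
    refine add_pos_of_pos_of_nonneg (mul_pos (lt_max_of_lt_left ?_) ht') ?_
    · norm_num
    · split_ifs
      · positivity
      · exact le_rfl

/-- Every point other than a vertex is in the image of one of the standard charts. -/
theorem exists_chart_of_ne (hΓ : Function.Surjective Γ.root) {p : O.Surface}
    (hp : ∀ w, p ≠ O.incl (Γ.vertexPt w)) :
    ∃ φ : OpenPartialHomeomorph O.Surface ℂ, p ∈ φ.source := by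
  rcases O.exists_bump_pos hΓ p with ⟨w, hw⟩ | ⟨h, hh⟩ | ⟨h, hh⟩
  · exact absurd hw (hp w)
  · exact ⟨(O.edgeChart hΓ h).symm, hh⟩
  · exact ⟨(O.sideChart h).symm, hh⟩

/-- The coordinate functions of the standard charts, multiplied by bump functions, separate points;
the
only point where all of them vanish is the vertex. -/
theorem t2Space_surface (hΓ : Function.Surjective Γ.root) [Subsingleton Γ.V] :
    T2Space O.Surface := by
  refine T2Space.of_injective_continuous (f := fun p : O.Surface => fun h : Γ.H =>
    ((O.edgeBump hΓ h p, O.edgeCoord hΓ h p), (O.sideBump h p, O.sideCoord h p))) ?_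
    (continuous_pi fun h => ((O.continuous_edgeBump hΓ h).prodMk
      (O.continuous_edgeCoord hΓ h)).prodMk ((O.continuous_sideBump h).prodMk
        (O.continuous_sideCoord h)))
  -- the standard charts are quotients of these coordinate functions
  have key : ∀ p q : O.Surface, (∀ h, O.edgeBump hΓ h p = O.edgeBump hΓ h q) →
      (∀ h, O.edgeCoord hΓ h p = O.edgeCoord hΓ h q) → (∀ h, O.sideBump h p = O.sideBump h q) →
      (∀ h, O.sideCoord h p = O.sideCoord h q) →
      ((∃ h, 0 < O.edgeBump hΓ h p) ∨ ∃ h, 0 < O.sideBump h p) → p = q := by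
    rintro p q h1 h2 h3 h4 (⟨h, hp⟩ | ⟨h, hp⟩)
    · refine (O.edgeChart hΓ h).symm.injOn (show 0 < O.edgeBump hΓ h p from hp)
        (show 0 < O.edgeBump hΓ h q from h1 h ▸ hp) ?_
      change O.edgeCoord hΓ h p / O.edgeBump hΓ h p = O.edgeCoord hΓ h q / O.edgeBump hΓ h q
      rw [h1, h2]
    · refine (O.sideChart h).symm.injOn (show 0 < O.sideBump h p from hp)
        (show 0 < O.sideBump h q from h3 h ▸ hp) ?_
      change O.sideCoord h p / O.sideBump h p = O.sideCoord h q / O.sideBump h q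
      rw [h3, h4]
  intro p q hpq
  have h1 : ∀ h, O.edgeBump hΓ h p = O.edgeBump hΓ h q := fun h => congrArg (fun f => (f h).1.1) hpq
  have h2 : ∀ h, O.edgeCoord hΓ h p = O.edgeCoord hΓ h q := fun h =>
    congrArg (fun f => (f h).1.2) hpq
  have h3 : ∀ h, O.sideBump h p = O.sideBump h q := fun h => congrArg (fun f => (f h).2.1) hpq
  have h4 : ∀ h, O.sideCoord h p = O.sideCoord h q := fun h => congrArg (fun f => (f h).2.2) hpq
  rcases O.exists_bump_pos hΓ p with ⟨w, hw⟩ | hp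
  · rcases O.exists_bump_pos hΓ q with ⟨w', hw'⟩ | hq
    · rw [hw, hw', Subsingleton.elim w w']
    · exact (key q p (fun h => (h1 h).symm) (fun h => (h2 h).symm) (fun h => (h3 h).symm)
        (fun h => (h4 h).symm) hq).symm
  · exact key p q h1 h2 h3 h4 hp

variable [Finite Γ.H]

theorem isCompact_height_le (hΓ : Function.Surjective Γ.root) (T : ℝ≥0) :
    IsCompact {p | O.height p ≤ T} := by
  have h1 : {p | O.height p ≤ T} =
      ⋃ h, (fun q : I × ℝ≥0 => O.stripPt h q.1 q.2) '' (Set.univ ×ˢ Set.Iic T) := by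
    ext p
    rw [Set.mem_iUnion]
    constructor
    · intro hp
      obtain ⟨h, x, t, rfl⟩ := O.exists_stripPt hΓ p
      exact ⟨h, (x, t), ⟨trivial, hp⟩, rfl⟩
    · rintro ⟨h, ⟨x, t⟩, ⟨-, ht⟩, rfl⟩
      exact ht
  rw [h1]
  refine isCompact_iUnion fun h => (isCompact_univ.prod ?_).image (O.continuous_stripPt h)
  rw [← Set.Icc_bot]
  exact isCompact_Icc

theorem weaklyLocallyCompactSpace_surface (hΓ : Function.Surjective Γ.root) :
    WeaklyLocallyCompactSpace O.Surface where
  exists_compact_mem_nhds p := ⟨_, O.isCompact_height_le hΓ (O.height p + 1),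
    Filter.mem_of_superset ((isOpen_lt O.continuous_height continuous_const).mem_nhds
      (show O.height p < O.height p + 1 from lt_add_one _))
          fun q (hq : O.height q < O.height p + 1) => hq.le⟩

/-- A continuous bijection is a homeomorphism if the height is bounded on the preimages of compact
sets. -/
theorem isHomeomorph_of_height (hΓ : Function.Surjective Γ.root) {Z : Type*} [TopologicalSpace Z]
    [T2Space Z]
    [WeaklyLocallyCompactSpace Z] {f : O.Surface → Z} (hf : Continuous f) (hb : f.Bijective)
    {r : Z → ℝ} (hr : Continuous r) (h : ∀ p, (O.height p : ℝ) ≤ r (f p)) : IsHomeomorph f := by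
  have h1 : IsProperMap f := by
    refine isProperMap_iff_isCompact_preimage.2 ⟨hf, fun K hK => ?_⟩
    obtain ⟨T, hT⟩ := (hK.image hr).bddAbove
    refine (O.isCompact_height_le hΓ T.toNNReal).of_isClosed_subset (hK.isClosed.preimage hf)
      fun p hp => ?_
    exact NNReal.le_toNNReal_of_coe_le ((h p).trans (hT ⟨f p, hp, rfl⟩))
  exact isHomeomorph_iff_continuous_isClosedMap_bijective.2 ⟨hf, h1.isClosedMap, hb⟩

end RibbonStructure

/-! ### Removing a point by doubling an edge -/

namespace Graph

/-- One of the two directions of an edge. -/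
def side (Γ : Graph) (e : Γ.H) (c : Bool) : Γ.H := if c then Γ.flip e else e

variable {Γ : Graph} {e : Γ.H}

theorem flip_side (c : Bool) : Γ.flip (Γ.side e c) = Γ.side e (!c) := by
  cases c
  · rfl
  · exact Γ.flip_flip e

open Classical in
/-- The reversal in the graph in which the edge `e` is doubled: the half edge `Sum.inr c` is the
other end of the copy of `e` which starts with `Sum.inl (Γ.side e c)`. -/
def doubleFlip (Γ : Graph) (e : Γ.H) : Γ.H ⊕ Bool → Γ.H ⊕ Bool
  | Sum.inl h => if h = e then Sum.inr false else if h = Γ.flip e then Sum.inr true else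
      Sum.inl (Γ.flip h)
  | Sum.inr c => Sum.inl (Γ.side e c)

theorem doubleFlip_side (c : Bool) : Γ.doubleFlip e (Sum.inl (Γ.side e c)) = Sum.inr c := by
  cases c
  · exact if_pos rfl
  · exact (if_neg (Γ.flip_ne e)).trans (if_pos rfl)

theorem doubleFlip_of_ne {h : Γ.H} (hh : ∀ c, h ≠ Γ.side e c) :
    Γ.doubleFlip e (Sum.inl h) = Sum.inl (Γ.flip h) :=
  (if_neg (hh false)).trans (if_neg (hh true))

theorem flip_ne_side {h : Γ.H} (hh : ∀ c, h ≠ Γ.side e c) (c : Bool) : Γ.flip h ≠ Γ.side e c :=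
  fun h1 => hh (!c) (by rw [← flip_side, ← h1, Γ.flip_flip])

theorem doubleFlip_doubleFlip (x : Γ.H ⊕ Bool) : Γ.doubleFlip e (Γ.doubleFlip e x) = x := by
  rcases x with h | c
  · by_cases hh : ∀ c, h ≠ Γ.side e c
    · rw [doubleFlip_of_ne hh, doubleFlip_of_ne (flip_ne_side hh), Γ.flip_flip]
    · push Not at hh
      obtain ⟨c, rfl⟩ := hh
      rw [doubleFlip_side]
      rfl
  · exact doubleFlip_side c

/-- The graph in which the edge `e` is doubled. The strips of the half edges `Sum.inl h`
correspond to the strips of `Γ`, and the strips of the half edges `Sum.inr c` lie between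
the two copies of `e`. -/
def double (Γ : Graph) (e : Γ.H) : Graph where
  V := Γ.V
  H := Γ.H ⊕ Bool
  flip := Γ.doubleFlip e
  flip_flip := doubleFlip_doubleFlip
  flip_ne := by
    rintro (h | c)
    · by_cases hh : ∀ c, h ≠ Γ.side e c
      · rw [doubleFlip_of_ne hh]
        exact fun h1 => Γ.flip_ne h (Sum.inl_injective h1)
      · push Not at hh
        obtain ⟨c, rfl⟩ := hh
        rw [doubleFlip_side]
        exact Sum.inr_ne_inl
    · exact Sum.inl_ne_inr
  root := Sum.elim Γ.root fun c => Γ.root (Γ.flip (Γ.side e c))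

/-- The half edge of the doubled graph whose strip corresponds to that of `h`. -/
def outer (e h : Γ.H) : (Γ.double e).H := Sum.inl h

/-- A half edge of the doubled graph whose strip lies between the two copies of `e`. -/
def inner (e : Γ.H) (c : Bool) : (Γ.double e).H := Sum.inr c

instance [Subsingleton Γ.V] : Subsingleton (Γ.double e).V := inferInstanceAs (Subsingleton Γ.V)

instance [Finite Γ.H] : Finite (Γ.double e).H := inferInstanceAs (Finite (Γ.H ⊕ Bool))

theorem flip_outer_of_ne {h : Γ.H} (hh : ∀ c, h ≠ Γ.side e c) :
    (Γ.double e).flip (outer e h) = outer e (Γ.flip h) := doubleFlip_of_ne hh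

theorem flip_outer_side (c : Bool) : (Γ.double e).flip (outer e (Γ.side e c)) = inner e c :=
  doubleFlip_side c

theorem flip_inner (c : Bool) : (Γ.double e).flip (inner e c) = outer e (Γ.side e c) := rfl

theorem root_surjective_double (hΓ : Function.Surjective Γ.root) :
    Function.Surjective (Γ.double e).root := fun w => by
  obtain ⟨h, rfl⟩ := hΓ w
  exact ⟨outer e h, rfl⟩

end Graph

namespace RibbonStructure

variable {Γ : Graph} (O : RibbonStructure Γ) (e : Γ.H)

/-- The cyclic ordering of the graph with a doubled edge. Its boundary cycles are those of
the given graph, and one further boundary cycle of length two. -/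
def doublePerm : Equiv.Perm (Γ.H ⊕ Bool) :=
  (Function.Involutive.toPerm (Γ.doubleFlip e) (Γ.double e).flip_flip).trans
    (Equiv.sumCongr O.bnPerm Equiv.boolNot)

/-- Between `h` and its old successor, the new cyclic ordering passes through at most one of the
additional half edges. -/
theorem sameCycle_doublePerm_next (h : Γ.H) :
    (O.doublePerm e).SameCycle (Sum.inl h) (Sum.inl (O.next h)) := by
  have hstep : ∀ x y, O.doublePerm e x = y → (O.doublePerm e).SameCycle x y := by
    rintro x _ rfl
    exact ⟨1, rfl⟩
  by_cases hh : ∀ c, h ≠ Γ.side e c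
  · refine hstep _ _ ?_
    change Sum.map O.bnPerm not (Γ.doubleFlip e (Sum.inl h)) = _
    rw [Graph.doubleFlip_of_ne hh]
    change Sum.inl (O.next (Γ.flip (Γ.flip h))) = _
    rw [Γ.flip_flip]
  · push Not at hh
    obtain ⟨c, rfl⟩ := hh
    refine (hstep _ (Sum.inr !c) ?_).trans (hstep _ _ ?_)
    · change Sum.map O.bnPerm not (Γ.doubleFlip e (Sum.inl _)) = _
      rw [Graph.doubleFlip_side]
      rfl
    · change Sum.inl (O.next (Γ.flip (Γ.side e !c))) = _
      rw [Graph.flip_side, Bool.not_not]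

/-- The ribbon graph in which the edge `e` is doubled. -/
def double [Subsingleton Γ.V] : RibbonStructure (Γ.double e) where
  next := O.doublePerm e
  sameCycle_iff x y := by
    refine iff_of_true ?_ (Subsingleton.elim (α := Γ.V) _ _)
    have h1 : ∀ h, (O.doublePerm e).SameCycle (Sum.inl e) (Sum.inl h) := fun h => by
      obtain ⟨i, rfl⟩ := (O.sameCycle_iff e h).2 (Subsingleton.elim _ _)
      refine cast (apply_zpow_eq (f := O.next)
        (r := fun x => (O.doublePerm e).SameCycle (Sum.inl e) (Sum.inl x))
        (fun x => propext ⟨fun h => h.trans (O.sameCycle_doublePerm_next e x).symm,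
          fun h => h.trans (O.sameCycle_doublePerm_next e x)⟩) i e).symm
              (Equiv.Perm.SameCycle.refl _ _)
    have h2 : ∀ x, (O.doublePerm e).SameCycle (Sum.inl e) x := by
      rintro (h | c)
      · exact h1 h
      · exact (h1 (O.bnPerm (Γ.side e c))).trans
          (Equiv.Perm.SameCycle.symm ⟨1, rfl⟩)
    exact (h2 x).symm.trans (h2 y)

variable {O e}

theorem boundaryNext_outer [Subsingleton Γ.V] (h : Γ.H) :
    (O.double e).boundaryNext (Graph.outer e h) = Graph.outer e (O.boundaryNext h) := by
  change Sum.map O.bnPerm not (Γ.doubleFlip e (Γ.doubleFlip e (Sum.inl h))) = _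
  rw [Graph.doubleFlip_doubleFlip]
  rfl

theorem boundaryNext_inner [Subsingleton Γ.V] (c : Bool) :
    (O.double e).boundaryNext (Graph.inner e c) = Graph.inner e (!c) := by
  change Sum.map O.bnPerm not (Γ.doubleFlip e (Γ.doubleFlip e (Sum.inr c))) = _
  rw [Graph.doubleFlip_doubleFlip]
  rfl

variable (O e)

theorem stripDesc_stp {Y : Type*} (hΓ : Function.Surjective Γ.root) (K : Γ.H → ℝ → ℝ → Y)
    (side bottom) (h : Γ.H) {x t : ℝ} (hx : x ∈ Set.Icc (0 : ℝ) 1) (ht : 0 ≤ t) :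
    O.stripDesc hΓ (fun h x t => K h x t) side bottom (O.stp h x t) = K h x t := by
  change K h ((Set.projIcc 0 1 zero_le_one x : I) : ℝ) (t.toNNReal : ℝ) = _
  rw [coe_projIcc_unit hx, Real.coe_toNNReal _ ht]

theorem exists_stp (hΓ : Function.Surjective Γ.root) (p : O.Surface) :
    ∃ h x t, x ∈ Set.Icc (0 : ℝ) 1 ∧ 0 ≤ t ∧ p = O.stp h x t := by
  obtain ⟨h, x, t, rfl⟩ := O.exists_stripPt hΓ p
  exact ⟨h, x, t, x.2, t.2, stripPt_eq_stp _ _ _ _⟩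

theorem stp_zero_zero (h : Γ.H) : O.stp h 0 0 = O.incl (Γ.vertexPt (Γ.root h)) := by
  rw [← Γ.edgePt_zero, ← stripPt_bottom, stripPt_eq_stp]
  rfl

theorem stp_eq_of_vertex [Subsingleton Γ.V] {h k : Γ.H} {x y : ℝ} (hx : x = 0 ∨ x = 1)
    (hy : y = 0 ∨ y = 1) : O.stp h x 0 = O.stp k y 0 := by
  have key : ∀ (h : Γ.H) (x : ℝ), (x = 0 ∨ x = 1) → O.stp h x 0 =
      O.incl (Γ.vertexPt (Γ.root h)) := by
    rintro h x (rfl | rfl)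
    · exact O.stp_zero_zero h
    · rw [stp_one, stp_zero_zero, Subsingleton.elim (Γ.root _)]
  rw [key h x hx, key k y hy, Subsingleton.elim (Γ.root h)]

end RibbonStructure

/-! ### The map that fills in a puncture -/

namespace RibbonStructure

variable {Γ : Graph} (O : RibbonStructure Γ) (e : Γ.H)

open Classical in
/-- The height of the lens around the edge `e` above the point `x` of the edge `h`. -/
def lens (h : Γ.H) (x : ℝ) : ℝ := if ∃ c, h = Γ.side e c then 1 / 2 - |x - 1 / 2| else 0

variable {e} in
theorem lens_side (c : Bool) (x : ℝ) : lens e (Γ.side e c) x = 1 / 2 - |x - 1 / 2| :=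
  if_pos ⟨c, rfl⟩

variable {e} in
theorem lens_of_ne {h : Γ.H} (hh : ∀ c, h ≠ Γ.side e c) (x : ℝ) : lens e h x = 0 :=
  if_neg fun ⟨c, hc⟩ => hh c hc

theorem continuous_lens (h : Γ.H) : Continuous (lens e h) := by
  unfold lens
  split_ifs <;> fun_prop

theorem lens_one (h : Γ.H) : lens e h 1 = 0 := by
  rw [lens]; split_ifs <;> norm_num

theorem lens_zero (h : Γ.H) : lens e h 0 = 0 := by
  rw [lens]; split_ifs <;> norm_num

theorem lens_nonneg (h : Γ.H) {x : ℝ} (hx : x ∈ Set.Icc (0 : ℝ) 1) : 0 ≤ lens e h x := by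
  rw [lens]
  split_ifs
  · rw [sub_nonneg, abs_le]
    exact ⟨by linarith [hx.1], by linarith [hx.2]⟩
  · exact le_rfl

theorem abs_half (x : ℝ) : |1 - x - 1 / 2| = |x - 1 / 2| := by
  rw [show 1 - x - 1 / 2 = -(x - 1 / 2) by ring, abs_neg]

theorem lens_flip (h : Γ.H) (x : ℝ) : lens e (Γ.flip h) (1 - x) = lens e h x := by
  by_cases hh : ∀ c, h ≠ Γ.side e c
  · rw [lens_of_ne hh, lens_of_ne (Graph.flip_ne_side hh)]
  · push Not at hh
    obtain ⟨c, rfl⟩ := hh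
    rw [Graph.flip_side, lens_side, lens_side, abs_half]

/-- On the strips, the map from the surface of the doubled graph to the original surface. -/
def fillStrip : Γ.H ⊕ Bool → ℝ → ℝ → O.Surface
  | Sum.inl h, x, t => O.stp h x (t + lens e h x)
  | Sum.inr c, x, t => O.stp (Γ.side e c) (1 / 2 + (1 / 2 - x) / (1 + t))
      ((1 / 2 - |x - 1 / 2|) / (1 + t))

/-- The midpoint of an edge. -/
def midpoint : O.Surface := O.stp e (1 / 2) 0

theorem stp_side_half (c : Bool) : O.stp (Γ.side e c) (1 / 2) 0 = O.midpoint e := by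
  cases c
  · rfl
  · change O.stp (Γ.flip e) (1 / 2) 0 = O.stp e (1 / 2) 0
    rw [← stp_flip (h := e) _ le_rfl]
    norm_num

theorem height_stp (h : Γ.H) (x : ℝ) {t : ℝ} (ht : 0 ≤ t) : (O.height (O.stp h x t) : ℝ) = t :=
  Real.coe_toNNReal _ ht

variable (hΓ : Function.Surjective Γ.root)

/-- Twice the sum of the coordinate distances to the midpoint of the edge: the lens is the region
where this is at most `1`. -/
def lensRadius (x t : ℝ) : ℝ := 2 * |x - 1 / 2| + 2 * t

open Classical in
/-- The distance from the midpoint of an edge, cut off at the boundary of the lens. -/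
def lensDist : O.Surface → ℝ :=
  O.stripDesc hΓ (fun h x t => if ∃ c, h = Γ.side e c then min 1 (lensRadius x t) else 1)
    (fun h t => by
      have h1 : min 1 (lensRadius 1 t) = 1 := min_eq_left (by rw [lensRadius]; norm_num)
      have h2 : min 1 (lensRadius 0 t) = 1 := min_eq_left (by rw [lensRadius]; norm_num)
      rw [Set.Icc.coe_one, Set.Icc.coe_zero, h1, h2, ite_self, ite_self])
    (fun h x => by
      have h1 : (∃ c, Γ.flip h = Γ.side e c) ↔ ∃ c, h = Γ.side e c :=
        ⟨fun ⟨c, hc⟩ => ⟨!c, by rw [← Graph.flip_side, ← hc, Γ.flip_flip]⟩,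
          fun ⟨c, hc⟩ => ⟨!c, by rw [← Graph.flip_side, hc]⟩⟩
      simp only [h1, lensRadius, unitInterval.coe_symm_eq, abs_half])

theorem continuous_lensDist : Continuous (O.lensDist e hΓ) := by
  classical
  refine continuous_surface_iff.2 fun h => ?_
  change Continuous fun p : I × ℝ≥0 => if ∃ c, h = Γ.side e c then
    min 1 (2 * |(p.1 : ℝ) - 1 / 2| + 2 * (p.2 : ℝ)) else 1
  split_ifs <;> fun_prop

theorem lensDist_side (c : Bool) {x t : ℝ} (hx : x ∈ Set.Icc (0 : ℝ) 1) (ht : 0 ≤ t) :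
    O.lensDist e hΓ (O.stp (Γ.side e c) x t) = min 1 (lensRadius x t) := by
  classical
  exact (stripDesc_stp _ _ (fun h x t => if ∃ c, h = Γ.side e c then min 1 (lensRadius x t) else 1)
    _ _ _ hx ht).trans (if_pos ⟨c, rfl⟩)

theorem lensDist_of_ne {h : Γ.H} (hh : ∀ c, h ≠ Γ.side e c) {x t : ℝ} (hx : x ∈ Set.Icc (0 : ℝ) 1)
    (ht : 0 ≤ t) : O.lensDist e hΓ (O.stp h x t) = 1 := by
  classical
  exact (stripDesc_stp _ _ (fun h x t => if ∃ c, h = Γ.side e c then min 1 (lensRadius x t) else 1)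
    _ _ _ hx ht).trans (if_neg fun ⟨c, hc⟩ => hh c hc)

theorem lensDist_midpoint : O.lensDist e hΓ (O.midpoint e) = 0 := by
  refine (O.lensDist_side e hΓ false (x := 1 / 2) (t := 0)
    ⟨by norm_num, by norm_num⟩ le_rfl).trans ?_
  norm_num [lensRadius]

theorem lensDist_nonneg (p : O.Surface) : 0 ≤ O.lensDist e hΓ p := by
  obtain ⟨h, x, t, hx, ht, rfl⟩ := O.exists_stp hΓ p
  by_cases hh : ∀ c, h ≠ Γ.side e c
  · rw [lensDist_of_ne _ _ _ hh hx ht]; exact zero_le_one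
  · push Not at hh
    obtain ⟨c, rfl⟩ := hh
    rw [lensDist_side _ _ _ _ hx ht, lensRadius]
    positivity

variable [Subsingleton Γ.V]

/-- The map from the surface of the doubled graph to the original surface: the two strips between
the copies of `e` are mapped to a lens around `e`, with the puncture of the disk at its centre. -/
def fill : (O.double e).Surface → O.Surface :=
  (O.double e).stripDesc (Graph.root_surjective_double hΓ) (fun h x t => O.fillStrip e h x t)
    (by
      rintro (h | c) t
      · change O.stp h 1 (t + lens e h 1) =
          O.fillStrip e ((O.double e).boundaryNext (Graph.outer e h)) 0 t
        rw [boundaryNext_outer]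
        change _ = O.stp (O.boundaryNext h) 0 (t + lens e _ 0)
        rw [lens_one, lens_zero, stp_one]
      · change O.stp (Γ.side e c) (1 / 2 + (1 / 2 - 1) / (1 + t))
          ((1 / 2 - |1 - 1 / 2|) / (1 + t)) =
          O.fillStrip e ((O.double e).boundaryNext (Graph.inner e c)) 0 t
        rw [boundaryNext_inner]
        change _ = O.stp (Γ.side e (!c)) (1 / 2 + (1 / 2 - 0) / (1 + t))
          ((1 / 2 - |0 - 1 / 2|) / (1 + t))
        have h1 : (1 / 2 - |(1 : ℝ) - 1 / 2|) / (1 + t) = 0 := by norm_num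
        have h2 : (1 / 2 - |(0 : ℝ) - 1 / 2|) / (1 + t) = 0 := by norm_num
        rw [h1, h2, ← Graph.flip_side, ← stp_flip _ le_rfl]
        congr 1; ring)
    (by
      rintro (h | c) x
      · by_cases hh : ∀ c, h ≠ Γ.side e c
        · change O.fillStrip e ((Γ.double e).flip (Graph.outer e h)) (σ x) (0 : ℝ≥0) =
            O.stp h x ((0 : ℝ≥0) + lens e h x)
          rw [Graph.flip_outer_of_ne hh, unitInterval.coe_symm_eq]
          change O.stp (Γ.flip h) (1 - x) ((0 : ℝ≥0) + lens e _ _) = _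
          rw [lens_flip, lens_of_ne hh, stp_flip _ (by simp)]
        · push Not at hh
          obtain ⟨c, rfl⟩ := hh
          change O.fillStrip e ((Γ.double e).flip (Graph.outer e (Γ.side e c))) (σ x) (0 : ℝ≥0) =
            O.stp (Γ.side e c) x ((0 : ℝ≥0) + lens e _ x)
          rw [Graph.flip_outer_side, unitInterval.coe_symm_eq, lens_side]
          change O.stp (Γ.side e c) (1 / 2 + (1 / 2 - (1 - x)) / (1 + (0 : ℝ≥0)))
            ((1 / 2 - |1 - (x : ℝ) - 1 / 2|) / (1 + (0 : ℝ≥0))) = _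
          rw [abs_half, NNReal.coe_zero, add_zero, div_one, div_one, zero_add]
          congr 1; ring
      · change O.fillStrip e ((Γ.double e).flip (Graph.inner e c)) (σ x) (0 : ℝ≥0) =
          O.stp (Γ.side e c) (1 / 2 + (1 / 2 - x) / (1 + (0 : ℝ≥0)))
            ((1 / 2 - |(x : ℝ) - 1 / 2|) / (1 + (0 : ℝ≥0)))
        rw [Graph.flip_inner, unitInterval.coe_symm_eq]
        change O.stp (Γ.side e c) (1 - x) ((0 : ℝ≥0) + lens e _ _) = _
        rw [lens_side, abs_half, NNReal.coe_zero, add_zero, div_one, div_one, zero_add]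
        congr 1; ring)

theorem fill_outer (h : Γ.H) {x t : ℝ} (hx : x ∈ Set.Icc (0 : ℝ) 1) (ht : 0 ≤ t) :
    O.fill e hΓ ((O.double e).stp (Graph.outer e h) x t) = O.stp h x (t + lens e h x) :=
  (O.double e).stripDesc_stp (Graph.root_surjective_double hΓ) (fun h x t => O.fillStrip e h x t)
    _ _ (Graph.outer e h) hx ht

theorem fill_inner (c : Bool) {x t : ℝ} (hx : x ∈ Set.Icc (0 : ℝ) 1) (ht : 0 ≤ t) :
    O.fill e hΓ ((O.double e).stp (Graph.inner e c) x t) =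
      O.stp (Γ.side e c) (1 / 2 + (1 / 2 - x) / (1 + t)) ((1 / 2 - |x - 1 / 2|) / (1 + t)) :=
  (O.double e).stripDesc_stp (Graph.root_surjective_double hΓ) (fun h x t => O.fillStrip e h x t)
    _ _ (Graph.inner e c) hx ht

theorem double_cases (hΓ : Function.Surjective Γ.root) (p : (O.double e).Surface) :
    (∃ h x t, x ∈ Set.Icc (0 : ℝ) 1 ∧ 0 ≤ t ∧ p = (O.double e).stp (Graph.outer e h) x t) ∨
      ∃ c x t, x ∈ Set.Icc (0 : ℝ) 1 ∧ 0 ≤ t ∧ p = (O.double e).stp (Graph.inner e c) x t := by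
  obtain ⟨h | c, x, t, hp⟩ := (O.double e).exists_stp (Graph.root_surjective_double hΓ) p
  · exact Or.inl ⟨h, x, t, hp⟩
  · exact Or.inr ⟨c, x, t, hp⟩

theorem continuous_fill : Continuous (O.fill e hΓ) := by
  refine continuous_surface_iff.2 ?_
  rintro (h | c)
  · exact (O.continuous_stp h).comp (f := fun p : I × ℝ≥0 => ((p.1 : ℝ), (p.2 : ℝ) + lens e h p.1))
      (by have := continuous_lens e h; fun_prop)
  · refine (O.continuous_stp (Γ.side e c)).comp (f := fun p : I × ℝ≥0 =>
      (1 / 2 + (1 / 2 - (p.1 : ℝ)) / (1 + p.2), (1 / 2 - |(p.1 : ℝ) - 1 / 2|) / (1 + p.2))) ?_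
    have h1 : ∀ p : I × ℝ≥0, (1 : ℝ) + p.2 ≠ 0 := fun p => by positivity
    fun_prop (disch := exact h1 _)

open Classical in
/-- On the strips, the inverse of the map from the surface of the doubled graph. -/
def emptyStrip (h : Γ.H) (x t : ℝ) : (O.double e).Surface :=
  if lens e h x ≤ t then (O.double e).stp (Graph.outer e h) x (t - lens e h x) else
    (O.double e).stp (Graph.inner e (decide (h = Γ.flip e)))
      ((t + |x - 1 / 2| + 1 / 2 - x) / lensRadius x t) (1 / lensRadius x t - 1)

variable {e} in
theorem emptyStrip_side (c : Bool) (x t : ℝ) : O.emptyStrip e (Γ.side e c) x t =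
    if 1 / 2 - |x - 1 / 2| ≤ t then
      (O.double e).stp (Graph.outer e (Γ.side e c)) x (t - (1 / 2 - |x - 1 / 2|)) else
    (O.double e).stp (Graph.inner e c)
      ((t + |x - 1 / 2| + 1 / 2 - x) / lensRadius x t) (1 / lensRadius x t - 1) := by
  classical
  have h1 : decide (Γ.side e c = Γ.flip e) = c := by
    cases c
    · exact decide_eq_false (Γ.flip_ne e).symm
    · exact decide_eq_true rfl
  rw [emptyStrip, lens_side, h1]

variable {e} in
theorem emptyStrip_of_ne {h : Γ.H} (hh : ∀ c, h ≠ Γ.side e c) (x : ℝ) {t : ℝ} (ht : 0 ≤ t) :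
    O.emptyStrip e h x t = (O.double e).stp (Graph.outer e h) x t := by
  rw [emptyStrip, lens_of_ne hh, if_pos ht, sub_zero]

theorem emptyStrip_of_le {h : Γ.H} {x t : ℝ} (hx : lens e h x ≤ t) :
    O.emptyStrip e h x t = (O.double e).stp (Graph.outer e h) x (t - lens e h x) := if_pos hx

/-- The definitions of the inverse map on the two strips along an edge agree on the edge. -/
theorem emptyStrip_bottom_side (c : Bool) {x : ℝ} (hx : x ∈ Set.Icc (0 : ℝ) (1 / 2)) :
    O.emptyStrip e (Γ.side e (!c)) (1 - x) 0 = O.emptyStrip e (Γ.side e c) x 0 := by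
  have hab : |x - 1 / 2| = 1 / 2 - x := by
    rw [abs_of_nonpos (by linarith [hx.2])]; ring
  rcases hx.1.eq_or_lt with rfl | h0
  · rw [emptyStrip_of_le _ _ (by rw [sub_zero, lens_one]), emptyStrip_of_le _ _ (lens_zero e _).le,
      lens_zero, sub_zero, lens_one, sub_zero]
    exact (O.double e).stp_eq_of_vertex (h := Graph.outer e _) (Or.inr rfl) (Or.inl rfl)
  rw [emptyStrip_side, emptyStrip_side, lensRadius, lensRadius, abs_half, hab,
    if_neg (by linarith), if_neg (by linarith)]
  rcases hx.2.eq_or_lt with rfl | h1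
  · -- at the centre of the lens, the junk value of the division gives a vertex on both sides
    have h2 : (1 : ℝ) / (2 * (1 / 2 - 1 / 2) + 2 * 0) - 1 ≤ 0 := by norm_num
    have h3 : ∀ k y, (O.double e).stp k y (1 / (2 * (1 / 2 - 1 / 2) + 2 * 0) - 1) =
        (O.double e).stp k y 0 := fun k y => by
      rw [stp, Real.toNNReal_of_nonpos h2, stp, Real.toNNReal_zero]
    rw [h3, h3]
    exact (O.double e).stp_eq_of_vertex (by norm_num) (by norm_num)
  · have h2 : (0 + (1 / 2 - x) + 1 / 2 - x) / (2 * (1 / 2 - x) + 2 * 0) = 1 := by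
      rw [div_eq_one_iff_eq (by linarith)]; ring
    have h3 : (0 + (1 / 2 - x) + 1 / 2 - (1 - x)) / (2 * (1 / 2 - x) + 2 * 0) = 0 := by
      rw [div_eq_zero_iff]; left; ring
    rw [h2, h3, stp_one, boundaryNext_inner]

/-- The inverse of the map from the surface of the doubled graph, with a junk value at the
centre of the lens. -/
def empty : O.Surface → (O.double e).Surface :=
  O.stripDesc hΓ (fun h x t => O.emptyStrip e h x t)
    (fun h t => by
      rw [Set.Icc.coe_one, Set.Icc.coe_zero, emptyStrip_of_le _ _ (by simp [lens_one]),
        emptyStrip_of_le _ _ (by simp [lens_zero]), lens_one, lens_zero, stp_one,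
        boundaryNext_outer])
    (fun h x => by
      rw [unitInterval.coe_symm_eq, NNReal.coe_zero]
      by_cases hh : ∀ c, h ≠ Γ.side e c
      · rw [emptyStrip_of_ne _ (Graph.flip_ne_side hh) _ le_rfl, emptyStrip_of_ne _ hh _ le_rfl,
          ← Graph.flip_outer_of_ne hh, stp_flip _ le_rfl]
      · push Not at hh
        obtain ⟨c, rfl⟩ := hh
        rw [Graph.flip_side]
        rcases le_total (x : ℝ) (1 / 2) with hx | hx
        · exact O.emptyStrip_bottom_side e c ⟨x.2.1, hx⟩
        · have h1 := O.emptyStrip_bottom_side e (!c) (x := 1 - x) ⟨by linarith [x.2.2], by linarith⟩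
          rw [Bool.not_not, sub_sub_cancel] at h1
          exact h1.symm)

theorem empty_stp (h : Γ.H) {x t : ℝ} (hx : x ∈ Set.Icc (0 : ℝ) 1) (ht : 0 ≤ t) :
    O.empty e hΓ (O.stp h x t) = O.emptyStrip e h x t :=
  stripDesc_stp _ _ (O.emptyStrip e) _ _ _ hx ht

theorem empty_fill (p : (O.double e).Surface) : O.empty e hΓ (O.fill e hΓ p) = p := by
  rcases O.double_cases e hΓ p with ⟨h, x, t, hx, ht, rfl⟩ | ⟨c, x, t, hx, ht, rfl⟩
  · rw [fill_outer _ _ _ _ hx ht, empty_stp _ _ _ _ hx (add_nonneg ht (lens_nonneg e h hx)),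
      emptyStrip_of_le _ _ (by linarith), add_sub_cancel_right]
  · have ht1 : 0 < 1 + t := by linarith
    have habs : |x - 1 / 2| ≤ 1 / 2 := by
      rw [abs_le]; exact ⟨by linarith [hx.1], by linarith [hx.2]⟩
    have h1 : |1 / 2 + (1 / 2 - x) / (1 + t) - 1 / 2| = |x - 1 / 2| / (1 + t) := by
      rw [add_sub_cancel_left, abs_div, abs_of_pos ht1, abs_sub_comm]
    have hT : 0 ≤ (1 / 2 - |x - 1 / 2|) / (1 + t) := div_nonneg (by linarith) ht1.le
    have hX : 1 / 2 + (1 / 2 - x) / (1 + t) ∈ Set.Icc (0 : ℝ) 1 := by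
      have h2 : |1 / 2 + (1 / 2 - x) / (1 + t) - 1 / 2| ≤ 1 / 2 := by
        rw [h1, div_le_iff₀ ht1]
        linarith
      rw [abs_le] at h2
      exact ⟨by linarith, by linarith⟩
    rw [fill_inner _ _ _ _ hx ht, empty_stp _ _ _ _ hX hT, emptyStrip_side]
    rcases ht.eq_or_lt with rfl | ht0
    · have h2 : 1 / 2 + (1 / 2 - x) / (1 + 0) = 1 - x := by ring
      rw [h2, abs_half, add_zero, div_one, if_pos le_rfl, sub_self, ← Graph.flip_inner,
        stp_flip _ le_rfl]
    · have h2 : lensRadius (1 / 2 + (1 / 2 - x) / (1 + t)) ((1 / 2 - |x - 1 / 2|) / (1 + t)) =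
          1 / (1 + t) := by
        rw [lensRadius, h1]; field_simp; ring
      rw [if_neg, h2, h1, one_div_one_div, add_sub_cancel_left]
      · congr 1
        field_simp; ring
      · rw [h1, not_le, ← sub_pos]
        have : 1 / 2 - |x - 1 / 2| / (1 + t) - (1 / 2 - |x - 1 / 2|) / (1 + t) =
            1 / 2 * (t / (1 + t)) := by
          field_simp; ring
        rw [this]
        positivity

theorem fill_empty {p : O.Surface} (hp : p ≠ O.midpoint e) :
    O.fill e hΓ (O.empty e hΓ p) = p := by
  obtain ⟨h, x, t, hx, ht, rfl⟩ := O.exists_stp hΓ p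
  rw [empty_stp _ _ _ _ hx ht]
  by_cases hl : lens e h x ≤ t
  · rw [emptyStrip_of_le _ _ hl, fill_outer _ _ _ _ hx (sub_nonneg.2 hl), sub_add_cancel]
  by_cases hh : ∀ c, h ≠ Γ.side e c
  · rw [lens_of_ne hh] at hl
    exact absurd ht hl
  push Not at hh
  obtain ⟨c, rfl⟩ := hh
  rw [lens_side] at hl
  rw [emptyStrip_side, if_neg hl]
  push Not at hl
  have hN : 0 < lensRadius x t := by
    rcases (abs_nonneg (x - 1 / 2)).eq_or_lt with h1 | h1
    · rcases ht.eq_or_lt with rfl | h2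
      · have : x = 1 / 2 := sub_eq_zero.1 (abs_eq_zero.1 h1.symm)
        subst this
        exact absurd (O.stp_side_half e c) hp
      · rw [lensRadius]; linarith
    · rw [lensRadius]; linarith
  have hN1 : lensRadius x t ≤ 1 := by rw [lensRadius]; linarith
  have ha1 := le_abs_self (x - 1 / 2)
  have ha2 := neg_abs_le (x - 1 / 2)
  have hX : (t + |x - 1 / 2| + 1 / 2 - x) / lensRadius x t ∈ Set.Icc (0 : ℝ) 1 := by
    refine ⟨div_nonneg (by linarith) hN.le, (div_le_one hN).2 ?_⟩
    rw [lensRadius]; linarith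
  have hT : 0 ≤ 1 / lensRadius x t - 1 := sub_nonneg.2 ((one_le_div hN).2 hN1)
  rw [fill_inner _ _ _ _ hX hT, add_sub_cancel, div_div_eq_mul_div, div_div_eq_mul_div, div_one,
    div_one]
  have h2 : (t + |x - 1 / 2| + 1 / 2 - x) / lensRadius x t - 1 / 2 =
      (1 / 2 - x) / lensRadius x t := by
    rw [div_sub' hN.ne']
    congr 1
    rw [lensRadius]; ring
  have h3 : (1 / 2 - (t + |x - 1 / 2| + 1 / 2 - x) / lensRadius x t) * lensRadius x t =
      x - 1 / 2 := by
    rw [← neg_sub, h2, neg_mul, div_mul_cancel₀ _ hN.ne']; ring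
  rw [h3, h2, abs_div, abs_of_pos hN, abs_sub_comm, sub_mul, div_mul_cancel₀ _ hN.ne', lensRadius]
  congr 1 <;> ring

theorem lensDist_fill_outer (h : Γ.H) {x t : ℝ} (hx : x ∈ Set.Icc (0 : ℝ) 1) (ht : 0 ≤ t) :
    O.lensDist e hΓ (O.fill e hΓ ((O.double e).stp (Graph.outer e h) x t)) = 1 := by
  have h1 := add_nonneg ht (lens_nonneg e h hx)
  rw [fill_outer _ _ _ _ hx ht]
  by_cases hh : ∀ c, h ≠ Γ.side e c
  · rw [lensDist_of_ne _ _ _ hh hx h1]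
  · push Not at hh
    obtain ⟨c, rfl⟩ := hh
    rw [lensDist_side _ _ _ _ hx h1, lensRadius, lens_side]
    exact min_eq_left (by linarith)

theorem lensDist_fill_inner (c : Bool) {x t : ℝ} (hx : x ∈ Set.Icc (0 : ℝ) 1) (ht : 0 ≤ t) :
    O.lensDist e hΓ (O.fill e hΓ ((O.double e).stp (Graph.inner e c) x t)) = 1 / (1 + t) := by
  have ht1 : 0 < 1 + t := by linarith
  have habs : |x - 1 / 2| ≤ 1 / 2 := by
    rw [abs_le]; exact ⟨by linarith [hx.1], by linarith [hx.2]⟩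
  have h1 : |1 / 2 + (1 / 2 - x) / (1 + t) - 1 / 2| = |x - 1 / 2| / (1 + t) := by
    rw [add_sub_cancel_left, abs_div, abs_of_pos ht1, abs_sub_comm]
  have hT : 0 ≤ (1 / 2 - |x - 1 / 2|) / (1 + t) := div_nonneg (by linarith) ht1.le
  have hX : 1 / 2 + (1 / 2 - x) / (1 + t) ∈ Set.Icc (0 : ℝ) 1 := by
    have h2 : |1 / 2 + (1 / 2 - x) / (1 + t) - 1 / 2| ≤ 1 / 2 := by
      rw [h1, div_le_iff₀ ht1]
      linarith
    rw [abs_le] at h2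
    exact ⟨by linarith, by linarith⟩
  have h2 : lensRadius (1 / 2 + (1 / 2 - x) / (1 + t)) ((1 / 2 - |x - 1 / 2|) / (1 + t)) =
      1 / (1 + t) := by
    rw [lensRadius, h1]; field_simp; ring
  rw [fill_inner _ _ _ _ hx ht, lensDist_side _ _ _ _ hX hT, h2]
  exact min_eq_right ((div_le_one ht1).2 (by linarith))

/-- The surface of a ribbon graph with one vertex, minus the midpoint of an edge, is again the
surface of a ribbon graph. -/
theorem isOpenEmbedding_fill [Finite Γ.H] : Topology.IsOpenEmbedding (O.fill e hΓ) ∧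
    Set.range (O.fill e hΓ) = {O.midpoint e}ᶜ := by
  have := O.t2Space_surface hΓ
  have := O.weaklyLocallyCompactSpace_surface hΓ
  have hd : ∀ p, 0 < O.lensDist e hΓ (O.fill e hΓ p) := fun p => by
    rcases O.double_cases e hΓ p with ⟨h, x, t, hx, ht, rfl⟩ | ⟨c, x, t, hx, ht, rfl⟩
    · exact (O.lensDist_fill_outer e hΓ h hx ht).symm ▸ zero_lt_one
    · exact (O.lensDist_fill_inner e hΓ c hx ht).symm ▸ by positivity
  have hmem : ∀ p, O.fill e hΓ p ∈ ({O.midpoint e}ᶜ : Set O.Surface) := fun p h1 => by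
    have h2 := hd p
    rw [h1, lensDist_midpoint] at h2
    exact lt_irrefl _ h2
  have hopen : IsOpen ({O.midpoint e}ᶜ : Set O.Surface) := isOpen_compl_singleton
  have hd' : ∀ z : ({O.midpoint e}ᶜ : Set O.Surface), O.lensDist e hΓ z ≠ 0 := fun z => by
    have := hd (O.empty e hΓ z)
    rw [fill_empty _ _ _ z.2] at this
    exact this.ne'
  have := hopen.locallyCompactSpace
  have hf : IsHomeomorph fun p => (⟨O.fill e hΓ p, hmem p⟩ :
      ({O.midpoint e}ᶜ : Set O.Surface)) := by
    refine (O.double e).isHomeomorph_of_height (Graph.root_surjective_double hΓ)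
      ((O.continuous_fill e hΓ).subtype_mk _) ⟨fun p q h => ?_, fun z => ?_⟩
      -- heights in the new punctured disk are bounded by the inverse distance from the midpoint
      (r := fun z => (O.height (z : O.Surface) : ℝ) + 1 / O.lensDist e hΓ z) ?_ fun p => ?_
    · have h1 := congrArg (O.empty e hΓ) (congrArg Subtype.val h)
      rwa [empty_fill, empty_fill] at h1
    · exact ⟨O.empty e hΓ z, Subtype.ext (O.fill_empty e hΓ z.2)⟩
    · exact (NNReal.continuous_coe.comp (O.continuous_height.comp continuous_subtype_val)).add
        (continuous_const.div ((O.continuous_lensDist e hΓ).comp continuous_subtype_val) hd')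
    · rcases O.double_cases e hΓ p with ⟨h, x, t, hx, ht, rfl⟩ | ⟨c, x, t, hx, ht, rfl⟩
      · have h1 : (O.height (O.fill e hΓ ((O.double e).stp (Graph.outer e h) x t)) : ℝ) =
            t + lens e h x := by
          rw [fill_outer _ _ _ _ hx ht, height_stp _ _ _ (add_nonneg ht (lens_nonneg e h hx))]
        have h2 := O.lensDist_fill_outer e hΓ h hx ht
        change ((O.double e).height _ : ℝ) ≤ (O.height (O.fill e hΓ ((O.double e).stp
          (Graph.outer e h) x t)) : ℝ) + 1 / O.lensDist e hΓ (O.fill e hΓ ((O.double e).stp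
          (Graph.outer e h) x t))
        rw [height_stp _ _ _ ht, h1]
        have := lens_nonneg e h hx
        have := one_div_nonneg.2 (O.lensDist_nonneg e hΓ
          (O.fill e hΓ ((O.double e).stp (Graph.outer e h) x t)))
        linarith
      · have h2 := O.lensDist_fill_inner e hΓ c hx ht
        change ((O.double e).height _ : ℝ) ≤ (O.height (O.fill e hΓ ((O.double e).stp
          (Graph.inner e c) x t)) : ℝ) + 1 / O.lensDist e hΓ (O.fill e hΓ ((O.double e).stp
          (Graph.inner e c) x t))
        rw [height_stp _ _ _ ht, h2, one_div_one_div]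
        linarith [NNReal.coe_nonneg
          (O.height (O.fill e hΓ ((O.double e).stp (Graph.inner e c) x t)))]
  constructor
  · exact hopen.isOpenEmbedding_subtypeVal.comp hf.isOpenEmbedding
  · ext z
    exact ⟨fun ⟨p, hp⟩ => hp ▸ hmem p, fun hz => ⟨O.empty e hΓ z, O.fill_empty e hΓ hz⟩⟩

end RibbonStructure

/-! ### Removing finitely many points -/

/-- The complement of `Q` is homeomorphic to the surface of a ribbon graph with one vertex and `m`
half edges. -/
def IsRibbonComplement {Y : Type*} [TopologicalSpace Y] (m : ℕ) (Q : Set Y) : Prop :=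
  ∃ (Γ : Graph) (O : RibbonStructure Γ), Nat.card Γ.V = 1 ∧ Nat.card Γ.H = m ∧
    ∃ j : O.Surface → Y, Topology.IsOpenEmbedding j ∧ Set.range j = Qᶜ

theorem range_comp_eq_compl {X Y Z : Type*} {i : Y → Z} {j : X → Y} {P Q : Set Z} (hPQ : P ⊆ Q)
    (hi : Set.range i = Pᶜ) (hj : Set.range j = (i ⁻¹' Q)ᶜ) : Set.range (i ∘ j) = Qᶜ := by
  rw [Set.range_comp, hj, ← Set.preimage_compl, Set.image_preimage_eq_inter_range, hi,
    Set.inter_eq_left, Set.compl_subset_compl]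
  exact hPQ

theorem ncard_preimage_of_range {Y Z : Type*} {i : Y → Z} (hinj : Function.Injective i)
    {P Q : Set Z}
    (hi : Set.range i = Pᶜ) : (i ⁻¹' Q).ncard = (Q \ P).ncard := by
  rw [← Set.ncard_image_of_injective _ hinj, Set.image_preimage_eq_inter_range, hi, Set.sdiff_eq]

/-- Induction on the number of points: a point is moved to the midpoint of an edge, and removed by
doubling this edge. -/
theorem IsConnectedSurface.isRibbonComplement (s : ℕ) : ∀ {Γ : Graph} (O : RibbonStructure Γ),
    Nat.card Γ.V = 1 → 0 < Nat.card Γ.H → IsConnectedSurface O.Surface →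
    ∀ Q : Set O.Surface, Q.Finite → Q.ncard = s →
      IsRibbonComplement (Nat.card Γ.H + 2 * s) Q := by
  induction s with
  | zero =>
    intro Γ O hV hH hS Q hQ hs
    rw [Set.ncard_eq_zero hQ] at hs
    subst hs
    exact ⟨Γ, O, hV, rfl, id, Topology.IsOpenEmbedding.id, by simp⟩
  | succ s ih =>
    intro Γ O hV hH hS Q hQ hs
    obtain ⟨⟨e⟩, hfin⟩ := Nat.card_pos_iff.1 hH
    have := (Nat.card_eq_one_iff_unique.1 hV).1
    have hΓ := RibbonStructure.root_surjective_of_subsingleton e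
    obtain ⟨h1, h2⟩ := O.isOpenEmbedding_fill e hΓ
    -- move a point of `Q` to the midpoint of the edge, fixing the other points of `Q`
    obtain ⟨A, hA⟩ : ∃ A : O.Surface ≃ₜ O.Surface, O.midpoint e ∈ A '' Q := by
      by_cases hm : O.midpoint e ∈ Q
      · exact ⟨Homeomorph.refl _, O.midpoint e, hm, rfl⟩
      · obtain ⟨q, hq⟩ := Set.nonempty_of_ncard_ne_zero (s := Q) (by omega)
        obtain ⟨A, hA, -⟩ := hS.exists_homeomorph (F := Q \ {q}) hQ.sdiff (x := q)
          (y := O.midpoint e) (fun h => h.2 rfl) fun h => hm h.1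
        exact ⟨A, q, hq, hA⟩
    have hc : (O.fill e hΓ ⁻¹' (A '' Q)).ncard = s := by
      rw [ncard_preimage_of_range h1.injective h2, Set.ncard_sdiff_singleton_of_mem hA,
        Set.ncard_image_of_injective _ A.injective, hs, Nat.add_sub_cancel]
    have hH' : Nat.card (Γ.double e).H = Nat.card Γ.H + 2 := by
      change Nat.card (Γ.H ⊕ Bool) = _
      rw [Nat.card_sum]
      simp
    obtain ⟨Γ', O', hV', hc', j, hj, hr⟩ := ih (O.double e) hV (by omega)
      (hS.of_isOpenEmbedding h1 (by rw [h2, compl_compl]; exact Set.finite_singleton _))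
      (O.fill e hΓ ⁻¹' (A '' Q)) ((hQ.image A).preimage h1.injective.injOn) hc
    refine ⟨Γ', O', hV', by omega, A.symm ∘ O.fill e hΓ ∘ j,
      A.symm.isOpenEmbedding.comp (h1.comp hj), ?_⟩
    rw [Set.range_comp, range_comp_eq_compl (Set.singleton_subset_iff.2 hA) h2 hr,
      Set.image_compl_eq A.symm.bijective, ← Set.image_comp]
    congr 1
    convert Set.image_id Q
    exact A.symm_apply_apply _

/-- The same for a space which becomes a ribbon graph surface when some of the points are removed.
-/
theorem IsConnectedSurface.isRibbonComplement_of_subset {Y : Type*} [TopologicalSpace Y]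
    {Γ : Graph} (O : RibbonStructure Γ) (hV : Nat.card Γ.V = 1) (hH : 0 < Nat.card Γ.H)
    (hS : IsConnectedSurface O.Surface) {i : O.Surface → Y} (hi : Topology.IsOpenEmbedding i)
    {P Q : Set Y} (hr : Set.range i = Pᶜ) (hPQ : P ⊆ Q) (hQ : Q.Finite) :
    IsRibbonComplement (Nat.card Γ.H + 2 * (Q \ P).ncard) Q := by
  obtain ⟨Γ', O', hV', hc', j, hj, hr'⟩ := hS.isRibbonComplement _ O hV hH (i ⁻¹' Q)
    (hQ.preimage hi.injective.injOn) rfl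
  rw [ncard_preimage_of_range hi.injective hr] at hc'
  exact ⟨Γ', O', hV', hc', i ∘ j, hi.comp hj, range_comp_eq_compl hPQ hr hr'⟩

/-! ### Genus zero -/

instance (n : ℕ) : Subsingleton (Graph.rose n).V := inferInstanceAs (Subsingleton Unit)

/-- The cyclic ordering of the rose with one petal. -/
def annulusRibbon : RibbonStructure (Graph.rose 1) where
  next := Function.Involutive.toPerm (Graph.rose 1).flip (Graph.rose 1).flip_flip
  sameCycle_iff := by
    rintro ⟨i, b⟩ ⟨j, c⟩
    refine iff_of_true ?_ rfl
    obtain rfl := Subsingleton.elim i j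
    by_cases h : b = c
    · subst h; exact Equiv.Perm.SameCycle.refl _ _
    · refine ⟨1, ?_⟩
      change ((i, !b) : Fin 1 × Bool) = (i, c)
      rw [Bool.eq_not.2 (Ne.symm h)]

theorem annulusRibbon_boundaryNext (h : (Graph.rose 1).H) : annulusRibbon.boundaryNext h = h :=
  (Graph.rose 1).flip_flip h

/-- The sign of a direction of the petal. -/
def petalSign (h : (Graph.rose 1).H) : ℝ := if h.2 = true then 1 else -1

theorem petalSign_flip (h : (Graph.rose 1).H) :
    petalSign ((Graph.rose 1).flip h) = -petalSign h := by
  obtain ⟨i, _ | _⟩ := h <;> simp [petalSign, Graph.rose]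

theorem eq_or_eq_flip (h k : (Graph.rose 1).H) : k = h ∨ k = (Graph.rose 1).flip h := by
  obtain ⟨i, b⟩ := h
  obtain ⟨j, c⟩ := k
  obtain rfl := Subsingleton.elim i j
  by_cases hbc : c = b
  · left; rw [hbc]
  · right
    change ((i, c) : Fin 1 × Bool) = (i, !b)
    rw [Bool.eq_not.2 hbc]

theorem petalSign_mul_self (h : (Graph.rose 1).H) : petalSign h * petalSign h = 1 := by
  rw [petalSign]; split_ifs <;> norm_num

/-- The punctured plane in polar coordinates on the two strips. -/
def annulusStrip (h : (Graph.rose 1).H) (x t : ℝ) : ℂ :=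
  Complex.exp (petalSign h * (t + 2 * Real.pi * x * Complex.I))

theorem annulusStrip_one (h : (Graph.rose 1).H) (t : ℝ) :
    annulusStrip h 1 t = annulusStrip h 0 t := by
  rw [annulusStrip, annulusStrip, Complex.exp_eq_exp_iff_exists_int, petalSign]
  split_ifs
  · exact ⟨1, by push_cast; ring⟩
  · exact ⟨-1, by push_cast; ring⟩

/-- The homeomorphism from the surface of the rose with one petal to the punctured plane. -/
def annulusMap : annulusRibbon.Surface → ℂ :=
  annulusRibbon.stripDesc (fun _ => ⟨((0 : Fin 1), true), rfl⟩) (fun h x t => annulusStrip h x t)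
    (fun h t => by
      rw [annulusRibbon_boundaryNext, Set.Icc.coe_one, Set.Icc.coe_zero, annulusStrip_one])
    (fun h x => by
      rw [annulusStrip, annulusStrip, Complex.exp_eq_exp_iff_exists_int, petalSign_flip,
        unitInterval.coe_symm_eq, petalSign]
      split_ifs
      · exact ⟨-1, by push_cast; ring⟩
      · exact ⟨1, by push_cast; ring⟩)

theorem annulusMap_stp (h : (Graph.rose 1).H) {x t : ℝ} (hx : x ∈ Set.Icc (0 : ℝ) 1) (ht : 0 ≤ t) :
    annulusMap (annulusRibbon.stp h x t) = annulusStrip h x t :=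
  annulusRibbon.stripDesc_stp (fun _ => ⟨((0 : Fin 1), true), rfl⟩)
    (fun h x t => annulusStrip h x t) _ _ h hx ht

theorem exists_annulus_stp (p : annulusRibbon.Surface) :
    ∃ h x t, x ∈ Set.Ico (0 : ℝ) 1 ∧ 0 ≤ t ∧ p = annulusRibbon.stp h x t := by
  obtain ⟨h, x, t, hx, ht, rfl⟩ := annulusRibbon.exists_stp
    (fun _ => ⟨((0 : Fin 1), true), rfl⟩) p
  rcases hx.2.eq_or_lt with rfl | h1
  · exact ⟨h, 0, t, by norm_num, ht, by rw [RibbonStructure.stp_one, annulusRibbon_boundaryNext]⟩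
  · exact ⟨h, x, t, ⟨hx.1, h1⟩, ht, rfl⟩

/-- The logarithm of the modulus determines the height and the strip, unless the modulus is one; on
the
unit circle, which is the petal, the points at `x` and `1 - x` of the two directed edges agree. -/
theorem annulusMap_injective : Function.Injective annulusMap := by
  intro p q hpq
  obtain ⟨h, x, t, hx, ht, rfl⟩ := exists_annulus_stp p
  obtain ⟨k, y, u, hy, hu, rfl⟩ := exists_annulus_stp q
  rw [annulusMap_stp _ ⟨hx.1, hx.2.le⟩ ht, annulusMap_stp _ ⟨hy.1, hy.2.le⟩ hu, annulusStrip,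
    annulusStrip, Complex.exp_eq_exp_iff_exists_int] at hpq
  obtain ⟨n, hn⟩ := hpq
  have hre := congrArg Complex.re hn
  have him := congrArg Complex.im hn
  simp only [Complex.mul_re, Complex.mul_im, Complex.add_re, Complex.add_im, Complex.ofReal_re,
    Complex.ofReal_im, Complex.I_re, Complex.I_im, Complex.intCast_re, Complex.intCast_im,
    Complex.re_ofNat, Complex.im_ofNat] at hre him
  have hpi := Real.pi_pos
  have hs := petalSign_mul_self h
  have him' : petalSign h * x = petalSign k * y + n := by
    have : 2 * Real.pi * (petalSign h * x) = 2 * Real.pi * (petalSign k * y + n) := by linarith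
    exact mul_left_cancel₀ (by positivity) this
  rcases eq_or_eq_flip h k with rfl | rfl
  · have h1 : t = u := by
      have : petalSign k * t = petalSign k * u := by linarith
      exact mul_left_cancel₀ (left_ne_zero_of_mul_eq_one hs) this
    have h2 : x - y = petalSign k * n := by
      linear_combination petalSign k * him' - (x - y) * hs
    have h3 : x = y := by
      have h4 : (x - y) * (x - y) = n * n := by
        rw [h2]; linear_combination (n * n : ℝ) * hs
      have h5 : (n * n : ℝ) < 1 := by
        rw [← h4, ← abs_mul_abs_self]
        have : |x - y| < 1 := abs_lt.2 ⟨by linarith [hx.1, hy.2], by linarith [hx.2, hy.1]⟩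
        nlinarith [abs_nonneg (x - y)]
      have h6 : n * n < 1 := by exact_mod_cast h5
      have h7 : n = 0 := by nlinarith
      rw [h7] at h2
      simp at h2
      linarith
    rw [h1, h3]
  · rw [petalSign_flip] at hre him'
    have h1 : t + u = 0 := by
      have : petalSign h * (t + u) = petalSign h * 0 := by linarith
      exact mul_left_cancel₀ (left_ne_zero_of_mul_eq_one hs) this
    have ht0 : t = 0 := by linarith
    have hu0 : u = 0 := by linarith
    subst ht0 hu0
    have h2 : x + y = petalSign h * n := by
      linear_combination petalSign h * him' - (x + y) * hs
    have h4 : (x + y) * (x + y) = n * n := by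
      rw [h2]; linear_combination (n * n : ℝ) * hs
    rcases (add_nonneg hx.1 hy.1).eq_or_lt with h3 | h3
    · have hx0 : x = 0 := by linarith [hx.1, hy.1]
      have hy0 : y = 0 := by linarith [hx.1, hy.1]
      exact annulusRibbon.stp_eq_of_vertex (Or.inl hx0) (Or.inl hy0)
    · have h5 : (n * n : ℝ) < 4 := by rw [← h4]; nlinarith [hx.2, hy.2]
      have h6 : 0 < (n * n : ℝ) := by rw [← h4]; positivity
      have h7 : n * n < 4 := by exact_mod_cast h5
      have h8 : 0 < n * n := by exact_mod_cast h6
      have h9 : n * n = 1 := by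
        have : n < 2 := by nlinarith
        have : -2 < n := by nlinarith
        interval_cases n <;> simp_all
      have h10 : x + y = 1 := by
        have h11 : (x + y) * (x + y) = 1 := by rw [h4]; exact_mod_cast h9
        nlinarith
      rw [show y = 1 - x by linarith, RibbonStructure.stp_flip _ le_rfl]

theorem range_annulusMap : Set.range annulusMap = {0}ᶜ := by
  ext z
  constructor
  · rintro ⟨p, rfl⟩
    obtain ⟨h, x, t, hx, ht, rfl⟩ := exists_annulus_stp p
    rw [annulusMap_stp _ ⟨hx.1, hx.2.le⟩ ht]
    exact Complex.exp_ne_zero _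
  · intro hz
    obtain ⟨h, hh⟩ : ∃ h : (Graph.rose 1).H, 0 ≤ petalSign h * Real.log ‖z‖ := by
      rcases le_total 0 (Real.log ‖z‖) with h1 | h1
      · exact ⟨((0 : Fin 1), true), by simpa [petalSign] using h1⟩
      · exact ⟨((0 : Fin 1), false), by simpa [petalSign] using h1⟩
    have hs := petalSign_mul_self h
    refine ⟨annulusRibbon.stp h (Int.fract (petalSign h * z.arg / (2 * Real.pi)))
      (petalSign h * Real.log ‖z‖), ?_⟩
    rw [annulusMap_stp _ ⟨Int.fract_nonneg _, (Int.fract_lt_one _).le⟩ hh, annulusStrip]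
    conv_rhs => rw [← Complex.exp_log hz]
    rw [Complex.exp_eq_exp_iff_exists_int]
    obtain ⟨m, hm⟩ : ∃ m : ℤ, (m : ℝ) =
        -petalSign h * ⌊petalSign h * z.arg / (2 * Real.pi)⌋ := by
      rw [petalSign]
      split_ifs
      · exact ⟨-⌊1 * z.arg / (2 * Real.pi)⌋, by push_cast; ring⟩
      · exact ⟨⌊-1 * z.arg / (2 * Real.pi)⌋, by ring⟩
    refine ⟨m, ?_⟩
    have hpi := Real.pi_ne_zero
    have hfr := (Int.self_sub_floor (petalSign h * z.arg / (2 * Real.pi))).symm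
    generalize Int.fract (petalSign h * z.arg / (2 * Real.pi)) = r at hfr
    apply Complex.ext
    · simp [Complex.log_re]
      linear_combination Real.log ‖z‖ * hs
    · simp [Complex.log_im]
      rw [hm, hfr]
      field_simp
      linear_combination z.arg * hs

theorem continuous_annulusMap : Continuous annulusMap := by
  refine RibbonStructure.continuous_surface_iff.2 fun h => ?_
  change Continuous fun p : I × ℝ≥0 =>
    Complex.exp (petalSign h * (((p.2 : ℝ) : ℂ) + 2 * Real.pi * ((p.1 : ℝ) : ℂ) * Complex.I))
  fun_prop

theorem isOpenEmbedding_annulusMap : Topology.IsOpenEmbedding annulusMap := by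
  have hopen : IsOpen ({0}ᶜ : Set ℂ) := isOpen_compl_singleton
  have := hopen.locallyCompactSpace
  have : Finite (Graph.rose 1).H := inferInstanceAs (Finite (Fin 1 × Bool))
  have hmem : ∀ p, annulusMap p ∈ ({0}ᶜ : Set ℂ) := fun p => by
    rw [← range_annulusMap]; exact ⟨p, rfl⟩
  have hf : IsHomeomorph fun p => (⟨annulusMap p, hmem p⟩ : ({0}ᶜ : Set ℂ)) := by
    refine annulusRibbon.isHomeomorph_of_height (fun _ => ⟨((0 : Fin 1), true), rfl⟩)
      (continuous_annulusMap.subtype_mk _) ⟨fun p q h => ?_, fun z => ?_⟩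
      (r := fun z => |Real.log ‖(z : ℂ)‖|) ?_ fun p => ?_
    · exact annulusMap_injective (congrArg Subtype.val h)
    · obtain ⟨p, hp⟩ : (z : ℂ) ∈ Set.range annulusMap := by rw [range_annulusMap]; exact z.2
      exact ⟨p, Subtype.ext hp⟩
    · exact (Real.continuousOn_log.comp_continuous (continuous_norm.comp continuous_subtype_val)
        fun (z : ({0}ᶜ : Set ℂ)) h => (show (z : ℂ) ≠ 0 from z.2) (norm_eq_zero.1 h)).abs
    · obtain ⟨h, x, t, hx, ht, rfl⟩ := exists_annulus_stp p
      have h1 : ‖annulusStrip h x t‖ = Real.exp (petalSign h * t) := by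
        rw [annulusStrip, Complex.norm_exp]
        congr 1
        simp
      change (annulusRibbon.height _ : ℝ) ≤ |Real.log ‖annulusMap (annulusRibbon.stp h x t)‖|
      rw [RibbonStructure.height_stp _ _ _ ht, annulusMap_stp _ ⟨hx.1, hx.2.le⟩ ht, h1,
        Real.log_exp, abs_mul, abs_of_nonneg ht]
      have h2 : |petalSign h| = 1 := by rw [petalSign]; split_ifs <;> simp
      rw [h2, one_mul]
  exact hopen.isOpenEmbedding_subtypeVal.comp hf.isOpenEmbedding

theorem isConnectedSurface_complex : IsConnectedSurface ℂ where
  t2 := inferInstance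
  exists_chart _ := ⟨OpenPartialHomeomorph.refl ℂ, trivial⟩
  isPreconnected_compl _ hF := isPreconnected_compl_of_dense continuous_id Function.injective_id
    Function.surjective_id.denseRange hF

/-- Two of the points are moved to `∞` and `0` by stereographic projection; the complement of these
is
the surface of the rose with one petal. -/
theorem isRibbonComplement_sphere {P : Set (ClosedSurface 0)} (hP : P.Finite) (h2 : 2 ≤ P.ncard) :
    IsRibbonComplement (2 * (P.ncard - 1)) P := by
  obtain ⟨p, hp, q, hq, hpq⟩ := (Set.one_lt_ncard hP).1 h2
  have : Fact (Module.finrank ℝ (EuclideanSpace ℝ (Fin 3)) = 2 + 1) := ⟨by simp⟩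
  let p' : Metric.sphere (0 : EuclideanSpace ℝ (Fin 3)) 1 := p
  let i : ℂ → ClosedSurface 0 := fun z =>
    (stereographic' 2 p').symm (Complex.orthonormalBasisOneI.repr z)
  have hi : Topology.IsOpenEmbedding i :=
    ((stereographic' 2 p').symm.isOpenEmbedding (stereographic'_target p')).comp
      Complex.orthonormalBasisOneI.repr.toHomeomorph.isOpenEmbedding
  have hr : Set.range i = {p}ᶜ := by
    have h1 : Set.range ((stereographic' 2 p').symm ∘ Complex.orthonormalBasisOneI.repr) =
        {p'}ᶜ := by
      rw [Set.range_comp, Complex.orthonormalBasisOneI.repr.surjective.range_eq,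
        ← stereographic'_target p', ← OpenPartialHomeomorph.symm_source,
        OpenPartialHomeomorph.image_source_eq_target, OpenPartialHomeomorph.symm_target,
        stereographic'_source]
    exact h1
  -- the stereographic projection from `p`, translated so that `q` is mapped to the origin
  obtain ⟨w, hw⟩ : q ∈ Set.range i := by rw [hr]; exact hpq.symm
  have hS : IsConnectedSurface annulusRibbon.Surface :=
    isConnectedSurface_complex.of_isOpenEmbedding isOpenEmbedding_annulusMap
      (by rw [range_annulusMap, compl_compl]; exact Set.finite_singleton _)
  have hj := hi.comp ((Homeomorph.addRight w).isOpenEmbedding.comp isOpenEmbedding_annulusMap)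
  have hrj : Set.range (i ∘ Homeomorph.addRight w ∘ annulusMap) = ({p, q} : Set _)ᶜ := by
    refine range_comp_eq_compl (by simp) hr ?_
    rw [Set.range_comp, range_annulusMap, Set.image_compl_eq (Homeomorph.addRight w).bijective,
      Set.image_singleton]
    congr 1
    ext z
    change z = 0 + w ↔ i z ∈ ({p, q} : Set _)
    rw [zero_add]
    refine ⟨fun h => by rw [h, hw]; exact Or.inr rfl, ?_⟩
    rintro (h | h)
    · have : i z ∈ Set.range i := ⟨z, rfl⟩
      rw [hr] at this
      exact absurd h this
    · exact hi.injective (h.trans hw.symm)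
  have hH : Nat.card (Graph.rose 1).H = 2 := by
    change Nat.card (Fin 1 × Bool) = 2
    simp
  have hsub : ({p, q} : Set (ClosedSurface 0)) ⊆ P := Set.insert_subset hp (by simpa using hq)
  have h3 := hS.isRibbonComplement_of_subset annulusRibbon
    (show Nat.card Unit = 1 by simp) (by omega) hj hrj hsub hP
  rwa [Set.ncard_sdiff hsub, Set.ncard_pair hpq, hH,
    show 2 + 2 * (P.ncard - 2) = 2 * (P.ncard - 1) by omega] at h3

/-! ### The polygon model of a closed surface -/

/-- The point of the unit circle at angle `a`, where the full circle has angle `m`. -/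
def circlePt (m : ℕ) (a : ℝ) : ℂ := Complex.exp (2 * Real.pi * Complex.I * ((a / m : ℝ) : ℂ))

theorem norm_circlePt (m : ℕ) (a : ℝ) : ‖circlePt m a‖ = 1 := by
  rw [circlePt, mul_right_comm, ← Complex.ofReal_ofNat, ← Complex.ofReal_mul, ← Complex.ofReal_mul,
    Complex.norm_exp_ofReal_mul_I]

theorem continuous_circlePt (m : ℕ) : Continuous (circlePt m) := by
  unfold circlePt; fun_prop

theorem circlePt_eq_iff {m : ℕ} (hm : m ≠ 0) {a b : ℝ} :
    circlePt m a = circlePt m b ↔ ∃ n : ℤ, a = b + n * m := by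
  have hm' : (m : ℂ) ≠ 0 := Nat.cast_ne_zero.2 hm
  have hpi : (2 * Real.pi * Complex.I : ℂ) ≠ 0 := Complex.two_pi_I_ne_zero
  rw [circlePt, circlePt, Complex.exp_eq_exp_iff_exists_int]
  refine exists_congr fun n => ?_
  rw [← Complex.ofReal_inj]
  push_cast
  constructor
  · intro h
    have h1 : (a / m : ℂ) = b / m + n := by
      apply mul_left_cancel₀ hpi
      rw [h]; ring
    field_simp at h1
    linear_combination h1
  · intro h
    rw [h]
    field_simp

theorem circlePt_val {m : ℕ} [NeZero m] (j : ℕ) (a : ℝ) :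
    circlePt m ((j : ZMod m).val + a) = circlePt m (j + a) := by
  rw [circlePt_eq_iff (NeZero.ne m)]
  refine ⟨-((j / m : ℕ) : ℤ), ?_⟩
  rw [ZMod.val_natCast]
  have h := Nat.div_add_mod j m
  have h' : (m : ℝ) * (j / m : ℕ) + (j % m : ℕ) = j := by exact_mod_cast h
  rw [Int.cast_neg, Int.cast_natCast]
  linarith

/-- The residue modulo four of a side of the `4 g`-gon. -/
def sideType (g : ℕ) : ZMod (4 * g) →+* ZMod 4 := ZMod.castHom (dvd_mul_right 4 g) (ZMod 4)

/-- The side of the `4 g`-gon which is glued to the side `k`. -/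
def pairedSide (g : ℕ) (k : ZMod (4 * g)) : ZMod (4 * g) :=
  if sideType g k = 0 ∨ sideType g k = 1 then k + 2 else k - 2

theorem pairedSide_of_lt {g : ℕ} {k : ZMod (4 * g)} (h : sideType g k = 0 ∨ sideType g k = 1) :
    pairedSide g k = k + 2 := if_pos h

theorem pairedSide_of_ge {g : ℕ} {k : ZMod (4 * g)} (h : sideType g k = 2 ∨ sideType g k = 3) :
    pairedSide g k = k - 2 := by
  refine if_neg ?_
  rcases h with h | h <;> rw [h] <;> decide

theorem sideType_cases {g : ℕ} (k : ZMod (4 * g)) : (sideType g k = 0 ∨ sideType g k = 1) ∨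
    sideType g k = 2 ∨ sideType g k = 3 := by
  generalize sideType g k = c
  revert c; decide

theorem pairedSide_pairedSide {g : ℕ} (k : ZMod (4 * g)) : pairedSide g (pairedSide g k) = k := by
  rcases sideType_cases k with h | h
  · rw [pairedSide_of_lt h, pairedSide_of_ge, add_sub_cancel_right]
    rw [map_add, map_ofNat]
    rcases h with h | h <;> rw [h] <;> decide
  · rw [pairedSide_of_ge h, pairedSide_of_lt, sub_add_cancel]
    rw [map_sub, map_ofNat]
    rcases h with h | h <;> rw [h] <;> decide

theorem pairedSide_ne {g : ℕ} (k : ZMod (4 * g)) : pairedSide g k ≠ k := by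
  intro h1
  have h2 := congrArg (sideType g) h1
  rcases sideType_cases k with h | h
  · rw [pairedSide_of_lt h, map_add, map_ofNat] at h2
    revert h2; generalize sideType g k = c; revert c; decide
  · rw [pairedSide_of_ge h, map_sub, map_ofNat] at h2
    revert h2; generalize sideType g k = c; revert c; decide

theorem sideType_natCast (g j i : ℕ) : sideType g ((4 * j + i : ℕ) : ZMod (4 * g)) = i := by
  rw [map_natCast]
  push_cast
  rw [show (4 : ZMod 4) = 0 from rfl, zero_mul, zero_add]

/-- The graph dual to the sides of the `4 g`-gon: its vertex is the centre of the polygon, and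
the half edge `k` leads from the centre to the side `k`. -/
def polygonGraph (g : ℕ) : Graph where
  V := Unit
  H := ZMod (4 * g)
  flip := pairedSide g
  flip_flip := pairedSide_pairedSide
  flip_ne := pairedSide_ne
  root _ := ()

instance (g : ℕ) : Subsingleton (polygonGraph g).V := inferInstanceAs (Subsingleton Unit)

theorem root_surjective_polygonGraph (g : ℕ) : Function.Surjective (polygonGraph g).root :=
  fun _ => ⟨(0 : ZMod (4 * g)), rfl⟩

theorem sameCycle_addRight_one (m : ℕ) [NeZero m] (h k : ZMod m) :
    (Equiv.addRight (1 : ZMod m)).SameCycle h k := by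
  have h1 : ∀ (n : ℕ) (h : ZMod m), ((Equiv.addRight (1 : ZMod m)) ^ n) h = h + n := fun n => by
    induction n with
    | zero => intro h; simp
    | succ n ih => intro h; rw [pow_succ', Equiv.Perm.mul_apply, ih]; simp [add_assoc]
  refine ⟨((k - h).val : ℕ), ?_⟩
  rw [zpow_natCast, h1, ZMod.natCast_zmod_val, add_sub_cancel]

/-- The sides of the polygon in their cyclic order. -/
def polygonRibbon (g : ℕ) [NeZero g] : RibbonStructure (polygonGraph g) where
  next := (Equiv.addRight (1 : ZMod (4 * g)) : Equiv.Perm (ZMod (4 * g)))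
  sameCycle_iff h k := iff_of_true (sameCycle_addRight_one (4 * g) h k) rfl

section Corners

variable {g : ℕ}

/-- The point of the disk with radius `r` at the position `x` above the side `k`. -/
def diskPt (k : ZMod (4 * g)) (r x : ℝ) : Metric.closedBall (0 : ℂ) 1 :=
  ⟨((Set.projIcc 0 1 zero_le_one r : I) : ℝ) * circlePt (4 * g) (k.val + x), by
    rw [mem_closedBall_zero_iff, norm_mul, norm_circlePt, mul_one, Complex.norm_real,
      Real.norm_eq_abs, abs_of_nonneg (Set.projIcc 0 1 zero_le_one r).2.1]
    exact (Set.projIcc 0 1 zero_le_one r).2.2⟩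

theorem continuous_diskPt (k : ZMod (4 * g)) : Continuous fun p : ℝ × ℝ => diskPt k p.1 p.2 := by
  refine Continuous.subtype_mk ?_ _
  exact (Complex.continuous_ofReal.comp (continuous_subtype_val.comp
    (continuous_projIcc.comp continuous_fst))).mul
      ((continuous_circlePt _).comp (by fun_prop))

theorem coe_diskPt (k : ZMod (4 * g)) {r : ℝ} (hr : r ∈ Set.Icc (0 : ℝ) 1) (x : ℝ) :
    (diskPt k r x : ℂ) = r * circlePt (4 * g) (k.val + x) := by
  change (((Set.projIcc 0 1 zero_le_one r : I) : ℝ) : ℂ) * _ = _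
  rw [RibbonStructure.coe_projIcc_unit hr]

theorem diskPt_zero (k k' : ZMod (4 * g)) (x x' : ℝ) : diskPt k 0 x = diskPt k' 0 x' := by
  refine Subtype.ext ?_
  rw [coe_diskPt k ⟨le_rfl, zero_le_one⟩, coe_diskPt k' ⟨le_rfl, zero_le_one⟩, Complex.ofReal_zero,
    zero_mul, zero_mul]

theorem norm_diskPt (k : ZMod (4 * g)) {r : ℝ} (hr : r ∈ Set.Icc (0 : ℝ) 1) (x : ℝ) :
    ‖(diskPt k r x : ℂ)‖ = r := by
  rw [coe_diskPt k hr, norm_mul, norm_circlePt, mul_one, Complex.norm_real, Real.norm_eq_abs,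
    abs_of_nonneg hr.1]

variable [NeZero g]

theorem diskPt_one_natCast (j : ℕ) (x : ℝ) :
    (diskPt (j : ZMod (4 * g)) 1 x : ℂ) = circlePt (4 * g) (j + x) := by
  rw [coe_diskPt _ ⟨zero_le_one, le_rfl⟩, circlePt_val, Complex.ofReal_one, one_mul]

theorem diskPt_succ (k : ZMod (4 * g)) (r : ℝ) : diskPt (k + 1) r 0 = diskPt k r 1 := by
  refine Subtype.ext ?_
  have h := circlePt_val (m := 4 * g) (k.val + 1) 0
  rw [Nat.cast_add, ZMod.natCast_zmod_val, Nat.cast_one] at h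
  have h2 : ((k.val + 1 : ℕ) : ℝ) + 0 = k.val + 1 := by push_cast; ring
  rw [h2] at h
  exact congrArg (fun w => (((Set.projIcc 0 1 zero_le_one r : I) : ℝ) : ℂ) * w) h

/-- The projection from the disk to the closed surface. -/
def polygonProj (g : ℕ) (z : Metric.closedBall (0 : ℂ) 1) : Quot (SidePairing g) := Quot.mk _ z

/-- The side pairing in terms of the involution `pairedSide`. -/
theorem polygonProj_paired (k : ZMod (4 * g)) {x : ℝ} (hx : x ∈ Set.Icc (0 : ℝ) 1) :
    polygonProj g (diskPt (pairedSide g k) 1 (1 - x)) = polygonProj g (diskPt k 1 x) := by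
  have key : ∀ (j : ℕ) (hj : j < g) (x : I),
      polygonProj g (diskPt ((4 * j : ℕ) : ZMod (4 * g)) 1 x) =
        polygonProj g (diskPt ((4 * j + 2 : ℕ) : ZMod (4 * g)) 1 (1 - x)) ∧
      polygonProj g (diskPt ((4 * j + 1 : ℕ) : ZMod (4 * g)) 1 x) =
        polygonProj g (diskPt ((4 * j + 3 : ℕ) : ZMod (4 * g)) 1 (1 - x)) := fun j hj x =>
    ⟨Quot.sound (SidePairing.a _ _ j hj x (diskPt_one_natCast _ _) (diskPt_one_natCast _ _)),
      Quot.sound (SidePairing.b _ _ j hj x (diskPt_one_natCast _ _) (diskPt_one_natCast _ _))⟩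
  have hk := ZMod.natCast_zmod_val k
  have hlt := ZMod.val_lt k
  have hdiv := Nat.div_add_mod k.val 4
  have hmod := Nat.mod_lt k.val (show 0 < 4 by norm_num)
  set j := k.val / 4
  have hj : j < g := by omega
  have hσ : 1 - x ∈ Set.Icc (0 : ℝ) 1 := ⟨by linarith [hx.2], by linarith [hx.1]⟩
  obtain ⟨i, hi⟩ : ∃ i, k.val % 4 = i := ⟨_, rfl⟩
  rw [hi] at hmod hdiv
  rw [← hk, ← hdiv]
  interval_cases i
  · rw [pairedSide_of_lt (Or.inl (sideType_natCast g j 0))]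
    have := (key j hj ⟨x, hx⟩).1.symm
    push_cast at this ⊢
    simpa using this
  · rw [pairedSide_of_lt (Or.inr (sideType_natCast g j 1))]
    have := (key j hj ⟨x, hx⟩).2.symm
    push_cast at this ⊢
    rw [add_assoc, show (1 + 2 : ZMod (4 * g)) = 3 by norm_num]
    exact this
  · rw [pairedSide_of_ge (Or.inl (sideType_natCast g j 2))]
    have := (key j hj ⟨1 - x, hσ⟩).1
    push_cast at this ⊢
    rw [add_sub_cancel_right]
    rwa [sub_sub_cancel] at this
  · rw [pairedSide_of_ge (Or.inr (sideType_natCast g j 3))]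
    have := (key j hj ⟨1 - x, hσ⟩).2
    push_cast at this ⊢
    rw [add_sub_assoc, show (3 - 2 : ZMod (4 * g)) = 1 by norm_num]
    rwa [sub_sub_cancel] at this

/-- All corners of the polygon are identified. -/
theorem polygonProj_corner (k : ZMod (4 * g)) :
    polygonProj g (diskPt k 1 0) = polygonProj g (diskPt (0 : ZMod (4 * g)) 1 0) := by
  have h1 : ∀ k : ZMod (4 * g),
      polygonProj g (diskPt (pairedSide g k + 1) 1 0) = polygonProj g (diskPt k 1 0) := fun k => by
    rw [diskPt_succ, ← polygonProj_paired k (x := 0) (by simp), sub_zero]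
  have h2 : ∀ k : ZMod (4 * g), sideType g k = 2 ∨ sideType g k = 3 →
      polygonProj g (diskPt (k - 1) 1 0) = polygonProj g (diskPt k 1 0) := fun k hk => by
    rw [← h1 k, pairedSide_of_ge hk, sub_add, show (2 - 1 : ZMod (4 * g)) = 1 by norm_num]
  have h3 : ∀ k : ZMod (4 * g), sideType g k = 0 ∨ sideType g k = 1 →
      polygonProj g (diskPt (k + 3) 1 0) = polygonProj g (diskPt k 1 0) := fun k hk => by
    rw [← h1 k, pairedSide_of_lt hk, add_assoc, show (2 + 1 : ZMod (4 * g)) = 3 by norm_num]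
  have hadd : ∀ (k : ZMod (4 * g)) (c : ℕ), sideType g (k + c) = sideType g k + c := fun k c => by
    rw [map_add, map_natCast]
  -- the corner at the start of `k` is the corner at the end of the side paired with `k`; this
  -- connects the corners `k` and `k + 1` in each residue class modulo four
  have h4 : ∀ k : ZMod (4 * g),
      polygonProj g (diskPt (k + 1) 1 0) = polygonProj g (diskPt k 1 0) := fun k => by
    have e1 := hadd k 1
    have e2 := hadd k 2
    have e3 := hadd k 3
    have e4 : sideType g (k - 2) = sideType g k - 2 := by rw [map_sub, map_ofNat]
    have e5 : sideType g (k - 1) = sideType g k - 1 := by rw [map_sub, map_one]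
    push_cast at e1 e2 e3
    rcases sideType_cases k with (h | h) | h | h
    · rw [h] at e1 e2 e3
      have a1 := h2 (k + 3) (Or.inr (e3.trans (by decide)))
      have a2 := h2 (k + 2) (Or.inl (e2.trans (by decide)))
      have a3 := h3 k (Or.inl h)
      rw [show k + 3 - 1 = k + 2 by ring] at a1
      rw [show k + 2 - 1 = k + 1 by ring] at a2
      rw [a2, a1, a3]
    · rw [h] at e1
      have a1 := h2 (k + 1) (Or.inl (e1.trans (by decide)))
      rw [add_sub_cancel_right] at a1
      exact a1.symm
    · rw [h] at e1
      have a1 := h2 (k + 1) (Or.inr (e1.trans (by decide)))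
      rw [add_sub_cancel_right] at a1
      exact a1.symm
    · rw [h] at e4 e5
      have a1 := h3 (k - 2) (Or.inr (e4.trans (by decide)))
      have a2 := h2 k (Or.inr h)
      have a3 := h2 (k - 1) (Or.inl (e5.trans (by decide)))
      rw [show k - 2 + 3 = k + 1 by ring] at a1
      rw [show k - 1 - 1 = k - 2 by ring] at a3
      rw [a1, a3, a2]
  have h5 : ∀ n : ℕ, polygonProj g (diskPt (n : ZMod (4 * g)) 1 0) =
      polygonProj g (diskPt (0 : ZMod (4 * g)) 1 0) := fun n => by
    induction n with
    | zero => rw [Nat.cast_zero]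
    | succ n ih => rw [Nat.cast_add, Nat.cast_one, h4, ih]
  rw [← ZMod.natCast_zmod_val k, h5]

end Corners

/-! ### The glued polygon as a one-point compactification -/

namespace RibbonStructure

theorem height_band {Γ : Graph} (O : RibbonStructure Γ) (h : Γ.H) (x y : ℝ) :
    (O.height (O.band h x y) : ℝ) = |y| := by
  rcases le_total y 0 with hy | hy
  · rw [band_of_nonpos hy, stp, height_stripPt, Real.coe_toNNReal _ (by linarith), abs_of_nonpos hy]
  · rw [band_of_nonneg hy, stp, height_stripPt, Real.coe_toNNReal _ hy, abs_of_nonneg hy]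

theorem band_zero_zero {Γ : Graph} (O : RibbonStructure Γ) (h : Γ.H) :
    O.band h 0 0 = O.incl (Γ.vertexPt (Γ.root h)) := by
  rw [band_of_nonpos le_rfl, stp, neg_zero, Real.toNNReal_zero, stripPt_bottom, Set.projIcc_left]
  exact congrArg _ (Γ.edgePt_zero h)

end RibbonStructure

section Polygon

variable {g : ℕ} [NeZero g]

theorem exists_diskPt (z : Metric.closedBall (0 : ℂ) 1) :
    ∃ (k : ZMod (4 * g)) (r x : ℝ), r ∈ Set.Icc (0 : ℝ) 1 ∧ x ∈ Set.Icc (0 : ℝ) 1 ∧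
      z = diskPt k r x := by
  have hm : (4 * g : ℕ) ≠ 0 := NeZero.ne _
  have hm' : ((4 * g : ℕ) : ℝ) ≠ 0 := Nat.cast_ne_zero.2 hm
  have hr : ‖(z : ℂ)‖ ∈ Set.Icc (0 : ℝ) 1 := ⟨norm_nonneg _, mem_closedBall_zero_iff.1 z.2⟩
  obtain ⟨a, ha⟩ : ∃ a : ℝ, a = Complex.arg z / (2 * Real.pi) * (4 * g : ℕ) := ⟨_, rfl⟩
  refine ⟨(⌊a⌋ : ZMod (4 * g)), ‖(z : ℂ)‖, Int.fract a, hr,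
    ⟨Int.fract_nonneg _, (Int.fract_lt_one _).le⟩, ?_⟩
  refine Subtype.ext ?_
  rw [coe_diskPt _ hr]
  have h1 : (((⌊a⌋ : ZMod (4 * g)).val : ℤ) : ZMod (4 * g)) = (⌊a⌋ : ZMod (4 * g)) := by
    rw [Int.cast_natCast, ZMod.natCast_zmod_val]
  rw [ZMod.intCast_eq_intCast_iff_dvd_sub] at h1
  obtain ⟨n, hn⟩ := h1
  have h2 : circlePt (4 * g) ((⌊a⌋ : ZMod (4 * g)).val + Int.fract a) = circlePt (4 * g) a := by
    rw [circlePt_eq_iff hm]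
    refine ⟨-n, ?_⟩
    have h3 : (⌊a⌋ : ℝ) - (⌊a⌋ : ZMod (4 * g)).val = (4 * g : ℕ) * n := by exact_mod_cast hn
    have h4 := Int.floor_add_fract a
    rw [Int.cast_neg]
    linarith
  rw [h2, circlePt, ha]
  have h5 : (2 * Real.pi * Complex.I *
      ((Complex.arg z / (2 * Real.pi) * (4 * g : ℕ) / (4 * g : ℕ) : ℝ) : ℂ) : ℂ) =
      Complex.arg z * Complex.I := by
    have := Complex.ofReal_ne_zero.2 Real.pi_ne_zero
    rw [mul_div_cancel_right₀ _ hm']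
    push_cast
    field_simp
  rw [h5, Complex.norm_mul_exp_arg_mul_I]

/-- Polar coordinates in the polygon are unique, except at the centre and on the segments between
adjacent sectors. -/
theorem diskPt_eq_cases {k k' : ZMod (4 * g)} {r r' x x' : ℝ} (hr : r ∈ Set.Icc (0 : ℝ) 1)
    (hr' : r' ∈ Set.Icc (0 : ℝ) 1) (hx : x ∈ Set.Icc (0 : ℝ) 1) (hx' : x' ∈ Set.Icc (0 : ℝ) 1)
    (h : diskPt k r x = diskPt k' r' x') : r = r' ∧ (r = 0 ∨ (k = k' ∧ x = x') ∨
      (k' = k + 1 ∧ x = 1 ∧ x' = 0) ∨ (k = k' + 1 ∧ x = 0 ∧ x' = 1)) := by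
  obtain rfl : r = r' := by rw [← norm_diskPt k hr x, h, norm_diskPt k' hr']
  refine ⟨rfl, or_iff_not_imp_left.2 fun h0 => ?_⟩
  have h1 := congrArg Subtype.val h
  rw [coe_diskPt k hr, coe_diskPt k' hr] at h1
  have h2 := mul_left_cancel₀ (Complex.ofReal_ne_zero.2 h0) h1
  obtain ⟨n, hn⟩ := (circlePt_eq_iff (NeZero.ne _)).1 h2
  obtain ⟨j, hj⟩ : ∃ j : ℤ, j = (k'.val : ℤ) + n * (4 * g : ℕ) - k.val := ⟨_, rfl⟩
  have hk : k' = k + (j : ZMod (4 * g)) := by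
    rw [hj]
    push_cast
    have h0 : (4 * (g : ZMod (4 * g))) = 0 := by exact_mod_cast ZMod.natCast_self (4 * g)
    rw [h0, ZMod.natCast_zmod_val, ZMod.natCast_zmod_val]
    ring
  have hj' : x = x' + j := by rw [hj]; push_cast at hn ⊢; linarith
  have hj1 : (-2 : ℝ) < j := by linarith [hx.1, hx'.2]
  have hj2 : (j : ℝ) < 2 := by linarith [hx.2, hx'.1]
  have hj3 : -2 < j := by exact_mod_cast hj1
  have hj4 : j < 2 := by exact_mod_cast hj2
  have hx1 := hx.1
  have hx2 := hx.2
  have hx3 := hx'.1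
  have hx4 := hx'.2
  interval_cases j
  · push_cast at hj' hk
    exact Or.inr (Or.inr ⟨by rw [hk]; ring, by linarith, by linarith⟩)
  · push_cast at hj' hk
    exact Or.inl ⟨by rw [hk, add_zero], by linarith⟩
  · push_cast at hj' hk
    exact Or.inr (Or.inl ⟨hk, by linarith, by linarith⟩)

/-- A function on the disk is continuous if it is continuous in polar coordinates above every
side. -/
theorem continuous_of_diskPt {Z : Type*} [TopologicalSpace Z] {f : Metric.closedBall (0 : ℂ) 1 → Z}
    (h : ∀ k : ZMod (4 * g), ContinuousOn (fun p : ℝ × ℝ => f (diskPt k p.1 p.2))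
      (Set.Icc 0 1 ×ˢ Set.Icc 0 1)) : Continuous f := by
  refine continuous_iff_isClosed.2 fun C hC => ?_
  have h1 : f ⁻¹' C = ⋃ k : ZMod (4 * g), (fun p : ℝ × ℝ => diskPt k p.1 p.2) ''
      ((Set.Icc 0 1 ×ˢ Set.Icc 0 1) ∩ (fun p : ℝ × ℝ => f (diskPt k p.1 p.2)) ⁻¹' C) := by
    ext z
    rw [Set.mem_iUnion]
    constructor
    · intro hz
      obtain ⟨k, r, x, hr, hx, rfl⟩ := exists_diskPt (g := g) z
      exact ⟨k, (r, x), ⟨⟨hr, hx⟩, hz⟩, rfl⟩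
    · rintro ⟨k, p, ⟨-, hp⟩, rfl⟩
      exact hp
  rw [h1]
  refine isClosed_iUnion_of_finite fun k => ?_
  have h2 : IsCompact (Set.Icc (0 : ℝ) 1 ×ˢ Set.Icc (0 : ℝ) 1) := isCompact_Icc.prod isCompact_Icc
  exact ((h2.of_isClosed_subset ((h k).preimage_isClosed_of_isClosed h2.isClosed hC)
    Set.inter_subset_left).image (continuous_diskPt k)).isClosed

open scoped Classical in
/-- The point of the one-point compactification of the ribbon surface that corresponds to the
point of the disk at radius `r` and position `(1 + β) / 2` above the side `k`; the corners
of the polygon correspond to the point at infinity. -/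
def bandPt (k : ZMod (4 * g)) (r β : ℝ) : OnePoint (polygonRibbon g).Surface :=
  if |β| * r = 1 then OnePoint.infty else
    ((polygonRibbon g).band k (r * (1 - |β|) / (2 * (1 - |β| * r))) (β * r / (1 - |β| * r)) :
      (polygonRibbon g).Surface)

theorem bandPt_zero (k : ZMod (4 * g)) (β : ℝ) :
    bandPt k 0 β = (((polygonRibbon g).incl ((polygonGraph g).vertexPt ()) :
      (polygonRibbon g).Surface) : OnePoint _) := by
  rw [bandPt, if_neg (by simp)]
  simp only [zero_mul, mul_zero, zero_div]
  exact congrArg _ (RibbonStructure.band_zero_zero _ _)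

theorem bandPt_next (k : ZMod (4 * g)) {r : ℝ} (hr : r ∈ Set.Icc (0 : ℝ) 1) :
    bandPt (k + 1) r (-1) = bandPt k r 1 := by
  rw [bandPt, bandPt, abs_neg, abs_one, one_mul]
  split_ifs with h
  · rfl
  · have h1 : 0 ≤ r / (1 - r) := div_nonneg hr.1 (sub_nonneg.2 hr.2)
    have h2 := (polygonRibbon g).band_next k h1
    simp only [sub_self, mul_zero, zero_div, neg_mul, one_mul, neg_div]
    exact congrArg _ h2

theorem bandPt_paired (k : ZMod (4 * g)) (β : ℝ) :
    bandPt (pairedSide g k) 1 (-β) = bandPt k 1 β := by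
  rw [bandPt, bandPt, abs_neg, mul_one]
  split_ifs with h
  · rfl
  · have h1 : 1 - |β| ≠ 0 := fun h' => h (by linarith)
    have h2 : 1 * (1 - |β|) / (2 * (1 - |β|)) = 1 / 2 := by field_simp
    rw [h2, mul_one, mul_one, neg_div]
    exact congrArg _ ((polygonRibbon g).band_flip k _)

/-- The ambiguities of the polar coordinates are respected: the centre is the vertex, and adjacent
sectors meet like consecutive bands at the vertex. -/
theorem bandPt_eq_of_diskPt_eq {k k' : ZMod (4 * g)} {r r' x x' : ℝ} (hr : r ∈ Set.Icc (0 : ℝ) 1)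
    (hr' : r' ∈ Set.Icc (0 : ℝ) 1) (hx : x ∈ Set.Icc (0 : ℝ) 1) (hx' : x' ∈ Set.Icc (0 : ℝ) 1)
    (h : diskPt k r x = diskPt k' r' x') : bandPt k r (2 * x - 1) = bandPt k' r' (2 * x' - 1) := by
  obtain ⟨rfl, rfl | ⟨rfl, rfl⟩ | ⟨rfl, rfl, rfl⟩ | ⟨rfl, rfl, rfl⟩⟩ :=
    diskPt_eq_cases hr hr' hx hx' h
  · rw [bandPt_zero, bandPt_zero]
  · rfl
  · have := bandPt_next k hr
    norm_num at this ⊢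
    exact this.symm
  · have := bandPt_next k' hr
    norm_num at this ⊢
    exact this

/-- At a corner the height tends to infinity, and away from the corners the formula is continuous.
-/
theorem continuousOn_bandPt (k : ZMod (4 * g)) :
    ContinuousOn (fun p : ℝ × ℝ => bandPt k p.1 p.2) (Set.Icc 0 1 ×ˢ Set.Icc (-1) 1) := by
  rintro ⟨r, β⟩ ⟨⟨hr0, hr1⟩, hβ⟩
  have hmul : Continuous fun p : ℝ × ℝ => |p.2| * p.1 := by fun_prop
  by_cases h : |β| * r = 1
  · have h0 : bandPt k r β = OnePoint.infty := if_pos h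
    rw [ContinuousWithinAt, h0]
    refine Filter.tendsto_def.2 fun s hs => ?_
    rw [OnePoint.nhds_infty_eq, Filter.mem_sup, Filter.mem_map, Filter.mem_pure] at hs
    obtain ⟨K, ⟨-, hK⟩, hKs⟩ := Filter.hasBasis_coclosedCompact.mem_iff.1 hs.1
    -- the height is bounded on `K`, and it equals `|β| r / (1 - |β| r)`
    obtain ⟨T, hT⟩ := (hK.image (polygonRibbon g).continuous_height).bddAbove
    have h1 : (T : ℝ) / (1 + T) < |β| * r := by
      rw [h, div_lt_one (by positivity)]
      linarith
    have h2 : ∀ᶠ p in 𝓝 (r, β), (T : ℝ) / (1 + T) < |p.2| * p.1 :=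
      hmul.continuousAt.eventually (lt_mem_nhds h1)
    filter_upwards [nhdsWithin_le_nhds h2, self_mem_nhdsWithin] with p hp hpm
    rw [Set.mem_preimage, bandPt]
    split_ifs with h3
    · exact hs.2
    · refine hKs fun h4 => ?_
      have h5 := (RibbonStructure.height_band _ _ _ _).symm.le.trans
        (NNReal.coe_le_coe.2 (hT ⟨_, h4, rfl⟩))
      have h6 : |p.2| * p.1 ≤ 1 :=
        mul_le_one₀ (abs_le.2 hpm.2) hpm.1.1 hpm.1.2
      have h7 : 0 < 1 - |p.2| * p.1 := sub_pos.2 (lt_of_le_of_ne h6 h3)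
      rw [abs_div, abs_mul, abs_of_nonneg hpm.1.1, abs_of_pos h7, div_le_iff₀ h7] at h5
      rw [div_lt_iff₀ (by positivity)] at hp
      linarith
  · refine ContinuousAt.continuousWithinAt ?_
    have h1 : ∀ᶠ p in 𝓝 (r, β), |p.2| * p.1 ≠ 1 :=
      (isOpen_ne_fun hmul continuous_const).mem_nhds h
    have h2 : 1 - |β| * r ≠ 0 := fun h' => h (by linarith)
    have h3 : ContinuousAt (fun p : ℝ × ℝ => (((polygonRibbon g).band k
        (p.1 * (1 - |p.2|) / (2 * (1 - |p.2| * p.1))) (p.2 * p.1 / (1 - |p.2| * p.1)) :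
          (polygonRibbon g).Surface) : OnePoint (polygonRibbon g).Surface)) (r, β) := by
      refine (OnePoint.continuous_coe.comp ((polygonRibbon g).continuous_band k)).continuousAt.comp
        (f := fun p : ℝ × ℝ => (p.1 * (1 - |p.2|) / (2 * (1 - |p.2| * p.1)),
          p.2 * p.1 / (1 - |p.2| * p.1))) ?_
      refine ContinuousAt.prodMk (ContinuousAt.div (by fun_prop) (by fun_prop) ?_)
        (ContinuousAt.div (by fun_prop) (by fun_prop) h2)
      exact mul_ne_zero two_ne_zero h2
    refine h3.congr (h1.mono fun p hp => ?_)
    exact (if_neg hp).symm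

/-- The map from the disk to the compactified ribbon surface. -/
def diskToBand (z : Metric.closedBall (0 : ℂ) 1) : OnePoint (polygonRibbon g).Surface :=
  bandPt (exists_diskPt (g := g) z).choose (exists_diskPt (g := g) z).choose_spec.choose
    (2 * (exists_diskPt (g := g) z).choose_spec.choose_spec.choose - 1)

theorem diskToBand_diskPt (k : ZMod (4 * g)) {r x : ℝ} (hr : r ∈ Set.Icc (0 : ℝ) 1)
    (hx : x ∈ Set.Icc (0 : ℝ) 1) : diskToBand (diskPt k r x) = bandPt k r (2 * x - 1) := by
  obtain ⟨h1, h2, h3⟩ := (exists_diskPt (g := g) (diskPt k r x)).choose_spec.choose_spec.choose_spec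
  exact (bandPt_eq_of_diskPt_eq hr h1 hx h2 h3).symm

theorem continuous_diskToBand : Continuous (diskToBand (g := g)) := by
  refine continuous_of_diskPt (g := g) fun k => ?_
  have h1 : ContinuousOn (fun p : ℝ × ℝ => bandPt k p.1 (2 * p.2 - 1))
      (Set.Icc 0 1 ×ˢ Set.Icc 0 1) :=
    (continuousOn_bandPt k).comp (f := fun p : ℝ × ℝ => (p.1, 2 * p.2 - 1))
      (by fun_prop) fun p hp => ⟨hp.1, by linarith [hp.2.1], by linarith [hp.2.2]⟩
  exact h1.congr fun p hp => diskToBand_diskPt k hp.1 hp.2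

/-- The map from the polygon with its sides glued to the compactified ribbon surface. -/
def polygonToBand : Quot (SidePairing g) → OnePoint (polygonRibbon g).Surface :=
  Quot.lift diskToBand (by
    have key : ∀ (j : ℕ) (k : ZMod (4 * g)) (x : I) (p q : Metric.closedBall (0 : ℂ) 1),
        (j : ZMod (4 * g)) = k → ∀ j' : ℕ, (j' : ZMod (4 * g)) = pairedSide g k →
        (p : ℂ) = polygonSide (4 * g) j x → (q : ℂ) = polygonSide (4 * g) j' (σ x) →
        diskToBand (g := g) p = diskToBand q := fun j k x p q hj j' hj' hp hq => by
      have hp' : p = diskPt k 1 x := Subtype.ext (by rw [hp, ← hj, diskPt_one_natCast]; rfl)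
      have hq' : q = diskPt (pairedSide g k) 1 (1 - x) :=
        Subtype.ext (by rw [hq, ← hj', diskPt_one_natCast]; rfl)
      rw [hp', hq', diskToBand_diskPt k ⟨zero_le_one, le_rfl⟩ x.2,
        diskToBand_diskPt _ ⟨zero_le_one, le_rfl⟩ ⟨by linarith [x.2.2], by linarith [x.2.1]⟩,
        ← bandPt_paired]
      congr 1
      ring
    rintro p q (⟨j, -, x, hp, hq⟩ | ⟨j, -, x, hp, hq⟩)
    · refine key (4 * j) _ x p q rfl (4 * j + 2) ?_ (by exact_mod_cast hp) (by exact_mod_cast hq)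
      rw [pairedSide_of_lt (k := ((4 * j : ℕ) : ZMod (4 * g))) (Or.inl (sideType_natCast g j 0))]
      push_cast
      ring
    · refine key (4 * j + 1) _ x p q rfl (4 * j + 3) ?_ (by exact_mod_cast hp)
        (by exact_mod_cast hq)
      rw [pairedSide_of_lt (Or.inr (by exact_mod_cast sideType_natCast g j 1))]
      push_cast
      ring)

theorem polygonToBand_proj (k : ZMod (4 * g)) {r x : ℝ} (hr : r ∈ Set.Icc (0 : ℝ) 1)
    (hx : x ∈ Set.Icc (0 : ℝ) 1) :
    polygonToBand (polygonProj g (diskPt k r x)) = bandPt k r (2 * x - 1) :=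
  diskToBand_diskPt k hr hx

theorem continuous_polygonToBand : Continuous (polygonToBand (g := g)) :=
  continuous_quot_lift _ continuous_diskToBand

/-- The inverse of the map from the glued polygon to the ribbon surface, on the ribbon surface. -/
def bandToPolygon : (polygonRibbon g).Surface → Quot (SidePairing g) :=
  (polygonRibbon g).bandDesc (root_surjective_polygonGraph g)
    (fun k ξ y => polygonProj g (diskPt (g := g) k ((2 * ξ + |y|) / (1 + |y|))
      ((1 + y / (2 * ξ + |y|)) / 2)))
    (fun k y => by
      have h1 : (0 : ℝ) < 1 + |y| := by positivity
      have h2 : (2 * (1 / 2 : ℝ) + |y|) = 1 + |y| := by ring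
      have h3 : |y / (1 + |y|)| ≤ 1 := by
        rw [abs_div, abs_of_pos h1, div_le_one h1]; linarith
      rw [abs_neg, h2, div_self h1.ne',
        ← polygonProj_paired (g := g) k (x := (1 + y / (1 + |y|)) / 2)
          ⟨by linarith [(abs_le.1 h3).1], by linarith [(abs_le.1 h3).2]⟩]
      congr 2
      ring)
    (fun k y hy => by
      rcases hy.eq_or_lt with rfl | hy
      · simp only [mul_zero, abs_zero, add_zero, neg_zero, zero_div]
        exact congrArg _ (diskPt_zero _ _ _ _)
      · rw [abs_neg, abs_of_pos hy, mul_zero, zero_add, neg_div, div_self hy.ne',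
          show (1 + (-1 : ℝ)) / 2 = 0 by norm_num, show (1 + (1 : ℝ)) / 2 = 1 by norm_num]
        exact congrArg _ (diskPt_succ (g := g) k _))

theorem bandToPolygon_band (k : ZMod (4 * g)) {ξ : ℝ} (hξ : ξ ∈ Set.Icc (0 : ℝ) (1 / 2)) (y : ℝ) :
    bandToPolygon ((polygonRibbon g).band k ξ y) = polygonProj g (diskPt (g := g) k
      ((2 * ξ + |y|) / (1 + |y|)) ((1 + y / (2 * ξ + |y|)) / 2)) :=
  RibbonStructure.bandDesc_band (O := polygonRibbon g) k hξ

theorem polygonToBand_bandToPolygon (p : (polygonRibbon g).Surface) :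
    polygonToBand (bandToPolygon p) = p := by
  obtain ⟨k, ξ, y, hξ, rfl⟩ : ∃ (k : ZMod (4 * g)) (ξ y : ℝ), ξ ∈ Set.Icc (0 : ℝ) (1 / 2) ∧
    p = (polygonRibbon g).band k ξ y :=
      (polygonRibbon g).exists_band (root_surjective_polygonGraph g) p
  have hy := abs_nonneg y
  have h1 : (0 : ℝ) < 1 + |y| := by positivity
  have hs : 0 ≤ 2 * ξ + |y| := by linarith [hξ.1]
  have hβ : |y / (2 * ξ + |y|)| ≤ 1 := by
    rw [abs_div, abs_of_nonneg hs]
    exact div_le_one_of_le₀ (by linarith [hξ.1]) hs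
  rw [bandToPolygon_band k hξ, polygonToBand_proj (g := g) k
    ⟨div_nonneg hs h1.le, (div_le_one h1).2 (by linarith [hξ.2])⟩
    ⟨by linarith [(abs_le.1 hβ).1], by linarith [(abs_le.1 hβ).2]⟩]
  rcases hs.eq_or_lt with h0 | h0
  · obtain rfl : ξ = 0 := by linarith [hξ.1]
    obtain rfl : y = 0 := abs_eq_zero.1 (by linarith)
    rw [← h0, zero_div, bandPt_zero]
    exact congrArg _ ((polygonRibbon g).band_zero_zero k).symm
  · have h2 : 2 * ((1 + y / (2 * ξ + |y|)) / 2) - 1 = y / (2 * ξ + |y|) := by ring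
    have h3 : |y| / (2 * ξ + |y|) * ((2 * ξ + |y|) / (1 + |y|)) = |y| / (1 + |y|) := by
      field_simp
    have h4 : 1 - |y| / (1 + |y|) = 1 / (1 + |y|) := by field_simp; ring
    rw [h2, bandPt, abs_div, abs_of_pos h0, h3, h4, if_neg (by
      rw [div_eq_one_iff_eq h1.ne']; linarith)]
    congr 2
    · field_simp; ring
    · field_simp

/-- The inverse of the map to the ribbon surface, with the corner as the value at infinity, undoes
the
formula in polar coordinates. -/
theorem elim_bandPt (k : ZMod (4 * g)) {r β : ℝ} (hr : r ∈ Set.Icc (0 : ℝ) 1)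
    (hβ : |β| ≤ 1) : (bandPt k r β).elim (polygonProj g (diskPt (0 : ZMod (4 * g)) 1 0))
      bandToPolygon = polygonProj g (diskPt k r ((1 + β) / 2)) := by
  have hβ0 := abs_nonneg β
  rw [bandPt]
  split_ifs with h
  · have hr1 : r = 1 := le_antisymm hr.2 (by nlinarith [hr.1])
    rw [hr1, mul_one] at h
    rw [hr1, OnePoint.elim_infty]
    rcases eq_or_eq_neg_of_abs_eq h with rfl | rfl
    · rw [show (1 + (1 : ℝ)) / 2 = 1 by norm_num, ← diskPt_succ, polygonProj_corner (k + 1)]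
    · rw [show (1 + (-1 : ℝ)) / 2 = 0 by norm_num, polygonProj_corner k]
  · have h0 : |β| * r ≤ 1 := mul_le_one₀ hβ hr.1 hr.2
    have h1 : 0 < 1 - |β| * r := sub_pos.2 (lt_of_le_of_ne h0 h)
    have hy : |β * r / (1 - |β| * r)| = |β| * r / (1 - |β| * r) := by
      rw [abs_div, abs_mul, abs_of_nonneg hr.1, abs_of_pos h1]
    have hd : 1 + |β| * r / (1 - |β| * r) = 1 / (1 - |β| * r) := by field_simp; ring
    have hs : 2 * (r * (1 - |β|) / (2 * (1 - |β| * r))) + |β| * r / (1 - |β| * r) =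
        r / (1 - |β| * r) := by field_simp; ring
    rw [OnePoint.elim_some, bandToPolygon_band k ⟨by
      have := hr.1
      have : 0 ≤ 1 - |β| := by linarith
      positivity, by
      rw [div_le_div_iff₀ (by positivity) two_pos]
      nlinarith [hr.2]⟩, hy, hs, hd]
    have h2 : r / (1 - |β| * r) / (1 / (1 - |β| * r)) = r := by
      rw [div_div_div_cancel_right₀ h1.ne', div_one]
    rw [h2]
    rcases hr.1.eq_or_lt with h3 | h3
    · rw [← h3, diskPt_zero k k]
    · have h4 : β * r / (1 - |β| * r) / (r / (1 - |β| * r)) = β := by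
        rw [div_div_div_cancel_right₀ h1.ne', mul_div_cancel_right₀ _ h3.ne']
      rw [h4]

theorem polygonToBand_injective : Function.Injective (polygonToBand (g := g)) := by
  refine Function.LeftInverse.injective (g := fun q => q.elim
    (polygonProj g (diskPt (0 : ZMod (4 * g)) 1 0)) bandToPolygon) fun q => ?_
  induction q using Quot.ind with
  | mk z =>
    obtain ⟨k, r, x, hr, hx, rfl⟩ := exists_diskPt (g := g) z
    have h1 := polygonToBand_proj k hr hx
    have h2 := elim_bandPt k (β := 2 * x - 1) hr
      (abs_le.2 ⟨by linarith [hx.1], by linarith [hx.2]⟩)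
    rw [← h1, show (1 + (2 * x - 1)) / 2 = x by ring] at h2
    exact h2

theorem polygonToBand_corner :
    polygonToBand (polygonProj g (diskPt (0 : ZMod (4 * g)) 1 0)) = OnePoint.infty := by
  rw [polygonToBand_proj _ ⟨zero_le_one, le_rfl⟩ ⟨le_rfl, zero_le_one⟩, bandPt,
      if_pos (by norm_num)]

theorem polygonToBand_surjective : Function.Surjective (polygonToBand (g := g)) := fun q => by
  induction q using OnePoint.rec with
  | infty => exact ⟨_, polygonToBand_corner⟩
  | coe p => exact ⟨_, polygonToBand_bandToPolygon p⟩

/-- The glued `4 g`-gon is the one-point compactification of the ribbon surface dual to its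
sides. -/
def polygonHomeomorph : Quot (SidePairing g) ≃ₜ OnePoint (polygonRibbon g).Surface :=
  haveI := (polygonRibbon g).t2Space_surface (root_surjective_polygonGraph g)
  haveI : Finite (polygonGraph g).H := inferInstanceAs (Finite (ZMod (4 * g)))
  haveI := (polygonRibbon g).weaklyLocallyCompactSpace_surface (root_surjective_polygonGraph g)
  haveI : CompactSpace (Metric.closedBall (0 : ℂ) 1) :=
    isCompact_iff_compactSpace.1 (isCompact_closedBall _ _)
  Continuous.homeoOfEquivCompactToT2
    (f := Equiv.ofBijective polygonToBand ⟨polygonToBand_injective, polygonToBand_surjective⟩)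
    continuous_polygonToBand

/-- The ribbon surface as the complement of the corner of the polygon. -/
def bandEmbedding (p : (polygonRibbon g).Surface) : Quot (SidePairing g) :=
  polygonHomeomorph.symm (p : OnePoint (polygonRibbon g).Surface)

theorem isOpenEmbedding_bandEmbedding : Topology.IsOpenEmbedding (bandEmbedding (g := g)) :=
  polygonHomeomorph.symm.isOpenEmbedding.comp OnePoint.isOpenEmbedding_coe

theorem range_bandEmbedding :
    Set.range (bandEmbedding (g := g)) = {polygonHomeomorph.symm OnePoint.infty}ᶜ := by
  change Set.range (polygonHomeomorph.symm ∘ (OnePoint.some (X := (polygonRibbon g).Surface))) = _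
  rw [Set.range_comp, ← OnePoint.compl_infty, Set.image_compl_eq polygonHomeomorph.symm.bijective,
    Set.image_singleton]

end Polygon

/-! ### Punctured closed surfaces of positive genus -/

section Polygon

variable {g : ℕ}

theorem norm_eq_one_of_sidePairing {p q : Metric.closedBall (0 : ℂ) 1} (h : SidePairing g p q) :
    ‖(p : ℂ)‖ = 1 ∧ ‖(q : ℂ)‖ = 1 := by
  have key : ∀ (k : ℕ) (x : I), ‖polygonSide (4 * g) k x‖ = 1 := fun k x =>
    norm_circlePt (4 * g) (k + x)
  rcases h with ⟨j, -, x, hp, hq⟩ | ⟨j, -, x, hp, hq⟩ <;> rw [hp, hq] <;> exact ⟨key _ _, key _ _⟩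

/-- The distance to the centre, as a function on the glued polygon. -/
def polygonRadius : Quot (SidePairing g) → ℝ :=
  Quot.lift (fun z => ‖(z : ℂ)‖) fun p q h => by
    rw [(norm_eq_one_of_sidePairing h).1, (norm_eq_one_of_sidePairing h).2]

/-- A function on the glued polygon from which the points of the open disk can be recovered. -/
def polygonCoord : Quot (SidePairing g) → ℂ :=
  Quot.lift (fun z => ((1 - ‖(z : ℂ)‖ : ℝ) : ℂ) * z) fun p q h => by
    rw [(norm_eq_one_of_sidePairing h).1, (norm_eq_one_of_sidePairing h).2]
    simp

/-- The projection from the disk to the glued polygon, extended to the plane. -/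
def planeProj (g : ℕ) (z : ℂ) : Quot (SidePairing g) :=
  polygonProj g ⟨((max 1 ‖z‖)⁻¹ : ℝ) * z, by
    have h1 : 0 < max 1 ‖z‖ := lt_max_of_lt_left one_pos
    rw [mem_closedBall_zero_iff, norm_mul, Complex.norm_real, Real.norm_eq_abs,
      abs_of_pos (inv_pos.2 h1), inv_mul_le_one₀ h1]
    exact le_max_right _ _⟩

theorem continuous_planeProj : Continuous (planeProj g) := by
  refine continuous_quot_mk.comp (Continuous.subtype_mk ?_ _)
  refine (Complex.continuous_ofReal.comp (Continuous.inv₀ (by fun_prop) fun z => ?_)).mul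
    continuous_id
  exact (lt_max_of_lt_left one_pos).ne'

theorem planeProj_coe (z : Metric.closedBall (0 : ℂ) 1) : planeProj g z = polygonProj g z := by
  refine congrArg (polygonProj g) (Subtype.ext ?_)
  change ((max 1 ‖(z : ℂ)‖)⁻¹ : ℝ) * (z : ℂ) = z
  rw [max_eq_left (mem_closedBall_zero_iff.1 z.2), inv_one, Complex.ofReal_one, one_mul]

/-- The chart of the glued polygon around its centre. -/
def centreChart (g : ℕ) : OpenPartialHomeomorph ℂ (Quot (SidePairing g)) :=
  chartOfBump (planeProj g) (Metric.ball 0 1) (fun p => 1 - polygonRadius p) polygonCoord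
    Metric.isOpen_ball continuous_planeProj.continuousOn
    (continuous_const.sub (continuous_quot_lift _ (by fun_prop)))
    (continuous_quot_lift _ (by fun_prop))
    (fun z hz => by
      have h1 := planeProj_coe (g := g) ⟨z, Metric.ball_subset_closedBall hz⟩
      dsimp only at h1
      rw [h1]
      exact ⟨sub_pos.2 (mem_ball_zero_iff.1 hz), rfl⟩)
    (fun p hp => by
      induction p using Quot.ind with
      | mk z => exact ⟨z, mem_ball_zero_iff.2 (sub_pos.1 hp), planeProj_coe z⟩)

/-- Complements of finite sets in the glued polygon are connected, because the open disk is dense.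
-/
theorem isPreconnected_compl_polygon {F : Set (Quot (SidePairing g))} (hF : F.Finite) :
    IsPreconnected Fᶜ := by
  have h1 : ∀ w : ℂ, ((Homeomorph.unitBall w : Metric.ball (0 : ℂ) 1) : ℂ) ∈
      Metric.ball (0 : ℂ) 1 :=
    fun w => (Homeomorph.unitBall w).2
  have h2 : DenseRange fun w : ℂ => (⟨(Homeomorph.unitBall w : Metric.ball (0 : ℂ) 1),
      Metric.ball_subset_closedBall (h1 w)⟩ : Metric.closedBall (0 : ℂ) 1) := fun z => by
    rw [closure_subtype, ← Set.range_comp]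
    have h3 : Set.range (Subtype.val ∘ fun w : ℂ =>
        (⟨(Homeomorph.unitBall w : Metric.ball (0 : ℂ) 1),
          Metric.ball_subset_closedBall (h1 w)⟩ : Metric.closedBall (0 : ℂ) 1)) =
        Metric.ball (0 : ℂ) 1 := by
      ext y
      constructor
      · rintro ⟨w, rfl⟩
        exact h1 w
      · intro hy
        exact ⟨Homeomorph.unitBall.symm ⟨y, hy⟩, by simp⟩
    rw [h3, closure_ball _ one_ne_zero]
    exact z.2
  refine isPreconnected_compl_of_dense
    (m := fun w => planeProj g (Homeomorph.unitBall w : Metric.ball (0 : ℂ) 1))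
    (continuous_planeProj.comp (continuous_subtype_val.comp Homeomorph.unitBall.continuous))
    (fun w w' h => Homeomorph.unitBall.injective
      (Subtype.ext ((centreChart g).injOn (h1 w) (h1 w') h))) ?_ hF
  have h4 : Function.Surjective (polygonProj g) := Quot.mk_surjective
  have h5 := h4.denseRange.comp h2 continuous_quot_mk
  convert h5 using 1
  funext w
  exact planeProj_coe (g := g) ⟨_, Metric.ball_subset_closedBall (h1 w)⟩

variable [NeZero g]

theorem t2Space_polygonRibbon : T2Space (polygonRibbon g).Surface :=
  (polygonRibbon g).t2Space_surface (root_surjective_polygonGraph g)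

instance : Finite (polygonGraph g).H := inferInstanceAs (Finite (ZMod (4 * g)))

theorem t2Space_polygon : T2Space (Quot (SidePairing g)) :=
  haveI := t2Space_polygonRibbon (g := g)
  haveI := (polygonRibbon g).weaklyLocallyCompactSpace_surface (root_surjective_polygonGraph g)
  polygonHomeomorph.isEmbedding.t2Space

/-- The point of the glued polygon given by its corners. -/
def polygonCorner (g : ℕ) [NeZero g] : Quot (SidePairing g) := polygonHomeomorph.symm OnePoint.infty

/-- The ribbon surface has standard charts away from its vertex, which is the centre of the
polygon. -/
theorem exists_chart_bandEmbedding (p : (polygonRibbon g).Surface) :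
    ∃ φ : OpenPartialHomeomorph (Quot (SidePairing g)) ℂ, bandEmbedding p ∈ φ.source := by
  by_cases hp : p = (polygonRibbon g).incl ((polygonGraph g).vertexPt ())
  · refine ⟨(centreChart g).symm, ?_⟩
    have h0 : (0 : ℝ) ∈ Set.Icc (0 : ℝ) 1 := ⟨le_rfl, zero_le_one⟩
    have h1 : bandEmbedding p = polygonProj g (diskPt (0 : ZMod (4 * g)) 0 0) := by
      rw [hp, bandEmbedding, Homeomorph.symm_apply_eq]
      exact ((polygonToBand_proj (0 : ZMod (4 * g)) h0 h0).trans (bandPt_zero _ _)).symm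
    rw [h1]
    change 0 < 1 - ‖(diskPt (0 : ZMod (4 * g)) 0 0 : ℂ)‖
    rw [norm_diskPt _ h0, sub_zero]
    exact one_pos
  · exact exists_chart_image isOpenEmbedding_bandEmbedding
      ((polygonRibbon g).exists_chart_of_ne (root_surjective_polygonGraph g) fun _ => hp)

theorem isConnectedSurface_polygonRibbon : IsConnectedSurface (polygonRibbon g).Surface :=
  isConnectedSurface_of_isOpenEmbedding isOpenEmbedding_bandEmbedding
    (by rw [range_bandEmbedding, compl_compl]; exact Set.finite_singleton _) t2Space_polygon
    exists_chart_bandEmbedding fun _ => isPreconnected_compl_polygon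

/-- Only at the corner a chart has to be supplied. -/
theorem isConnectedSurface_polygon
    (h : ∃ φ : OpenPartialHomeomorph (Quot (SidePairing g)) ℂ, polygonCorner g ∈ φ.source) :
    IsConnectedSurface (Quot (SidePairing g)) where
  t2 := t2Space_polygon
  exists_chart q := by
    by_cases hq : q = polygonCorner g
    · rwa [hq]
    · have h1 : q ∈ Set.range (bandEmbedding (g := g)) := by
        rw [range_bandEmbedding]
        exact hq
      obtain ⟨p, rfl⟩ := h1
      exact exists_chart_bandEmbedding p
  isPreconnected_compl _ := isPreconnected_compl_polygon

/-- A charted complement of finitely many points of the glued polygon has a rose as a spine. If the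
corner is not removed, a removed point is first moved to the corner. -/
theorem isRibbonComplement_polygon {P : Set (Quot (SidePairing g))} (hP : P.Finite)
    (hP0 : P.Nonempty) (hc : ∀ q ∉ P, ∃ φ : OpenPartialHomeomorph (Quot (SidePairing g)) ℂ,
      q ∈ φ.source) : IsRibbonComplement (4 * g + 2 * (P.ncard - 1)) P := by
  have key : ∀ {Q : Set (Quot (SidePairing g))}, Q.Finite → polygonCorner g ∈ Q →
      IsRibbonComplement (4 * g + 2 * (Q.ncard - 1)) Q := fun {Q} hQ hv => by
    have h2 : Nat.card (polygonGraph g).H = 4 * g := Nat.card_zmod (4 * g)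
    have h3 := NeZero.pos g
    have h1 := isConnectedSurface_polygonRibbon.isRibbonComplement_of_subset (polygonRibbon g)
      (P := {polygonCorner g}) (Q := Q) (Nat.card_unique (α := Unit))
      (by omega)
      isOpenEmbedding_bandEmbedding range_bandEmbedding (Set.singleton_subset_iff.2 hv) hQ
    rwa [h2, Set.ncard_sdiff_singleton_of_mem hv] at h1
  by_cases hv : polygonCorner g ∈ P
  · exact key hP hv
  · obtain ⟨p, hp⟩ := hP0
    obtain ⟨A, hA, hA'⟩ := (isConnectedSurface_polygon (hc _ hv)).exists_homeomorph
      (hP.subset (Set.sdiff_subset (t := {p}))) (x := p) (y := polygonCorner g)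
      (fun h => h.2 rfl) fun h => hv h.1
    obtain ⟨Γ, O, hV, hH, j, hj, hr⟩ := key (hP.image A) ⟨p, hp, hA⟩
    rw [Set.ncard_image_of_injective _ A.injective] at hH
    refine ⟨Γ, O, hV, hH, A.symm ∘ j, A.symm.isOpenEmbedding.comp hj, ?_⟩
    rw [Set.range_comp, hr, Set.image_compl_eq A.symm.bijective, ← Set.image_comp]
    congr 1
    convert Set.image_id P
    exact A.symm_apply_apply _

end Polygon

theorem t2Space_closedSurface_succ (g : ℕ) : T2Space (ClosedSurface (g + 1)) :=
  t2Space_polygon (g := g + 1)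

theorem isRibbonComplement_closedSurface_succ {g : ℕ} {P : Set (ClosedSurface (g + 1))}
    (hP : P.Finite) (hP0 : P.Nonempty)
    (hc : ∀ q ∉ P, ∃ φ : OpenPartialHomeomorph (ClosedSurface (g + 1)) ℂ, q ∈ φ.source) :
    IsRibbonComplement (4 * (g + 1) + 2 * (P.ncard - 1)) P :=
  isRibbonComplement_polygon (g := g + 1) hP hP0 hc

theorem exists_chart_of_homeomorph_compl {X S : Type*} [TopologicalSpace X] [T1Space X]
    [TopologicalSpace S] [ChartedSpace ℂ S] {P : Set X} (hP : P.Finite) (e : S ≃ₜ (Pᶜ : Set X))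
    {q : X} (hq : q ∉ P) : ∃ φ : OpenPartialHomeomorph X ℂ, q ∈ φ.source := by
  have h1 := exists_chart_image
    (hP.isClosed.isOpen_compl.isOpenEmbedding_subtypeVal.comp e.isOpenEmbedding)
    (x := e.symm ⟨q, hq⟩) ⟨chartAt ℂ (e.symm ⟨q, hq⟩), mem_chart_source ℂ _⟩
  rwa [Function.comp_apply, e.apply_symm_apply] at h1

/-! ### Marked surfaces as surfaces of ribbon roses -/

/-- Every punctured surface is homeomorphic to the surface of a ribbon structure on a rose. -/
theorem MarkedSurface.exists_ribbon {n : ℕ} (hn : 2 ≤ n) (S : MarkedSurface.{u} n) :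
    ∃ (Γ : Graph) (O : RibbonStructure Γ), Nat.card Γ.V = 1 ∧ Nat.card Γ.H = 2 * n ∧
      Nonempty (O.Surface ≃ₜ S.carrier) := by
  obtain ⟨g, s, hs, hgs, P, hP, hPs, ⟨e⟩⟩ := S.type
  have key : IsRibbonComplement (2 * n) P → ∃ (Γ : Graph) (O : RibbonStructure Γ),
      Nat.card Γ.V = 1 ∧ Nat.card Γ.H = 2 * n ∧ Nonempty (O.Surface ≃ₜ S.carrier) := by
    rintro ⟨Γ, O, hV, hH, j, hj, hr⟩
    exact ⟨Γ, O, hV, hH,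
      ⟨(hj.isEmbedding.toHomeomorph.trans (Homeomorph.setCongr hr)).trans e.symm⟩⟩
  apply key
  cases g with
  | zero =>
    have h1 := isRibbonComplement_sphere hP (by omega)
    rwa [show P.ncard - 1 = n by omega] at h1
  | succ g =>
    have := t2Space_closedSurface_succ g
    have h1 := isRibbonComplement_closedSurface_succ hP (Set.nonempty_of_ncard_ne_zero (by omega))
      fun q hq => exists_chart_of_homeomorph_compl hP e hq
    rwa [hPs, show 4 * (g + 1) + 2 * (s - 1) = 2 * n by omega] at h1

end RibbonCover

end

theorem mainTheorem6 (n : ℕ) (hn : 2 ≤ n)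
    (S₁ : RibbonCover.MarkedSurface.{u} n) (S₂ : RibbonCover.MarkedSurface.{v} n) :
    (S₁.ribbonComplex = S₂.ribbonComplex ↔ S₁.UnorientedEquivalent S₂) ∧
    ∀ (ρ : RibbonCover.GraphWithMarking n), ρ.IsRose →
      ∀ (O₁ O₂ : RibbonCover.RibbonStructure ρ.graph),
        S₁.DrawnBy ρ O₁ → S₂.DrawnBy ρ O₂ →
        RibbonCover.linkVertices S₁.ribbonComplex (RibbonCover.MarkedGraph.mk ρ) =
          RibbonCover.linkVertices S₂.ribbonComplex (RibbonCover.MarkedGraph.mk ρ) →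
        O₁ = O₂ ∨ O₁ = O₂.op := by
  refine ⟨⟨fun h => ?_, fun h => ?_⟩, fun ρ hρ O₁ O₂ ⟨k₁, _, hk₁⟩ ⟨k₂, _, hk₂⟩ hl => ?_⟩
  · obtain ⟨Γ, O, hV, hH, ⟨k⟩⟩ := S₁.exists_ribbon hn
    obtain ⟨ρ, P, j, hρ, hj⟩ := S₁.exists_rose_of_homeomorph hn O hV hH k
    exact RibbonCover.unorientedEquivalent_of_drawable_eq ρ hρ P j hj
      (RibbonCover.MarkedSurface.ribbonComplex_eq_iff.1 h)
  · exact RibbonCover.MarkedSurface.ribbonComplex_eq_iff.2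
      (h.drawable_subset.antisymm h.symm.drawable_subset)
  · have := (Nat.card_eq_one_iff_unique.1 hρ).1
    exact ρ.eq_or_eq_op_of_link O₁ O₂ S₁ S₂ k₁ hk₁ k₂ hk₂ hl.le
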